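/- Let $\mathring H^{1/2}(\mathbb R^2)$ be the completion of $C_c^\infty(\mathbb R^2)$ in the Gagliardo norm $\|u\|^2=\frac1{4\pi}\iint\frac{|u(x)-u(y)|^2}{|x-y|^3}\,dx\,dy$ (a space of functions in $L^4(\mathbb R^2)$, with inner product $\langle\cdot,\cdot\rangle$), let $\mathring H^{-1/2}(\mathbb R^2)$ be its dual, and for $u\in\mathring H^{1/2}(\mathbb R^2)$ let $(-\Delta)^{1/2}u\in\mathring H^{-1/2}(\mathbb R^2)$ be the functional $\varphi\mapsto\langle u,\varphi\rangle$. Let $C^\alpha(\mathbb R^2)$ denote the locally Hölder continuous functions of order $\alpha$. Let $V\in\mathring H^{1/2}(\mathbb R^2)\cap C^{\alpha}(\mathbb R^2)$ for some $\alpha\in(0,1]$, $V\ne0$. Assume that $(-\Delta)^{1/2}V\ge0$ in $\mathbb R^2$ and that for some $R>1$ and $C>0$ $$(-\Delta)^{1/2}V\le\frac{C}{|x|^2(\log|x|)^2}\quad\text{for }|x|>R,$$ both inequalities being understood in the sense of distributions. No radial symmetry is assumed. Then the Thomas–Fermi energy $$\mathcal E_0(\rho)=\frac23\int_{\mathbb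 R^2}|\rho|^{3/2}\,dx-\langle\rho,V\rangle+\frac12\|\rho\|_{\mathring H^{-1/2}(\mathbb R^2)}^2,\qquad \rho\in \mathring H^{-1/2}(\mathbb R^2)\cap L^{3/2}(\mathbb R^2),$$ where $\langle\rho,V\rangle$ is the duality pairing, has a minimizer $\rho_V$, unique up to equality almost everywhere, and, for a suitable representative of $\rho_V$, the function $u_V:=\operatorname{sgn}(\rho_V)|\rho_V|^{1/2}$ is the unique (up to equality almost everywhere) solution in $\mathring H^{1/2}(\mathbb R^2)$ of $$(-\Delta)^{1/2}u+|u|u=(-\Delta)^{1/2}V,$$ where $|u|u$ is required to lie in $\mathring H^{-1/2}(\mathbb R^2)$ and the equation is tested against all of $\mathring H^{1/2}(\mathbb R^2)$. Moreover $u_V\in H^{1/2}(\mathbb R^2)\cap C^\alpha(\mathbb R^2)$, it satisfies $$0<u_V(x)\le V(x)\quad\text{for all }x\in\mathbb R^2,$$ and there are constants $c_1,c_2>0$ and $R'>1$ such that $$\frac{c_1}{|x|\log|x|}\le u_V(x)\le\frac{c_2}{|x|\log|x|}\quad\text{for all }|x|\ge R'.$$ In particular, $u_V\in L^2(\mathbb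 R^2)$. -/

import Mathlib

open MeasureTheory Filter Topology
open scoped NNReal ENNReal

noncomputable section

namespace Graphene

/-- The Euclidean plane. -/
abbrev Plane : Type := EuclideanSpace ℝ (Fin 2)

/-- Test functions: smooth and compactly supported. -/
def IsTest (φ : Plane → ℝ) : Prop :=
  ContDiff ℝ (⊤ : ℕ∞) φ ∧ HasCompactSupport φ

/-- The Gagliardo norm
`( (1/4π) ∬ |u(x) - u(y)|² / |x - y|³ dx dy )^{1/2}`, possibly infinite. -/
def gagliardo (u : Plane → ℝ) : ℝ≥0∞ :=
  (ENNReal.ofReal (1 / (4 * Real.pi)) *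
    ∫⁻ p : Plane × Plane,
      ENNReal.ofReal (|u p.1 - u p.2| ^ 2 / ‖p.1 - p.2‖ ^ 3)) ^ (1 / 2 : ℝ)

/-- The bilinear form associated with the Gagliardo norm. When `φ` is a test function and `u`
belongs to the homogeneous space below, this is the value at `φ` of the distribution
`(-Δ)^{1/2} u`. -/
def hdotInner (u v : Plane → ℝ) : ℝ :=
  (1 / (4 * Real.pi)) *
    ∫ p : Plane × Plane, (u p.1 - u p.2) * (v p.1 - v p.2) / ‖p.1 - p.2‖ ^ 3

/-- `u` belongs to the homogeneous Sobolev space of order `1/2`: the completion of the test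
functions in the Gagliardo norm, realized inside `L⁴` by the Sobolev inequality. -/
def MemHdot (u : Plane → ℝ) : Prop :=
  MemLp u 4 volume ∧
    ∃ φ : ℕ → Plane → ℝ, (∀ n, IsTest (φ n)) ∧
      Tendsto (fun n => eLpNorm (φ n - u) 4 volume) atTop (𝓝 0) ∧
      Tendsto (fun n => gagliardo (φ n - u)) atTop (𝓝 0)

/-- `u` belongs to the inhomogeneous Sobolev space of order `1/2`. -/
def MemH (u : Plane → ℝ) : Prop :=
  MemLp u 2 volume ∧ gagliardo u < ⊤

/-- The locally integrable function `ρ` belongs, as a regular distribution, to the dual of the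
homogeneous space of order `1/2`. -/
def MemHdotNeg (ρ : Plane → ℝ) : Prop :=
  LocallyIntegrable ρ volume ∧
    ∃ K : ℝ≥0, ∀ φ : Plane → ℝ, IsTest φ →
      ENNReal.ofReal |∫ x, ρ x * φ x| ≤ K * gagliardo φ

/-- The dual norm. -/
def hdotNegNorm (ρ : Plane → ℝ) : ℝ :=
  sSup {t : ℝ | ∃ φ : Plane → ℝ, IsTest φ ∧ gagliardo φ ≤ 1 ∧ t = |∫ x, ρ x * φ x|}

/-- Test functions converging to `v` in the Gagliardo norm. -/
def testNhds (v : Plane → ℝ) : Filter (Plane → ℝ) :=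
  comap (fun φ => gagliardo (φ - v)) (𝓝 0) ⊓ 𝓟 {φ | IsTest φ}

/-- The duality pairing `⟨ρ, v⟩`: the extension by continuity of `φ ↦ ∫ ρ φ` from the test
functions to the homogeneous space. The limit exists by `tendsto_pairing`. -/
def pairing (ρ v : Plane → ℝ) : ℝ :=
  limUnder (testNhds v) (fun φ => ∫ x, ρ x * φ x)

/-- The class of admissible densities. -/
def MemH0 (ρ : Plane → ℝ) : Prop :=
  MemLp ρ (3 / 2) volume ∧ MemHdotNeg ρ

/-- The Thomas-Fermi energy of the density `ρ` in the external potential `V`. -/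
def tfEnergy (V ρ : Plane → ℝ) : ℝ :=
  2 / 3 * (∫ x, |ρ x| ^ (3 / 2 : ℝ)) - pairing ρ V + 1 / 2 * hdotNegNorm ρ ^ 2

/-- `ρ` minimizes the Thomas-Fermi energy over all admissible densities. -/
def IsTFMinimizer (V ρ : Plane → ℝ) : Prop :=
  MemH0 ρ ∧ ∀ σ : Plane → ℝ, MemH0 σ → tfEnergy V ρ ≤ tfEnergy V σ

/-- `sgn(ρ) |ρ|^{1/2}`. -/
def signedRoot (ρ : Plane → ℝ) : Plane → ℝ :=
  fun x => Real.sign (ρ x) * Real.sqrt |ρ x|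

/-- `u` is a weak solution of `(-Δ)^{1/2} u + |u| u = (-Δ)^{1/2} V` in the homogeneous space of
order `1/2`. -/
def IsWeakSolution (V u : Plane → ℝ) : Prop :=
  MemHdot u ∧ MemHdotNeg (fun x => |u x| * u x) ∧
    ∀ φ : Plane → ℝ, MemHdot φ →
      hdotInner u φ + pairing (fun x => |u x| * u x) φ = hdotInner V φ

/-- `(-Δ)^{1/2} V ≥ 0` in the sense of distributions on the plane. -/
def HalfLapNonneg (V : Plane → ℝ) : Prop :=
  ∀ φ : Plane → ℝ, IsTest φ → (∀ x, 0 ≤ φ x) → 0 ≤ hdotInner V φ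

/-- `(-Δ)^{1/2} V ≤ f` in the sense of distributions on the open set `Ω`, where `f` is a function
that is locally integrable on `Ω`. -/
def HalfLapLE (V f : Plane → ℝ) (Ω : Set Plane) : Prop :=
  ∀ φ : Plane → ℝ, IsTest φ → tsupport φ ⊆ Ω → (∀ x, 0 ≤ φ x) →
    hdotInner V φ ≤ ∫ x, f x * φ x

/-- `u` is locally Hölder continuous of order `α` on the plane. -/
def LocallyHolder (α : ℝ≥0) (u : Plane → ℝ) : Prop :=
  ∀ S : Set Plane, IsCompact S → ∃ K : ℝ≥0, HolderOnWith K α u S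

/-! The remaining facts show that the limit which defines `pairing` exists. -/

theorem gagliardo_sub_le {u v w : Plane → ℝ} (hu : AEStronglyMeasurable u volume)
    (hv : AEStronglyMeasurable v volume) (hw : AEStronglyMeasurable w volume) :
    gagliardo (u - v) ≤ gagliardo (u - w) + gagliardo (v - w) := by
  have key : ∀ f : Plane → ℝ, gagliardo f =
      (ENNReal.ofReal (1 / (4 * Real.pi))) ^ (1 / 2 : ℝ) *
        (∫⁻ p : Plane × Plane, (ENNReal.ofReal
          (|f p.1 - f p.2| * (‖p.1 - p.2‖ ^ (3 / 2 : ℝ))⁻¹)) ^ (2 : ℝ)) ^ (1 / 2 : ℝ) := by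
    intro f
    unfold gagliardo
    rw [ENNReal.mul_rpow_of_nonneg _ _ (by norm_num)]
    congr 3
    funext p
    rw [ENNReal.ofReal_rpow_of_nonneg (by positivity) (by norm_num)]
    congr 1
    rw [Real.mul_rpow (by positivity) (by positivity), Real.inv_rpow (by positivity),
      ← Real.rpow_mul (norm_nonneg _), div_eq_mul_inv]
    norm_num
  have hm : ∀ f : Plane → ℝ, AEStronglyMeasurable f volume → AEMeasurable (fun p : Plane × Plane =>
      ENNReal.ofReal (|f p.1 - f p.2| * (‖p.1 - p.2‖ ^ (3 / 2 : ℝ))⁻¹))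
      (volume : Measure (Plane × Plane)) := by
    intro f hf
    have h1 : AEMeasurable (fun p : Plane × Plane => f p.1) (volume : Measure (Plane × Plane)) :=
      hf.comp_fst.aemeasurable
    have h2 : AEMeasurable (fun p : Plane × Plane => f p.2) (volume : Measure (Plane × Plane)) :=
      hf.comp_snd.aemeasurable
    have h3 : Measurable (fun p : Plane × Plane => (‖p.1 - p.2‖ ^ (3 / 2 : ℝ))⁻¹) := by
      fun_prop
    exact ((h1.sub h2).norm.mul h3.aemeasurable).ennreal_ofReal
  rw [key, key, key, ← mul_add]
  gcongr
  refine le_trans ?_ (ENNReal.lintegral_Lp_add_le (hm _ (hu.sub hw)) (hm _ (hv.sub hw))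
    (by norm_num))
  gcongr with p
  simp only [Pi.add_apply, Pi.sub_apply]
  rw [← ENNReal.ofReal_add (by positivity) (by positivity), ← add_mul]
  gcongr
  refine le_trans (le_of_eq ?_) (abs_sub (u p.1 - w p.1 - (u p.2 - w p.2))
    (v p.1 - w p.1 - (v p.2 - w p.2)))
  congr 1
  ring

theorem tendsto_pairing {ρ v : Plane → ℝ} (hρ : MemHdotNeg ρ) (hv : MemHdot v) :
    Tendsto (fun φ => ∫ x, ρ x * φ x) (testNhds v) (𝓝 (pairing ρ v)) := by
  obtain ⟨hint, K, hK⟩ := hρ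
  obtain ⟨hv4, φ, hφ, -, hφv⟩ := hv
  have hne : (testNhds v).NeBot := by
    have : Tendsto φ atTop (testNhds v) := by
      refine tendsto_inf.2 ⟨tendsto_comap_iff.2 hφv, tendsto_principal.2 ?_⟩
      exact Eventually.of_forall hφ
    exact this.neBot
  apply tendsto_nhds_limUnder
  apply cauchy_map_iff_exists_tendsto.1
  rw [Metric.cauchy_iff]
  refine ⟨hne.map _, fun ε hε => ?_⟩
  obtain ⟨δ, hδ, hδε⟩ : ∃ δ : ℝ≥0∞, 0 < δ ∧ K * (δ + δ) < ENNReal.ofReal ε := by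
    have : Tendsto (fun δ : ℝ≥0∞ => K * (δ + δ)) (𝓝 0) (𝓝 (K * (0 + 0))) :=
      ENNReal.Tendsto.const_mul (tendsto_id.add tendsto_id) (Or.inr ENNReal.coe_ne_top)
    have h2 := this.eventually_lt_const (u := ENNReal.ofReal ε) (by simpa using hε)
    obtain ⟨δ, h1, h2⟩ := ((h2.filter_mono nhdsWithin_le_nhds).and
      (self_mem_nhdsWithin : Set.Ioi (0 : ℝ≥0∞) ∈ 𝓝[>] 0)).exists
    exact ⟨δ, h2, h1⟩
  have hs : {ψ : Plane → ℝ | gagliardo (ψ - v) < δ ∧ IsTest ψ} ∈ testNhds v :=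
    inter_mem_inf (preimage_mem_comap (Iio_mem_nhds hδ)) (mem_principal_self _)
  refine ⟨_, image_mem_map hs, ?_⟩
  rintro _ ⟨a, ⟨ha, hat⟩, rfl⟩ _ ⟨b, ⟨hb, hbt⟩, rfl⟩
  have hi : ∀ c : Plane → ℝ, IsTest c → Integrable (fun x => ρ x * c x) volume := by
    intro c hc
    simpa [smul_eq_mul, mul_comm] using
      hint.integrable_smul_left_of_hasCompactSupport hc.1.continuous hc.2
  have hsub : ∫ x, ρ x * (a - b) x = (∫ x, ρ x * a x) - ∫ x, ρ x * b x := by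
    rw [← integral_sub (hi a hat) (hi b hbt)]
    simp [mul_sub]
  have hab := hK (a - b) ⟨hat.1.sub hbt.1, hat.2.sub hbt.2⟩
  have htri := gagliardo_sub_le hat.1.continuous.aestronglyMeasurable
    hbt.1.continuous.aestronglyMeasurable hv4.1
  rw [Real.dist_eq, ← hsub]
  rw [← ENNReal.ofReal_lt_ofReal_iff hε]
  refine lt_of_le_of_lt hab (lt_of_le_of_lt ?_ hδε)
  gcongr
  exact htri.trans (add_le_add ha.le hb.le)

end Graphene

end

noncomputable section

/-! Everything is governed by the strictly convex functional J(φ) = ½‖φ‖² − ⟨V, φ⟩ + ⅓∫|φ|³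
(`dualEnergy`), which is dual to the Thomas–Fermi energy. The parallelogram law and a Clarkson
inequality for cubes make suitable minimizing sequences of test functions Cauchy in the Gagliardo
norm and in L³, hence in L⁴ by the Sobolev inequality, and the limit u solves the equation
(`exists_isGround`). Put f = |u|u, which is the half-Laplacian of V − u. Young's inequality σu ≤
⅔|σ|^{3/2} + ⅓|u|³ together with ⟨σ, V − u⟩ ≤ ½‖σ‖² + ½‖V − u‖² bounds the energy of every
admissible σ from below, and σ = f attains the bound; the equality case in Young's inequality makes
the minimizer unique. Uniqueness of the weak solution is subtler, because a competitor w is only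
known to have |w|w in L² and in the dual space, so that u − w cannot simply be integrated against
the nonlinearity; truncations of u − w between ± test functions replace it
(`IsGround.weakSolution_unique`).

Testing with negative parts gives 0 ≤ u ≤ V. For the finer properties let k_s(x) = (|x|² +
s²)^{-1/2} (`coulomb`) and let P_s = s k_s³ (`poisson`), of total mass 2π. The explicit identity P_t
∗ k_s = 2π k_{s+t} shows that the half-Laplacian of k_s is P_s (`hdotInner_coulomb`). Testing the
equation with k_s and letting s → 0 yields 2π(V − u) = f ∗ |x|⁻¹. Since 0 ≤ u ≤ V, the density f is
locally bounded, so its potential is locally γ-Hölder for every γ < 1, and it is locally Lipschitz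
once f itself is Hölder; thus u inherits the exponent of V. The hypothesis (-Δ)^{1/2}V ≥ 0 makes ⟨V,
k_s⟩ = P_s ∗ u + f ∗ k_s decreasing in s, and comparing small s with s → 0 at a zero of u
contradicts u ≢ 0 (`IsGround.pos`).

The decay rate comes from the barrier w = Σ (k_{2^k} − k_{2^{k+1}})/(k+1). The terms with 2^k of
order |x| have weight of order 1/log|x|, so w is comparable with 1/(|x| log|x|). Abel summation
gives (-Δ)^{1/2}w = P_1 − Σ P_{2^{k+1}}/((k+1)(k+2)), which is negative at infinity and of order
−1/(|x| log|x|)², exactly the order of w². Hence in (-Δ)^{1/2}(cw) + (cw)² the linear term wins for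
small c, a subsolution, and the quadratic term wins for large c with room for the source C/(|x|
log|x|)², a supersolution. Comparison on the two sides gives the asymptotics, and u ∈ L² follows
because 1/(r log² r) is integrable at infinity. -/

namespace Graphene

/-! ### The Gagliardo form as an L² inner product of increments -/

/-- The measure `(1/4π) |x - y|⁻³ dx dy` on pairs of points. -/
def gagMeasure : Measure (Plane × Plane) :=
  volume.withDensity fun p => ENNReal.ofReal (1 / (4 * Real.pi) * (‖p.1 - p.2‖ ^ 3)⁻¹)

/-- The increment `u(x) - u(y)`. -/
def incr (u : Plane → ℝ) : Plane × Plane → ℝ := fun p => u p.1 - u p.2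

theorem gagDensity_measurable : Measurable fun p : Plane × Plane =>
    ENNReal.ofReal (1 / (4 * Real.pi) * (‖p.1 - p.2‖ ^ 3)⁻¹) := by fun_prop

theorem lintegral_gagMeasure (g : Plane × Plane → ℝ≥0∞) :
    ∫⁻ p, g p ∂gagMeasure =
      ∫⁻ p, ENNReal.ofReal (1 / (4 * Real.pi) * (‖p.1 - p.2‖ ^ 3)⁻¹) * g p := by
  unfold gagMeasure
  rw [lintegral_withDensity_eq_lintegral_mul_non_measurable _ gagDensity_measurable
    (ae_of_all _ fun _ => ENNReal.ofReal_lt_top)]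
  rfl

theorem gagliardo_sq (u : Plane → ℝ) :
    gagliardo u ^ 2 = ∫⁻ p, ENNReal.ofReal (incr u p ^ 2) ∂gagMeasure := by
  rw [lintegral_gagMeasure]
  unfold gagliardo
  rw [← ENNReal.rpow_natCast, ← ENNReal.rpow_mul]
  norm_num
  rw [← lintegral_const_mul' _ _ ENNReal.ofReal_ne_top]
  congr 1
  funext p
  rw [← ENNReal.ofReal_mul (by positivity), ← ENNReal.ofReal_mul (by positivity)]
  congr 1
  rw [div_eq_mul_inv]
  simp only [incr]
  ring

theorem gagliardo_eq (u : Plane → ℝ) : gagliardo u = eLpNorm (incr u) 2 gagMeasure := by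
  have h : gagliardo u ^ 2 = eLpNorm (incr u) 2 gagMeasure ^ 2 := by
    rw [gagliardo_sq, eLpNorm_eq_lintegral_rpow_enorm_toReal (by norm_num) (by norm_num),
      ← ENNReal.rpow_natCast, ← ENNReal.rpow_mul]
    norm_num
    congr 1
    funext p
    rw [← ofReal_norm, ← ENNReal.ofReal_pow (norm_nonneg _)]
    simp
  exact (ENNReal.pow_right_strictMono (n := 2) (by norm_num)).injective h

theorem hdotInner_eq (u v : Plane → ℝ) :
    hdotInner u v = ∫ p, incr u p * incr v p ∂gagMeasure := by
  unfold gagMeasure hdotInner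
  rw [integral_withDensity_eq_integral_toReal_smul gagDensity_measurable
    (ae_of_all _ fun _ => ENNReal.ofReal_lt_top), ← integral_const_mul]
  congr 1
  funext p
  rw [ENNReal.toReal_ofReal (by positivity), smul_eq_mul, incr, incr]
  ring

theorem gagMeasure_ac : gagMeasure ≪ (volume : Measure (Plane × Plane)) :=
  withDensity_absolutelyContinuous _ _

theorem aestronglyMeasurable_incr {u : Plane → ℝ} (hu : AEStronglyMeasurable u volume) :
    AEStronglyMeasurable (incr u) gagMeasure :=
  (hu.comp_fst.sub hu.comp_snd).mono_ac gagMeasure_ac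

theorem ae_gagMeasure {P : Plane → Prop} (h : ∀ᵐ x, P x) :
    ∀ᵐ p ∂gagMeasure, P p.1 ∧ P p.2 := by
  apply gagMeasure_ac.ae_le
  filter_upwards [Measure.quasiMeasurePreserving_fst.ae h,
    Measure.quasiMeasurePreserving_snd.ae h] with p h1 h2 using ⟨h1, h2⟩

theorem incr_ae_tendsto {u : ℕ → Plane → ℝ} {v : Plane → ℝ}
    (h : ∀ᵐ x, Tendsto (fun n => u n x) atTop (𝓝 (v x))) :
    ∀ᵐ p ∂gagMeasure, Tendsto (fun n => incr (u n) p) atTop (𝓝 (incr v p)) := by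
  filter_upwards [ae_gagMeasure h] with p hp using hp.1.sub hp.2

theorem incr_congr {u v : Plane → ℝ} (h : u =ᵐ[volume] v) : incr u =ᵐ[gagMeasure] incr v := by
  filter_upwards [ae_gagMeasure h] with p hp
  simp [incr, hp.1, hp.2]

theorem gagliardo_congr {u v : Plane → ℝ} (h : u =ᵐ[volume] v) : gagliardo u = gagliardo v := by
  rw [gagliardo_eq, gagliardo_eq, eLpNorm_congr_ae (incr_congr h)]

theorem hdotInner_congr {u u' v v' : Plane → ℝ} (h : u =ᵐ[volume] u') (h' : v =ᵐ[volume] v') :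
    hdotInner u v = hdotInner u' v' := by
  rw [hdotInner_eq, hdotInner_eq]
  exact integral_congr_ae ((incr_congr h).mul (incr_congr h'))

/-- A measurable function with finite Gagliardo norm. -/
structure FiniteEnergy (u : Plane → ℝ) : Prop where
  meas : AEStronglyMeasurable u volume
  lt_top : gagliardo u < ⊤

theorem FiniteEnergy.memLp {u : Plane → ℝ} (h : FiniteEnergy u) :
    MemLp (incr u) 2 gagMeasure :=
  ⟨aestronglyMeasurable_incr h.meas, by rw [← gagliardo_eq]; exact h.lt_top⟩

theorem finiteEnergy_of_memLp {u : Plane → ℝ} (hu : AEStronglyMeasurable u volume)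
    (h : MemLp (incr u) 2 gagMeasure) : FiniteEnergy u :=
  ⟨hu, by rw [gagliardo_eq]; exact h.2⟩

theorem FiniteEnergy.sub {u v : Plane → ℝ} (hu : FiniteEnergy u) (hv : FiniteEnergy v) :
    FiniteEnergy (u - v) := by
  refine finiteEnergy_of_memLp (hu.meas.sub hv.meas) ?_
  convert hu.memLp.sub hv.memLp using 1
  funext p; simp [incr]; ring

theorem FiniteEnergy.add {u v : Plane → ℝ} (hu : FiniteEnergy u) (hv : FiniteEnergy v) :
    FiniteEnergy (u + v) := by
  refine finiteEnergy_of_memLp (hu.meas.add hv.meas) ?_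
  convert hu.memLp.add hv.memLp using 1
  funext p; simp [incr]; ring

theorem FiniteEnergy.smul {u : Plane → ℝ} (hu : FiniteEnergy u) (c : ℝ) :
    FiniteEnergy (c • u) := by
  refine finiteEnergy_of_memLp (hu.meas.const_smul c) ?_
  convert hu.memLp.const_smul c using 1
  funext p; simp [incr]; ring

theorem FiniteEnergy.integrable {u v : Plane → ℝ} (hu : FiniteEnergy u) (hv : FiniteEnergy v) :
    Integrable (fun p => incr u p * incr v p) gagMeasure :=
  hu.memLp.integrable_mul hv.memLp

theorem hdotInner_comm (u v : Plane → ℝ) : hdotInner u v = hdotInner v u := by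
  simp only [hdotInner_eq, mul_comm]

theorem hdotInner_add_right {u v w : Plane → ℝ} (hu : FiniteEnergy u) (hv : FiniteEnergy v)
    (hw : FiniteEnergy w) : hdotInner u (v + w) = hdotInner u v + hdotInner u w := by
  rw [hdotInner_eq, hdotInner_eq, hdotInner_eq, ← integral_add (hu.integrable hv)
    (hu.integrable hw)]
  congr 1; funext p; simp only [incr, Pi.add_apply]; ring

theorem hdotInner_smul_right (u v : Plane → ℝ) (c : ℝ) :
    hdotInner u (c • v) = c * hdotInner u v := by
  rw [hdotInner_eq, hdotInner_eq, ← integral_const_mul]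
  congr 1; funext p; simp only [incr, Pi.smul_apply, smul_eq_mul]; ring

theorem hdotInner_sub_right {u v w : Plane → ℝ} (hu : FiniteEnergy u) (hv : FiniteEnergy v)
    (hw : FiniteEnergy w) : hdotInner u (v - w) = hdotInner u v - hdotInner u w := by
  have h : v - w = v + (-1 : ℝ) • w := by funext x; simp [sub_eq_add_neg]
  rw [h, hdotInner_add_right hu hv (hw.smul _), hdotInner_smul_right]
  ring

theorem hdotInner_add_left {u v w : Plane → ℝ} (hu : FiniteEnergy u) (hv : FiniteEnergy v)
    (hw : FiniteEnergy w) : hdotInner (v + w) u = hdotInner v u + hdotInner w u := by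
  simp only [hdotInner_comm _ u, hdotInner_add_right hu hv hw]

theorem hdotInner_smul_left (u v : Plane → ℝ) (c : ℝ) :
    hdotInner (c • v) u = c * hdotInner v u := by
  simp only [hdotInner_comm _ u, hdotInner_smul_right]

theorem hdotInner_sub_left {u v w : Plane → ℝ} (hu : FiniteEnergy u) (hv : FiniteEnergy v)
    (hw : FiniteEnergy w) : hdotInner (v - w) u = hdotInner v u - hdotInner w u := by
  simp only [hdotInner_comm _ u, hdotInner_sub_right hu hv hw]

/-- For an integer exponent, the integral of the power is the power of the norm. -/
theorem integral_abs_pow_eq {β : Type*} [MeasurableSpace β] {μ : Measure β} {f : β → ℝ} {p : ℕ}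
    (hp : p ≠ 0) (hf : MemLp f p μ) : ∫ x, |f x| ^ p ∂μ = (eLpNorm f p μ).toReal ^ p := by
  rw [hf.eLpNorm_eq_integral_rpow_norm (by simpa using hp) (by simp)]
  simp only [ENNReal.toReal_natCast, Real.norm_eq_abs, Real.rpow_natCast]
  have h : 0 ≤ ∫ x, |f x| ^ p ∂μ := integral_nonneg fun x => by positivity
  rw [ENNReal.toReal_ofReal (by positivity), ← Real.rpow_natCast, ← Real.rpow_mul h,
    inv_mul_cancel₀ (by exact_mod_cast hp), Real.rpow_one]

theorem integrable_abs_pow {β : Type*} [MeasurableSpace β] {μ : Measure β} {f : β → ℝ} {p : ℕ}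
    (hp : p ≠ 0) (hf : MemLp f p μ) : Integrable (fun x => |f x| ^ p) μ :=
  hf.integrable_norm_pow hp

theorem hdotInner_self {u : Plane → ℝ} (hu : FiniteEnergy u) :
    hdotInner u u = (gagliardo u).toReal ^ 2 := by
  rw [hdotInner_eq, gagliardo_eq]
  have := integral_abs_pow_eq (p := 2) (by norm_num) (by exact_mod_cast hu.memLp)
  simp only [Nat.cast_ofNat] at this
  rw [← this]
  congr 1; funext p; rw [sq_abs, sq]

theorem abs_hdotInner_le {u v : Plane → ℝ} (hu : FiniteEnergy u) (hv : FiniteEnergy v) :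
    |hdotInner u v| ≤ (gagliardo u).toReal * (gagliardo v).toReal := by
  have key : ∀ t : ℝ, 0 ≤ hdotInner v v * (t * t) + (2 * hdotInner u v) * t + hdotInner u u := by
    intro t
    have h1 := hdotInner_self (hu.add (hv.smul t))
    rw [hdotInner_add_right (hu.add (hv.smul t)) hu (hv.smul t),
      hdotInner_add_left hu hu (hv.smul t), hdotInner_add_left (hv.smul t) hu (hv.smul t),
      hdotInner_smul_left, hdotInner_smul_right, hdotInner_smul_left, hdotInner_smul_right,
      hdotInner_comm v u] at h1
    nlinarith [sq_nonneg (gagliardo (u + t • v)).toReal]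
  have hd := discrim_le_zero key
  rw [discrim, hdotInner_self hu, hdotInner_self hv] at hd
  apply abs_le_of_sq_le_sq _ (by positivity)
  nlinarith

/-- Pointwise control of increments gives control of the Gagliardo norm. -/
theorem gagliardo_le_add {u a b : Plane → ℝ} (ha : AEStronglyMeasurable a volume)
    (hb : AEStronglyMeasurable b volume)
    (h : ∀ x y, |u x - u y| ≤ |a x - a y| + |b x - b y|) :
    gagliardo u ≤ gagliardo a + gagliardo b := by
  rw [gagliardo_eq, gagliardo_eq, gagliardo_eq, ← eLpNorm_norm (incr a), ← eLpNorm_norm (incr b)]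
  refine le_trans (eLpNorm_mono_real (g := fun p => ‖incr a p‖ + ‖incr b p‖) fun p => ?_)
    (eLpNorm_add_le (aestronglyMeasurable_incr ha).norm (aestronglyMeasurable_incr hb).norm
      (by norm_num))
  exact h p.1 p.2

theorem gagliardo_mono {u a : Plane → ℝ} (h : ∀ x y, |u x - u y| ≤ |a x - a y|) :
    gagliardo u ≤ gagliardo a := by
  rw [gagliardo_eq, gagliardo_eq]
  exact eLpNorm_mono fun p => h p.1 p.2

/-- Fatou's lemma, applied to the increments. -/
theorem gagliardo_le_of_tendsto {u : ℕ → Plane → ℝ} {v : Plane → ℝ} {K : ℝ≥0∞}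
    (hu : ∀ n, AEStronglyMeasurable (u n) volume) (hK : ∀ n, gagliardo (u n) ≤ K)
    (h : ∀ᵐ x, Tendsto (fun n => u n x) atTop (𝓝 (v x))) : gagliardo v ≤ K := by
  rw [gagliardo_eq]
  refine (Lp.eLpNorm_lim_le_liminf_eLpNorm (fun n => aestronglyMeasurable_incr (hu n)) _
    (incr_ae_tendsto h)).trans ?_
  refine liminf_le_of_le (by isBoundedDefault) fun b hb => ?_
  obtain ⟨n, hn⟩ := hb.exists
  exact hn.trans (by rw [← gagliardo_eq]; exact hK n)

/-! ### Weak convergence from almost everywhere convergence and norm bounds -/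

/-- Weak convergence to zero from almost everywhere convergence and a bound on `∫ Φ (f n)`. -/
theorem tendsto_integral_mul_zero {β : Type*} [MeasurableSpace β] {μ : Measure β}
    {g θ : β → ℝ} {f : ℕ → β → ℝ} {Φ : ℝ → ℝ} {K : ℝ}
    (hg : AEStronglyMeasurable g μ) (hθm : AEStronglyMeasurable θ μ)
    (hf : ∀ n, AEStronglyMeasurable (f n) μ)
    (h0 : ∀ᵐ x ∂μ, Tendsto (fun n => f n x) atTop (𝓝 0)) (hθ : ∀ x, 0 ≤ θ x)
    (hgθ : Integrable (fun x => |g x| * θ x) μ) (hΦ0 : ∀ t, 0 ≤ Φ t)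
    (hΦ : ∀ x t (k : ℝ), 1 ≤ k → k * θ x < |t| → |g x| * |t| ≤ Φ t / k)
    (hint : ∀ n, Integrable (fun x => Φ (f n x)) μ) (hK : ∀ n, ∫ x, Φ (f n x) ∂μ ≤ K) :
    Tendsto (fun n => ∫ x, g x * f n x ∂μ) atTop (𝓝 0) := by
  -- Split at |f n| = kθ: below the threshold the product is dominated by k|g|θ, above it by Φ(f
  -- n)/k, whose integral is at most K/k uniformly in n.
  have hbd : ∀ k : ℝ, 1 ≤ k → ∀ n x,
      ‖g x * f n x‖ ≤ |g x| * min |f n x| (k * θ x) + Φ (f n x) / k := by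
    intro k hk n x
    rw [norm_mul, Real.norm_eq_abs, Real.norm_eq_abs]
    rcases le_or_gt |f n x| (k * θ x) with h | h
    · rw [min_eq_left h]
      have := div_nonneg (hΦ0 (f n x)) (by linarith : (0 : ℝ) ≤ k)
      linarith
    · have h2 := hΦ x _ k hk h
      have h3 : 0 ≤ |g x| * min |f n x| (k * θ x) :=
        mul_nonneg (abs_nonneg _) (le_min (abs_nonneg _) (mul_nonneg (by linarith) (hθ x)))
      linarith
  have hmeas : ∀ (k : ℝ) n, AEStronglyMeasurable (fun x => |g x| * min |f n x| (k * θ x)) μ := by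
    intro k n
    exact hg.norm.mul ((hf n).norm.inf (hθm.const_mul k))
  have hle : ∀ (k : ℝ), 1 ≤ k → ∀ n x, ‖|g x| * min |f n x| (k * θ x)‖ ≤ k * (|g x| * θ x) := by
    intro k hk n x
    have h3 : 0 ≤ min |f n x| (k * θ x) :=
      le_min (abs_nonneg _) (mul_nonneg (by linarith) (hθ x))
    rw [Real.norm_of_nonneg (mul_nonneg (abs_nonneg _) h3)]
    calc |g x| * min |f n x| (k * θ x) ≤ |g x| * (k * θ x) := by
          gcongr; exact min_le_right _ _
      _ = _ := by ring
  have hlim : ∀ k : ℝ, 1 ≤ k →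
      Tendsto (fun n => ∫ x, |g x| * min |f n x| (k * θ x) ∂μ) atTop (𝓝 0) := by
    intro k hk
    have := tendsto_integral_of_dominated_convergence (μ := μ)
      (F := fun n x => |g x| * min |f n x| (k * θ x)) (f := fun _ => 0)
      (fun x => k * (|g x| * θ x)) (hmeas k) (hgθ.const_mul k)
      (fun n => ae_of_all _ (hle k hk n)) (by
        filter_upwards [h0] with x hx
        have h1 : Tendsto (fun n => min |f n x| (k * θ x)) atTop (𝓝 (min |0| (k * θ x))) :=
          hx.abs.min tendsto_const_nhds
        rw [abs_zero, min_eq_left (mul_nonneg (by linarith) (hθ x))] at h1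
        simpa using h1.const_mul |g x|)
    simpa using this
  rw [tendsto_iff_forall_eventually_mem]
  have hK0 : 0 ≤ K := (integral_nonneg fun x => hΦ0 _).trans (hK 0)
  rw [← tendsto_iff_forall_eventually_mem, Metric.tendsto_atTop]
  intro ε hε
  set k : ℝ := max 1 (4 * K / ε) with hk
  have hk1 : 1 ≤ k := le_max_left _ _
  have hkK : K / k ≤ ε / 4 := by
    rw [div_le_iff₀ (by linarith)]
    have : 4 * K / ε ≤ k := le_max_right _ _
    rw [div_le_iff₀ hε] at this
    linarith
  obtain ⟨N, hN⟩ := (Metric.tendsto_atTop.1 (hlim k hk1)) (ε / 4) (by positivity)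
  refine ⟨N, fun n hn => ?_⟩
  have h1 := hN n hn
  rw [Real.dist_eq, sub_zero] at h1 ⊢
  have hi1 : Integrable (fun x => |g x| * min |f n x| (k * θ x)) μ :=
    (hgθ.const_mul k).mono' (hmeas k n) (ae_of_all _ (hle k hk1 n))
  calc |∫ x, g x * f n x ∂μ| ≤ ∫ x, (|g x| * min |f n x| (k * θ x) + Φ (f n x) / k) ∂μ :=
        norm_integral_le_of_norm_le (hi1.add ((hint n).div_const k))
          (ae_of_all _ (hbd k hk1 n))
    _ = (∫ x, |g x| * min |f n x| (k * θ x) ∂μ) + (∫ x, Φ (f n x) ∂μ) / k := by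
        rw [integral_add hi1 ((hint n).div_const k), integral_div]
    _ ≤ ε / 4 + K / k := by
        gcongr
        · exact (le_abs_self _).trans h1.le
        · exact hK n
    _ < ε := by linarith

theorem memLp_of_tendsto_of_le {β : Type*} [MeasurableSpace β] {μ : Measure β}
    {f : ℕ → β → ℝ} {h : β → ℝ} {p : ℝ≥0∞} {K : ℝ≥0}
    (hf : ∀ n, AEStronglyMeasurable (f n) μ) (hK : ∀ n, eLpNorm (f n) p μ ≤ K)
    (hlim : ∀ᵐ x ∂μ, Tendsto (fun n => f n x) atTop (𝓝 (h x))) :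
    MemLp h p μ ∧ eLpNorm h p μ ≤ K := by
  have h1 : eLpNorm h p μ ≤ K := by
    refine (Lp.eLpNorm_lim_le_liminf_eLpNorm hf _ hlim).trans ?_
    refine liminf_le_of_le (by isBoundedDefault) fun b hb => ?_
    obtain ⟨n, hn⟩ := hb.exists
    exact hn.trans (hK n)
  exact ⟨⟨aestronglyMeasurable_of_tendsto_ae _ hf hlim, h1.trans_lt ENNReal.coe_lt_top⟩, h1⟩

theorem eLpNorm_sub_bound {β : Type*} [MeasurableSpace β] {μ : Measure β}
    {f h : β → ℝ} {p : ℕ} (hp : 1 ≤ p) {K : ℝ≥0} (hf : AEStronglyMeasurable f μ)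
    (hh : AEStronglyMeasurable h μ) (hfK : eLpNorm f p μ ≤ K) (hhK : eLpNorm h p μ ≤ K) :
    MemLp (f - h) p μ ∧ ∫ x, |f x - h x| ^ p ∂μ ≤ (2 * (K : ℝ)) ^ p := by
  have h1 : eLpNorm (f - h) p μ ≤ ((2 * K : ℝ≥0) : ℝ≥0∞) := by
    refine (eLpNorm_sub_le hf hh (by exact_mod_cast hp)).trans ?_
    push_cast
    rw [two_mul]
    exact add_le_add hfK hhK
  have hm : MemLp (f - h) p μ := ⟨hf.sub hh, h1.trans_lt ENNReal.coe_lt_top⟩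
  refine ⟨hm, ?_⟩
  have := integral_abs_pow_eq (by omega) hm
  simp only [Pi.sub_apply] at this
  rw [this]
  have h2 := ENNReal.toReal_mono ENNReal.coe_ne_top h1
  rw [ENNReal.coe_toReal] at h2
  push_cast at h2
  gcongr

/-- Here Φ(t) = t² and θ = |g|: if |t| > k|g|, then |g||t| ≤ t²/k. -/
theorem tendsto_integral_mul_two {β : Type*} [MeasurableSpace β] {μ : Measure β}
    {g h : β → ℝ} {f : ℕ → β → ℝ} {K : ℝ≥0} (hg : MemLp g 2 μ)
    (hf : ∀ n, AEStronglyMeasurable (f n) μ) (hK : ∀ n, eLpNorm (f n) 2 μ ≤ K)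
    (hlim : ∀ᵐ x ∂μ, Tendsto (fun n => f n x) atTop (𝓝 (h x))) :
    Tendsto (fun n => ∫ x, g x * f n x ∂μ) atTop (𝓝 (∫ x, g x * h x ∂μ)) := by
  obtain ⟨hh, hhK⟩ := memLp_of_tendsto_of_le hf hK hlim
  have hb := fun n => eLpNorm_sub_bound (p := 2) (by norm_num) (hf n) hh.1
    (by exact_mod_cast hK n) (by exact_mod_cast hhK)
  have key := tendsto_integral_mul_zero (g := g) (θ := fun x => |g x|) (f := fun n => f n - h)
    (Φ := fun t => |t| ^ 2) (μ := μ) (K := (2 * (K : ℝ)) ^ 2) hg.1 hg.1.norm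
    (fun n => (hf n).sub hh.1)
    (by filter_upwards [hlim] with x hx; simpa using hx.sub_const (h x))
    (fun x => abs_nonneg _) (by
      have := integrable_abs_pow (p := 2) (by norm_num) (f := g) (μ := μ) (by exact_mod_cast hg)
      simpa [sq] using this) (fun t => by positivity)
    (fun x t k hk ht => by
      rw [le_div_iff₀ (by linarith)]
      nlinarith [abs_nonneg t, abs_nonneg (g x)])
    (fun n => integrable_abs_pow (by norm_num) (hb n).1) (fun n => (hb n).2)
  have hfm : ∀ n, MemLp (f n) 2 μ := fun n => ⟨hf n, (hK n).trans_lt ENNReal.coe_lt_top⟩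
  have h3 : ∀ n, ∫ x, g x * (f n - h) x ∂μ = (∫ x, g x * f n x ∂μ) - ∫ x, g x * h x ∂μ := by
    intro n
    have i1 : Integrable (fun x => g x * f n x) μ := hg.integrable_mul (hfm n)
    have i2 : Integrable (fun x => g x * h x) μ := hg.integrable_mul hh
    rw [← integral_sub i1 i2]
    simp [mul_sub]
  simp only [h3] at key
  simpa using key.add_const (∫ x, g x * h x ∂μ)

instance holderTriple_three_halves : ENNReal.HolderTriple (3 / 2) 3 1 := ⟨by
  rw [ENNReal.inv_div (by norm_num) (by norm_num), inv_one, ← one_div, ENNReal.div_add_div_same]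
  norm_num
  exact ENNReal.div_self (by norm_num) (by norm_num)⟩

instance holderTriple_four_thirds : ENNReal.HolderTriple (4 / 3) 4 1 := ⟨by
  rw [ENNReal.inv_div (by norm_num) (by norm_num), inv_one, ← one_div, ENNReal.div_add_div_same]
  norm_num
  exact ENNReal.div_self (by norm_num) (by norm_num)⟩

/-- Here Φ(t) = |t|³ and θ = |g|^{1/2}, so that |g|θ = |g|^{3/2} is integrable; if |t| > kθ, then
|g| ≤ t²/k. -/
theorem tendsto_integral_mul_three {β : Type*} [MeasurableSpace β] {μ : Measure β}
    {g h : β → ℝ} {f : ℕ → β → ℝ} {K : ℝ≥0} (hg : MemLp g (3 / 2) μ)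
    (hf : ∀ n, AEStronglyMeasurable (f n) μ) (hK : ∀ n, eLpNorm (f n) 3 μ ≤ K)
    (hlim : ∀ᵐ x ∂μ, Tendsto (fun n => f n x) atTop (𝓝 (h x))) :
    Tendsto (fun n => ∫ x, g x * f n x ∂μ) atTop (𝓝 (∫ x, g x * h x ∂μ)) := by
  obtain ⟨hh, hhK⟩ := memLp_of_tendsto_of_le hf hK hlim
  have hb := fun n => eLpNorm_sub_bound (p := 3) (by norm_num) (hf n) hh.1
    (by exact_mod_cast hK n) (by exact_mod_cast hhK)
  have hg2 : Integrable (fun x => |g x| * Real.sqrt |g x|) μ := by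
    have := hg.integrable_norm_rpow (by norm_num) (by norm_num [ENNReal.div_eq_top])
    refine this.congr (ae_of_all _ fun x => ?_)
    simp only [ENNReal.toReal_div, ENNReal.toReal_ofNat, Real.norm_eq_abs]
    rw [Real.sqrt_eq_rpow]
    rcases eq_or_lt_of_le (abs_nonneg (g x)) with h0 | h0
    · rw [← h0]; norm_num
    · nth_rewrite 2 [← Real.rpow_one |g x|]
      rw [← Real.rpow_add h0]; norm_num
  have key := tendsto_integral_mul_zero (g := g) (θ := fun x => Real.sqrt |g x|)
    (f := fun n => f n - h)
    (Φ := fun t => |t| ^ 3) (μ := μ) (K := (2 * (K : ℝ)) ^ 3) hg.1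
    (Real.continuous_sqrt.comp_aestronglyMeasurable hg.1.norm)
    (fun n => (hf n).sub hh.1)
    (by filter_upwards [hlim] with x hx; simpa using hx.sub_const (h x))
    (fun x => Real.sqrt_nonneg _) hg2 (fun t => by positivity)
    (fun x t k hk ht => by
      rw [le_div_iff₀ (by linarith)]
      have h1 := Real.sq_sqrt (abs_nonneg (g x))
      have h2 := Real.sqrt_nonneg |g x|
      have h3 : |g x| * k ≤ |t| ^ 2 := by
        calc |g x| * k ≤ (k * Real.sqrt |g x|) ^ 2 := by
              rw [mul_pow, h1, sq, mul_comm, mul_assoc]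
              exact le_mul_of_one_le_left (by positivity) hk
          _ ≤ _ := by gcongr
      nlinarith [abs_nonneg t])
    (fun n => integrable_abs_pow (by norm_num) (hb n).1) (fun n => (hb n).2)
  have hfm : ∀ n, MemLp (f n) 3 μ := fun n => ⟨hf n, (hK n).trans_lt ENNReal.coe_lt_top⟩
  have h3 : ∀ n, ∫ x, g x * (f n - h) x ∂μ = (∫ x, g x * f n x ∂μ) - ∫ x, g x * h x ∂μ := by
    intro n
    have i1 : Integrable (fun x => g x * f n x) μ := hg.integrable_mul (hfm n)
    have i2 : Integrable (fun x => g x * h x) μ := hg.integrable_mul hh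
    rw [← integral_sub i1 i2]
    simp [mul_sub]
  simp only [h3] at key
  simpa using key.add_const (∫ x, g x * h x ∂μ)

/-- Weak continuity of the bilinear form. -/
theorem tendsto_hdotInner {u : ℕ → Plane → ℝ} {v w : Plane → ℝ} {K : ℝ≥0} (hw : FiniteEnergy w)
    (hu : ∀ n, AEStronglyMeasurable (u n) volume) (hK : ∀ n, gagliardo (u n) ≤ K)
    (h : ∀ᵐ x, Tendsto (fun n => u n x) atTop (𝓝 (v x))) :
    Tendsto (fun n => hdotInner w (u n)) atTop (𝓝 (hdotInner w v)) := by
  simp only [hdotInner_eq]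
  exact tendsto_integral_mul_two hw.memLp (fun n => aestronglyMeasurable_incr (hu n))
    (fun n => by rw [← gagliardo_eq]; exact hK n) (incr_ae_tendsto h)

theorem finiteEnergy_of_tendsto {u : ℕ → Plane → ℝ} {v : Plane → ℝ} {K : ℝ≥0}
    (hu : ∀ n, AEStronglyMeasurable (u n) volume) (hK : ∀ n, gagliardo (u n) ≤ K)
    (h : ∀ᵐ x, Tendsto (fun n => u n x) atTop (𝓝 (v x))) : FiniteEnergy v :=
  ⟨aestronglyMeasurable_of_tendsto_ae _ hu h,
    (gagliardo_le_of_tendsto hu hK h).trans_lt ENNReal.coe_lt_top⟩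

/-- Strong continuity of the bilinear form. -/
theorem tendsto_hdotInner_of_gagliardo {u : ℕ → Plane → ℝ} {v w : Plane → ℝ}
    (hw : FiniteEnergy w) (hu : ∀ n, FiniteEnergy (u n)) (hv : FiniteEnergy v)
    (h : Tendsto (fun n => gagliardo (u n - v)) atTop (𝓝 0)) :
    Tendsto (fun n => hdotInner w (u n)) atTop (𝓝 (hdotInner w v)) := by
  rw [tendsto_iff_norm_sub_tendsto_zero]
  have h2 : Tendsto (fun n => (gagliardo w).toReal * (gagliardo (u n - v)).toReal) atTop (𝓝 0) := by
    have := ((ENNReal.tendsto_toReal ENNReal.zero_ne_top).comp h).const_mul (gagliardo w).toReal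
    simpa using this
  refine squeeze_zero (fun n => norm_nonneg _) (fun n => ?_) h2
  rw [← hdotInner_sub_right hw (hu n) hv]
  exact abs_hdotInner_le hw ((hu n).sub hv)

/-! ### The fractional Sobolev inequality -/

theorem lintegral_incr_sq {u : Plane → ℝ} (hu : AEStronglyMeasurable u volume) :
    ∫⁻ x, ∫⁻ y, ENNReal.ofReal ((u x - u y) ^ 2 * (‖x - y‖ ^ 3)⁻¹) =
      ENNReal.ofReal (4 * Real.pi) * gagliardo u ^ 2 := by
  have hm : AEMeasurable (fun p : Plane × Plane =>
      ENNReal.ofReal ((u p.1 - u p.2) ^ 2 * (‖p.1 - p.2‖ ^ 3)⁻¹)) (volume.prod volume) := by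
    have h3 : Measurable (fun p : Plane × Plane => (‖p.1 - p.2‖ ^ 3)⁻¹) := by fun_prop
    exact (((hu.comp_fst.aemeasurable.sub hu.comp_snd.aemeasurable).pow_const 2).mul
      h3.aemeasurable).ennreal_ofReal
  rw [← lintegral_prod _ hm, gagliardo_sq, lintegral_gagMeasure,
    ← lintegral_const_mul' _ _ ENNReal.ofReal_ne_top]
  congr 1
  funext p
  rw [← ENNReal.ofReal_mul (by positivity), ← ENNReal.ofReal_mul (by positivity)]
  congr 1
  simp only [incr]
  field_simp

/-- Average u(x)² ≤ 2|u(x) − u(y)|² + 2u(y)² over y in the ball of radius r. On the ball 1 ≤ r³|x −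
y|⁻³, which handles the first term; Hölder's inequality with u ∈ L⁴ handles the second. -/
theorem sq_mul_le_of_ball {u : Plane → ℝ} (hu : MemLp u 4 volume) (x : Plane)
    (hG : ∫⁻ y, ENNReal.ofReal ((u x - u y) ^ 2 * (‖x - y‖ ^ 3)⁻¹) < ⊤) {r : ℝ} (hr : 0 < r) :
    Real.pi * r ^ 2 * u x ^ 2 ≤
      2 * r ^ 3 * (∫⁻ y, ENNReal.ofReal ((u x - u y) ^ 2 * (‖x - y‖ ^ 3)⁻¹)).toReal +
        2 * ((eLpNorm u 4 volume).toReal ^ 2 * (Real.sqrt Real.pi * r)) := by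
  set G := ∫⁻ y, ENNReal.ofReal ((u x - u y) ^ 2 * (‖x - y‖ ^ 3)⁻¹) with hGdef
  set B := Metric.ball x r with hB
  have hvol : volume B = ENNReal.ofReal (r ^ 2 * Real.pi) := by
    rw [hB, EuclideanSpace.volume_ball_fin_two, ENNReal.ofReal_mul (by positivity),
      ENNReal.ofReal_pow hr.le]
  have h1 : ∫⁻ y in B, ENNReal.ofReal ((u x - u y) ^ 2) ≤ ENNReal.ofReal (r ^ 3) * G := by
    rw [hGdef, ← lintegral_const_mul' _ _ ENNReal.ofReal_ne_top]
    refine le_trans (setLIntegral_mono_ae' measurableSet_ball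
      (ae_of_all _ fun y hy => ?_)) (setLIntegral_le_lintegral B _)
    rw [← ENNReal.ofReal_mul (by positivity)]
    apply ENNReal.ofReal_le_ofReal
    rcases eq_or_ne x y with rfl | hxy
    · simp
    · have h0 : 0 < ‖x - y‖ := norm_pos_iff.2 (sub_ne_zero.2 hxy)
      have h2 : ‖x - y‖ ≤ r := by
        rw [hB, Metric.mem_ball, dist_comm, dist_eq_norm] at hy; exact hy.le
      rw [mul_comm, mul_assoc, ← div_eq_inv_mul]
      apply le_mul_of_one_le_right (sq_nonneg _)
      rw [one_le_div (by positivity)]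
      gcongr
  have h2 : ∫⁻ y in B, ENNReal.ofReal (u y ^ 2) ≤
      ENNReal.ofReal ((eLpNorm u 4 volume).toReal ^ 2 * (Real.sqrt Real.pi * r)) := by
    have e1 : ∫⁻ y in B, ENNReal.ofReal (u y ^ 2) = eLpNorm u 2 (volume.restrict B) ^ 2 := by
      rw [eLpNorm_eq_lintegral_rpow_enorm_toReal (by norm_num) (by norm_num),
        ← ENNReal.rpow_natCast, ← ENNReal.rpow_mul]
      norm_num
      congr 1
      funext p
      rw [← ofReal_norm, ← ENNReal.ofReal_pow (norm_nonneg _)]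
      simp
    have e2 := eLpNorm_le_eLpNorm_mul_rpow_measure_univ (p := 2) (q := 4) (f := u)
      (μ := volume.restrict B) (by norm_num) hu.1.restrict
    have e3 : eLpNorm u 4 (volume.restrict B) ≤ eLpNorm u 4 volume :=
      eLpNorm_mono_measure _ Measure.restrict_le_self
    rw [e1, ENNReal.ofReal_mul (by positivity), ENNReal.ofReal_pow ENNReal.toReal_nonneg,
      ENNReal.ofReal_toReal hu.2.ne]
    calc eLpNorm u 2 (volume.restrict B) ^ 2 ≤
        (eLpNorm u 4 volume * (volume B) ^ (1 / 4 : ℝ)) ^ 2 := by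
          gcongr
          refine e2.trans ?_
          rw [Measure.restrict_apply_univ]
          norm_num
          gcongr
      _ = _ := by
          rw [mul_pow]
          congr 1
          rw [← ENNReal.rpow_natCast, ← ENNReal.rpow_mul, hvol,
            ENNReal.ofReal_rpow_of_nonneg (by positivity) (by norm_num)]
          congr 1
          norm_num
          rw [← Real.sqrt_eq_rpow, mul_comm, Real.sqrt_mul Real.pi_pos.le, Real.sqrt_sq hr.le]
  have h3 : ENNReal.ofReal (u x ^ 2) * volume B ≤
      2 * (ENNReal.ofReal (r ^ 3) * G) +
        2 * ENNReal.ofReal ((eLpNorm u 4 volume).toReal ^ 2 * (Real.sqrt Real.pi * r)) := by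
    rw [← setLIntegral_const]
    have hm : AEMeasurable (fun y => 2 * ENNReal.ofReal (u y ^ 2)) (volume.restrict B) :=
      ((hu.1.aemeasurable.pow_const 2).ennreal_ofReal.const_mul 2).restrict
    calc ∫⁻ _ in B, ENNReal.ofReal (u x ^ 2) ≤
        ∫⁻ y in B, (2 * ENNReal.ofReal ((u x - u y) ^ 2) + 2 * ENNReal.ofReal (u y ^ 2)) := by
          refine lintegral_mono fun y => ?_
          rw [← mul_add, ← ENNReal.ofReal_add (by positivity) (by positivity),
            show (2 : ℝ≥0∞) = ENNReal.ofReal 2 by simp, ← ENNReal.ofReal_mul (by norm_num)]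
          apply ENNReal.ofReal_le_ofReal
          nlinarith [sq_nonneg (u x - 2 * u y)]
      _ = 2 * (∫⁻ y in B, ENNReal.ofReal ((u x - u y) ^ 2)) +
            2 * ∫⁻ y in B, ENNReal.ofReal (u y ^ 2) := by
          rw [lintegral_add_right' _ hm, lintegral_const_mul' _ _ (by norm_num),
            lintegral_const_mul' _ _ (by norm_num)]
      _ ≤ _ := by gcongr
  have hGr : G = ENNReal.ofReal G.toReal := (ENNReal.ofReal_toReal hG.ne).symm
  rw [hvol, hGr, ← ENNReal.ofReal_mul (by positivity), ← ENNReal.ofReal_mul (by positivity),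
    two_mul, two_mul, ← ENNReal.ofReal_add (by positivity) (by positivity),
    ← ENNReal.ofReal_add (by positivity) (by positivity),
    ← ENNReal.ofReal_add (by positivity) (by positivity),
    ENNReal.ofReal_le_ofReal_iff (by positivity)] at h3
  linarith

/-- The fractional Sobolev inequality on the plane. -/
theorem exists_sobolev : ∃ C : ℝ≥0, 0 < C ∧ ∀ u : Plane → ℝ, MemLp u 4 volume →
    eLpNorm u 4 volume ≤ C * gagliardo u := by
  set c : ℝ := 16 / (Real.pi * Real.sqrt Real.pi) with hc
  have hcpos : 0 < c := by positivity
  have hC0 : 0 < Real.toNNReal (Real.sqrt (c * (4 * Real.pi))) :=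
    Real.toNNReal_pos.2 (Real.sqrt_pos.2 (by positivity))
  refine ⟨_, hC0, fun u hu => ?_⟩
  by_cases htop : gagliardo u = ⊤
  · rw [htop, ENNReal.mul_top (by simpa using hC0.ne')]; exact le_top
  have hI := lintegral_incr_sq hu.1
  have hIfin : ENNReal.ofReal (4 * Real.pi) * gagliardo u ^ 2 ≠ ⊤ :=
    ENNReal.mul_ne_top ENNReal.ofReal_ne_top (ENNReal.pow_ne_top htop)
  have hmeas : AEMeasurable
      (fun x => ∫⁻ y, ENNReal.ofReal ((u x - u y) ^ 2 * (‖x - y‖ ^ 3)⁻¹)) volume := by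
    have hm : AEMeasurable (fun p : Plane × Plane =>
        ENNReal.ofReal ((u p.1 - u p.2) ^ 2 * (‖p.1 - p.2‖ ^ 3)⁻¹)) (volume.prod volume) := by
      have h3 : Measurable (fun p : Plane × Plane => (‖p.1 - p.2‖ ^ 3)⁻¹) := by fun_prop
      exact (((hu.1.comp_fst.aemeasurable.sub hu.1.comp_snd.aemeasurable).pow_const 2).mul
        h3.aemeasurable).ennreal_ofReal
    exact hm.lintegral_prod_right'
  have hfin := ae_lt_top' hmeas (by rw [hI]; exact hIfin)
  set N := (eLpNorm u 4 volume).toReal with hN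
  have hpt : ∀ᵐ x, ENNReal.ofReal (u x ^ 4) ≤ ENNReal.ofReal (c * N ^ 2) *
      ∫⁻ y, ENNReal.ofReal ((u x - u y) ^ 2 * (‖x - y‖ ^ 3)⁻¹) := by
    filter_upwards [hfin] with x hx
    rw [← ENNReal.ofReal_toReal hx.ne, ← ENNReal.ofReal_mul (by positivity)]
    apply ENNReal.ofReal_le_ofReal
    set g := (∫⁻ y, ENNReal.ofReal ((u x - u y) ^ 2 * (‖x - y‖ ^ 3)⁻¹)).toReal with hg
    have hg0 : 0 ≤ g := ENNReal.toReal_nonneg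
    have hpi := Real.pi_pos
    -- Divided by r, the ball estimate says that a quadratic in r is nonnegative, so optimizing in r
    -- amounts to a nonpositive discriminant. This bounds u(x)⁴ by N² times the inner Gagliardo
    -- integral at x.
    have hd := discrim_le_zero (a := 2 * g) (b := - (Real.pi * u x ^ 2))
      (c := 2 * (N ^ 2 * Real.sqrt Real.pi)) (fun r => by
        have hs : 0 ≤ 2 * (N ^ 2 * Real.sqrt Real.pi) := by positivity
        rcases le_or_gt r 0 with hr | hr
        · have h1 : 0 ≤ 2 * g * (r * r) := mul_nonneg (by positivity) (mul_self_nonneg r)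
          have h2 : 0 ≤ (Real.pi * u x ^ 2) * (-r) :=
            mul_nonneg (by positivity) (by linarith)
          linarith
        · have h1 := sq_mul_le_of_ball hu x hx hr
          rw [← hg, ← hN] at h1
          have h2 : 0 ≤ r * (2 * g * (r * r) + -(Real.pi * u x ^ 2) * r +
            2 * (N ^ 2 * Real.sqrt Real.pi)) := by linarith
          exact nonneg_of_mul_nonneg_right h2 hr)
    rw [discrim] at hd
    have hs := Real.sq_sqrt hpi.le
    have hs0 : 0 < Real.sqrt Real.pi := Real.sqrt_pos.2 hpi
    have h5 : Real.pi ^ 2 * u x ^ 4 ≤ 16 * g * N ^ 2 * Real.sqrt Real.pi := by nlinarith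
    rw [hc, div_mul_eq_mul_div, div_mul_eq_mul_div, le_div_iff₀ (by positivity)]
    have h6 : Real.sqrt Real.pi * (u x ^ 4 * (Real.pi * Real.sqrt Real.pi)) ≤
        Real.sqrt Real.pi * (16 * N ^ 2 * g) := by
      calc _ = Real.pi * u x ^ 4 * Real.sqrt Real.pi ^ 2 := by ring
        _ = Real.pi ^ 2 * u x ^ 4 := by rw [hs]; ring
        _ ≤ _ := by linarith
    exact le_of_mul_le_mul_left h6 hs0
  have hint : ∫⁻ x, ENNReal.ofReal (u x ^ 4) = ENNReal.ofReal (N ^ 4) := by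
    rw [hN, ENNReal.ofReal_pow ENNReal.toReal_nonneg, ENNReal.ofReal_toReal hu.2.ne,
      eLpNorm_eq_lintegral_rpow_enorm_toReal (by norm_num) (by norm_num),
        ← ENNReal.rpow_natCast, ← ENNReal.rpow_mul]
    norm_num
    congr 1
    funext p
    rw [← ofReal_norm, ← ENNReal.ofReal_pow (norm_nonneg _), Real.norm_eq_abs]
    congr 1
    rw [← abs_pow, abs_of_nonneg (by positivity)]
  have h7 := lintegral_mono_ae hpt
  rw [lintegral_const_mul' _ _ ENNReal.ofReal_ne_top, hI, hint,
    ← ENNReal.ofReal_toReal htop, ← ENNReal.ofReal_pow ENNReal.toReal_nonneg,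
    ← ENNReal.ofReal_mul (by positivity), ← ENNReal.ofReal_mul (by positivity),
    ENNReal.ofReal_le_ofReal_iff (by positivity)] at h7
  set γ := (gagliardo u).toReal with hγ
  have hN0 : 0 ≤ N := ENNReal.toReal_nonneg
  have hγ0 : 0 ≤ γ := ENNReal.toReal_nonneg
  -- The integrated bound reads N⁴ ≤ C N² γ². Cancelling N² is legitimate because u ∈ L⁴ was
  -- assumed, so N is finite.
  have h8 : N ^ 2 ≤ c * (4 * Real.pi) * γ ^ 2 := by
    rcases eq_or_lt_of_le hN0 with h0 | h0
    · rw [← h0, zero_pow two_ne_zero]; positivity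
    · have : N ^ 2 * N ^ 2 ≤ N ^ 2 * (c * (4 * Real.pi) * γ ^ 2) := by nlinarith
      exact le_of_mul_le_mul_left this (pow_pos h0 2)
  have h9 : N ≤ Real.sqrt (c * (4 * Real.pi)) * γ := by
    rw [← Real.sqrt_sq hγ0, ← Real.sqrt_mul (by positivity)]
    exact Real.le_sqrt_of_sq_le h8
  rw [← ENNReal.ofReal_toReal hu.2.ne, ← ENNReal.ofReal_toReal htop]
  refine (ENNReal.ofReal_le_ofReal h9).trans ?_
  rw [ENNReal.ofReal_mul (Real.sqrt_nonneg _)]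
  rfl

/-- A Sobolev constant. -/
def sobolevConst : ℝ≥0 := exists_sobolev.choose

theorem sobolev {u : Plane → ℝ} (hu : MemLp u 4 volume) :
    eLpNorm u 4 volume ≤ sobolevConst * gagliardo u :=
  exists_sobolev.choose_spec.2 u hu

theorem ae_eq_zero_of_gagliardo {u : Plane → ℝ} (hu : MemLp u 4 volume)
    (h : gagliardo u = 0) : u =ᵐ[volume] 0 := by
  have := sobolev hu
  rw [h, mul_zero, nonpos_iff_eq_zero, eLpNorm_eq_zero_iff hu.1 (by norm_num)] at this
  exact this

/-! ### Compactly supported Lipschitz functions and their mollification -/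

/-- In polar coordinates the integrand is at most B² for r ≤ 1, by the linear bound, and at most
A²r⁻² for r > 1, by the constant bound. -/
theorem lintegral_truncated_kernel_lt_top (A B : ℝ) (hA : 0 ≤ A) (hB : 0 ≤ B) :
    ∫⁻ h : Plane, ENNReal.ofReal (min A (B * ‖h‖) ^ 2 * (‖h‖ ^ 3)⁻¹) < ⊤ := by
  have h1 : Integrable (fun h : Plane => min A (B * ‖h‖) ^ 2 * (‖h‖ ^ 3)⁻¹) volume := by
    refine (integrable_fun_norm_addHaar volume
      (f := fun y : ℝ => min A (B * y) ^ 2 * (y ^ 3)⁻¹)).2 ?_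
    simp only [finrank_euclideanSpace, Fintype.card_fin, smul_eq_mul]
    have hm : Measurable fun y : ℝ => y ^ (2 - 1) * (min A (B * y) ^ 2 * (y ^ 3)⁻¹) := by
      fun_prop
    rw [← Set.Ioc_union_Ioi_eq_Ioi zero_le_one]
    refine IntegrableOn.union ?_ ?_
    · refine Measure.integrableOn_of_bounded (M := B ^ 2) (by simp) hm.aestronglyMeasurable ?_
      refine (ae_restrict_iff' measurableSet_Ioc).2 (ae_of_all _ fun y hy => ?_)
      have hy0 : 0 < y := hy.1
      have h2 : min A (B * y) ^ 2 ≤ (B * y) ^ 2 := by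
        have : 0 ≤ min A (B * y) := le_min hA (by positivity)
        gcongr
        exact min_le_right _ _
      rw [Real.norm_of_nonneg (by positivity)]
      calc y ^ (2 - 1) * (min A (B * y) ^ 2 * (y ^ 3)⁻¹) ≤ y ^ (2 - 1) * ((B * y) ^ 2 * (y ^ 3)⁻¹) := by
            gcongr
        _ = B ^ 2 := by norm_num; field_simp
    · have h3 : IntegrableOn (fun y : ℝ => A ^ 2 * y ^ (-2 : ℝ)) (Set.Ioi 1) :=
        (integrableOn_Ioi_rpow_of_lt (by norm_num) zero_lt_one).const_mul _
      refine Integrable.mono' h3 hm.aestronglyMeasurable ?_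
      refine (ae_restrict_iff' measurableSet_Ioi).2 (ae_of_all _ fun y hy => ?_)
      have hy0 : 0 < y := zero_lt_one.trans hy
      have h2 : min A (B * y) ^ 2 ≤ A ^ 2 := by
        have : 0 ≤ min A (B * y) := le_min hA (by positivity)
        gcongr
        exact min_le_left _ _
      rw [Real.norm_of_nonneg (by positivity)]
      calc y ^ (2 - 1) * (min A (B * y) ^ 2 * (y ^ 3)⁻¹) ≤ y ^ (2 - 1) * (A ^ 2 * (y ^ 3)⁻¹) := by
            gcongr
        _ = A ^ 2 * y ^ (-2 : ℝ) := by
            rw [Real.rpow_neg hy0.le, Real.rpow_ofNat]; norm_num; field_simp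
  exact h1.lintegral_lt_top

/-- A majorant for the squared increments of Lipschitz functions supported in `S`. -/
def incrBound (A B : ℝ) (S : Set Plane) (p : Plane × Plane) : ℝ≥0∞ :=
  ENNReal.ofReal (min A (B * ‖p.1 - p.2‖) ^ 2) *
    (S.indicator (fun _ => 1) p.1 + S.indicator (fun _ => 1) p.2)

/-- By Tonelli and translation invariance each of the two indicator terms contributes the integral
of the truncated kernel times the volume of S. -/
theorem lintegral_incrBound_lt_top {A B : ℝ} (hA : 0 ≤ A) (hB : 0 ≤ B) {S : Set Plane}
    (hS : MeasurableSet S) (hSv : volume S < ⊤) :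
    ∫⁻ p, incrBound A B S p ∂gagMeasure < ⊤ := by
  set k : Plane → ℝ≥0∞ := fun h => ENNReal.ofReal (min A (B * ‖h‖) ^ 2 * (‖h‖ ^ 3)⁻¹) with hk
  have hkm : Measurable k := by rw [hk]; fun_prop
  have hSm : Measurable (S.indicator (fun _ => (1 : ℝ≥0∞))) := measurable_const.indicator hS
  have e1 : ∫⁻ p, incrBound A B S p ∂gagMeasure = ENNReal.ofReal (1 / (4 * Real.pi)) *
      ((∫⁻ p : Plane × Plane, k (p.1 - p.2) * S.indicator (fun _ => 1) p.1) +
        ∫⁻ p : Plane × Plane, k (p.1 - p.2) * S.indicator (fun _ => 1) p.2) := by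
    have hm1 : Measurable fun p : Plane × Plane =>
        k (p.1 - p.2) * S.indicator (fun _ => (1 : ℝ≥0∞)) p.1 := by fun_prop
    rw [lintegral_gagMeasure, ← lintegral_add_left hm1, ← lintegral_const_mul' _ _ ENNReal.ofReal_ne_top]
    congr 1
    funext p
    simp only [incrBound, hk]
    rw [← mul_assoc, ← mul_add, ← mul_assoc, ← ENNReal.ofReal_mul (by positivity),
      ← ENNReal.ofReal_mul (by positivity)]
    congr 2
    ring
  have hI := lintegral_truncated_kernel_lt_top A B hA hB
  have e2 : ∫⁻ p : Plane × Plane, k (p.1 - p.2) * S.indicator (fun _ => 1) p.1 =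
      (∫⁻ h, k h) * volume S := by
    rw [Measure.volume_eq_prod, lintegral_prod _ (by fun_prop)]
    have : ∀ x : Plane, ∫⁻ y, k (x - y) * S.indicator (fun _ => 1) x =
        (∫⁻ h, k h) * S.indicator (fun _ => 1) x := by
      intro x
      rw [lintegral_mul_const _ (by fun_prop), lintegral_sub_left_eq_self k x]
    simp only [this]
    rw [lintegral_const_mul _ hSm, lintegral_indicator_const hS, one_mul]
  have e3 : ∫⁻ p : Plane × Plane, k (p.1 - p.2) * S.indicator (fun _ => 1) p.2 =
      (∫⁻ h, k h) * volume S := by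
    rw [Measure.volume_eq_prod, lintegral_prod_symm _ (by fun_prop)]
    have : ∀ y : Plane, ∫⁻ x, k (x - y) * S.indicator (fun _ => 1) y =
        (∫⁻ h, k h) * S.indicator (fun _ => 1) y := by
      intro y
      rw [lintegral_mul_const _ (by fun_prop), lintegral_sub_right_eq_self k y]
    simp only [this]
    rw [lintegral_const_mul _ hSm, lintegral_indicator_const hS, one_mul]
  rw [e1, e2, e3]
  exact ENNReal.mul_lt_top ENNReal.ofReal_lt_top
    (ENNReal.add_lt_top.2 ⟨ENNReal.mul_lt_top hI hSv, ENNReal.mul_lt_top hI hSv⟩)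

theorem incr_sq_le_incrBound {f : Plane → ℝ} {A B : ℝ} {S : Set Plane}
    (h : ∀ x y, |f x - f y| ≤ min A (B * ‖x - y‖)) (hS : ∀ x, x ∉ S → f x = 0)
    (p : Plane × Plane) : ENNReal.ofReal (incr f p ^ 2) ≤ incrBound A B S p := by
  have h1 : ENNReal.ofReal (incr f p ^ 2) ≤
      ENNReal.ofReal (min A (B * ‖p.1 - p.2‖) ^ 2) := by
    apply ENNReal.ofReal_le_ofReal
    rw [← sq_abs]
    have := h p.1 p.2
    unfold incr
    gcongr
  by_cases h2 : p.1 ∈ S ∨ p.2 ∈ S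
  · refine h1.trans (le_mul_of_one_le_right zero_le ?_)
    rcases h2 with h2 | h2
    · rw [Set.indicator_of_mem h2]; exact le_self_add
    · rw [Set.indicator_of_mem h2]; exact le_add_self
  · push Not at h2
    rw [incr, hS _ h2.1, hS _ h2.2]
    simp

/-- Lipschitz functions with compact support. -/
structure IsLipc (f : Plane → ℝ) : Prop where
  lip : ∃ K : ℝ≥0, LipschitzWith K f
  supp : HasCompactSupport f

theorem IsLipc.continuous {f : Plane → ℝ} (hf : IsLipc f) : Continuous f :=
  hf.lip.choose_spec.continuous

theorem IsLipc.exists_bound {f : Plane → ℝ} (hf : IsLipc f) : ∃ M : ℝ, 0 ≤ M ∧ ∀ x, |f x| ≤ M := by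
  obtain ⟨M, hM⟩ := hf.supp.exists_bound_of_continuous hf.continuous
  exact ⟨M, (norm_nonneg _).trans (hM 0), hM⟩

theorem IsLipc.memLp {f : Plane → ℝ} (hf : IsLipc f) (p : ℝ≥0∞) : MemLp f p volume :=
  hf.continuous.memLp_of_hasCompactSupport hf.supp

theorem IsLipc.integrable {f : Plane → ℝ} (hf : IsLipc f) : Integrable f volume :=
  hf.continuous.integrable_of_hasCompactSupport hf.supp

theorem tsupport_volume_lt_top {f : Plane → ℝ} (hf : HasCompactSupport f) :
    volume (tsupport f) < ⊤ := hf.isCompact.measure_lt_top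

theorem gagliardo_lt_top_of_incr_le {f : Plane → ℝ} {A B : ℝ} (hA : 0 ≤ A) (hB : 0 ≤ B)
    {S : Set Plane} (h : ∀ x y, |f x - f y| ≤ min A (B * ‖x - y‖)) (hS : ∀ x, x ∉ S → f x = 0)
    (hSm : MeasurableSet S) (hSv : volume S < ⊤) : gagliardo f < ⊤ := by
  have h1 : gagliardo f ^ 2 < ⊤ := by
    rw [gagliardo_sq]
    exact (lintegral_mono (incr_sq_le_incrBound h hS)).trans_lt
      (lintegral_incrBound_lt_top hA hB hSm hSv)
  by_contra h2
  rw [not_lt_top_iff.1 h2] at h1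
  simp at h1

theorem LipschitzWith.abs_sub_le_min {f : Plane → ℝ} {K : ℝ≥0} (hf : LipschitzWith K f) {M : ℝ}
    (hM : ∀ x, |f x| ≤ M) (x y : Plane) : |f x - f y| ≤ min (2 * M) (K * ‖x - y‖) := by
  refine le_min ?_ ?_
  · refine (abs_sub _ _).trans ?_
    linarith [hM x, hM y]
  · rw [← Real.norm_eq_abs, ← dist_eq_norm, ← dist_eq_norm]; exact hf.dist_le_mul x y

theorem IsLipc.finiteEnergy {f : Plane → ℝ} (hf : IsLipc f) : FiniteEnergy f := by
  obtain ⟨M, hM0, hM⟩ := hf.exists_bound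
  obtain ⟨K, hK⟩ := hf.lip
  refine ⟨hf.continuous.aestronglyMeasurable, ?_⟩
  exact gagliardo_lt_top_of_incr_le (A := 2 * M) (B := K) (by positivity) K.2
    (LipschitzWith.abs_sub_le_min hK hM)
    (fun x hx => image_eq_zero_of_notMem_tsupport hx) (isClosed_tsupport f).measurableSet
    (tsupport_volume_lt_top hf.supp)

theorem IsTest.isLipc {f : Plane → ℝ} (hf : IsTest f) : IsLipc f := by
  refine ⟨?_, hf.2⟩
  obtain ⟨C, hC⟩ := (hf.2.fderiv (𝕜 := ℝ)).exists_bound_of_continuous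
    (hf.1.continuous_fderiv (by simp))
  have hd : Differentiable ℝ f := hf.1.differentiable (by simp)
  exact ⟨Real.toNNReal C, lipschitzWith_of_nnnorm_fderiv_le hd fun x => by
    rw [← norm_toNNReal]; exact Real.toNNReal_le_toNNReal (hC x)⟩

/-- Dominated convergence with the fixed majorant `incrBound`: a common Lipschitz bound and a common
support turn pointwise convergence into convergence in energy. -/
theorem tendsto_gagliardo_of_uniform {f : ℕ → Plane → ℝ} {A B : ℝ} (hA : 0 ≤ A) (hB : 0 ≤ B)
    {S : Set Plane} (hf : ∀ n, Measurable (f n))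
    (h : ∀ n x y, |f n x - f n y| ≤ min A (B * ‖x - y‖))
    (hS : ∀ n x, x ∉ S → f n x = 0) (hSm : MeasurableSet S) (hSv : volume S < ⊤)
    (hlim : ∀ x, Tendsto (fun n => f n x) atTop (𝓝 0)) :
    Tendsto (fun n => gagliardo (f n)) atTop (𝓝 0) := by
  have h1 : Tendsto (fun n => gagliardo (f n) ^ 2) atTop (𝓝 0) := by
    simp only [gagliardo_sq]
    have := tendsto_lintegral_of_dominated_convergence (μ := gagMeasure)
      (F := fun n p => ENNReal.ofReal (incr (f n) p ^ 2)) (f := fun _ => 0) (incrBound A B S)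
      (fun n => by
        have := hf n
        unfold incr
        fun_prop)
      (fun n => ae_of_all _ (incr_sq_le_incrBound (h n) (hS n)))
      (lintegral_incrBound_lt_top hA hB hSm hSv).ne
      (ae_of_all _ fun p => by
        have h3 := ((hlim p.1).sub (hlim p.2)).pow 2
        have h4 := ENNReal.tendsto_ofReal h3
        simpa [incr] using h4)
    simpa using this
  have h2 := h1.ennrpow_const (1 / 2 : ℝ)
  rw [ENNReal.zero_rpow_of_pos (by norm_num)] at h2
  refine h2.congr fun n => ?_
  rw [← ENNReal.rpow_natCast, ← ENNReal.rpow_mul]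
  norm_num

open scoped Convolution in
/-- Mollification of Lipschitz functions with compact support. -/
theorem IsLipc.exists_test {f : Plane → ℝ} (hf : IsLipc f) :
    ∃ (φ : ℕ → Plane → ℝ) (S : Set Plane), IsCompact S ∧ tsupport f ⊆ S ∧
      (∀ n, IsTest (φ n)) ∧
      (∀ n x, |φ n x - f x| ≤ 1 / ((n : ℝ) + 1)) ∧ (∀ n, tsupport (φ n) ⊆ S) ∧
      Tendsto (fun n => gagliardo (φ n - f)) atTop (𝓝 0) ∧
      ((∀ x, 0 ≤ f x) → ∀ n x, 0 ≤ φ n x) ∧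
      (∀ Ω : Set Plane, IsOpen Ω → tsupport f ⊆ Ω → ∀ᶠ n in atTop, tsupport (φ n) ⊆ Ω) := by
  obtain ⟨M, hM0, hM⟩ := hf.exists_bound
  obtain ⟨K, hK⟩ := hf.lip
  have hδpos : ∀ n : ℕ, (0 : ℝ) < 1 / (((K : ℝ) + 1) * ((n : ℝ) + 1)) := fun n => by positivity
  have hδle : ∀ n : ℕ, 1 / (((K : ℝ) + 1) * ((n : ℝ) + 1)) ≤ 1 / ((n : ℝ) + 1) := fun n => by
    apply one_div_le_one_div_of_le (by positivity)
    have : (0 : ℝ) ≤ K := K.2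
    nlinarith [(n.cast_nonneg : (0 : ℝ) ≤ n)]
  -- The mollification radius satisfies Kδ n ≤ 1/(n+1), which gives the uniform error; K + 1 avoids
  -- division by zero, and δ n ≤ 1 keeps all supports in the 1-thickening of the support of f.
  set δ : ℕ → ℝ := fun n => 1 / (((K : ℝ) + 1) * ((n : ℝ) + 1)) with hδ
  have hδ1 : ∀ n, δ n ≤ 1 := fun n => (hδle n).trans (by
    rw [div_le_one (by positivity)]; linarith [(n.cast_nonneg : (0 : ℝ) ≤ n)])
  set η : ℕ → ContDiffBump (0 : Plane) := fun n =>
    ⟨δ n / 2, δ n, half_pos (hδpos n), half_lt_self (hδpos n)⟩ with hη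
  set φ : ℕ → Plane → ℝ := fun n =>
    (η n).normed volume ⋆[ContinuousLinearMap.lsmul ℝ ℝ, volume] f with hφ
  have hval : ∀ n x, φ n x = ∫ t, (η n).normed volume t * f (x - t) := by
    intro n x
    simp only [hφ, convolution_def, ContinuousLinearMap.lsmul_apply, smul_eq_mul]
  have hint : ∀ n x, Integrable (fun t => (η n).normed volume t * f (x - t)) volume := by
    intro n x
    have h1 : Continuous fun t => (η n).normed volume t * f (x - t) :=
      (η n).continuous_normed.mul (hf.continuous.comp (by fun_prop))
    exact h1.integrable_of_hasCompactSupport ((η n).hasCompactSupport_normed.mul_right)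
  have hlip : ∀ n x y, |φ n x - φ n y| ≤ K * ‖x - y‖ := by
    intro n x y
    rw [hval, hval, ← integral_sub (hint n x) (hint n y)]
    calc |∫ t, ((η n).normed volume t * f (x - t) - (η n).normed volume t * f (y - t))|
        ≤ ∫ t, (η n).normed volume t * (K * ‖x - y‖) := by
          have hi : Integrable ((η n).normed volume) volume := (η n).integrable_normed
          rw [← Real.norm_eq_abs]
          refine norm_integral_le_of_norm_le (hi.mul_const _)
            (ae_of_all _ fun t => ?_)
          rw [← mul_sub, norm_mul, Real.norm_of_nonneg ((η n).nonneg_normed t)]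
          refine mul_le_mul_of_nonneg_left ?_ ((η n).nonneg_normed t)
          have := hK.dist_le_mul (x - t) (y - t)
          rwa [dist_eq_norm, dist_eq_norm, sub_sub_sub_cancel_right] at this
      _ = K * ‖x - y‖ := by rw [integral_mul_const, (η n).integral_normed, one_mul]
  have hclose : ∀ n x, |φ n x - f x| ≤ 1 / ((n : ℝ) + 1) := by
    intro n x
    rw [← Real.dist_eq]
    refine ContDiffBump.dist_normed_convolution_le (μ := volume) hf.continuous.aestronglyMeasurable
      fun y hy => ?_
    refine (hK.dist_le_mul y x).trans ?_
    have h1 : dist y x ≤ δ n := (Metric.mem_ball.1 hy).le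
    have hK0 : (0 : ℝ) ≤ K := K.2
    calc (K : ℝ) * dist y x ≤ (K + 1) * δ n := by
          apply mul_le_mul _ h1 dist_nonneg (by positivity); linarith
      _ = 1 / ((n : ℝ) + 1) := by simp only [hδ]; field_simp
  have hsupp : ∀ n, tsupport (φ n) ⊆ Metric.cthickening (δ n) (tsupport f) := by
    intro n
    refine closure_minimal ?_ Metric.isClosed_cthickening
    refine (support_convolution_subset _).trans ?_
    rintro _ ⟨a, ha, b, hb, rfl⟩
    rw [(η n).support_normed_eq] at ha
    apply Metric.thickening_subset_cthickening
    rw [Metric.mem_thickening_iff]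
    refine ⟨b, subset_tsupport _ hb, ?_⟩
    simpa [dist_eq_norm] using ha
  set S := Metric.cthickening 1 (tsupport f) with hSdef
  have hS : IsCompact S := hf.supp.isCompact.cthickening
  have hsuppS : ∀ n, tsupport (φ n) ⊆ S := fun n =>
    (hsupp n).trans (Metric.cthickening_mono (hδ1 n) _)
  have hfS : tsupport f ⊆ S := Metric.self_subset_cthickening _
  have htest : ∀ n, IsTest (φ n) := by
    intro n
    refine ⟨?_, HasCompactSupport.of_support_subset_isCompact hS
      ((subset_tsupport _).trans (hsuppS n))⟩
    exact HasCompactSupport.contDiff_convolution_left _ (η n).hasCompactSupport_normed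
      (η n).contDiff_normed hf.continuous.locallyIntegrable
  refine ⟨φ, S, hS, hfS, htest, hclose, hsuppS, ?_, ?_, ?_⟩
  · refine tendsto_gagliardo_of_uniform (A := 2) (B := 2 * K) (S := S) (by norm_num)
      (by positivity) (fun n => ((htest n).1.continuous.sub hf.continuous).measurable) ?_ ?_
      hS.measurableSet hS.measure_lt_top ?_
    · intro n x y
      have hK1 : |f x - f y| ≤ K * ‖x - y‖ := by
        have := hK.dist_le_mul x y
        rwa [Real.dist_eq, dist_eq_norm] at this
      have h1 : ∀ x, |φ n x - f x| ≤ 1 := fun x => (hclose n x).trans (by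
        rw [div_le_one (by positivity)]; linarith [(n.cast_nonneg : (0 : ℝ) ≤ n)])
      have hx := abs_le.1 (h1 x)
      have hy := abs_le.1 (h1 y)
      have h2 := abs_le.1 hK1
      have h3 := abs_le.1 (hlip n x y)
      simp only [Pi.sub_apply]
      refine le_min (abs_le.2 ⟨?_, ?_⟩) (abs_le.2 ⟨?_, ?_⟩) <;> linarith
    · intro n x hx
      simp only [Pi.sub_apply]
      rw [image_eq_zero_of_notMem_tsupport fun h => hx (hsuppS n h),
        image_eq_zero_of_notMem_tsupport fun h => hx (hfS h), sub_zero]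
    · intro x
      have h0 := tendsto_one_div_add_atTop_nhds_zero_nat (𝕜 := ℝ)
      exact squeeze_zero_norm (fun n => hclose n x) h0
  · intro h0 n x
    rw [hval]
    exact integral_nonneg fun t => mul_nonneg ((η n).nonneg_normed t) (h0 _)
  · intro Ω hΩ hfΩ
    obtain ⟨ε, hε, hεΩ⟩ := hf.supp.isCompact.exists_cthickening_subset_open hΩ hfΩ
    have h0 := tendsto_one_div_add_atTop_nhds_zero_nat (𝕜 := ℝ)
    filter_upwards [h0.eventually_lt_const hε] with n hn
    exact (hsupp n).trans ((Metric.cthickening_mono ((hδle n).trans hn.le) _).trans hεΩ)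

theorem tendsto_integral_mul_of_uniform {F f : Plane → ℝ} {φ : ℕ → Plane → ℝ} {S : Set Plane}
    (hF : LocallyIntegrable F volume) (hS : IsCompact S) (hf : IsLipc f)
    (hφ : ∀ n, IsTest (φ n)) (hφS : ∀ n, tsupport (φ n) ⊆ S)
    (h : ∀ n x, |φ n x - f x| ≤ 1 / ((n : ℝ) + 1)) :
    Tendsto (fun n => ∫ x, F x * φ n x) atTop (𝓝 (∫ x, F x * f x)) := by
  obtain ⟨M, hM0, hM⟩ := hf.exists_bound
  have h0 := tendsto_one_div_add_atTop_nhds_zero_nat (𝕜 := ℝ)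
  have hFS : Integrable (fun x => (M + 1) * S.indicator (fun x => ‖F x‖) x) volume :=
    (IntegrableOn.integrable_indicator (hF.integrableOn_isCompact hS).norm
      hS.measurableSet).const_mul _
  refine tendsto_integral_of_dominated_convergence _
    (fun n => hF.aestronglyMeasurable.mul (hφ n).1.continuous.aestronglyMeasurable) hFS
    (fun n => ae_of_all _ fun x => ?_) (ae_of_all _ fun x => ?_)
  · by_cases hx : x ∈ S
    · rw [Set.indicator_of_mem hx, norm_mul, mul_comm]
      gcongr
      have h1 := abs_le.1 (h n x)
      have h2 := abs_le.1 (hM x)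
      have h3 : 1 / ((n : ℝ) + 1) ≤ 1 := by
        rw [div_le_one (by positivity)]; linarith [(n.cast_nonneg : (0 : ℝ) ≤ n)]
      rw [Real.norm_eq_abs, abs_le]
      constructor <;> linarith
    · rw [Set.indicator_of_notMem hx,
        image_eq_zero_of_notMem_tsupport fun h => hx (hφS n h)]
      simp
  · refine Tendsto.const_mul _ ?_
    rw [tendsto_iff_norm_sub_tendsto_zero]
    exact squeeze_zero (fun n => norm_nonneg _) (fun n => h n x) h0

/-! ### Approximating sequences, the pairing and weak limits -/

instance holderTriple_four_four_two : ENNReal.HolderTriple 4 4 2 := ⟨by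
  rw [← one_div, ← one_div, ENNReal.div_add_div_same, ENNReal.div_eq_div_iff] <;> norm_num⟩

instance holderTriple_three_three : ENNReal.HolderTriple 3 3 (3 / 2) := ⟨by
  rw [ENNReal.inv_div (by norm_num) (by norm_num), ← one_div, ENNReal.div_add_div_same]
  norm_num⟩

theorem memLp_abs_mul_self {u : Plane → ℝ} {p r : ℝ≥0∞} [ENNReal.HolderTriple p p r]
    (hu : MemLp u p volume) : MemLp (fun x => |u x| * u x) r volume :=
  hu.mul hu.abs

theorem locallyIntegrable_abs_mul_self {u : Plane → ℝ} (hu : MemLp u 4 volume) :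
    LocallyIntegrable (fun x => |u x| * u x) volume :=
  (memLp_abs_mul_self (r := 2) hu).locallyIntegrable (by norm_num)

theorem MemHdot.exists_seq {u : Plane → ℝ} (hu : MemHdot u) :
    ∃ φ : ℕ → Plane → ℝ, (∀ n, IsTest (φ n)) ∧
      Tendsto (fun n => eLpNorm (φ n - u) 4 volume) atTop (𝓝 0) ∧
      Tendsto (fun n => gagliardo (φ n - u)) atTop (𝓝 0) ∧
      ∀ᵐ x, Tendsto (fun n => φ n x) atTop (𝓝 (u x)) := by
  obtain ⟨h4, φ, hφ, h1, h2⟩ := hu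
  obtain ⟨ns, hns, hae⟩ := (tendstoInMeasure_of_tendsto_eLpNorm (by norm_num)
    (fun n => (hφ n).1.continuous.aestronglyMeasurable) h4.1 h1).exists_seq_tendsto_ae
  exact ⟨fun n => φ (ns n), fun n => hφ _, h1.comp hns.tendsto_atTop,
    h2.comp hns.tendsto_atTop, hae⟩

theorem finiteEnergy_of_approx {u : Plane → ℝ} {φ : ℕ → Plane → ℝ}
    (hu : AEStronglyMeasurable u volume) (hφ : ∀ n, IsTest (φ n))
    (h : Tendsto (fun n => gagliardo (φ n - u)) atTop (𝓝 0)) : FiniteEnergy u := by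
  obtain ⟨n, hn⟩ := (h.eventually_lt_const (u := ⊤) (by simp)).exists
  have h1 : FiniteEnergy (φ n - u) :=
    ⟨(hφ n).1.continuous.aestronglyMeasurable.sub hu, hn⟩
  have h2 := (hφ n).isLipc.finiteEnergy.sub h1
  rwa [sub_sub_cancel] at h2

theorem MemHdot.finiteEnergy {u : Plane → ℝ} (hu : MemHdot u) : FiniteEnergy u := by
  obtain ⟨φ, hφ, -, h2, -⟩ := hu.exists_seq
  exact finiteEnergy_of_approx hu.1.1 hφ h2

theorem exists_gagliardo_bound {u : Plane → ℝ} {φ : ℕ → Plane → ℝ} (hu : FiniteEnergy u)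
    (hφ : ∀ n, FiniteEnergy (φ n))
    (h : Tendsto (fun n => gagliardo (φ n - u)) atTop (𝓝 0)) :
    ∃ K : ℝ≥0, ∀ n, gagliardo (φ n) ≤ K := by
  have h0 : ∀ n, gagliardo (φ n - u) ≠ ⊤ := fun n => ((hφ n).sub hu).lt_top.ne
  have h1 : Tendsto (fun n => (gagliardo (φ n - u)).toNNReal) atTop (𝓝 0) :=
    (ENNReal.tendsto_toNNReal ENNReal.zero_ne_top).comp h
  obtain ⟨B, hB⟩ := h1.bddAbove_range
  refine ⟨B + (gagliardo u).toNNReal, fun n => ?_⟩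
  have h2 : gagliardo (φ n) ≤ gagliardo (φ n - u) + gagliardo u := by
    refine gagliardo_le_add ((hφ n).meas.sub hu.meas) hu.meas fun x y => ?_
    refine le_trans (le_of_eq ?_) (abs_add_le _ _)
    simp only [Pi.sub_apply]; congr 1; ring
  refine h2.trans ?_
  push_cast
  rw [ENNReal.coe_toNNReal hu.lt_top.ne, ← ENNReal.coe_toNNReal (h0 n)]
  gcongr
  exact hB ⟨n, rfl⟩

theorem IsLipc.memHdot {f : Plane → ℝ} (hf : IsLipc f) : MemHdot f := by
  obtain ⟨φ, S, -, -, hφ, -, -, hg, -⟩ := hf.exists_test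
  refine ⟨hf.memLp 4, φ, hφ, ?_, hg⟩
  have h2 : Tendsto (fun n => (sobolevConst : ℝ≥0∞) * gagliardo (φ n - f)) atTop (𝓝 0) := by
    simpa using ENNReal.Tendsto.const_mul hg (Or.inr ENNReal.coe_ne_top)
  exact tendsto_of_tendsto_of_tendsto_of_le_of_le tendsto_const_nhds h2 (fun n => zero_le)
    fun n => sobolev (((hφ n).isLipc.memLp 4).sub (hf.memLp 4))

theorem tendsto_pairing_seq {ρ v : Plane → ℝ} (hρ : MemHdotNeg ρ) (hv : MemHdot v)
    {φ : ℕ → Plane → ℝ} (hφ : ∀ n, IsTest (φ n))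
    (h : Tendsto (fun n => gagliardo (φ n - v)) atTop (𝓝 0)) :
    Tendsto (fun n => ∫ x, ρ x * φ n x) atTop (𝓝 (pairing ρ v)) := by
  have h1 : Tendsto φ atTop (testNhds v) :=
    tendsto_inf.2 ⟨tendsto_comap_iff.2 h, tendsto_principal.2 (Eventually.of_forall hφ)⟩
  exact (tendsto_pairing hρ hv).comp h1

theorem pairing_lipc {ρ f : Plane → ℝ} (hρ : MemHdotNeg ρ) (hf : IsLipc f) :
    pairing ρ f = ∫ x, ρ x * f x := by
  obtain ⟨φ, S, hS, -, hφ, hu, hφS, hg, -⟩ := hf.exists_test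
  exact tendsto_nhds_unique (tendsto_pairing_seq hρ hf.memHdot hφ hg)
    (tendsto_integral_mul_of_uniform hρ.1 hS hf hφ hφS hu)

/-- `v` is the almost everywhere limit of Lipschitz functions with compact support, bounded in
the Gagliardo norm and in `L³`. -/
structure IsWeakLimit (ψ : ℕ → Plane → ℝ) (v : Plane → ℝ) : Prop where
  lipc : ∀ n, IsLipc (ψ n)
  bound : ∃ K : ℝ≥0, ∀ n, gagliardo (ψ n) ≤ K
  bound_three : ∃ K : ℝ≥0, ∀ n, eLpNorm (ψ n) 3 volume ≤ K
  lim : ∀ᵐ x, Tendsto (fun n => ψ n x) atTop (𝓝 (v x))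

/-- This one condition on F covers maxima, minima, sums, positive parts and `clamp`; it is also the
condition under which `gagliardo_le_add` bounds the energy of the composition. -/
theorem IsLipc.comp₂ {F : ℝ → ℝ → ℝ} (hF : ∀ a b a' b', |F a b - F a' b'| ≤ |a - a'| + |b - b'|)
    (h0 : F 0 0 = 0) {a b : Plane → ℝ} (ha : IsLipc a) (hb : IsLipc b) :
    IsLipc fun x => F (a x) (b x) := by
  obtain ⟨Ka, hKa⟩ := ha.lip
  obtain ⟨Kb, hKb⟩ := hb.lip
  refine ⟨⟨Ka + Kb, LipschitzWith.of_dist_le_mul fun x y => ?_⟩, ?_⟩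
  · have h1 := hKa.dist_le_mul x y
    have h2 := hKb.dist_le_mul x y
    rw [Real.dist_eq] at *
    push_cast
    rw [add_mul]
    exact (hF _ _ _ _).trans (add_le_add h1 h2)
  · refine HasCompactSupport.intro (ha.supp.isCompact.union hb.supp.isCompact) fun x hx => ?_
    rw [Set.mem_union, not_or] at hx
    rw [image_eq_zero_of_notMem_tsupport hx.1, image_eq_zero_of_notMem_tsupport hx.2, h0]

theorem tendsto_comp₂ {F : ℝ → ℝ → ℝ} (hF : ∀ a b a' b', |F a b - F a' b'| ≤ |a - a'| + |b - b'|)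
    {a b : ℕ → ℝ} {s t : ℝ} (ha : Tendsto a atTop (𝓝 s)) (hb : Tendsto b atTop (𝓝 t)) :
    Tendsto (fun n => F (a n) (b n)) atTop (𝓝 (F s t)) := by
  rw [tendsto_iff_norm_sub_tendsto_zero]
  have h1 := ((ha.sub_const s).abs).add ((hb.sub_const t).abs)
  simp only [sub_self, abs_zero, add_zero] at h1
  exact squeeze_zero (fun n => norm_nonneg _) (fun n => hF _ _ _ _) h1

theorem IsWeakLimit.comp₂ {F : ℝ → ℝ → ℝ}
    (hF : ∀ a b a' b', |F a b - F a' b'| ≤ |a - a'| + |b - b'|)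
    (h0 : F 0 0 = 0) {a b : ℕ → Plane → ℝ} {u v : Plane → ℝ} (ha : IsWeakLimit a u)
    (hb : IsWeakLimit b v) :
    IsWeakLimit (fun n x => F (a n x) (b n x)) (fun x => F (u x) (v x)) := by
  obtain ⟨K, hK⟩ := ha.bound
  obtain ⟨K', hK'⟩ := hb.bound
  obtain ⟨L, hL⟩ := ha.bound_three
  obtain ⟨L', hL'⟩ := hb.bound_three
  refine ⟨fun n => (ha.lipc n).comp₂ hF h0 (hb.lipc n), ⟨K + K', fun n => ?_⟩,
    ⟨L + L', fun n => ?_⟩, ?_⟩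
  · push_cast
    exact (gagliardo_le_add (ha.lipc n).finiteEnergy.meas (hb.lipc n).finiteEnergy.meas
      fun x y => hF _ _ _ _).trans (add_le_add (hK n) (hK' n))
  · push_cast
    refine le_trans ?_ (add_le_add (hL n) (hL' n))
    rw [← eLpNorm_norm (a n), ← eLpNorm_norm (b n)]
    refine le_trans (eLpNorm_mono_real (g := fun x => ‖a n x‖ + ‖b n x‖) fun x => ?_)
      (eLpNorm_add_le ((ha.lipc n).memLp 3).1.norm ((hb.lipc n).memLp 3).1.norm (by norm_num))
    have := hF (a n x) (b n x) 0 0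
    simpa [h0] using this
  · filter_upwards [ha.lim, hb.lim] with x hx hy using tendsto_comp₂ hF hx hy

theorem IsWeakLimit.finiteEnergy {ψ : ℕ → Plane → ℝ} {v : Plane → ℝ} (h : IsWeakLimit ψ v) :
    FiniteEnergy v := by
  obtain ⟨K, hK⟩ := h.bound
  exact finiteEnergy_of_tendsto (fun n => (h.lipc n).finiteEnergy.meas) hK h.lim

theorem IsWeakLimit.memLp_three {ψ : ℕ → Plane → ℝ} {v : Plane → ℝ} (h : IsWeakLimit ψ v) :
    MemLp v 3 volume := by
  obtain ⟨K, hK⟩ := h.bound_three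
  exact (memLp_of_tendsto_of_le (fun n => (h.lipc n).finiteEnergy.meas) hK h.lim).1

theorem memLp_four_of_tendsto {ψ : ℕ → Plane → ℝ} {v : Plane → ℝ} {K : ℝ≥0}
    (hψ : ∀ n, IsLipc (ψ n)) (hK : ∀ n, gagliardo (ψ n) ≤ K)
    (hlim : ∀ᵐ x, Tendsto (fun n => ψ n x) atTop (𝓝 (v x))) : MemLp v 4 volume := by
  refine (memLp_of_tendsto_of_le (K := sobolevConst * K)
    (fun n => (hψ n).finiteEnergy.meas) (fun n => ?_) hlim).1
  push_cast
  exact (sobolev ((hψ n).memLp 4)).trans (by gcongr; exact hK n)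

theorem IsWeakLimit.memLp_four {ψ : ℕ → Plane → ℝ} {v : Plane → ℝ} (h : IsWeakLimit ψ v) :
    MemLp v 4 volume := by
  obtain ⟨K, hK⟩ := h.bound
  exact memLp_four_of_tendsto h.lipc hK h.lim

theorem IsWeakLimit.tendsto_hdotInner {ψ : ℕ → Plane → ℝ} {v w : Plane → ℝ}
    (h : IsWeakLimit ψ v) (hw : FiniteEnergy w) :
    Tendsto (fun n => hdotInner w (ψ n)) atTop (𝓝 (hdotInner w v)) := by
  obtain ⟨K, hK⟩ := h.bound
  exact Graphene.tendsto_hdotInner hw (fun n => (h.lipc n).finiteEnergy.meas) hK h.lim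

theorem IsWeakLimit.tendsto_integral {ψ : ℕ → Plane → ℝ} {v g : Plane → ℝ}
    (h : IsWeakLimit ψ v) (hg : MemLp g (3 / 2) volume) :
    Tendsto (fun n => ∫ x, g x * ψ n x) atTop (𝓝 (∫ x, g x * v x)) := by
  obtain ⟨K, hK⟩ := h.bound_three
  exact tendsto_integral_mul_three hg (fun n => (h.lipc n).finiteEnergy.meas) hK h.lim

theorem isWeakLimit_const {f : Plane → ℝ} (hf : IsLipc f) : IsWeakLimit (fun _ => f) f := by
  refine ⟨fun _ => hf, ⟨(gagliardo f).toNNReal, fun _ => ?_⟩,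
    ⟨(eLpNorm f 3 volume).toNNReal, fun _ => ?_⟩, ae_of_all _ fun x => tendsto_const_nhds⟩
  · rw [ENNReal.coe_toNNReal hf.finiteEnergy.lt_top.ne]
  · rw [ENNReal.coe_toNNReal (hf.memLp 3).2.ne]

/-- If `(-Δ)^{1/2} w = g` against Lipschitz functions, then also against weak limits. -/
theorem IsWeakLimit.hdotInner_eq {ψ : ℕ → Plane → ℝ} {v w g : Plane → ℝ} (h : IsWeakLimit ψ v)
    (hw : FiniteEnergy w) (hg : MemLp g (3 / 2) volume)
    (heq : ∀ f, IsLipc f → hdotInner w f = ∫ x, g x * f x) :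
    hdotInner w v = ∫ x, g x * v x :=
  tendsto_nhds_unique (h.tendsto_hdotInner hw)
    ((h.tendsto_integral hg).congr fun n => (heq _ (h.lipc n)).symm)

theorem HalfLapNonneg.lipc {V f : Plane → ℝ} (hV : HalfLapNonneg V) (hVe : FiniteEnergy V)
    (hf : IsLipc f) (h0 : ∀ x, 0 ≤ f x) : 0 ≤ hdotInner V f := by
  obtain ⟨φ, S, hS, -, hφ, hu, hφS, hg, hpos, -⟩ := hf.exists_test
  exact ge_of_tendsto' (tendsto_hdotInner_of_gagliardo hVe (fun n => (hφ n).isLipc.finiteEnergy)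
    hf.finiteEnergy hg) fun n => hV _ (hφ n) (hpos h0 n)

/-- Mollification enlarges the support, and g is integrable only on compact subsets of Ω. An open U
with compact closure in Ω absorbs the enlargement, and g may be cut off to the closure of U. -/
theorem HalfLapLE.lipc {V g f : Plane → ℝ} {Ω : Set Plane} (hV : HalfLapLE V g Ω)
    (hVe : FiniteEnergy V) (hΩ : IsOpen Ω) (hg : LocallyIntegrableOn g Ω volume)
    (hf : IsLipc f) (h0 : ∀ x, 0 ≤ f x) (hfΩ : tsupport f ⊆ Ω) :
    hdotInner V f ≤ ∫ x, g x * f x := by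
  obtain ⟨U, hUo, hfU, hUΩ, hUc⟩ :
      ∃ U : Set Plane, IsOpen U ∧ tsupport f ⊆ U ∧ closure U ⊆ Ω ∧ IsCompact (closure U) :=
    exists_open_between_and_isCompact_closure hf.supp.isCompact hΩ hfΩ
  obtain ⟨φ, S, hS, -, hφ, hu, hφS, hgag, hpos, hsub⟩ := hf.exists_test
  have hev := hsub U hUo hfU
  have hi : Integrable ((closure U).indicator g) volume :=
    (integrable_indicator_iff hUc.measurableSet).2
      (hg.integrableOn_compact_subset hUΩ hUc)
  have h1 : Tendsto (fun n => ∫ x, (closure U).indicator g x * φ n x) atTop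
      (𝓝 (∫ x, (closure U).indicator g x * f x)) :=
    tendsto_integral_mul_of_uniform hi.locallyIntegrable hS hf hφ hφS hu
  have h2 : ∀ v : Plane → ℝ, tsupport v ⊆ U →
      ∫ x, (closure U).indicator g x * v x = ∫ x, g x * v x := by
    intro v hv
    congr 1
    funext x
    by_cases hx : x ∈ closure U
    · rw [Set.indicator_of_mem hx]
    · rw [image_eq_zero_of_notMem_tsupport fun h => hx (subset_closure (hv h))]; simp
  rw [h2 f hfU] at h1
  refine le_of_tendsto_of_tendsto (tendsto_hdotInner_of_gagliardo hVe
    (fun n => (hφ n).isLipc.finiteEnergy) hf.finiteEnergy hgag) h1 ?_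
  filter_upwards [hev] with n hn
  rw [h2 _ hn]
  exact hV _ (hφ n) (hn.trans (subset_closure.trans hUΩ)) (hpos h0 n)

theorem hdotInner_mono {u v a b : Plane → ℝ} (hu : FiniteEnergy u) (hv : FiniteEnergy v)
    (ha : FiniteEnergy a) (hb : FiniteEnergy b)
    (h : ∀ᵐ p ∂gagMeasure, incr u p * incr v p ≤ incr a p * incr b p) :
    hdotInner u v ≤ hdotInner a b := by
  rw [Graphene.hdotInner_eq, Graphene.hdotInner_eq]
  exact integral_mono_ae (hu.integrable hv) (ha.integrable hb) h

theorem ae_eq_zero_of_hdotInner_self {u : Plane → ℝ} (hu : FiniteEnergy u) (h4 : MemLp u 4 volume)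
    (h : hdotInner u u ≤ 0) : u =ᵐ[volume] 0 := by
  apply ae_eq_zero_of_gagliardo h4
  rw [hdotInner_self hu] at h
  have h1 : (gagliardo u).toReal = 0 := by nlinarith [sq_nonneg (gagliardo u).toReal]
  rcases (ENNReal.toReal_eq_zero_iff _).1 h1 with h2 | h2
  · exact h2
  · exact absurd h2 hu.lt_top.ne

/-! ### The dual variational problem -/

/-- Solutions of `(-Δ)^{1/2} u + |u| u = (-Δ)^{1/2} V`, tested against test functions, which are
limits of test functions in all relevant norms. -/
structure IsGround (V u : Plane → ℝ) : Prop where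
  mem_three : MemLp u 3 volume
  mem_four : MemLp u 4 volume
  approx : ∃ φ : ℕ → Plane → ℝ, (∀ n, IsTest (φ n)) ∧
    Tendsto (fun n => gagliardo (φ n - u)) atTop (𝓝 0) ∧
    Tendsto (fun n => eLpNorm (φ n - u) 3 volume) atTop (𝓝 0) ∧
    Tendsto (fun n => eLpNorm (φ n - u) 4 volume) atTop (𝓝 0) ∧
    ∀ᵐ x, Tendsto (fun n => φ n x) atTop (𝓝 (u x))
  eq : ∀ φ, IsTest φ → hdotInner u φ + ∫ x, |u x| * u x * φ x = hdotInner V φ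

/-- The functional whose minimizer solves the Euler-Lagrange equation. -/
def dualEnergy (V φ : Plane → ℝ) : ℝ :=
  1 / 2 * hdotInner φ φ - hdotInner V φ + 1 / 3 * ∫ x, |φ x| ^ 3

/-- Clarkson's inequality for exponent 3; it supplies the L³ part of the uniform convexity of
`dualEnergy`. -/
theorem abs_add_cube_add_abs_sub_cube_le (a b : ℝ) :
    |a + b| ^ 3 + |a - b| ^ 3 ≤ 4 * (|a| ^ 3 + |b| ^ 3) := by
  have key : ∀ A B : ℝ, 0 ≤ A → 0 ≤ B → (A + B) ^ 3 + |A - B| ^ 3 ≤ 4 * (A ^ 3 + B ^ 3) := by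
    intro A B hA hB
    rcases abs_cases (A - B) with ⟨h, _⟩ | ⟨h, _⟩ <;> rw [h]
    · nlinarith [mul_nonneg (sq_nonneg (A - B)) (by linarith : (0 : ℝ) ≤ A + 2 * B)]
    · nlinarith [mul_nonneg (sq_nonneg (A - B)) (by linarith : (0 : ℝ) ≤ B + 2 * A)]
  have h := key |a| |b| (abs_nonneg a) (abs_nonneg b)
  rcases le_total 0 a with ha | ha <;> rcases le_total 0 b with hb | hb
  · rw [abs_of_nonneg ha, abs_of_nonneg hb, ← abs_of_nonneg (add_nonneg ha hb)] at h
    rwa [abs_of_nonneg ha, abs_of_nonneg hb]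
  · rw [abs_of_nonneg ha, abs_of_nonpos hb] at h
    rw [abs_of_nonneg ha, abs_of_nonpos hb, abs_of_nonneg (a := a - b) (by linarith)]
    simp only [sub_neg_eq_add, ← sub_eq_add_neg] at h
    linarith
  · rw [abs_of_nonpos ha, abs_of_nonneg hb] at h
    rw [abs_of_nonpos ha, abs_of_nonneg hb, abs_of_nonpos (a := a - b) (by linarith)]
    rw [show -a - b = -(a + b) by ring, abs_neg, show -a + b = -(a - b) by ring] at h
    linarith
  · rw [abs_of_nonpos ha, abs_of_nonpos hb] at h
    rw [abs_of_nonpos ha, abs_of_nonpos hb, abs_of_nonpos (a := a + b) (by linarith)]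
    rw [show -a - -b = -(a - b) by ring, abs_neg, show -a + -b = -(a + b) by ring] at h
    linarith

/-- Taylor's expansion of |·|³ to second order, with the remainder bounded by |b|³. It replaces
differentiation under the integral in the Euler–Lagrange equation. -/
theorem abs_add_cube_le (a b : ℝ) :
    |a + b| ^ 3 ≤ |a| ^ 3 + 3 * (|a| * a) * b + 3 * |a| * b ^ 2 + |b| ^ 3 := by
  have key : ∀ A B : ℝ, 0 ≤ A →
      |A + B| ^ 3 ≤ A ^ 3 + 3 * (A * A) * B + 3 * A * B ^ 2 + |B| ^ 3 := by
    intro A B hA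
    rcases abs_cases (A + B) with ⟨h, h'⟩ | ⟨h, h'⟩ <;> rcases abs_cases B with ⟨k, k'⟩ | ⟨k, k'⟩ <;>
      rw [h, k]
    · nlinarith
    · nlinarith [pow_pos (neg_pos.2 k') 3]
    · linarith
    · have : 0 ≤ A * (A ^ 2 + 3 * A * B + 3 * B ^ 2) :=
        mul_nonneg hA (by nlinarith [sq_nonneg (2 * A + 3 * B), sq_nonneg B])
      nlinarith
  rcases le_total 0 a with ha | ha
  · rw [abs_of_nonneg ha]; exact key a b ha
  · have h := key (-a) (-b) (by linarith)
    rw [abs_of_nonpos ha]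
    rw [show -a + -b = -(a + b) by ring, abs_neg, abs_neg] at h
    nlinarith

theorem IsTest.add {f g : Plane → ℝ} (hf : IsTest f) (hg : IsTest g) : IsTest (f + g) :=
  ⟨hf.1.add hg.1, hf.2.add hg.2⟩

theorem IsTest.smul {f : Plane → ℝ} (hf : IsTest f) (c : ℝ) : IsTest (c • f) :=
  ⟨contDiff_const.smul hf.1, hf.2.smul_left⟩

theorem IsTest.sub {f g : Plane → ℝ} (hf : IsTest f) (hg : IsTest g) : IsTest (f - g) :=
  ⟨hf.1.sub hg.1, hf.2.sub hg.2⟩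

theorem isTest_zero : IsTest 0 := ⟨contDiff_const, HasCompactSupport.zero⟩

/-- Complete the square: ½‖V − φ‖² ≥ 0. -/
theorem dualEnergy_bound {V φ : Plane → ℝ} (hV : FiniteEnergy V) (hφ : IsTest φ) :
    -(1 / 2 * hdotInner V V) ≤ dualEnergy V φ := by
  have he := hφ.isLipc.finiteEnergy
  have h1 : 0 ≤ hdotInner (V - φ) (V - φ) := by
    rw [hdotInner_self (hV.sub he)]; positivity
  rw [hdotInner_sub_right (hV.sub he) hV he, hdotInner_sub_left hV hV he,
    hdotInner_sub_left he hV he, hdotInner_comm φ V] at h1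
  have h2 : 0 ≤ ∫ x, |φ x| ^ 3 := integral_nonneg fun x => by positivity
  unfold dualEnergy
  linarith

theorem dualEnergy_midpoint {V f g : Plane → ℝ} (hV : FiniteEnergy V) (hf : IsTest f)
    (hg : IsTest g) :
    dualEnergy V ((1 / 2 : ℝ) • (f + g)) + 1 / 8 * hdotInner (f - g) (f - g) +
      1 / 24 * ∫ x, |f x - g x| ^ 3 ≤ (dualEnergy V f + dualEnergy V g) / 2 := by
  have hfe := hf.isLipc.finiteEnergy
  have hge := hg.isLipc.finiteEnergy
  have i3 : ∀ h : Plane → ℝ, IsTest h → Integrable (fun x => |h x| ^ 3) volume := fun h hh =>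
    integrable_abs_pow (by norm_num) (hh.isLipc.memLp _)
  have c : (1 / 3 : ℝ) * (∫ x, |(1 / 2 : ℝ) * (f x + g x)| ^ 3) + 1 / 24 * ∫ x, |f x - g x| ^ 3 ≤
      (1 / 3 * (∫ x, |f x| ^ 3) + 1 / 3 * ∫ x, |g x| ^ 3) / 2 := by
    have j1 := i3 _ ((hf.add hg).smul (1 / 2))
    have j2 := i3 _ (hf.sub hg)
    simp only [Pi.smul_apply, Pi.add_apply, Pi.sub_apply, smul_eq_mul] at j1 j2
    rw [← mul_add, mul_div_assoc, show (1 / 24 : ℝ) = 1 / 3 * (1 / 8) by norm_num, mul_assoc,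
      ← mul_add, ← integral_const_mul, ← integral_add j1 (j2.const_mul _),
      ← integral_add (i3 f hf) (i3 g hg), ← integral_div]
    refine mul_le_mul_of_nonneg_left ?_ (by norm_num)
    refine integral_mono (j1.add (j2.const_mul _)) (((i3 f hf).add (i3 g hg)).div_const 2)
      fun x => ?_
    have := abs_add_cube_add_abs_sub_cube_le (f x) (g x)
    rw [abs_mul, mul_pow]
    norm_num
    linarith
  unfold dualEnergy
  simp only [hdotInner_smul_left, hdotInner_smul_right]
  rw [hdotInner_add_right (hfe.add hge) hfe hge, hdotInner_add_left hfe hfe hge,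
    hdotInner_add_left hge hfe hge, hdotInner_sub_right (hfe.sub hge) hfe hge,
    hdotInner_sub_left hfe hfe hge, hdotInner_sub_left hge hfe hge,
    hdotInner_add_right hV hfe hge, hdotInner_comm g f]
  simp only [Pi.smul_apply, Pi.add_apply, smul_eq_mul]
  linarith

theorem dualEnergy_add_le {V f φ : Plane → ℝ} (hV : FiniteEnergy V) (hf : IsTest f)
    (hφ : IsTest φ) (t : ℝ) :
    dualEnergy V (f + t • φ) ≤ dualEnergy V f +
      t * (hdotInner φ f - hdotInner V φ + ∫ x, φ x * (|f x| * f x)) +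
      t ^ 2 * (1 / 2 * hdotInner φ φ + ∫ x, φ x ^ 2 * |f x|) +
      |t| ^ 3 * (1 / 3 * ∫ x, |φ x| ^ 3) := by
  have hfe := hf.isLipc.finiteEnergy
  have hφe := hφ.isLipc.finiteEnergy
  have hfc := hf.1.continuous
  have hφc := hφ.1.continuous
  have i3 : ∀ h : Plane → ℝ, IsTest h → Integrable (fun x => |h x| ^ 3) volume := fun h hh =>
    integrable_abs_pow (by norm_num) (hh.isLipc.memLp _)
  have i1 : Integrable (fun x => φ x * (|f x| * f x)) volume :=
    Continuous.integrable_of_hasCompactSupport (by fun_prop) hφ.2.mul_right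
  have i2 : Integrable (fun x => φ x ^ 2 * |f x|) volume := by
    refine Continuous.integrable_of_hasCompactSupport (by fun_prop) ?_
    simp only [sq]
    exact hφ.2.mul_right.mul_right
  have h1 : ∫ x, |f x + t * φ x| ^ 3 ≤ (∫ x, |f x| ^ 3) + 3 * t * (∫ x, φ x * (|f x| * f x)) +
      3 * t ^ 2 * (∫ x, φ x ^ 2 * |f x|) + |t| ^ 3 * ∫ x, |φ x| ^ 3 := by
    simp only [← integral_const_mul]
    have j1 : Integrable (fun x => |f x| ^ 3 + 3 * t * (φ x * (|f x| * f x))) volume :=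
      (i3 f hf).add (i1.const_mul _)
    have j2 : Integrable (fun x => |f x| ^ 3 + 3 * t * (φ x * (|f x| * f x)) +
        3 * t ^ 2 * (φ x ^ 2 * |f x|)) volume := j1.add (i2.const_mul _)
    rw [← integral_add (i3 f hf) (i1.const_mul _), ← integral_add j1 (i2.const_mul _),
      ← integral_add j2 ((i3 φ hφ).const_mul _)]
    refine integral_mono (i3 _ (hf.add (hφ.smul t))) (j2.add ((i3 φ hφ).const_mul _))
      fun x => ?_
    refine (abs_add_cube_le (f x) (t * φ x)).trans (le_of_eq ?_)
    rw [abs_mul]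
    ring
  unfold dualEnergy
  rw [hdotInner_add_right (hfe.add (hφe.smul t)) hfe (hφe.smul t),
    hdotInner_add_left hfe hfe (hφe.smul t), hdotInner_add_left (hφe.smul t) hfe (hφe.smul t),
    hdotInner_add_right hV hfe (hφe.smul t)]
  simp only [hdotInner_smul_left, hdotInner_smul_right, Pi.add_apply, Pi.smul_apply, smul_eq_mul]
  rw [hdotInner_comm f φ]
  nlinarith

/-- For small t of sign opposite to L the linear term would dominate. -/
theorem eq_zero_of_forall_quadratic {L M N : ℝ} (hM : 0 ≤ M) (hN : 0 ≤ N)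
    (h : ∀ t : ℝ, 0 ≤ t * L + t ^ 2 * M + |t| ^ 3 * N) : L = 0 := by
  by_contra hL
  have hL0 : 0 < |L| := abs_pos.2 hL
  -- With t = ±s and s ≤ 1 the hypothesis gives |L| ≤ s(M + N), while the choice of s makes s(M + N)
  -- smaller than |L|/2.
  set s : ℝ := |L| / (|L| + 2 * (M + N)) with hs
  have hden : 0 < |L| + 2 * (M + N) := by positivity
  have hs0 : 0 < s := by positivity
  have hs1 : s ≤ 1 := by rw [hs, div_le_one hden]; linarith
  have h1 : s * (|L| + 2 * (M + N)) = |L| := by rw [hs]; field_simp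
  have h2 : s * |L| ≤ s ^ 2 * (M + N) := by
    have h3 : s ^ 3 * N ≤ s ^ 2 * N := by
      have : s ^ 3 ≤ s ^ 2 := pow_le_pow_of_le_one hs0.le hs1 (by norm_num)
      gcongr
    rcases abs_cases L with ⟨e, _⟩ | ⟨e, _⟩
    · have := h (-s)
      rw [abs_neg, abs_of_pos hs0] at this
      rw [e]
      nlinarith
    · have := h s
      rw [abs_of_pos hs0] at this
      rw [e]
      nlinarith
  have h3 : |L| ≤ s * (M + N) := by
    have : s * |L| ≤ s * (s * (M + N)) := by linarith [h2, sq s ▸ (by ring : s ^ 2 * (M + N) = s * (s * (M + N)))]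
    exact le_of_mul_le_mul_left this hs0
  nlinarith [mul_pos hs0 hL0]

/-- The direct method, run on test functions only. Uniform convexity makes the minimizing sequence
Cauchy, and optimality is exploited along the sequence before passing to the limit, so that J is
never evaluated at u. -/
theorem exists_isGround {V : Plane → ℝ} (hV : FiniteEnergy V) : ∃ u, IsGround V u := by
  set T : Set ℝ := {t | ∃ φ, IsTest φ ∧ t = dualEnergy V φ} with hT
  have hTne : T.Nonempty := ⟨_, 0, isTest_zero, rfl⟩
  have hTbdd : BddBelow T := ⟨-(1 / 2 * hdotInner V V), by
    rintro _ ⟨φ, hφ, rfl⟩; exact dualEnergy_bound hV hφ⟩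
  set m := sInf T with hm
  have hmle : ∀ φ, IsTest φ → m ≤ dualEnergy V φ := fun φ hφ => csInf_le hTbdd ⟨φ, hφ, rfl⟩
  -- The midpoint inequality turns an energy excess below 8^{-N}/24 into distances at most 2^{-N},
  -- both in the Gagliardo norm and in L³. These are summable, so the sequence converges almost
  -- everywhere without passing to a subsequence.
  set ε : ℕ → ℝ := fun n => (1 / 8) ^ n / 24 with hε
  have hεpos : ∀ n, 0 < ε n := fun n => by positivity
  have hεanti : ∀ N n, N ≤ n → ε n ≤ ε N := fun N n hNn => by
    simp only [hε]
    have : (1 / 8 : ℝ) ^ n ≤ (1 / 8) ^ N := pow_le_pow_of_le_one (by norm_num) (by norm_num) hNn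
    linarith
  have hex : ∀ n, ∃ φ, IsTest φ ∧ dualEnergy V φ < m + ε n := by
    intro n
    obtain ⟨_, ⟨φ, hφ, rfl⟩, h⟩ := exists_lt_of_csInf_lt hTne
      (show sInf T < m + ε n by linarith [hεpos n])
    exact ⟨φ, hφ, h⟩
  choose φ hφ hφm using hex
  have hmid : ∀ N n k, N ≤ n → N ≤ k → 1 / 8 * hdotInner (φ n - φ k) (φ n - φ k) +
      1 / 24 * ∫ x, |φ n x - φ k x| ^ 3 ≤ ε N := by
    intro N n k hn hk
    have h1 := dualEnergy_midpoint hV (hφ n) (hφ k)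
    have h2 := hmle _ (((hφ n).add (hφ k)).smul (1 / 2))
    linarith [hφm n, hφm k, hεanti N n hn, hεanti N k hk]
  have hgag : ∀ N n k, N ≤ n → N ≤ k → gagliardo (φ n - φ k) ≤ ENNReal.ofReal ((1 / 2) ^ N) := by
    intro N n k hn hk
    have he := ((hφ n).sub (hφ k)).isLipc.finiteEnergy
    have h1 := hmid N n k hn hk
    have h2 : 0 ≤ ∫ x, |φ n x - φ k x| ^ 3 := integral_nonneg fun x => by positivity
    rw [hdotInner_self he] at h1
    rw [← ENNReal.ofReal_toReal he.lt_top.ne]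
    apply ENNReal.ofReal_le_ofReal
    apply le_of_sq_le_sq _ (by positivity)
    have h4 : (1 / 8 : ℝ) ^ N ≤ (1 / 4) ^ N := pow_le_pow_left₀ (by norm_num) (by norm_num) N
    have h5 : ((1 / 2 : ℝ) ^ N) ^ 2 = (1 / 4) ^ N := by rw [← pow_mul, mul_comm, pow_mul]; norm_num
    rw [h5]
    simp only [hε] at h1
    have h6 : (0 : ℝ) < (1 / 8) ^ N := by positivity
    linarith
  have hthree : ∀ N n k, N ≤ n → N ≤ k →
      eLpNorm (φ n - φ k) 3 volume ≤ ENNReal.ofReal ((1 / 2) ^ N) := by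
    intro N n k hn hk
    have ht := ((hφ n).sub (hφ k)).isLipc
    have h1 := hmid N n k hn hk
    rw [hdotInner_self ht.finiteEnergy] at h1
    have h2 := integral_abs_pow_eq (p := 3) (by norm_num) (ht.memLp ((3 : ℕ) : ℝ≥0∞))
    simp only [Pi.sub_apply, Nat.cast_ofNat] at h2
    rw [h2] at h1
    rw [← ENNReal.ofReal_toReal (ht.memLp 3).2.ne]
    apply ENNReal.ofReal_le_ofReal
    have h5 : ((1 / 2 : ℝ) ^ N) ^ 3 = (1 / 8) ^ N := by rw [← pow_mul, mul_comm, pow_mul]; norm_num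
    refine le_of_pow_le_pow_left₀ (n := 3) (by norm_num) (by positivity) ?_
    rw [h5]
    simp only [hε] at h1
    nlinarith [sq_nonneg (gagliardo (φ n - φ k)).toReal]
  have hfour : ∀ N n k, N ≤ n → N ≤ k →
      eLpNorm (φ n - φ k) 4 volume ≤ sobolevConst * ENNReal.ofReal ((1 / 2) ^ N) := by
    intro N n k hn hk
    exact (sobolev (((hφ n).sub (hφ k)).isLipc.memLp 4)).trans (by gcongr; exact hgag N n k hn hk)
  -- A single summable sequence that strictly exceeds the Gagliardo, L³ and L⁴ distances at once.
  set B : ℕ → ℝ≥0∞ := fun N => (sobolevConst + 2 : ℝ≥0) * ENNReal.ofReal ((1 / 2) ^ N) with hB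
  have hBsum : ∑' i, B i ≠ ⊤ := by
    simp only [hB]
    rw [ENNReal.tsum_mul_left]
    refine ENNReal.mul_ne_top ENNReal.coe_ne_top ?_
    rw [← ENNReal.ofReal_tsum_of_nonneg (fun n => by positivity) summable_geometric_two]
    exact ENNReal.ofReal_ne_top
  have hpos2 : ∀ N : ℕ, 0 < ENNReal.ofReal ((1 / 2 : ℝ) ^ N) := fun N =>
    ENNReal.ofReal_pos.2 (by positivity)
  have hBlt : ∀ N, ∀ c : ℝ≥0, c < sobolevConst + 2 → c * ENNReal.ofReal ((1 / 2 : ℝ) ^ N) < B N :=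
    fun N c hc => ENNReal.mul_lt_mul_left (hpos2 N).ne' ENNReal.ofReal_ne_top
      (ENNReal.coe_lt_coe.2 hc)
  have hone : (1 : ℝ≥0) < sobolevConst + 2 := lt_of_lt_of_le one_lt_two le_add_self
  have hgagB : ∀ N n k, N ≤ n → N ≤ k → gagliardo (φ n - φ k) < B N := fun N n k hn hk =>
    (hgag N n k hn hk).trans_lt (by simpa using hBlt N 1 hone)
  have hthreeB : ∀ N n k, N ≤ n → N ≤ k → eLpNorm (φ n - φ k) 3 volume < B N :=
    fun N n k hn hk => (hthree N n k hn hk).trans_lt (by simpa using hBlt N 1 hone)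
  have hfourB : ∀ N n k, N ≤ n → N ≤ k → eLpNorm (φ n - φ k) 4 volume < B N :=
    fun N n k hn hk => (hfour N n k hn hk).trans_lt
      (hBlt N _ (lt_add_of_pos_right _ two_pos))
  have hmeas : ∀ n, AEStronglyMeasurable (φ n) volume := fun n =>
    (hφ n).1.continuous.aestronglyMeasurable
  have hae := Lp.ae_tendsto_of_cauchy_eLpNorm hmeas (by norm_num : (1 : ℝ≥0∞) ≤ 4) hBsum hfourB
  set u : Plane → ℝ := fun x => limUnder atTop fun n => φ n x with hu
  have hlim : ∀ᵐ x, Tendsto (fun n => φ n x) atTop (𝓝 (u x)) := by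
    filter_upwards [hae] with x hx using tendsto_nhds_limUnder hx
  have hum : AEStronglyMeasurable u volume := aestronglyMeasurable_of_tendsto_ae _ hmeas hlim
  have h3 := Lp.cauchy_tendsto_of_tendsto hmeas u hBsum hthreeB hlim
  have h4 := Lp.cauchy_tendsto_of_tendsto hmeas u hBsum hfourB hlim
  have hg : Tendsto (fun n => gagliardo (φ n - u)) atTop (𝓝 0) := by
    have := Lp.cauchy_tendsto_of_tendsto (μ := gagMeasure) (p := 2) (f := fun n => incr (φ n))
      (fun n => aestronglyMeasurable_incr (hmeas n)) (incr u) hBsum (fun N n k hn hk => by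
        have := hgagB N n k hn hk
        rw [gagliardo_eq] at this
        convert this using 2
        funext p; simp only [incr, Pi.sub_apply]; ring) (incr_ae_tendsto hlim)
    refine this.congr fun n => ?_
    rw [gagliardo_eq]
    congr 1
    funext p; simp only [incr, Pi.sub_apply]; ring
  have hue : FiniteEnergy u := finiteEnergy_of_approx hum hφ hg
  have memOf : ∀ p : ℝ≥0∞, 1 ≤ p → Tendsto (fun n => eLpNorm (φ n - u) p volume) atTop (𝓝 0) →
      MemLp u p volume := by
    intro p hp h
    obtain ⟨n, hn⟩ := (h.eventually_lt_const (u := ⊤) (by simp)).exists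
    have h1 : MemLp (φ n - u) p volume := ⟨(hmeas n).sub hum, hn⟩
    have h2 := ((hφ n).isLipc.memLp p).sub h1
    rwa [sub_sub_cancel] at h2
  have hu3 := memOf 3 (by norm_num) h3
  have hu4 := memOf 4 (by norm_num) h4
  refine ⟨u, hu3, hu4, ⟨φ, hφ, hg, h3, h4, hlim⟩, fun ψ hψ => ?_⟩
  have hψe := hψ.isLipc.finiteEnergy
  obtain ⟨K, hK⟩ := exists_gagliardo_bound hue (fun n => (hφ n).isLipc.finiteEnergy) hg
  have hK4 : ∀ n, eLpNorm (φ n) 4 volume ≤ ((sobolevConst * K : ℝ≥0) : ℝ≥0∞) := fun n => by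
    push_cast
    exact (sobolev ((hφ n).isLipc.memLp 4)).trans (by gcongr; exact hK n)
  have c1 : Tendsto (fun n => ∫ x, ψ x * (|φ n x| * φ n x)) atTop
      (𝓝 (∫ x, ψ x * (|u x| * u x))) := by
    refine tendsto_integral_mul_two (K := (sobolevConst * K) * (sobolevConst * K))
      (hψ.isLipc.memLp 2) (fun n => (hmeas n).norm.mul (hmeas n)) (fun n => ?_) ?_
    · have := eLpNorm_smul_le_mul_eLpNorm (p := 4) (q := 4) (r := 2) (hmeas n) (hmeas n).norm
      rw [eLpNorm_norm] at this
      refine this.trans ?_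
      rw [ENNReal.coe_mul]
      exact mul_le_mul' (hK4 n) (hK4 n)
    · filter_upwards [hlim] with x hx using hx.abs.mul hx
  have c2 : Tendsto (fun n => ∫ x, ψ x ^ 2 * |φ n x|) atTop (𝓝 (∫ x, ψ x ^ 2 * |u x|)) := by
    have hψ2 : IsLipc fun x => ψ x ^ 2 := by
      have : IsTest fun x => ψ x ^ 2 :=
        ⟨hψ.1.pow 2, by simp only [sq]; exact hψ.2.mul_right⟩
      exact this.isLipc
    have hb : ∀ n, eLpNorm (φ n) 3 volume ≤
        ((1 + (eLpNorm (φ 0) 3 volume).toNNReal : ℝ≥0) : ℝ≥0∞) := by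
      intro n
      push_cast
      rw [ENNReal.coe_toNNReal ((hφ 0).isLipc.memLp 3).2.ne]
      have e1 : φ n = (φ n - φ 0) + φ 0 := by simp
      have e2 := eLpNorm_add_le (p := 3) ((hmeas n).sub (hmeas 0)) (hmeas 0) (by norm_num)
      rw [← e1] at e2
      refine e2.trans ?_
      gcongr
      simpa using hthree 0 n 0 (zero_le) (zero_le)
    refine tendsto_integral_mul_three (hψ2.memLp _) (fun n => (hmeas n).norm)
      (fun n => (eLpNorm_norm (φ n)).trans_le (hb n)) ?_
    filter_upwards [hlim] with x hx using hx.abs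
  have c3 := tendsto_hdotInner_of_gagliardo hψe (fun n => (hφ n).isLipc.finiteEnergy) hue hg
  have key : hdotInner ψ u - hdotInner V ψ + ∫ x, ψ x * (|u x| * u x) = 0 := by
    have hq : 0 ≤ hdotInner ψ ψ := by rw [hdotInner_self hψe]; positivity
    refine eq_zero_of_forall_quadratic
      (M := 1 / 2 * hdotInner ψ ψ + ∫ x, ψ x ^ 2 * |u x|) (N := 1 / 3 * ∫ x, |ψ x| ^ 3) ?_ ?_ ?_
    · have : 0 ≤ ∫ x, ψ x ^ 2 * |u x| := integral_nonneg fun x => by positivity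
      positivity
    · have : 0 ≤ ∫ x, |ψ x| ^ 3 := integral_nonneg fun x => by positivity
      positivity
    · intro t
      have hεlim : Tendsto ε atTop (𝓝 0) := by
        have := (tendsto_pow_atTop_nhds_zero_of_lt_one (r := (1 / 8 : ℝ)) (by norm_num)
          (by norm_num)).div_const 24
        rwa [zero_div] at this
      have hl := ((((c3.sub_const (hdotInner V ψ)).add c1).const_mul t).add
        ((c2.const_add (1 / 2 * hdotInner ψ ψ)).const_mul (t ^ 2))).add_const
          (|t| ^ 3 * (1 / 3 * ∫ x, |ψ x| ^ 3))
      have hl2 := hεlim.neg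
      rw [neg_zero] at hl2
      refine le_of_tendsto_of_tendsto' hl2 hl fun n => ?_
      -- Near-minimality: J(φ n + tψ) ≥ m > J(φ n) − ε n. As n → ∞ the cubic upper bound for the
      -- increment of J becomes nonnegative for every t, which forces its linear coefficient to
      -- vanish.
      have h5 := dualEnergy_add_le hV (hφ n) hψ t
      have h6 := hmle _ ((hφ n).add (hψ.smul t))
      linarith [hφm n]
  rw [hdotInner_comm u ψ]
  have e : ∫ x, |u x| * u x * ψ x = ∫ x, ψ x * (|u x| * u x) := by
    congr 1; funext x; ring
  rw [e]
  linarith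

/-! ### The equation for the ground state, tested against wider classes -/

theorem abs_max_sub_max_le_add (a b c d : ℝ) : |max a b - max c d| ≤ |a - c| + |b - d| :=
  (abs_max_sub_max_le_max a b c d).trans (max_le_add_of_nonneg (abs_nonneg _) (abs_nonneg _))

theorem abs_min_sub_min_le_add (a b c d : ℝ) : |min a b - min c d| ≤ |a - c| + |b - d| :=
  (abs_min_sub_min_le_max a b c d).trans (max_le_add_of_nonneg (abs_nonneg _) (abs_nonneg _))

theorem IsGround.congr {V u v : Plane → ℝ} (h : IsGround V u) (huv : u =ᵐ[volume] v) :
    IsGround V v := by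
  obtain ⟨φ, hφ, hg, h3, h4, hl⟩ := h.approx
  have hs : ∀ n, φ n - u =ᵐ[volume] φ n - v := fun n => by
    filter_upwards [huv] with x hx; simp [hx]
  refine ⟨h.mem_three.ae_eq huv, h.mem_four.ae_eq huv, ⟨φ, hφ, ?_, ?_, ?_, ?_⟩, fun ψ hψ => ?_⟩
  · exact hg.congr fun n => gagliardo_congr (hs n)
  · exact h3.congr fun n => eLpNorm_congr_ae (hs n)
  · exact h4.congr fun n => eLpNorm_congr_ae (hs n)
  · filter_upwards [hl, huv] with x hx hx'; rwa [← hx']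
  · rw [← h.eq ψ hψ, hdotInner_congr huv.symm (ae_eq_refl ψ)]
    congr 1
    apply integral_congr_ae
    filter_upwards [huv] with x hx; simp [hx]

theorem IsGround.memHdot {V u : Plane → ℝ} (h : IsGround V u) : MemHdot u := by
  obtain ⟨φ, hφ, hg, h3, h4, hl⟩ := h.approx
  exact ⟨h.mem_four, φ, hφ, h4, hg⟩

theorem IsGround.finiteEnergy {V u : Plane → ℝ} (h : IsGround V u) : FiniteEnergy u :=
  h.memHdot.finiteEnergy

theorem exists_eLpNorm_bound {u : Plane → ℝ} {φ : ℕ → Plane → ℝ} {p : ℝ≥0∞} (hp : 1 ≤ p)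
    (hu : MemLp u p volume) (hφ : ∀ n, MemLp (φ n) p volume)
    (h : Tendsto (fun n => eLpNorm (φ n - u) p volume) atTop (𝓝 0)) :
    ∃ K : ℝ≥0, ∀ n, eLpNorm (φ n) p volume ≤ K := by
  have h0 : ∀ n, eLpNorm (φ n - u) p volume ≠ ⊤ := fun n => ((hφ n).sub hu).2.ne
  have h1 : Tendsto (fun n => (eLpNorm (φ n - u) p volume).toNNReal) atTop (𝓝 0) :=
    (ENNReal.tendsto_toNNReal ENNReal.zero_ne_top).comp h
  obtain ⟨B, hB⟩ := h1.bddAbove_range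
  refine ⟨B + (eLpNorm u p volume).toNNReal, fun n => ?_⟩
  have e2 := eLpNorm_add_le (p := p) ((hφ n).sub hu).1 hu.1 hp
  rw [sub_add_cancel] at e2
  refine e2.trans ?_
  push_cast
  rw [ENNReal.coe_toNNReal hu.2.ne, ← ENNReal.coe_toNNReal (h0 n)]
  gcongr
  exact hB ⟨n, rfl⟩

theorem IsGround.exists_isWeakLimit {V u : Plane → ℝ} (h : IsGround V u) :
    ∃ φ : ℕ → Plane → ℝ, (∀ n, IsTest (φ n)) ∧ IsWeakLimit φ u ∧
      Tendsto (fun n => gagliardo (φ n - u)) atTop (𝓝 0) := by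
  obtain ⟨φ, hφ, hg, h3, -, hl⟩ := h.approx
  exact ⟨φ, hφ, ⟨fun n => (hφ n).isLipc,
    exists_gagliardo_bound h.finiteEnergy (fun n => (hφ n).isLipc.finiteEnergy) hg,
    exists_eLpNorm_bound (by norm_num) h.mem_three (fun n => (hφ n).isLipc.memLp 3) h3, hl⟩, hg⟩

theorem IsGround.eq_lipc {V u f : Plane → ℝ} (h : IsGround V u) (hV : FiniteEnergy V)
    (hf : IsLipc f) : hdotInner u f + ∫ x, |u x| * u x * f x = hdotInner V f := by
  obtain ⟨φ, S, hS, -, hφ, hu, hφS, hg, -⟩ := hf.exists_test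
  have he := fun n => (hφ n).isLipc.finiteEnergy
  have h1 := (tendsto_hdotInner_of_gagliardo h.finiteEnergy he hf.finiteEnergy hg).add
    (tendsto_integral_mul_of_uniform (locallyIntegrable_abs_mul_self h.mem_four) hS hf hφ hφS hu)
  exact tendsto_nhds_unique h1 ((tendsto_hdotInner_of_gagliardo hV he hf.finiteEnergy hg).congr
    fun n => (h.eq _ (hφ n)).symm)

theorem IsGround.hdotInner_sub {V u f : Plane → ℝ} (h : IsGround V u) (hV : FiniteEnergy V)
    (hf : IsLipc f) : hdotInner (V - u) f = ∫ x, |u x| * u x * f x := by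
  rw [hdotInner_sub_left hf.finiteEnergy hV h.finiteEnergy, ← h.eq_lipc hV hf]
  ring

theorem IsGround.eq_isWeakLimit {V u v : Plane → ℝ} {ψ : ℕ → Plane → ℝ} (h : IsGround V u)
    (hV : FiniteEnergy V) (hψ : IsWeakLimit ψ v) :
    hdotInner u v + ∫ x, |u x| * u x * v x = hdotInner V v := by
  have h1 := hψ.hdotInner_eq (hV.sub h.finiteEnergy)
    (memLp_abs_mul_self (r := 3 / 2) h.mem_three) fun f hf => h.hdotInner_sub hV hf
  rw [hdotInner_sub_left hψ.finiteEnergy hV h.finiteEnergy] at h1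
  linarith

/-- By the equation |u|u is the half-Laplacian of V − u, so Cauchy–Schwarz provides the constant ‖V
− u‖. -/
theorem IsGround.memHdotNeg {V u : Plane → ℝ} (h : IsGround V u) (hV : FiniteEnergy V) :
    MemHdotNeg fun x => |u x| * u x := by
  have he := hV.sub h.finiteEnergy
  refine ⟨locallyIntegrable_abs_mul_self h.mem_four, (gagliardo (V - u)).toNNReal, fun φ hφ => ?_⟩
  rw [← h.hdotInner_sub hV hφ.isLipc, ENNReal.coe_toNNReal he.lt_top.ne,
    ← ENNReal.ofReal_toReal he.lt_top.ne,
    ← ENNReal.ofReal_toReal hφ.isLipc.finiteEnergy.lt_top.ne,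
    ← ENNReal.ofReal_mul ENNReal.toReal_nonneg]
  exact ENNReal.ofReal_le_ofReal (abs_hdotInner_le he hφ.isLipc.finiteEnergy)

theorem IsGround.pairing_eq {V u φ : Plane → ℝ} (h : IsGround V u) (hV : FiniteEnergy V)
    (hφ : MemHdot φ) : pairing (fun x => |u x| * u x) φ = hdotInner (V - u) φ := by
  obtain ⟨ψ, hψ, -, hg, -⟩ := hφ.exists_seq
  refine tendsto_nhds_unique (tendsto_pairing_seq (h.memHdotNeg hV) hφ hψ hg) ?_
  exact (tendsto_hdotInner_of_gagliardo (hV.sub h.finiteEnergy)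
    (fun n => (hψ n).isLipc.finiteEnergy) hφ.finiteEnergy hg).congr fun n =>
      h.hdotInner_sub hV (hψ n).isLipc

theorem IsGround.isWeakSolution {V u : Plane → ℝ} (h : IsGround V u) (hV : FiniteEnergy V) :
    IsWeakSolution V u := by
  refine ⟨h.memHdot, h.memHdotNeg hV, fun φ hφ => ?_⟩
  rw [h.pairing_eq hV hφ, hdotInner_sub_left hφ.finiteEnergy hV h.finiteEnergy]
  ring

/-! ### Duality and the Thomas–Fermi minimizer -/

theorem tendsto_gagliardo_sub {u v : Plane → ℝ} {φ ψ : ℕ → Plane → ℝ} (hu : FiniteEnergy u)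
    (hv : FiniteEnergy v) (hφ : ∀ n, FiniteEnergy (φ n)) (hψ : ∀ n, FiniteEnergy (ψ n))
    (h1 : Tendsto (fun n => gagliardo (φ n - u)) atTop (𝓝 0))
    (h2 : Tendsto (fun n => gagliardo (ψ n - v)) atTop (𝓝 0)) :
    Tendsto (fun n => gagliardo (φ n - ψ n - (u - v))) atTop (𝓝 0) := by
  have h3 := h1.add h2
  rw [add_zero] at h3
  refine tendsto_of_tendsto_of_tendsto_of_le_of_le tendsto_const_nhds h3 (fun n => zero_le)
    fun n => ?_
  refine gagliardo_le_add ((hφ n).sub hu).meas ((hψ n).sub hv).meas fun x y => ?_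
  refine le_trans (le_of_eq ?_) (abs_sub _ _)
  simp only [Pi.sub_apply]; congr 1; ring

theorem MemHdot.sub {u v : Plane → ℝ} (hu : MemHdot u) (hv : MemHdot v) : MemHdot (u - v) := by
  obtain ⟨φ, hφ, h4, hg, -⟩ := hu.exists_seq
  obtain ⟨ψ, hψ, h4', hg', -⟩ := hv.exists_seq
  refine ⟨hu.1.sub hv.1, fun n => φ n - ψ n, fun n => (hφ n).sub (hψ n), ?_,
    tendsto_gagliardo_sub hu.finiteEnergy hv.finiteEnergy (fun n => (hφ n).isLipc.finiteEnergy)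
      (fun n => (hψ n).isLipc.finiteEnergy) hg hg'⟩
  have h3 := h4.add h4'
  rw [add_zero] at h3
  refine tendsto_of_tendsto_of_tendsto_of_le_of_le tendsto_const_nhds h3 (fun n => zero_le)
    fun n => ?_
  have e := eLpNorm_sub_le (p := 4) (((hφ n).isLipc.memLp 4).sub hu.1).1
    (((hψ n).isLipc.memLp 4).sub hv.1).1 (by norm_num)
  refine le_trans (le_of_eq ?_) e
  congr 1
  simp only; abel

theorem pairing_sub {ρ u v : Plane → ℝ} (hρ : MemHdotNeg ρ) (hu : MemHdot u) (hv : MemHdot v) :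
    pairing ρ (u - v) = pairing ρ u - pairing ρ v := by
  obtain ⟨φ, hφ, h4, hg, -⟩ := hu.exists_seq
  obtain ⟨ψ, hψ, h4', hg', -⟩ := hv.exists_seq
  have hi : ∀ c : Plane → ℝ, IsTest c → Integrable (fun x => ρ x * c x) volume := by
    intro c hc
    simpa [smul_eq_mul, mul_comm] using
      hρ.1.integrable_smul_left_of_hasCompactSupport hc.1.continuous hc.2
  refine tendsto_nhds_unique (tendsto_pairing_seq hρ (hu.sub hv) (fun n => (hφ n).sub (hψ n))
    (tendsto_gagliardo_sub hu.finiteEnergy hv.finiteEnergy (fun n => (hφ n).isLipc.finiteEnergy)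
      (fun n => (hψ n).isLipc.finiteEnergy) hg hg')) ?_
  refine ((tendsto_pairing_seq hρ hu hφ hg).sub (tendsto_pairing_seq hρ hv hψ hg')).congr
    fun n => ?_
  rw [← integral_sub (hi _ (hφ n)) (hi _ (hψ n))]
  simp [mul_sub]

theorem hdotNegNorm_nonneg (ρ : Plane → ℝ) : 0 ≤ hdotNegNorm ρ :=
  Real.sSup_nonneg (by rintro _ ⟨φ, -, -, rfl⟩; exact abs_nonneg _)

theorem abs_integral_le_hdotNegNorm {ρ φ : Plane → ℝ} (hρ : MemHdotNeg ρ) (hφ : IsTest φ) :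
    |∫ x, ρ x * φ x| ≤ hdotNegNorm ρ * (gagliardo φ).toReal := by
  obtain ⟨-, K, hK⟩ := hρ
  have hgt := fun {ψ : Plane → ℝ} (h : IsTest ψ) => h.isLipc.finiteEnergy.lt_top.ne
  have hK' : ∀ ψ, IsTest ψ → |∫ x, ρ x * ψ x| ≤ K * (gagliardo ψ).toReal := by
    intro ψ hψ
    have h := hK ψ hψ
    rwa [← ENNReal.ofReal_toReal (hgt hψ), ← ENNReal.ofReal_coe_nnreal,
      ← ENNReal.ofReal_mul (NNReal.coe_nonneg K), ENNReal.ofReal_le_ofReal_iff (by positivity)] at h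
  set g := (gagliardo φ).toReal with hg
  have hg0 : 0 ≤ g := ENNReal.toReal_nonneg
  -- Rescaling to unit norm needs g ≠ 0; for g = 0 the constant K from membership in the dual space
  -- shows that the integral vanishes.
  rcases eq_or_lt_of_le hg0 with h0 | h0
  · have := hK' φ hφ
    rw [← hg, ← h0] at this
    rw [← h0]; simpa using this
  · have hgs : gagliardo (g⁻¹ • φ) ≤ 1 := by
      have e := hdotInner_self (hφ.smul g⁻¹).isLipc.finiteEnergy
      rw [hdotInner_smul_left, hdotInner_smul_right, hdotInner_self hφ.isLipc.finiteEnergy,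
        ← hg] at e
      have e2 : (gagliardo (g⁻¹ • φ)).toReal ^ 2 = 1 := by rw [← e]; field_simp
      have e3 : (gagliardo (g⁻¹ • φ)).toReal = 1 := by
        rwa [pow_eq_one_iff_of_nonneg ENNReal.toReal_nonneg two_ne_zero] at e2
      rw [← ENNReal.ofReal_toReal (hgt (hφ.smul g⁻¹)), e3]
      simp
    have hb : BddAbove {t : ℝ | ∃ φ : Plane → ℝ, IsTest φ ∧ gagliardo φ ≤ 1 ∧
        t = |∫ x, ρ x * φ x|} := by
      refine ⟨K, ?_⟩
      rintro _ ⟨ψ, hψ, h1, rfl⟩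
      refine (hK' ψ hψ).trans ?_
      have h2 : (gagliardo ψ).toReal ≤ 1 := ENNReal.toReal_le_of_le_ofReal zero_le_one (by simpa)
      exact mul_le_of_le_one_right K.2 h2
    have h1 := le_csSup hb ⟨g⁻¹ • φ, hφ.smul g⁻¹, hgs, rfl⟩
    have h2 : ∫ x, ρ x * (g⁻¹ • φ) x = g⁻¹ * ∫ x, ρ x * φ x := by
      rw [← integral_const_mul]
      congr 1; funext x; simp only [Pi.smul_apply, smul_eq_mul]; ring
    rw [h2, abs_mul, abs_of_pos (inv_pos.2 h0), inv_mul_le_iff₀ h0, mul_comm] at h1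
    exact h1

theorem abs_pairing_le {ρ v : Plane → ℝ} (hρ : MemHdotNeg ρ) (hv : MemHdot v) :
    |pairing ρ v| ≤ hdotNegNorm ρ * (gagliardo v).toReal := by
  obtain ⟨φ, hφ, -, hg, -⟩ := hv.exists_seq
  have h1 := (tendsto_pairing_seq hρ hv hφ hg).abs
  have h2 : Tendsto (fun n => hdotNegNorm ρ * ((gagliardo (φ n - v)).toReal +
      (gagliardo v).toReal)) atTop (𝓝 (hdotNegNorm ρ * (0 + (gagliardo v).toReal))) :=
    (((ENNReal.tendsto_toReal ENNReal.zero_ne_top).comp hg).add_const _).const_mul _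
  rw [zero_add] at h2
  refine le_of_tendsto_of_tendsto' h1 h2 fun n => ?_
  refine (abs_integral_le_hdotNegNorm hρ (hφ n)).trans ?_
  have he := (hφ n).isLipc.finiteEnergy
  have h3 : gagliardo (φ n) ≤ gagliardo (φ n - v) + gagliardo v := by
    refine gagliardo_le_add (he.sub hv.finiteEnergy).meas hv.finiteEnergy.meas fun x y => ?_
    refine le_trans (le_of_eq ?_) (abs_add_le _ _)
    simp only [Pi.sub_apply]; congr 1; ring
  have h4 := (he.sub hv.finiteEnergy).lt_top.ne
  have h5 := hv.finiteEnergy.lt_top.ne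
  refine mul_le_mul_of_nonneg_left ?_ (hdotNegNorm_nonneg ρ)
  rw [← ENNReal.toReal_add h4 h5]
  exact ENNReal.toReal_mono (ENNReal.add_ne_top.2 ⟨h4, h5⟩) h3

/-- With a = |s|^{1/2} and b = |u| one has ⅔a³ − a²b + ⅓b³ = ⅓(a − b)²(2a + b). Equality forces a =
b and equal signs. -/
theorem young_nonneg (s u : ℝ) : 0 ≤ 2 / 3 * |s| ^ (3 / 2 : ℝ) - s * u + 1 / 3 * |u| ^ 3 ∧
    (2 / 3 * |s| ^ (3 / 2 : ℝ) - s * u + 1 / 3 * |u| ^ 3 = 0 → s = |u| * u) := by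
  obtain ⟨a, ha0, ha⟩ : ∃ a, 0 ≤ a ∧ a ^ 2 = |s| :=
    ⟨Real.sqrt |s|, Real.sqrt_nonneg _, Real.sq_sqrt (abs_nonneg s)⟩
  have h1 : |s| ^ (3 / 2 : ℝ) = a ^ 3 := by
    rw [← ha, ← Real.rpow_natCast a 2, ← Real.rpow_mul ha0, ← Real.rpow_natCast]
    norm_num
  have hb := abs_nonneg u
  have h2 : s * u ≤ a ^ 2 * |u| := by rw [ha, ← abs_mul]; exact le_abs_self _
  have h3 : 2 / 3 * a ^ 3 - a ^ 2 * |u| + 1 / 3 * |u| ^ 3 =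
      (a - |u|) ^ 2 * (2 * a + |u|) / 3 := by ring
  have h4 : 0 ≤ (a - |u|) ^ 2 * (2 * a + |u|) / 3 := by positivity
  rw [h1]
  refine ⟨by linarith, fun h => ?_⟩
  have h5 : (a - |u|) ^ 2 * (2 * a + |u|) = 0 := by linarith
  have h6 : a = |u| := by
    rcases mul_eq_zero.1 h5 with h | h
    · linarith [pow_eq_zero_iff (two_ne_zero) |>.1 h]
    · linarith
  have h7 : s * u = a ^ 2 * |u| := by linarith
  rw [h6] at h7
  rcases eq_or_ne u 0 with h0 | h0
  · rw [h6, h0] at ha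
    have : s = 0 := by simpa using ha.symm
    rw [this, h0]; simp
  · have : s * u = (|u| * u) * u := by
      rw [h7, sq_abs]; ring
    exact mul_right_cancel₀ h0 this

/-- Write ⟨σ, V⟩ = ⟨σ, u⟩ + ⟨σ, V − u⟩. The first pairing is a genuine integral because the test
functions approximating u converge in L³ as well, so it can be grouped with the two powers into the
nonnegative Young integrand. -/
theorem IsGround.tfEnergy_eq {V u σ : Plane → ℝ} (h : IsGround V u) (hV : MemHdot V)
    (hσ : MemH0 σ) : tfEnergy V σ =
      (∫ x, (2 / 3 * |σ x| ^ (3 / 2 : ℝ) - σ x * u x + 1 / 3 * |u x| ^ 3)) -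
        1 / 3 * (∫ x, |u x| ^ 3) - pairing σ (V - u) + 1 / 2 * hdotNegNorm σ ^ 2 := by
  obtain ⟨φ, hφ, hw, hg⟩ := h.exists_isWeakLimit
  have h1 : pairing σ u = ∫ x, σ x * u x :=
    tendsto_nhds_unique (tendsto_pairing_seq hσ.2 h.memHdot hφ hg) (hw.tendsto_integral hσ.1)
  have i1 : Integrable (fun x => |σ x| ^ (3 / 2 : ℝ)) volume := by
    have := hσ.1.integrable_norm_rpow (by norm_num) (by norm_num [ENNReal.div_eq_top])
    simpa [ENNReal.toReal_div] using this
  have i2 : Integrable (fun x => σ x * u x) volume := hσ.1.integrable_mul h.mem_three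
  have i3 : Integrable (fun x => |u x| ^ 3) volume :=
    integrable_abs_pow (by norm_num) (by exact_mod_cast h.mem_three)
  have i4 : Integrable (fun x => 2 / 3 * |σ x| ^ (3 / 2 : ℝ) - σ x * u x) volume :=
    (i1.const_mul _).sub i2
  rw [integral_add i4 (i3.const_mul _), integral_sub (i1.const_mul _) i2, integral_const_mul,
    integral_const_mul, pairing_sub hσ.2 hV h.memHdot, h1, tfEnergy]
  ring

theorem IsGround.memH0 {V u : Plane → ℝ} (h : IsGround V u) (hV : MemHdot V) :
    MemH0 fun x => |u x| * u x :=
  ⟨memLp_abs_mul_self h.mem_three, h.memHdotNeg hV.finiteEnergy⟩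

/-- The terms ½‖σ‖² − ⟨σ, V − u⟩ are at least −½‖V − u‖². Keeping the Young integral in the lower
bound is what later yields uniqueness. -/
theorem IsGround.le_tfEnergy {V u σ : Plane → ℝ} (h : IsGround V u) (hV : MemHdot V)
    (hσ : MemH0 σ) :
    (∫ x, (2 / 3 * |σ x| ^ (3 / 2 : ℝ) - σ x * u x + 1 / 3 * |u x| ^ 3)) -
        1 / 3 * (∫ x, |u x| ^ 3) - 1 / 2 * (gagliardo (V - u)).toReal ^ 2 ≤ tfEnergy V σ := by
  rw [h.tfEnergy_eq hV hσ]
  have h1 := le_of_abs_le (abs_pairing_le hσ.2 (hV.sub h.memHdot))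
  nlinarith [sq_nonneg (hdotNegNorm σ - (gagliardo (V - u)).toReal)]

/-- There is no duality gap: the Young integrand vanishes identically, the pairing with V − u equals
‖V − u‖², and the dual norm of |u|u is at most ‖V − u‖. -/
theorem IsGround.tfEnergy_self_le {V u : Plane → ℝ} (h : IsGround V u) (hV : MemHdot V) :
    tfEnergy V (fun x => |u x| * u x) ≤
      -(1 / 3 * (∫ x, |u x| ^ 3)) - 1 / 2 * (gagliardo (V - u)).toReal ^ 2 := by
  rw [h.tfEnergy_eq hV (h.memH0 hV)]
  have hVe := hV.finiteEnergy
  have he := hVe.sub h.finiteEnergy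
  have h0 : ∀ x, 2 / 3 * |(|u x| * u x)| ^ (3 / 2 : ℝ) - |u x| * u x * u x + 1 / 3 * |u x| ^ 3 =
      0 := by
    intro x
    have e : |u x| * u x * u x = |u x| ^ 3 := by
      rw [mul_assoc, ← abs_mul_abs_self (u x)]; ring
    rw [e, abs_mul, abs_abs, ← sq, ← Real.rpow_natCast |u x| 2, ← Real.rpow_mul (abs_nonneg _)]
    norm_num
    ring
  have h1 : hdotNegNorm (fun x => |u x| * u x) ≤ (gagliardo (V - u)).toReal := by
    refine Real.sSup_le ?_ ENNReal.toReal_nonneg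
    rintro _ ⟨φ, hφ, hg, rfl⟩
    rw [← h.hdotInner_sub hVe hφ.isLipc]
    refine (abs_hdotInner_le he hφ.isLipc.finiteEnergy).trans ?_
    have h2 : (gagliardo φ).toReal ≤ 1 := ENNReal.toReal_le_of_le_ofReal zero_le_one (by simpa)
    exact mul_le_of_le_one_right ENNReal.toReal_nonneg h2
  simp only [h0, integral_zero]
  rw [h.pairing_eq hVe (hV.sub h.memHdot), hdotInner_self he]
  nlinarith [hdotNegNorm_nonneg fun x => |u x| * u x]

theorem integral_young_nonneg (u σ : Plane → ℝ) :
    0 ≤ ∫ x, (2 / 3 * |σ x| ^ (3 / 2 : ℝ) - σ x * u x + 1 / 3 * |u x| ^ 3) :=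
  integral_nonneg fun x => (young_nonneg (σ x) (u x)).1

theorem IsGround.isTFMinimizer {V u : Plane → ℝ} (h : IsGround V u) (hV : MemHdot V) :
    IsTFMinimizer V fun x => |u x| * u x := by
  refine ⟨h.memH0 hV, fun σ hσ => (h.tfEnergy_self_le hV).trans ?_⟩
  refine le_trans ?_ (h.le_tfEnergy hV hσ)
  linarith [integral_young_nonneg u σ]

/-- A second minimizer makes the Young integral vanish, and the equality case determines it
pointwise. -/
theorem IsGround.tfMinimizer_unique {V u σ : Plane → ℝ} (h : IsGround V u) (hV : MemHdot V)
    (hσ : IsTFMinimizer V σ) : σ =ᵐ[volume] fun x => |u x| * u x := by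
  have h1 := (h.le_tfEnergy hV hσ.1).trans ((hσ.2 _ (h.memH0 hV)).trans (h.tfEnergy_self_le hV))
  have h2 : ∫ x, (2 / 3 * |σ x| ^ (3 / 2 : ℝ) - σ x * u x + 1 / 3 * |u x| ^ 3) = 0 :=
    le_antisymm (by linarith) (integral_young_nonneg u σ)
  have i1 : Integrable (fun x => |σ x| ^ (3 / 2 : ℝ)) volume := by
    have := hσ.1.1.integrable_norm_rpow (by norm_num) (by norm_num [ENNReal.div_eq_top])
    simpa [ENNReal.toReal_div] using this
  have i2 : Integrable (fun x => σ x * u x) volume := hσ.1.1.integrable_mul h.mem_three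
  have i3 : Integrable (fun x => |u x| ^ 3) volume :=
    integrable_abs_pow (by norm_num) (by exact_mod_cast h.mem_three)
  have h3 := (integral_eq_zero_iff_of_nonneg (fun x => (young_nonneg (σ x) (u x)).1)
    (((i1.const_mul _).sub i2).add (i3.const_mul _))).1 h2
  filter_upwards [h3] with x hx using (young_nonneg (σ x) (u x)).2 hx

/-! ### Uniqueness of the weak solution -/

/-- The truncation of `a` to the interval `[-|b|, |b|]`. -/
def clamp (a b : ℝ) : ℝ := max (-|b|) (min a |b|)

theorem abs_clamp_sub_clamp_le (a b a' b' : ℝ) :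
    |clamp a b - clamp a' b'| ≤ |a - a'| + |b - b'| := by
  have h1 : |(-|b|) - (-|b'|)| ≤ |b - b'| := by
    rw [neg_sub_neg, abs_sub_comm]; exact abs_abs_sub_abs_le _ _
  have h2 := (abs_min_sub_min_le_max a |b| a' |b'|).trans
    (max_le_max_left _ (abs_abs_sub_abs_le b b'))
  refine (abs_max_sub_max_le_max _ _ _ _).trans (max_le ?_ (h2.trans (max_le ?_ ?_)))
  · linarith [abs_nonneg (a - a')]
  · linarith [abs_nonneg (b - b')]
  · linarith [abs_nonneg (a - a')]

theorem abs_clamp_le (a b : ℝ) : |clamp a b| ≤ |b| := by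
  rw [clamp, abs_le]
  exact ⟨le_max_left _ _, max_le (by linarith [abs_nonneg b]) (min_le_right _ _)⟩

theorem clamp_self (a : ℝ) : clamp a a = a := by
  rw [clamp, min_eq_left (le_abs_self a), max_eq_right (neg_abs_le a)]

theorem mul_clamp_nonneg {a b F : ℝ} (h1 : 0 ≤ a → 0 ≤ F) (h2 : a ≤ 0 → F ≤ 0) :
    0 ≤ F * clamp a b := by
  rcases le_total 0 a with h | h
  · refine mul_nonneg (h1 h) ?_
    exact le_max_of_le_right (le_min h (abs_nonneg b))
  · refine mul_nonneg_of_nonpos_of_nonpos (h2 h) ?_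
    exact max_le (by linarith [abs_nonneg b]) (min_le_of_left_le h)

theorem abs_mul_self_mono {a b : ℝ} (h : a ≤ b) : |a| * a ≤ |b| * b := by
  rcases le_total 0 a with ha | ha <;> rcases le_total 0 b with hb | hb
  · rw [abs_of_nonneg ha, abs_of_nonneg hb]; nlinarith
  · rw [abs_of_nonneg ha, abs_of_nonpos hb]; nlinarith
  · rw [abs_of_nonpos ha, abs_of_nonneg hb]; nlinarith
  · rw [abs_of_nonpos ha, abs_of_nonpos hb]; nlinarith

/-- Formally the difference v = u − w satisfies ‖v‖² = −∫Fv ≤ 0 by monotonicity of t ↦ |t|t. Here F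
is only in L² and v only in L⁴, so v is replaced by its truncation to [−|χ|, |χ|] with χ a test
function: this keeps the sign of v and is square integrable. -/
theorem IsGround.weakSolution_unique {V u w : Plane → ℝ} (h : IsGround V u) (hV : MemHdot V)
    (hw : IsWeakSolution V w) : w =ᵐ[volume] u := by
  obtain ⟨hwH, hwN, hweq⟩ := hw
  have hve := h.finiteEnergy.sub hwH.finiteEnergy
  have hvH := h.memHdot.sub hwH
  set v := u - w with hv
  set F : Plane → ℝ := fun x => |u x| * u x - |w x| * w x with hF
  have hF2 : MemLp F 2 volume :=
    (memLp_abs_mul_self h.mem_four).sub (memLp_abs_mul_self hwH.1)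
  have heq : ∀ f, IsLipc f → hdotInner v f = -∫ x, F x * f x := by
    intro f hf
    have h1 := h.eq_lipc hV.finiteEnergy hf
    have h2 := hweq f hf.memHdot
    rw [pairing_lipc hwN hf] at h2
    have i1 : Integrable (fun x => |u x| * u x * f x) volume :=
      (memLp_abs_mul_self (r := 2) h.mem_four).integrable_mul (hf.memLp 2)
    have i2 : Integrable (fun x => |w x| * w x * f x) volume :=
      (memLp_abs_mul_self (r := 2) hwH.1).integrable_mul (hf.memLp 2)
    simp only [hF, sub_mul]
    rw [integral_sub i1 i2, hv, hdotInner_sub_left hf.finiteEnergy h.finiteEnergy hwH.finiteEnergy]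
    linarith
  obtain ⟨χ, hχ, -, hχg, hχl⟩ := hvH.exists_seq
  obtain ⟨K, hK⟩ := exists_gagliardo_bound hve (fun n => (hχ n).isLipc.finiteEnergy) hχg
  have hpos : ∀ x b, 0 ≤ F x * clamp (v x) b := by
    intro x b
    apply mul_clamp_nonneg
    · intro h0
      have : w x ≤ u x := by simpa [hv] using h0
      simpa [hF] using abs_mul_self_mono this
    · intro h0
      have : u x ≤ w x := by simpa [hv] using h0
      simpa [hF] using abs_mul_self_mono this
  -- The truncation of v by χ n need not be Lipschitz; it is the limit, as m → ∞, of truncations of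
  -- the test functions χ m, all dominated by |χ n|.
  have hstep : ∀ n, hdotInner v (fun x => clamp (v x) (χ n x)) ≤ 0 := by
    intro n
    have hL : ∀ m, IsLipc fun x => clamp (χ m x) (χ n x) := fun m =>
      (hχ m).isLipc.comp₂ abs_clamp_sub_clamp_le (by simp [clamp]) (hχ n).isLipc
    have hl : ∀ᵐ x, Tendsto (fun m => clamp (χ m x) (χ n x)) atTop
        (𝓝 (clamp (v x) (χ n x))) := by
      filter_upwards [hχl] with x hx
        using tendsto_comp₂ abs_clamp_sub_clamp_le hx tendsto_const_nhds
    have h1 := tendsto_hdotInner (K := K + K) hve (fun m => (hL m).finiteEnergy.meas)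
      (fun m => by
        push_cast
        exact (gagliardo_le_add (hχ m).isLipc.finiteEnergy.meas (hχ n).isLipc.finiteEnergy.meas
          fun x y => abs_clamp_sub_clamp_le _ _ _ _).trans (add_le_add (hK m) (hK n))) hl
    have h2 := tendsto_integral_mul_two (K := (eLpNorm (χ n) 2 volume).toNNReal) hF2
      (fun m => (hL m).finiteEnergy.meas) (fun m => by
        rw [ENNReal.coe_toNNReal ((hχ n).isLipc.memLp 2).2.ne]
        exact eLpNorm_mono fun x => abs_clamp_le _ _) hl
    have h3 := tendsto_nhds_unique h1 (h2.neg.congr fun m => (heq _ (hL m)).symm)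
    rw [h3, neg_nonpos]
    exact integral_nonneg fun x => hpos x _
  -- Removing the truncation: as χ n → v almost everywhere, the truncated functions tend to v with
  -- bounded energy, and weak convergence preserves the inequality.
  have hfin : hdotInner v v ≤ 0 := by
    have h1 := tendsto_hdotInner (u := fun n x => clamp (v x) (χ n x)) (v := v)
      (K := (gagliardo v).toNNReal + K) hve (fun n => by
        have hb : Continuous fun p : ℝ × ℝ => clamp p.1 p.2 := by unfold clamp; fun_prop
        exact hb.comp_aestronglyMeasurable (hve.meas.prodMk (hχ n).isLipc.finiteEnergy.meas))
      (fun n => by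
        push_cast
        rw [ENNReal.coe_toNNReal hve.lt_top.ne]
        exact (gagliardo_le_add hve.meas (hχ n).isLipc.finiteEnergy.meas
          fun x y => abs_clamp_sub_clamp_le _ _ _ _).trans (by gcongr; exact hK n))
      (by
        filter_upwards [hχl] with x hx
        have := tendsto_comp₂ abs_clamp_sub_clamp_le (tendsto_const_nhds (x := v x)) hx
        rwa [clamp_self] at this)
    exact le_of_tendsto' h1 hstep
  filter_upwards [ae_eq_zero_of_hdotInner_self hve hvH.1 hfin] with x hx
  simp only [hv, Pi.sub_apply, Pi.zero_apply] at hx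
  linarith

/-! ### Comparison with zero and with the potential -/

theorem incr_mul_negPart_le (a b : ℝ) :
    (a - b) * (max (-a) 0 - max (-b) 0) ≤ -((max (-a) 0 - max (-b) 0) * (max (-a) 0 - max (-b) 0)) := by
  rcases le_total (-a) 0 with ha | ha <;> rcases le_total (-b) 0 with hb | hb <;>
    simp only [max_eq_right, max_eq_left, ha, hb] <;> nlinarith

theorem hdotInner_negPart_le {w : Plane → ℝ} (hw : FiniteEnergy w)
    (hn : FiniteEnergy fun x => max (-w x) 0) :
    hdotInner w (fun x => max (-w x) 0) ≤
      -hdotInner (fun x => max (-w x) 0) (fun x => max (-w x) 0) := by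
  rw [hdotInner_eq, hdotInner_eq, ← integral_neg]
  exact integral_mono (hw.integrable hn) (hn.integrable hn).neg fun p =>
    incr_mul_negPart_le (w p.1) (w p.2)

/-- Test with the negative part u⁻: the left side of the equation is at most −‖u⁻‖², the right side
is nonnegative. -/
theorem IsGround.nonneg {V u : Plane → ℝ} (h : IsGround V u) (hV : MemHdot V)
    (hVn : HalfLapNonneg V) : ∀ᵐ x, 0 ≤ u x := by
  obtain ⟨φ, hφ, hw, -⟩ := h.exists_isWeakLimit
  have hψ := hw.comp₂ (F := fun a _ => max (-a) 0) (fun a b a' b' => by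
    refine (abs_max_sub_max_le_add _ _ _ _).trans ?_
    rw [neg_sub_neg, sub_self, abs_zero, abs_sub_comm a' a]
    linarith [abs_nonneg (b - b')]) (by simp) hw
  have h1 := h.eq_isWeakLimit hV.finiteEnergy hψ
  have h2 : 0 ≤ hdotInner V fun x => max (-u x) 0 :=
    ge_of_tendsto' (hψ.tendsto_hdotInner hV.finiteEnergy) fun n =>
      hVn.lipc hV.finiteEnergy (hψ.lipc n) fun x => le_max_right _ _
  have h3 := hdotInner_negPart_le h.finiteEnergy hψ.finiteEnergy
  have h4 : ∫ x, |u x| * u x * max (-u x) 0 ≤ 0 := integral_nonpos fun x => by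
    rcases le_total 0 (u x) with h0 | h0
    · simp [max_eq_right (neg_nonpos.2 h0)]
    · have : 0 ≤ max (-u x) 0 := le_max_right _ _
      have h5 : |u x| * u x ≤ 0 := mul_nonpos_of_nonneg_of_nonpos (abs_nonneg _) h0
      exact mul_nonpos_of_nonpos_of_nonneg h5 this
  filter_upwards [ae_eq_zero_of_hdotInner_self hψ.finiteEnergy hψ.memLp_four (by linarith)]
    with x hx
  have : max (-u x) 0 = 0 := hx
  linarith [le_max_left (-u x) 0]

/-- Since u ≥ 0, the half-Laplacian of V − u is nonnegative; test with (V − u)⁻. As V is not assumed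
to lie in L³, the sign is used on each Lipschitz approximant, and only the energy bound survives in
the limit. -/
theorem IsGround.le {V u : Plane → ℝ} (h : IsGround V u) (hV : MemHdot V)
    (hu : ∀ᵐ x, 0 ≤ u x) : ∀ᵐ x, u x ≤ V x := by
  have hd := hV.sub h.memHdot
  obtain ⟨χ, hχ, -, hχg, hχl⟩ := hd.exists_seq
  set w := V - u with hw
  have hF : ∀ a b a' b' : ℝ, |max (-a) 0 - max (-a') 0| ≤ |a - a'| + |b - b'| := by
    intro a b a' b'
    refine (abs_max_sub_max_le_add _ _ _ _).trans ?_
    rw [neg_sub_neg, sub_self, abs_zero, abs_sub_comm a' a]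
    linarith [abs_nonneg (b - b')]
  have hL : ∀ n, IsLipc fun x => max (-χ n x) 0 := fun n =>
    (hχ n).isLipc.comp₂ (F := fun a _ => max (-a) 0) hF (by simp) (hχ n).isLipc
  obtain ⟨K, hK⟩ := exists_gagliardo_bound hd.finiteEnergy
    (fun n => (hχ n).isLipc.finiteEnergy) hχg
  have hgb : ∀ n, gagliardo (fun x => max (-χ n x) 0) ≤ K := fun n =>
    (gagliardo_mono fun x y => by simpa using hF (χ n x) 0 (χ n y) 0).trans (hK n)
  have hl : ∀ᵐ x, Tendsto (fun n => max (-χ n x) 0) atTop (𝓝 (max (-w x) 0)) := by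
    filter_upwards [hχl] with x hx using (hx.neg).max tendsto_const_nhds
  have hne := finiteEnergy_of_tendsto (fun n => (hL n).finiteEnergy.meas) hgb hl
  have h4 := memLp_four_of_tendsto hL hgb hl
  have h1 : 0 ≤ hdotInner w fun x => max (-w x) 0 := by
    refine ge_of_tendsto' (tendsto_hdotInner hd.finiteEnergy
      (fun n => (hL n).finiteEnergy.meas) hgb hl) fun n => ?_
    rw [h.hdotInner_sub hV.finiteEnergy (hL n)]
    refine integral_nonneg_of_ae ?_
    filter_upwards [hu] with x hx
    exact mul_nonneg (mul_nonneg (abs_nonneg _) hx) (le_max_right _ _)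
  have h2 := hdotInner_negPart_le hd.finiteEnergy hne
  filter_upwards [ae_eq_zero_of_hdotInner_self hne h4 (by linarith)] with x hx
  have h3 : max (-w x) 0 = 0 := hx
  have h5 := le_max_left (-w x) 0
  rw [h3] at h5
  simp only [hw, Pi.sub_apply] at h5
  linarith

/-! ### Regularized Coulomb and Poisson kernels -/

/-- The regularized Coulomb kernel `(|x - c|² + s²)^{-1/2}`. -/
def coulomb (s : ℝ) (c x : Plane) : ℝ := (Real.sqrt (‖x - c‖ ^ 2 + s ^ 2))⁻¹

/-- The kernel `s (|x - c|² + s²)^{-3/2}`, which is `2π` times the Poisson kernel. -/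
def poisson (s : ℝ) (c x : Plane) : ℝ := s * (Real.sqrt (‖x - c‖ ^ 2 + s ^ 2) ^ 3)⁻¹

theorem sqrt_reg_pos {s : ℝ} (hs : 0 < s) (c x : Plane) :
    0 < Real.sqrt (‖x - c‖ ^ 2 + s ^ 2) := Real.sqrt_pos.2 (by positivity)

theorem le_sqrt_reg (s : ℝ) (c x : Plane) :
    s ≤ Real.sqrt (‖x - c‖ ^ 2 + s ^ 2) := Real.le_sqrt_of_sq_le (by nlinarith [norm_nonneg (x - c)])

theorem continuous_coulomb {s : ℝ} (hs : 0 < s) (c : Plane) : Continuous (coulomb s c) := by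
  unfold coulomb
  exact Continuous.inv₀ (by fun_prop) fun x => (sqrt_reg_pos hs c x).ne'

theorem continuous_poisson {s : ℝ} (hs : 0 < s) (c : Plane) : Continuous (poisson s c) := by
  unfold poisson
  exact continuous_const.mul (Continuous.inv₀ (by fun_prop) fun x =>
    (pow_pos (sqrt_reg_pos hs c x) 3).ne')

theorem coulomb_pos {s : ℝ} (hs : 0 < s) (c x : Plane) : 0 < coulomb s c x :=
  inv_pos.2 (sqrt_reg_pos hs c x)

theorem poisson_pos {s : ℝ} (hs : 0 < s) (c x : Plane) : 0 < poisson s c x :=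
  mul_pos hs (inv_pos.2 (pow_pos (sqrt_reg_pos hs c x) 3))

theorem poisson_eq_coulomb (s : ℝ) (c x : Plane) : poisson s c x = s * coulomb s c x ^ 3 := by
  rw [poisson, coulomb, inv_pow]

theorem coulomb_le {s : ℝ} (hs : 0 < s) (c x : Plane) : coulomb s c x ≤ s⁻¹ :=
  inv_anti₀ hs (le_sqrt_reg s c x)

theorem poisson_comm (s : ℝ) (c x : Plane) : poisson s c x = poisson s x c := by
  rw [poisson, poisson, norm_sub_rev]

/-- Polar coordinates and the fundamental theorem of calculus, G being a primitive of r f(r);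
nonnegativity gives integrability for free. -/
theorem integral_radial {f G : ℝ → ℝ} {l : ℝ} (hG : ∀ r ∈ Set.Ici (0 : ℝ), HasDerivAt G (r * f r) r)
    (hf : ∀ r ∈ Set.Ioi (0 : ℝ), 0 ≤ r * f r) (hl : Tendsto G atTop (𝓝 l)) (c : Plane) :
    Integrable (fun x : Plane => f ‖x - c‖) volume ∧
      ∫ x : Plane, f ‖x - c‖ = 2 * Real.pi * (l - G 0) := by
  have hv : (volume : Measure Plane).real (Metric.ball 0 1) = Real.pi := by
    rw [Measure.real, EuclideanSpace.volume_ball_fin_two]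
    simp [Real.pi_pos.le]
  constructor
  · have : Integrable (fun x : Plane => f ‖x‖) volume := by
      rw [integrable_fun_norm_addHaar]
      simpa [finrank_euclideanSpace] using integrableOn_Ioi_deriv_of_nonneg' hG hf hl
    exact this.comp_sub_right c
  · rw [integral_sub_right_eq_self (fun x : Plane => f ‖x‖) c, integral_fun_norm_addHaar, hv]
    have := integral_Ioi_of_hasDerivAt_of_nonneg' hG hf hl
    simp only [finrank_euclideanSpace, Fintype.card_fin, smul_eq_mul, nsmul_eq_mul]
    norm_num
    rw [this]
    ring

theorem integral_poisson {s : ℝ} (hs : 0 < s) (c : Plane) :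
    Integrable (poisson s c) volume ∧ ∫ x, poisson s c x = 2 * Real.pi := by
  have hpos : ∀ r : ℝ, 0 < r ^ 2 + s ^ 2 := fun r => by positivity
  have hlim : Tendsto (fun r : ℝ => -(s * (Real.sqrt (r ^ 2 + s ^ 2))⁻¹)) atTop (𝓝 0) := by
    have h1 : Tendsto (fun r : ℝ => Real.sqrt (r ^ 2 + s ^ 2)) atTop atTop := by
      refine tendsto_atTop_mono (fun r => ?_) tendsto_id
      exact Real.le_sqrt_of_sq_le (by simp only [id]; nlinarith)
    have := (h1.inv_tendsto_atTop.const_mul s).neg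
    simpa using this
  have h := integral_radial (f := fun r => s * (Real.sqrt (r ^ 2 + s ^ 2) ^ 3)⁻¹)
    (G := fun r => -(s * (Real.sqrt (r ^ 2 + s ^ 2))⁻¹)) (l := 0) (fun r _ => by
      have h1 : HasDerivAt (fun r : ℝ => r ^ 2 + s ^ 2) (2 * r) r := by
        simpa using (hasDerivAt_pow 2 r).add_const (s ^ 2)
      have h2 := ((h1.sqrt (hpos r).ne').inv (Real.sqrt_pos.2 (hpos r)).ne').const_mul s
      refine h2.neg.congr_deriv ?_
      have h3 := (Real.sqrt_pos.2 (hpos r)).ne'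
      field_simp) (fun r hr => by have : 0 < r := hr; positivity) hlim c
  refine ⟨h.1, h.2.trans ?_⟩
  simp only [ne_eq, OfNat.ofNat_ne_zero, not_false_eq_true, zero_pow, zero_add, Real.sqrt_sq hs.le]
  field_simp
  ring

theorem integral_inv_sq_quadratic {α β : ℝ} (hα : 0 < α) (hβ : 0 < β) (c : Plane) :
    Integrable (fun x : Plane => ((α * ‖x - c‖ ^ 2 + β) ^ 2)⁻¹) volume ∧
      ∫ x : Plane, ((α * ‖x - c‖ ^ 2 + β) ^ 2)⁻¹ = Real.pi / (α * β) := by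
  have hpos : ∀ r : ℝ, 0 < α * r ^ 2 + β := fun r => by positivity
  have hlim : Tendsto (fun r : ℝ => -((2 * α)⁻¹ * (α * r ^ 2 + β)⁻¹)) atTop (𝓝 0) := by
    have h1 : Tendsto (fun r : ℝ => α * r ^ 2 + β) atTop atTop :=
      tendsto_atTop_add_const_right _ _ ((tendsto_pow_atTop two_ne_zero).const_mul_atTop hα)
    have := (h1.inv_tendsto_atTop.const_mul (2 * α)⁻¹).neg
    simpa using this
  have h := integral_radial (f := fun r => ((α * r ^ 2 + β) ^ 2)⁻¹)
    (G := fun r => -((2 * α)⁻¹ * (α * r ^ 2 + β)⁻¹)) (l := 0) (fun r _ => by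
      have h1 : HasDerivAt (fun r : ℝ => α * r ^ 2 + β) (α * (2 * r)) r := by
        simpa using ((hasDerivAt_pow 2 r).const_mul α).add_const β
      have h2 := (h1.inv (hpos r).ne').const_mul (2 * α)⁻¹
      refine h2.neg.congr_deriv ?_
      have h3 := (hpos r).ne'
      field_simp) (fun r hr => by have : 0 < r := hr; positivity) hlim c
  refine ⟨h.1, h.2.trans ?_⟩
  simp only [ne_eq, OfNat.ofNat_ne_zero, not_false_eq_true, zero_pow, mul_zero, zero_add]
  field_simp
  ring

/-- A Feynman parametrization: it writes 1/(a³b), the shape of a Poisson kernel times a Coulomb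
kernel, as an integral of inverse squares of a²+v²b², which is quadratic in position. -/
theorem integral_Ioi_feynman {a b : ℝ} (ha : 0 < a) (hb : 0 < b) :
    IntegrableOn (fun v : ℝ => ((a ^ 2 + v ^ 2 * b ^ 2) ^ 2)⁻¹) (Set.Ioi 0) ∧
      ∫ v in Set.Ioi (0 : ℝ), ((a ^ 2 + v ^ 2 * b ^ 2) ^ 2)⁻¹ = Real.pi / (4 * a ^ 3 * b) := by
  have hpos : ∀ v : ℝ, 0 < a ^ 2 + v ^ 2 * b ^ 2 := fun v => by positivity
  set G : ℝ → ℝ := fun v => (2 * a ^ 2)⁻¹ * (v * (a ^ 2 + v ^ 2 * b ^ 2)⁻¹) +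
    (2 * a ^ 3 * b)⁻¹ * Real.arctan (b / a * v) with hG
  have hd : ∀ v ∈ Set.Ici (0 : ℝ), HasDerivAt G (((a ^ 2 + v ^ 2 * b ^ 2) ^ 2)⁻¹) v := by
    intro v _
    have h1 : HasDerivAt (fun v : ℝ => a ^ 2 + v ^ 2 * b ^ 2) (2 * v * b ^ 2) v := by
      simpa using ((hasDerivAt_pow 2 v).mul_const (b ^ 2)).const_add (a ^ 2)
    have h2 := ((hasDerivAt_id v).mul (h1.inv (hpos v).ne')).const_mul (2 * a ^ 2)⁻¹
    have h3 := (((hasDerivAt_id v).const_mul (b / a)).arctan).const_mul (2 * a ^ 3 * b)⁻¹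
    refine (h2.add h3).congr_deriv ?_
    have h4 := (hpos v).ne'
    simp only [id, mul_one, Pi.inv_apply]
    have h5 : (1 + (b / a * v) ^ 2) = (a ^ 2 + v ^ 2 * b ^ 2) / a ^ 2 := by field_simp
    rw [h5]
    field_simp
    ring
  have hl : Tendsto G atTop (𝓝 ((2 * a ^ 2)⁻¹ * 0 + (2 * a ^ 3 * b)⁻¹ * (Real.pi / 2))) := by
    refine Tendsto.add (Tendsto.const_mul _ ?_) (Tendsto.const_mul _ ?_)
    · have h1 : Tendsto (fun v : ℝ => (b ^ 2)⁻¹ * v⁻¹) atTop (𝓝 0) := by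
        simpa using tendsto_inv_atTop_zero.const_mul (b ^ 2)⁻¹
      refine tendsto_of_tendsto_of_tendsto_of_le_of_le' tendsto_const_nhds h1 ?_ ?_
      · filter_upwards [eventually_gt_atTop 0] with v hv; positivity
      · filter_upwards [eventually_gt_atTop 0] with v hv
        rw [← div_eq_mul_inv, div_le_iff₀ (hpos v)]
        field_simp
        nlinarith [sq_nonneg a]
    · exact (tendsto_nhds_of_tendsto_nhdsWithin Real.tendsto_arctan_atTop).comp
        (tendsto_id.const_mul_atTop (div_pos hb ha))
  have hn : ∀ v ∈ Set.Ioi (0 : ℝ), 0 ≤ ((a ^ 2 + v ^ 2 * b ^ 2) ^ 2)⁻¹ := fun v _ => by positivity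
  refine ⟨integrableOn_Ioi_deriv_of_nonneg' hd hn hl, ?_⟩
  rw [integral_Ioi_of_hasDerivAt_of_nonneg' hd hn hl]
  simp only [hG, mul_zero, zero_mul, Real.arctan_zero, zero_add, sub_zero]
  field_simp
  norm_num

/-- Partial fractions, for which p and q must be distinct. -/
theorem integral_Ioi_quartic {p q : ℝ} (hq : 0 < q) (hpq : q < p) :
    IntegrableOn (fun v : ℝ => ((v ^ 2 + p ^ 2) * (v ^ 2 + q ^ 2))⁻¹) (Set.Ioi 0) ∧
      ∫ v in Set.Ioi (0 : ℝ), ((v ^ 2 + p ^ 2) * (v ^ 2 + q ^ 2))⁻¹ =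
        Real.pi / (2 * p * q * (p + q)) := by
  have hp : 0 < p := hq.trans hpq
  set G : ℝ → ℝ := fun v => (p ^ 2 - q ^ 2)⁻¹ * (q⁻¹ * Real.arctan (q⁻¹ * v) -
    p⁻¹ * Real.arctan (p⁻¹ * v)) with hG
  have hne : p ^ 2 - q ^ 2 ≠ 0 := by nlinarith
  have hat : ∀ p : ℝ, 0 < p → ∀ v, HasDerivAt (fun v => p⁻¹ * Real.arctan (p⁻¹ * v))
      (v ^ 2 + p ^ 2)⁻¹ v := by
    intro p hp v
    have h3 := (((hasDerivAt_id v).const_mul p⁻¹).arctan).const_mul p⁻¹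
    refine h3.congr_deriv ?_
    simp only [id, mul_one]
    have h5 : (1 + (p⁻¹ * v) ^ 2) = (v ^ 2 + p ^ 2) / p ^ 2 := by field_simp; ring
    rw [h5]
    field_simp
  have hd : ∀ v ∈ Set.Ici (0 : ℝ), HasDerivAt G (((v ^ 2 + p ^ 2) * (v ^ 2 + q ^ 2))⁻¹) v := by
    intro v _
    refine (((hat q hq v).sub (hat p hp v)).const_mul (p ^ 2 - q ^ 2)⁻¹).congr_deriv ?_
    have h1 : v ^ 2 + p ^ 2 ≠ 0 := by positivity
    have h2 : v ^ 2 + q ^ 2 ≠ 0 := by positivity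
    field_simp
    ring
  have hl : Tendsto G atTop (𝓝 ((p ^ 2 - q ^ 2)⁻¹ * (q⁻¹ * (Real.pi / 2) - p⁻¹ * (Real.pi / 2)))) := by
    have ht : ∀ p : ℝ, 0 < p → Tendsto (fun v => p⁻¹ * Real.arctan (p⁻¹ * v)) atTop
        (𝓝 (p⁻¹ * (Real.pi / 2))) := fun p hp =>
      ((tendsto_nhds_of_tendsto_nhdsWithin Real.tendsto_arctan_atTop).comp
        (tendsto_id.const_mul_atTop (inv_pos.2 hp))).const_mul _
    exact ((ht q hq).sub (ht p hp)).const_mul _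
  have hn : ∀ v ∈ Set.Ioi (0 : ℝ), 0 ≤ ((v ^ 2 + p ^ 2) * (v ^ 2 + q ^ 2))⁻¹ :=
    fun v _ => by positivity
  refine ⟨integrableOn_Ioi_deriv_of_nonneg' hd hn hl, ?_⟩
  rw [integral_Ioi_of_hasDerivAt_of_nonneg' hd hn hl]
  simp only [hG, mul_zero, Real.arctan_zero, sub_zero]
  have : p + q ≠ 0 := by positivity
  have e : p ^ 2 - q ^ 2 = (p - q) * (p + q) := by ring
  have : p - q ≠ 0 := by intro h; linarith
  rw [e]
  field_simp

theorem lintegral_ofReal_eq {β : Type*} [MeasurableSpace β] {μ : Measure β} {f : β → ℝ} {c : ℝ}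
    (hf : Integrable f μ) (h0 : ∀ x, 0 ≤ f x) (hc : ∫ x, f x ∂μ = c) :
    ∫⁻ x, ENNReal.ofReal (f x) ∂μ = ENNReal.ofReal c := by
  rw [← hc, ofReal_integral_eq_lintegral_ofReal hf (ae_of_all _ h0)]

theorem integral_of_lintegral_ofReal {β : Type*} [MeasurableSpace β] {μ : Measure β} {f : β → ℝ}
    {c : ℝ} (hf : AEStronglyMeasurable f μ) (h0 : ∀ x, 0 ≤ f x) (hc0 : 0 ≤ c)
    (hc : ∫⁻ x, ENNReal.ofReal (f x) ∂μ = ENNReal.ofReal c) :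
    Integrable f μ ∧ ∫ x, f x ∂μ = c := by
  refine ⟨⟨hf, ?_⟩, ?_⟩
  · rw [hasFiniteIntegral_iff_ofReal (ae_of_all _ h0), hc]
    exact ENNReal.ofReal_lt_top
  · rw [integral_eq_lintegral_of_nonneg_ae (ae_of_all _ h0) hf, hc, ENNReal.toReal_ofReal hc0]

/-- The Poisson extension of a regularized Coulomb kernel is again of this form. -/
theorem integral_poisson_mul_coulomb {s t : ℝ} (ht : 0 < t) (hst : t < s) (c x : Plane) :
    Integrable (fun y => poisson t x y * coulomb s c y) volume ∧
      ∫ y, poisson t x y * coulomb s c y = 2 * Real.pi * coulomb (s + t) c x := by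
  have hs : 0 < s := ht.trans hst
  refine integral_of_lintegral_ofReal
    ((continuous_poisson ht x).mul (continuous_coulomb hs c)).aestronglyMeasurable
    (fun y => (mul_pos (poisson_pos ht x y) (coulomb_pos hs c y)).le)
    (mul_nonneg (by positivity) (coulomb_pos (by linarith) c x).le) ?_
  set r2 := ‖x - c‖ ^ 2 with hr2
  have hr0 : 0 ≤ r2 := by positivity
  set k : Plane → ℝ → ℝ := fun y v =>
    (((‖y - x‖ ^ 2 + t ^ 2) + v ^ 2 * (‖y - c‖ ^ 2 + s ^ 2)) ^ 2)⁻¹ with hk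
  have hk0 : ∀ y v, 0 ≤ k y v := fun y v => by simp only [hk]; positivity
  have h1 : ∀ y, ENNReal.ofReal (poisson t x y * coulomb s c y) =
      ENNReal.ofReal (4 * t / Real.pi) * ∫⁻ v in Set.Ioi (0 : ℝ), ENNReal.ofReal (k y v) := by
    intro y
    have ha := sqrt_reg_pos ht x y
    have hb := sqrt_reg_pos hs c y
    obtain ⟨i1, i2⟩ := integral_Ioi_feynman ha hb
    rw [Real.sq_sqrt (by positivity), Real.sq_sqrt (by positivity)] at i1 i2
    rw [lintegral_ofReal_eq i1 (hk0 y) i2, ← ENNReal.ofReal_mul (by positivity)]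
    congr 1
    rw [poisson, coulomb]
    have := Real.pi_pos.ne'
    field_simp
  have hkm : Measurable (Function.uncurry k) := by
    simp only [hk, Function.uncurry_def]; fun_prop
  have h2 : ∀ v ∈ Set.Ioi (0 : ℝ), ∫⁻ y, ENNReal.ofReal (k y v) =
      ENNReal.ofReal (Real.pi / ((1 + v ^ 2) * (t ^ 2 + v ^ 2 * s ^ 2) + v ^ 2 * r2)) := by
    intro v hv
    have hv0 : 0 < v := hv
    -- Completing the square in y turns the spatial integral into that of a centered quadratic.
    have h3 : ∀ y, k y v = (((1 + v ^ 2) * ‖y - (1 + v ^ 2)⁻¹ • (x + v ^ 2 • c)‖ ^ 2 +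
        (t ^ 2 + v ^ 2 * s ^ 2 + v ^ 2 * r2 / (1 + v ^ 2))) ^ 2)⁻¹ := by
      intro y
      simp only [hk]
      congr 2
      have hne : (1 + v ^ 2) ≠ 0 := by positivity
      have e1 : y - (1 + v ^ 2)⁻¹ • (x + v ^ 2 • c) =
          (1 + v ^ 2)⁻¹ • ((y - x) + v ^ 2 • (y - c)) := by
        have : y = (1 + v ^ 2)⁻¹ • ((1 + v ^ 2) • y) := by rw [smul_smul, inv_mul_cancel₀ hne, one_smul]
        nth_rewrite 1 [this]
        rw [← smul_sub]
        congr 1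
        rw [add_smul, one_smul, smul_sub]
        abel
      have e2 : x - c = (y - c) - (y - x) := by abel
      rw [e1, hr2, e2, norm_smul, mul_pow, norm_add_sq_real, norm_sub_sq_real (y - c) (y - x),
        norm_smul, inner_smul_right, Real.norm_of_nonneg (by positivity),
        Real.norm_of_nonneg (by positivity), real_inner_comm (y - x) (y - c)]
      field_simp
      ring
    obtain ⟨i1, i2⟩ := integral_inv_sq_quadratic (α := 1 + v ^ 2)
      (β := t ^ 2 + v ^ 2 * s ^ 2 + v ^ 2 * r2 / (1 + v ^ 2)) (by positivity) (by positivity)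
      ((1 + v ^ 2)⁻¹ • (x + v ^ 2 • c))
    simp only [← h3] at i1 i2
    rw [lintegral_ofReal_eq i1 (fun y => hk0 y v) i2]
    congr 2
    field_simp
  simp only [h1]
  rw [lintegral_const_mul' _ _ ENNReal.ofReal_ne_top,
    lintegral_lintegral_swap (by exact hkm.ennreal_ofReal.aemeasurable),
    setLIntegral_congr_fun measurableSet_Ioi h2]
  -- The remaining quartic in v factors as s²(v² + p²)(v² + q²) with p, q = (D ± E)/(2s), pq = t/s
  -- and p + q = D/s. The condition t < s ensures E > 0, hence p ≠ q, even when x = c.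
  set D := Real.sqrt (r2 + (s + t) ^ 2) with hD
  set E := Real.sqrt (r2 + (s - t) ^ 2) with hE
  have hst' : 0 < s - t := by linarith
  have hD2 : D ^ 2 = r2 + (s + t) ^ 2 := Real.sq_sqrt (by positivity)
  have hE2 : E ^ 2 = r2 + (s - t) ^ 2 := Real.sq_sqrt (by positivity)
  have hD0 : 0 < D := Real.sqrt_pos.2 (by positivity)
  have hE0 : 0 < E := Real.sqrt_pos.2 (by positivity)
  have hED : E < D := Real.sqrt_lt_sqrt (by positivity) (by nlinarith)
  obtain ⟨i1, i2⟩ := integral_Ioi_quartic (p := (D + E) / (2 * s)) (q := (D - E) / (2 * s))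
    (div_pos (by linarith) (by positivity)) (by gcongr; linarith)
  have h4 : ∀ v : ℝ, Real.pi / ((1 + v ^ 2) * (t ^ 2 + v ^ 2 * s ^ 2) + v ^ 2 * r2) =
      Real.pi / s ^ 2 * ((v ^ 2 + ((D + E) / (2 * s)) ^ 2) * (v ^ 2 + ((D - E) / (2 * s)) ^ 2))⁻¹ := by
    intro v
    have e0 : (1 + v ^ 2) * (t ^ 2 + v ^ 2 * s ^ 2) + v ^ 2 * r2 = s ^ 2 *
        ((v ^ 2 + ((D + E) / (2 * s)) ^ 2) * (v ^ 2 + ((D - E) / (2 * s)) ^ 2)) := by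
      have e1 : ((D + E) / (2 * s)) ^ 2 + ((D - E) / (2 * s)) ^ 2 = (D ^ 2 + E ^ 2) / (2 * s ^ 2) := by
        field_simp; ring
      have e2 : ((D + E) / (2 * s)) ^ 2 * ((D - E) / (2 * s)) ^ 2 =
          ((D ^ 2 - E ^ 2) / (4 * s ^ 2)) ^ 2 := by
        field_simp; ring
      have e3 : (v ^ 2 + ((D + E) / (2 * s)) ^ 2) * (v ^ 2 + ((D - E) / (2 * s)) ^ 2) =
          v ^ 4 + v ^ 2 * (((D + E) / (2 * s)) ^ 2 + ((D - E) / (2 * s)) ^ 2) +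
            ((D + E) / (2 * s)) ^ 2 * ((D - E) / (2 * s)) ^ 2 := by ring
      rw [e3, e1, e2, hD2, hE2]
      field_simp
      ring
    rw [e0, ← div_eq_mul_inv, div_div]
  simp only [h4]
  have i1' := i1.const_mul (Real.pi / s ^ 2)
  have i2' : ∫ v in Set.Ioi (0 : ℝ), Real.pi / s ^ 2 *
      ((v ^ 2 + ((D + E) / (2 * s)) ^ 2) * (v ^ 2 + ((D - E) / (2 * s)) ^ 2))⁻¹ =
      Real.pi ^ 2 / (2 * t * D) := by
    rw [integral_const_mul, i2]
    have e4 : 2 * ((D + E) / (2 * s)) * ((D - E) / (2 * s)) *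
        ((D + E) / (2 * s) + (D - E) / (2 * s)) = 2 * t * D / s ^ 2 := by
      have : 2 * ((D + E) / (2 * s)) * ((D - E) / (2 * s)) *
        ((D + E) / (2 * s) + (D - E) / (2 * s)) = (D ^ 2 - E ^ 2) * D / (2 * s ^ 3) := by
          field_simp; ring
      rw [this, hD2, hE2]
      field_simp
      ring
    rw [e4]
    field_simp
  rw [lintegral_ofReal_eq i1' (fun v => by positivity) i2', ← ENNReal.ofReal_mul (by positivity)]
  congr 1
  rw [coulomb, ← hr2, ← hD]
  have := Real.pi_pos.ne'
  field_simp
  ring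

/-! ### The half-Laplacian of a regularized Coulomb kernel -/

/-- The factor by which the kernel `|x - y|⁻³` is truncated. -/
def truncRatio (t : ℝ) (p : Plane × Plane) : ℝ :=
  ‖p.1 - p.2‖ ^ 3 * (Real.sqrt (‖p.1 - p.2‖ ^ 2 + t ^ 2) ^ 3)⁻¹

theorem truncRatio_nonneg (t : ℝ) (p : Plane × Plane) : 0 ≤ truncRatio t p := by
  unfold truncRatio; positivity

theorem truncRatio_le_one (t : ℝ) (p : Plane × Plane) : truncRatio t p ≤ 1 := by
  unfold truncRatio
  rw [← div_eq_mul_inv]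
  refine div_le_one_of_le₀ ?_ (by positivity)
  gcongr
  exact Real.le_sqrt_of_sq_le (by nlinarith [sq_nonneg t])

theorem tendsto_hdotInner_trunc {u v : Plane → ℝ} (hu : FiniteEnergy u) (hv : FiniteEnergy v)
    {t : ℕ → ℝ} (ht : Tendsto t atTop (𝓝 0)) :
    Tendsto (fun n => ∫ p, incr u p * incr v p * truncRatio (t n) p ∂gagMeasure) atTop
      (𝓝 (hdotInner u v)) := by
  rw [hdotInner_eq]
  have hm : ∀ t, Measurable (truncRatio t) := fun t => by unfold truncRatio; fun_prop
  refine tendsto_integral_of_dominated_convergence (fun p => ‖incr u p * incr v p‖)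
    (fun n => (hu.integrable hv).1.mul (hm _).aestronglyMeasurable) (hu.integrable hv).norm
    (fun n => ae_of_all _ fun p => ?_) (ae_of_all _ fun p => ?_)
  · rw [norm_mul, Real.norm_of_nonneg (truncRatio_nonneg _ _)]
    exact mul_le_of_le_one_right (norm_nonneg _) (truncRatio_le_one _ _)
  · rcases eq_or_ne p.1 p.2 with h | h
    · simp [incr, h]
    · have hpos : 0 < ‖p.1 - p.2‖ := norm_pos_iff.2 (sub_ne_zero.2 h)
      have hc : ContinuousAt (fun t => truncRatio t p) 0 := by
        unfold truncRatio
        refine continuousAt_const.mul (ContinuousAt.inv₀ (by fun_prop) ?_)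
        simp [hpos.ne']
      have h1 : truncRatio 0 p = 1 := by
        unfold truncRatio
        rw [zero_pow two_ne_zero, add_zero, Real.sqrt_sq hpos.le]
        exact mul_inv_cancel₀ (by positivity)
      have := (hc.tendsto.comp ht).const_mul (incr u p * incr v p)
      rw [h1, mul_one] at this
      exact this

/-- The factor `truncRatio` replaces |x − y|⁻³ by (|x − y|² + t²)^{-3/2}, which is the Poisson
kernel divided by t: the truncated form is a difference quotient of the Poisson semigroup. -/
theorem integral_trunc (u v : Plane → ℝ) {t : ℝ} (ht : 0 < t) :
    ∫ p, incr u p * incr v p * truncRatio t p ∂gagMeasure =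
      (4 * Real.pi * t)⁻¹ * ∫ p : Plane × Plane, incr u p * incr v p * poisson t p.1 p.2 := by
  unfold gagMeasure
  rw [integral_withDensity_eq_integral_toReal_smul gagDensity_measurable
    (ae_of_all _ fun _ => ENNReal.ofReal_lt_top), ← integral_const_mul]
  congr 1
  funext p
  rw [ENNReal.toReal_ofReal (by positivity), smul_eq_mul]
  rcases eq_or_ne p.1 p.2 with h | h
  · simp [incr, h]
  · have hpos : 0 < ‖p.1 - p.2‖ := norm_pos_iff.2 (sub_ne_zero.2 h)
    rw [truncRatio, poisson, norm_sub_rev p.2 p.1]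
    have := Real.pi_pos.ne'
    field_simp

/-- By symmetry of the kernel the double integral is twice the one with v(x) in place of v(x) −
v(y); integrating in y then uses the mass 2π and the identity P_t ∗ k_s = 2πk_{s+t}. -/
theorem integral_incr_coulomb_mul {v : Plane → ℝ} (hv : IsLipc v) {s t : ℝ} (ht : 0 < t)
    (hst : t < s) (c : Plane) :
    Integrable (fun p : Plane × Plane => incr (coulomb s c) p * incr v p * poisson t p.1 p.2)
      volume ∧
    ∫ p : Plane × Plane, incr (coulomb s c) p * incr v p * poisson t p.1 p.2 =
      4 * Real.pi * ∫ x, v x * (coulomb s c x - coulomb (s + t) c x) := by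
  have hs : 0 < s := ht.trans hst
  have hpm : Continuous fun p : Plane × Plane => poisson t p.1 p.2 := by
    unfold poisson
    exact continuous_const.mul (Continuous.inv₀ (by fun_prop) fun p =>
      (pow_pos (sqrt_reg_pos ht p.1 p.2) 3).ne')
  have hcv := hv.continuous
  have hce := continuous_coulomb hs c
  have hK : Integrable (fun p : Plane × Plane => v p.1 * poisson t p.1 p.2) volume := by
    rw [Measure.volume_eq_prod, integrable_prod_iff
      (Continuous.aestronglyMeasurable (by fun_prop))]
    refine ⟨ae_of_all _ fun x => (integral_poisson ht x).1.const_mul (v x), ?_⟩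
    simp only [norm_mul, Real.norm_of_nonneg (poisson_pos ht _ _).le, integral_const_mul,
      (integral_poisson ht _).2]
    exact hv.integrable.norm.mul_const _
  set H : Plane × Plane → ℝ := fun p => incr (coulomb s c) p * (v p.1 * poisson t p.1 p.2) with hH
  have hHi : Integrable H volume := by
    refine hK.bdd_mul (c := s⁻¹ + s⁻¹) ?_ (ae_of_all _ fun p => ?_)
    · unfold incr; exact Continuous.aestronglyMeasurable (by fun_prop)
    · refine (norm_sub_le _ _).trans (add_le_add ?_ ?_) <;>
      · rw [Real.norm_of_nonneg (coulomb_pos hs _ _).le]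
        exact coulomb_le hs _ _
  have hHs : Integrable (H ∘ Prod.swap) volume := by
    rw [Measure.volume_eq_prod] at hHi ⊢
    exact hHi.swap
  have hHint : ∫ p, H p = 2 * Real.pi * ∫ x, v x * (coulomb s c x - coulomb (s + t) c x) := by
    rw [Measure.volume_eq_prod, integral_prod _ (by rwa [Measure.volume_eq_prod] at hHi),
      ← integral_const_mul]
    congr 1
    funext x
    obtain ⟨i1, i2⟩ := integral_poisson_mul_coulomb ht hst c x
    obtain ⟨j1, j2⟩ := integral_poisson ht x
    have e : (fun y => H (x, y)) = fun y =>
        v x * (coulomb s c x * poisson t x y - poisson t x y * coulomb s c y) := by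
      funext y; simp only [hH, incr]; ring
    rw [e, integral_const_mul, integral_sub (j1.const_mul _) i1, integral_const_mul, i2, j2]
    ring
  have hsum : (fun p : Plane × Plane => incr (coulomb s c) p * incr v p * poisson t p.1 p.2) =
      fun p => H p + (H ∘ Prod.swap) p := by
    funext p
    simp only [hH, incr, Function.comp, Prod.fst_swap, Prod.snd_swap, poisson_comm t p.2 p.1]
    ring
  rw [hsum]
  refine ⟨hHi.add hHs, ?_⟩
  rw [integral_add hHi hHs]
  have : ∫ p, (H ∘ Prod.swap) p = ∫ p, H p := by
    rw [Measure.volume_eq_prod]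
    exact integral_prod_swap H
  rw [this, hHint]
  ring

theorem coulomb_sub_coulomb {s t : ℝ} (hs : 0 < s) (ht : 0 ≤ t) (c x : Plane) :
    coulomb s c x - coulomb (s + t) c x = t * ((2 * s + t) / (Real.sqrt (‖x - c‖ ^ 2 + s ^ 2) *
      Real.sqrt (‖x - c‖ ^ 2 + (s + t) ^ 2) * (Real.sqrt (‖x - c‖ ^ 2 + s ^ 2) +
        Real.sqrt (‖x - c‖ ^ 2 + (s + t) ^ 2)))) := by
  have ha := sqrt_reg_pos hs c x
  have hb := sqrt_reg_pos (by linarith : 0 < s + t) c x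
  have ha2 := Real.sq_sqrt (show 0 ≤ ‖x - c‖ ^ 2 + s ^ 2 by positivity)
  have hb2 := Real.sq_sqrt (show 0 ≤ ‖x - c‖ ^ 2 + (s + t) ^ 2 by positivity)
  unfold coulomb
  set a := Real.sqrt (‖x - c‖ ^ 2 + s ^ 2)
  set b := Real.sqrt (‖x - c‖ ^ 2 + (s + t) ^ 2)
  field_simp
  linear_combination hb2 - ha2

theorem coulomb_sub_coulomb_nonneg {s t : ℝ} (hs : 0 < s) (ht : 0 ≤ t) (c x : Plane) :
    0 ≤ coulomb s c x - coulomb (s + t) c x := by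
  rw [coulomb_sub_coulomb hs ht]; positivity

theorem coulomb_sub_coulomb_le {s t : ℝ} (hs : 0 < s) (ht : 0 ≤ t) (hts : t ≤ s) (c x : Plane) :
    coulomb s c x - coulomb (s + t) c x ≤ t * (3 / 2 * s * coulomb s c x ^ 3) := by
  rw [coulomb_sub_coulomb hs ht]
  have ha := sqrt_reg_pos hs c x
  have hab : Real.sqrt (‖x - c‖ ^ 2 + s ^ 2) ≤ Real.sqrt (‖x - c‖ ^ 2 + (s + t) ^ 2) :=
    Real.sqrt_le_sqrt (by nlinarith)
  unfold coulomb
  set a := Real.sqrt (‖x - c‖ ^ 2 + s ^ 2)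
  set b := Real.sqrt (‖x - c‖ ^ 2 + (s + t) ^ 2)
  have h2 : (2 * s + t) / (a * b * (a + b)) ≤ 3 * s / (a * a * (a + a)) := by
    gcongr
    linarith
  have h3 : 3 * s / (a * a * (a + a)) = 3 / 2 * s * a⁻¹ ^ 3 := by
    field_simp; ring
  rw [← h3]
  exact mul_le_mul_of_nonneg_left h2 ht

theorem tendsto_coulomb_quotient {s : ℝ} (hs : 0 < s) (c x : Plane) {t : ℕ → ℝ}
    (ht0 : ∀ n, 0 < t n) (ht : Tendsto t atTop (𝓝 0)) :
    Tendsto (fun n => (t n)⁻¹ * (coulomb s c x - coulomb (s + t n) c x)) atTop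
      (𝓝 (poisson s c x)) := by
  have ha := sqrt_reg_pos hs c x
  have hc : ContinuousAt (fun t => (2 * s + t) / (Real.sqrt (‖x - c‖ ^ 2 + s ^ 2) *
      Real.sqrt (‖x - c‖ ^ 2 + (s + t) ^ 2) * (Real.sqrt (‖x - c‖ ^ 2 + s ^ 2) +
        Real.sqrt (‖x - c‖ ^ 2 + (s + t) ^ 2)))) 0 := by
    refine ContinuousAt.div (by fun_prop) (by fun_prop) ?_
    rw [add_zero]
    positivity
  have h := hc.tendsto.comp ht
  have e : (2 * s + 0) / (Real.sqrt (‖x - c‖ ^ 2 + s ^ 2) *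
      Real.sqrt (‖x - c‖ ^ 2 + (s + 0) ^ 2) * (Real.sqrt (‖x - c‖ ^ 2 + s ^ 2) +
        Real.sqrt (‖x - c‖ ^ 2 + (s + 0) ^ 2))) = poisson s c x := by
    rw [poisson, add_zero, add_zero]
    set a := Real.sqrt (‖x - c‖ ^ 2 + s ^ 2)
    field_simp
    ring
  rw [e] at h
  refine h.congr fun n => ?_
  rw [coulomb_sub_coulomb hs (ht0 n).le, inv_mul_cancel_left₀ (ht0 n).ne']
  rfl

theorem abs_coulomb_sub_le {s : ℝ} (hs : 0 < s) (c x y : Plane) :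
    |coulomb s c x - coulomb s c y| ≤ s⁻¹ * s⁻¹ * ‖x - y‖ := by
  have ha := sqrt_reg_pos hs c x
  have hb := sqrt_reg_pos hs c y
  have ha2 := Real.sq_sqrt (show 0 ≤ ‖x - c‖ ^ 2 + s ^ 2 by positivity)
  have hb2 := Real.sq_sqrt (show 0 ≤ ‖y - c‖ ^ 2 + s ^ 2 by positivity)
  have ha3 : ‖x - c‖ ≤ Real.sqrt (‖x - c‖ ^ 2 + s ^ 2) :=
    Real.le_sqrt_of_sq_le (by nlinarith [sq_nonneg s])
  have hb3 : ‖y - c‖ ≤ Real.sqrt (‖y - c‖ ^ 2 + s ^ 2) :=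
    Real.le_sqrt_of_sq_le (by nlinarith [sq_nonneg s])
  have hd : |‖y - c‖ - ‖x - c‖| ≤ ‖x - y‖ := by
    refine (abs_norm_sub_norm_le _ _).trans (le_of_eq ?_)
    rw [← norm_neg]; congr 1; abel
  have hca := coulomb_le hs c x
  have hcb := coulomb_le hs c y
  have hca0 := (coulomb_pos hs c x).le
  have hcb0 := (coulomb_pos hs c y).le
  have e : coulomb s c x - coulomb s c y = coulomb s c x * coulomb s c y *
      (Real.sqrt (‖y - c‖ ^ 2 + s ^ 2) - Real.sqrt (‖x - c‖ ^ 2 + s ^ 2)) := by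
    unfold coulomb; field_simp
  rw [e, abs_mul, abs_of_nonneg (mul_nonneg hca0 hcb0)]
  refine mul_le_mul (mul_le_mul hca hcb hcb0 (by positivity)) ?_ (abs_nonneg _) (by positivity)
  set a := Real.sqrt (‖x - c‖ ^ 2 + s ^ 2)
  set b := Real.sqrt (‖y - c‖ ^ 2 + s ^ 2)
  have h1 : (b - a) * (b + a) = (‖y - c‖ - ‖x - c‖) * (‖y - c‖ + ‖x - c‖) := by
    linear_combination hb2 - ha2
  have h2 : |b - a| * (b + a) ≤ ‖x - y‖ * (b + a) := by
    calc |b - a| * (b + a) = |(b - a) * (b + a)| := by rw [abs_mul, abs_of_pos (by positivity : 0 < b + a)]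
      _ = |‖y - c‖ - ‖x - c‖| * (‖y - c‖ + ‖x - c‖) := by
        rw [h1, abs_mul, abs_of_nonneg (by positivity : 0 ≤ ‖y - c‖ + ‖x - c‖)]
      _ ≤ ‖x - y‖ * (b + a) := by gcongr
  exact le_of_mul_le_mul_right h2 (by positivity)

/-- Truncations of a regularized Coulomb kernel. -/
def coulombTrunc (s : ℝ) (c : Plane) (κ : ℝ) (x : Plane) : ℝ := max (coulomb s c x - κ) 0

theorem isLipc_coulombTrunc {s κ : ℝ} (hs : 0 < s) (hκ : 0 < κ) (c : Plane) :
    IsLipc (coulombTrunc s c κ) := by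
  constructor
  · refine ⟨Real.toNNReal (s⁻¹ * s⁻¹), LipschitzWith.of_dist_le_mul fun x y => ?_⟩
    rw [Real.dist_eq, dist_eq_norm, Real.coe_toNNReal _ (by positivity)]
    refine le_trans ?_ (abs_coulomb_sub_le hs c x y)
    refine (abs_max_sub_max_le_max _ _ _ _).trans ?_
    simp
  · refine HasCompactSupport.intro (isCompact_closedBall c κ⁻¹) fun x hx => ?_
    rw [Metric.mem_closedBall, not_le, dist_eq_norm] at hx
    refine max_eq_right (sub_nonpos.2 ?_)
    have h1 : κ⁻¹ ≤ Real.sqrt (‖x - c‖ ^ 2 + s ^ 2) :=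
      hx.le.trans (Real.le_sqrt_of_sq_le (by nlinarith [sq_nonneg s]))
    exact (inv_anti₀ (by positivity) h1).trans (inv_inv κ).le

theorem coulombTrunc_nonneg (s : ℝ) (c : Plane) (κ : ℝ) (x : Plane) : 0 ≤ coulombTrunc s c κ x :=
  le_max_right _ _

theorem coulombTrunc_le {s κ : ℝ} (hs : 0 < s) (hκ : 0 ≤ κ) (c x : Plane) :
    coulombTrunc s c κ x ≤ coulomb s c x :=
  max_le (by linarith) (coulomb_pos hs c x).le

theorem integrable_coulomb_pow_four {s : ℝ} (hs : 0 < s) (c : Plane) :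
    Integrable (fun x => coulomb s c x ^ 4) volume := by
  have := (integral_inv_sq_quadratic one_pos (by positivity : 0 < s ^ 2) c).1
  refine this.congr (ae_of_all _ fun x => ?_)
  have h := Real.sq_sqrt (show 0 ≤ ‖x - c‖ ^ 2 + s ^ 2 by positivity)
  simp only [coulomb, one_mul, inv_pow]
  rw [show Real.sqrt (‖x - c‖ ^ 2 + s ^ 2) ^ 4 = (Real.sqrt (‖x - c‖ ^ 2 + s ^ 2) ^ 2) ^ 2 by ring, h]

theorem memLp_coulomb_three {s : ℝ} (hs : 0 < s) (c : Plane) : MemLp (coulomb s c) 3 volume := by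
  rw [← integrable_norm_rpow_iff (continuous_coulomb hs c).aestronglyMeasurable (by norm_num)
    (by norm_num)]
  refine ((integral_poisson hs c).1.const_mul s⁻¹).congr (ae_of_all _ fun x => ?_)
  simp only [poisson_eq_coulomb, Real.norm_of_nonneg (coulomb_pos hs c x).le,
    ENNReal.toReal_ofNat]
  rw [inv_mul_cancel_left₀ hs.ne']
  norm_cast

/-- The bound does not depend on κ, which is what gives k_s finite energy. As that is not yet known,
the argument uses the truncated forms: the energy of the truncation is at most its pairing with k_s,
namely t⁻¹∫v(k_s − k_{s+t}), and this is bounded uniformly in t. -/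
theorem hdotInner_coulombTrunc_le {s κ : ℝ} (hs : 0 < s) (hκ : 0 < κ) (c : Plane) :
    hdotInner (coulombTrunc s c κ) (coulombTrunc s c κ) ≤
      ∫ x, 3 / 2 * s * coulomb s c x ^ 4 := by
  have hv := isLipc_coulombTrunc hs hκ c
  set v := coulombTrunc s c κ with hvdef
  obtain ⟨t, -, htm, htl⟩ := exists_seq_strictAnti_tendsto' hs
  have ht0 : ∀ n, 0 < t n := fun n => (htm n).1
  have hts : ∀ n, t n < s := fun n => (htm n).2
  refine le_of_tendsto (tendsto_hdotInner_trunc hv.finiteEnergy hv.finiteEnergy htl)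
    (Eventually.of_forall fun n => ?_)
  rw [integral_trunc _ _ (ht0 n)]
  obtain ⟨i1, i2⟩ := integral_incr_coulomb_mul hv (ht0 n) (hts n) c
  have h1 : ∫ p : Plane × Plane, incr v p * incr v p * poisson (t n) p.1 p.2 ≤
      ∫ p : Plane × Plane, incr (coulomb s c) p * incr v p * poisson (t n) p.1 p.2 := by
    refine integral_mono_of_nonneg (ae_of_all _ fun p => ?_) i1 (ae_of_all _ fun p => ?_)
    · exact mul_nonneg (mul_self_nonneg _) (poisson_pos (ht0 n) _ _).le
    · refine mul_le_mul_of_nonneg_right ?_ (poisson_pos (ht0 n) _ _).le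
      simp only [incr, hvdef, coulombTrunc]
      rcases le_total (coulomb s c p.1 - κ) 0 with h1 | h1 <;>
      rcases le_total (coulomb s c p.2 - κ) 0 with h2 | h2 <;>
      simp only [max_eq_left, max_eq_right, h1, h2] <;> nlinarith
  have h2 : ∫ x, v x * (coulomb s c x - coulomb (s + t n) c x) ≤
      t n * ∫ x, 3 / 2 * s * coulomb s c x ^ 4 := by
    rw [← integral_const_mul]
    refine integral_mono_of_nonneg (ae_of_all _ fun x => ?_)
      (((integrable_coulomb_pow_four hs c).const_mul _).const_mul _) (ae_of_all _ fun x => ?_)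
    · exact mul_nonneg (coulombTrunc_nonneg _ _ _ _)
        (coulomb_sub_coulomb_nonneg hs (ht0 n).le c x)
    · calc v x * (coulomb s c x - coulomb (s + t n) c x)
          ≤ coulomb s c x * (t n * (3 / 2 * s * coulomb s c x ^ 3)) :=
            mul_le_mul (coulombTrunc_le hs hκ.le c x)
              (coulomb_sub_coulomb_le hs (ht0 n).le (hts n).le c x)
              (coulomb_sub_coulomb_nonneg hs (ht0 n).le c x) (coulomb_pos hs c x).le
        _ = t n * (3 / 2 * s * coulomb s c x ^ 4) := by ring
  rw [i2] at h1
  have h3 : 0 < 4 * Real.pi * t n := mul_pos (by positivity) (ht0 n)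
  rw [inv_mul_le_iff₀ h3]
  refine h1.trans ?_
  rw [mul_assoc (4 * Real.pi)]
  exact mul_le_mul_of_nonneg_left h2 (by positivity)

theorem isWeakLimit_coulomb {s : ℝ} (hs : 0 < s) (c : Plane) :
    IsWeakLimit (fun n => coulombTrunc s c (1 / ((n : ℝ) + 1))) (coulomb s c) := by
  have hκ : ∀ n : ℕ, 0 < 1 / ((n : ℝ) + 1) := fun n => by positivity
  refine ⟨fun n => isLipc_coulombTrunc hs (hκ n) c,
    ⟨Real.toNNReal (Real.sqrt (∫ x, 3 / 2 * s * coulomb s c x ^ 4)), fun n => ?_⟩,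
    ⟨(eLpNorm (coulomb s c) 3 volume).toNNReal, fun n => ?_⟩, ae_of_all _ fun x => ?_⟩
  · have h1 := hdotInner_coulombTrunc_le hs (hκ n) c
    have h2 := (isLipc_coulombTrunc hs (hκ n) c).finiteEnergy
    rw [hdotInner_self h2] at h1
    rw [← ENNReal.ofReal_toReal h2.lt_top.ne]
    exact ENNReal.ofReal_le_ofReal (Real.le_sqrt_of_sq_le h1)
  · rw [ENNReal.coe_toNNReal (memLp_coulomb_three hs c).2.ne]
    refine eLpNorm_mono_real fun x => ?_
    rw [Real.norm_of_nonneg (coulombTrunc_nonneg _ _ _ _)]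
    exact coulombTrunc_le hs (hκ n).le c x
  · have h1 := (tendsto_const_nhds (x := coulomb s c x)).sub
      (tendsto_one_div_add_atTop_nhds_zero_nat (𝕜 := ℝ))
    rw [sub_zero] at h1
    have h2 := h1.max (tendsto_const_nhds (x := (0 : ℝ)))
    rwa [max_eq_left (coulomb_pos hs c x).le] at h2

theorem finiteEnergy_coulomb {s : ℝ} (hs : 0 < s) (c : Plane) : FiniteEnergy (coulomb s c) :=
  (isWeakLimit_coulomb hs c).finiteEnergy

/-- The half-Laplacian of a regularized Coulomb kernel is the Poisson kernel. -/
theorem hdotInner_coulomb {v : Plane → ℝ} (hv : IsLipc v) {s : ℝ} (hs : 0 < s) (c : Plane) :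
    hdotInner (coulomb s c) v = ∫ x, poisson s c x * v x := by
  obtain ⟨t, -, htm, htl⟩ := exists_seq_strictAnti_tendsto' hs
  have ht0 : ∀ n, 0 < t n := fun n => (htm n).1
  have hts : ∀ n, t n < s := fun n => (htm n).2
  refine tendsto_nhds_unique
    (tendsto_hdotInner_trunc (finiteEnergy_coulomb hs c) hv.finiteEnergy htl) ?_
  -- The truncated form is the difference quotient of s ↦ k_s, and −∂k_s/∂s = P_s.
  have e : ∀ n, ∫ p, incr (coulomb s c) p * incr v p * truncRatio (t n) p ∂gagMeasure =
      ∫ x, v x * ((t n)⁻¹ * (coulomb s c x - coulomb (s + t n) c x)) := by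
    intro n
    rw [integral_trunc _ _ (ht0 n), (integral_incr_coulomb_mul hv (ht0 n) (hts n) c).2,
      ← mul_assoc, ← integral_const_mul]
    congr 1
    funext x
    have := Real.pi_pos.ne'
    have := (ht0 n).ne'
    field_simp
  simp only [e, mul_comm (poisson _ _ _)]
  refine tendsto_integral_of_dominated_convergence
    (fun x => ‖v x‖ * (3 / 2 * s * s⁻¹ ^ 3)) (fun n => ?_) (hv.integrable.norm.mul_const _)
    (fun n => ae_of_all _ fun x => ?_)
    (ae_of_all _ fun x => (tendsto_coulomb_quotient hs c x ht0 htl).const_mul _)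
  · exact (hv.continuous.mul (continuous_const.mul ((continuous_coulomb hs c).sub
      (continuous_coulomb (add_pos hs (ht0 n)) c)))).aestronglyMeasurable
  · rw [norm_mul]
    refine mul_le_mul_of_nonneg_left ?_ (norm_nonneg _)
    rw [Real.norm_of_nonneg (mul_nonneg (inv_nonneg.2 (ht0 n).le)
      (coulomb_sub_coulomb_nonneg hs (ht0 n).le c x)), inv_mul_le_iff₀ (ht0 n)]
    refine (coulomb_sub_coulomb_le hs (ht0 n).le (hts n).le c x).trans ?_
    have := coulomb_le hs c x
    have := (coulomb_pos hs c x).le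
    have := (ht0 n).le
    gcongr

/-! ### Hölder and Lipschitz estimates for Riesz potentials -/

/-- Interpolate the numerator: for b ≤ a, write a − b = (a − b)^γ (a − b)^{1−γ} ≤ d^γ a^{1−γ}. The
values 0⁻¹ = 0 and 0 to a negative power = 0 make the bound hold on the singularity too. -/
theorem abs_inv_sub_inv_le {a b d γ : ℝ} (ha : 0 ≤ a) (hb : 0 ≤ b) (hd : |a - b| ≤ d)
    (hγ0 : 0 < γ) (hγ1 : γ ≤ 1) :
    |a⁻¹ - b⁻¹| ≤ d ^ γ * (a ^ (-(1 + γ)) + b ^ (-(1 + γ))) := by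
  wlog h : b ≤ a generalizing a b
  · have := this hb ha (by rwa [abs_sub_comm]) (le_of_not_ge h)
    rwa [abs_sub_comm, add_comm (b ^ _)] at this
  have hd0 : 0 ≤ d := (abs_nonneg _).trans hd
  have hdγ : 0 ≤ d ^ γ := Real.rpow_nonneg hd0 _
  rcases hb.eq_or_lt with rfl | hb'
  · rcases ha.eq_or_lt with rfl | ha'
    · simp only [sub_self, abs_zero]
      exact mul_nonneg hdγ (by positivity)
    · rw [inv_zero, sub_zero, abs_of_pos (inv_pos.2 ha'), Real.zero_rpow (by linarith), add_zero]
      have h1 : a⁻¹ = a ^ γ * a ^ (-(1 + γ)) := by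
        rw [← Real.rpow_add ha', ← Real.rpow_neg_one]; congr 1; ring
      rw [h1]
      have : a ≤ d := by simpa [abs_of_pos ha'] using hd
      gcongr
  · have ha' : 0 < a := hb'.trans_le h
    rw [abs_of_nonneg (sub_nonneg.2 h)] at hd
    have h1 : |a⁻¹ - b⁻¹| = (a - b) * (a⁻¹ * b⁻¹) := by
      rw [abs_sub_comm, abs_of_nonneg (sub_nonneg.2 (inv_anti₀ hb' h))]
      field_simp
    have h2 : a - b ≤ d ^ γ * a ^ (1 - γ) := by
      rcases (sub_nonneg.2 h).eq_or_lt with h0 | h0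
      · rw [← h0]; positivity
      · calc a - b = (a - b) ^ γ * (a - b) ^ (1 - γ) := by
              rw [← Real.rpow_add h0]; simp
          _ ≤ d ^ γ * a ^ (1 - γ) := by
              have : 0 ≤ 1 - γ := by linarith
              gcongr
              linarith
    have h3 : a ^ (1 - γ) * (a⁻¹ * b⁻¹) ≤ b ^ (-(1 + γ)) := by
      have e1 : a ^ (1 - γ) * a⁻¹ = a ^ (-γ) := by
        rw [← Real.rpow_neg_one a, ← Real.rpow_add ha']; congr 1; ring
      have e2 : b ^ (-γ) * b⁻¹ = b ^ (-(1 + γ)) := by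
        rw [← Real.rpow_neg_one b, ← Real.rpow_add hb']; congr 1; ring
      rw [← mul_assoc, e1, ← e2]
      refine mul_le_mul_of_nonneg_right ?_ (by positivity)
      exact Real.rpow_le_rpow_of_nonpos hb' h (by linarith)
    rw [h1]
    calc (a - b) * (a⁻¹ * b⁻¹) ≤ d ^ γ * a ^ (1 - γ) * (a⁻¹ * b⁻¹) := by gcongr
      _ = d ^ γ * (a ^ (1 - γ) * (a⁻¹ * b⁻¹)) := by ring
      _ ≤ d ^ γ * (a ^ (-(1 + γ)) + b ^ (-(1 + γ))) := by
        gcongr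
        exact h3.trans (le_add_of_nonneg_left (by positivity))

/-- Locally bounded functions in `L^{3/2}`. -/
structure IsLocDensity (f : Plane → ℝ) : Prop where
  memLp : MemLp f (3 / 2) volume
  bound : ∀ r : ℝ, ∃ M : ℝ, 0 ≤ M ∧ ∀ᵐ y, ‖y‖ ≤ r → |f y| ≤ M

theorem integrable_indicator_rpow {a : ℝ} (ha : a < 2) :
    Integrable ((Metric.ball (0 : Plane) 1).indicator fun h => ‖h‖ ^ (-a)) volume := by
  rw [integrable_indicator_iff measurableSet_ball]
  refine integrableOn_ball_of_norm_le_rpow (C := 1) (α := a) (by simp) (by simpa using ha)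
    (ae_of_all _ fun x => ?_) (Measurable.aestronglyMeasurable (by fun_prop))
  rw [one_mul, Real.norm_of_nonneg (by positivity)]

/-- Near x, f is bounded and the singularity has exponent a < 2. Away from x the kernel is at most a
multiple of (1 + |y|²)^{-1/2}, an L³ function, to be paired with f ∈ L^{3/2}. -/
theorem IsLocDensity.riesz_bound {f : Plane → ℝ} (hf : IsLocDensity f) {a : ℝ} (ha1 : 1 ≤ a)
    (ha2 : a < 2) (r : ℝ) : ∃ C : ℝ, 0 ≤ C ∧ ∀ x : Plane, ‖x‖ ≤ r →
      Integrable (fun y => |f y| * ‖x - y‖ ^ (-a)) volume ∧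
        ∫ y, |f y| * ‖x - y‖ ^ (-a) ≤ C := by
  obtain ⟨M, hM0, hM⟩ := hf.bound (r + 1)
  set N : Plane → ℝ := (Metric.ball (0 : Plane) 1).indicator fun h => ‖h‖ ^ (-a) with hN
  have hNi : Integrable N volume := integrable_indicator_rpow ha2
  have hN0 : ∀ h, 0 ≤ N h := fun h => Set.indicator_nonneg (fun h _ => by positivity) h
  have hfe : Integrable (fun y => |f y| * coulomb 1 0 y) volume :=
    hf.memLp.norm.integrable_mul (memLp_coulomb_three one_pos 0)
  have hfe0 : ∀ y, 0 ≤ |f y| * coulomb 1 0 y := fun y =>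
    mul_nonneg (abs_nonneg _) (coulomb_pos one_pos 0 y).le
  have hmaj : ∀ x : Plane, ‖x‖ ≤ r → ∀ᵐ y, |f y| * ‖x - y‖ ^ (-a) ≤
      M * N (x - y) + (|r| + 2) * (|f y| * coulomb 1 0 y) := by
    intro x hx
    filter_upwards [hM] with y hy
    have hxy : ‖y‖ ≤ ‖x‖ + ‖x - y‖ := by
      have := norm_sub_le x (x - y); rwa [sub_sub_cancel] at this
    rcases lt_or_ge ‖x - y‖ 1 with h | h
    · have h1 : N (x - y) = ‖x - y‖ ^ (-a) :=
        Set.indicator_of_mem (by simpa using h) _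
      rw [h1]
      have := hy (by linarith)
      have h2 : |f y| * ‖x - y‖ ^ (-a) ≤ M * ‖x - y‖ ^ (-a) := by gcongr
      have h3 : 0 ≤ (|r| + 2) * (|f y| * coulomb 1 0 y) := mul_nonneg (by positivity) (hfe0 y)
      linarith
    · have h0 : 0 < ‖x - y‖ := one_pos.trans_le h
      have h1 : ‖x - y‖ ^ (-a) ≤ ‖x - y‖⁻¹ := by
        rw [← Real.rpow_neg_one]
        exact Real.rpow_le_rpow_of_exponent_le h (by linarith)
      have h2 : ‖x - y‖⁻¹ ≤ (|r| + 2) * coulomb 1 0 y := by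
        have h4 : Real.sqrt (‖y - 0‖ ^ 2 + 1 ^ 2) ≤ (|r| + 2) * ‖x - y‖ := by
          have h5 : Real.sqrt (‖y - 0‖ ^ 2 + 1 ^ 2) ≤ ‖y‖ + 1 := by
            rw [sub_zero]
            exact Real.sqrt_le_iff.2 ⟨by positivity, by nlinarith [norm_nonneg y]⟩
          have h6 : ‖y‖ + 1 ≤ (|r| + 2) * ‖x - y‖ := by
            have := le_abs_self r
            nlinarith [abs_nonneg r]
          exact h5.trans h6
        rw [coulomb, ← div_eq_mul_inv, le_div_iff₀ (sqrt_reg_pos one_pos 0 y), mul_comm,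
          ← div_eq_mul_inv, div_le_iff₀ h0]
        exact h4
      calc |f y| * ‖x - y‖ ^ (-a) ≤ |f y| * ((|r| + 2) * coulomb 1 0 y) := by
            gcongr; exact h1.trans h2
        _ = 0 + (|r| + 2) * (|f y| * coulomb 1 0 y) := by ring
        _ ≤ _ := by
            gcongr
            exact mul_nonneg hM0 (hN0 _)
  have hmi : ∀ x, Integrable (fun y => M * N (x - y) + (|r| + 2) * (|f y| * coulomb 1 0 y))
      volume := fun x => ((hNi.comp_sub_left x).const_mul M).add (hfe.const_mul _)
  refine ⟨M * (∫ h, N h) + (|r| + 2) * ∫ y, |f y| * coulomb 1 0 y,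
    add_nonneg (mul_nonneg hM0 (integral_nonneg hN0))
      (mul_nonneg (by positivity) (integral_nonneg hfe0)), fun x hx => ⟨?_, ?_⟩⟩
  · refine (hmi x).mono' ?_ ?_
    · exact hf.memLp.1.norm.mul (Measurable.aestronglyMeasurable (by fun_prop))
    · filter_upwards [hmaj x hx] with y hy
      rwa [Real.norm_of_nonneg (by positivity)]
  · refine (integral_mono_of_nonneg (ae_of_all _ fun y => by positivity) (hmi x)
      (hmaj x hx)).trans (le_of_eq ?_)
    rw [integral_add ((hNi.comp_sub_left x).const_mul M) (hfe.const_mul _), integral_const_mul,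
      integral_const_mul, integral_sub_left_eq_self N volume x]

/-- The (unnormalized) Riesz potential of order one. -/
def rieszPotential (f : Plane → ℝ) (x : Plane) : ℝ := ∫ y, f y * ‖x - y‖⁻¹

theorem IsLocDensity.integrable {f : Plane → ℝ} (hf : IsLocDensity f) (x : Plane) :
    Integrable (fun y => f y * ‖x - y‖⁻¹) volume := by
  obtain ⟨C, -, hC⟩ := hf.riesz_bound le_rfl one_lt_two ‖x‖
  refine (hC x le_rfl).1.mono (hf.memLp.1.mul ?_) (ae_of_all _ fun y => ?_)
  · exact Measurable.aestronglyMeasurable (by fun_prop)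
  · rw [norm_mul, norm_mul, Real.rpow_neg_one, Real.norm_eq_abs, Real.norm_eq_abs |f y|, abs_abs]

theorem IsLocDensity.abs_rieszPotential_le {f : Plane → ℝ} (hf : IsLocDensity f) (r : ℝ) :
    ∃ C : ℝ, 0 ≤ C ∧ ∀ x : Plane, ‖x‖ ≤ r → ∫ y, |f y| * ‖x - y‖⁻¹ ≤ C ∧
      |rieszPotential f x| ≤ C := by
  obtain ⟨C, hC0, hC⟩ := hf.riesz_bound le_rfl one_lt_two r
  refine ⟨C, hC0, fun x hx => ?_⟩
  have h1 := (hC x hx).2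
  simp only [Real.rpow_neg_one] at h1
  refine ⟨h1, (abs_integral_le_integral_abs).trans (le_trans (le_of_eq ?_) h1)⟩
  congr 1
  funext y
  rw [abs_mul, abs_of_nonneg (by positivity : 0 ≤ ‖x - y‖⁻¹)]

theorem abs_norm_sub_sub_le (x x' y : Plane) : |‖x - y‖ - ‖x' - y‖| ≤ ‖x - x'‖ := by
  refine (abs_norm_sub_norm_le _ _).trans (le_of_eq ?_)
  rw [sub_sub_sub_cancel_right]

theorem IsLocDensity.abs_rieszPotential_sub_le {f : Plane → ℝ} (hf : IsLocDensity f) {γ : ℝ}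
    (hγ0 : 0 < γ) (hγ1 : γ < 1) (r : ℝ) : ∃ C : ℝ, 0 ≤ C ∧ ∀ x x' : Plane, ‖x‖ ≤ r → ‖x'‖ ≤ r →
      |rieszPotential f x - rieszPotential f x'| ≤ C * ‖x - x'‖ ^ γ := by
  obtain ⟨C, hC0, hC⟩ := hf.riesz_bound (a := 1 + γ) (by linarith) (by linarith) r
  refine ⟨2 * C, by positivity, fun x x' hx hx' => ?_⟩
  obtain ⟨i1, j1⟩ := hC x hx
  obtain ⟨i2, j2⟩ := hC x' hx'
  rw [rieszPotential, rieszPotential, ← integral_sub (hf.integrable x) (hf.integrable x')]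
  refine (abs_integral_le_integral_abs).trans ?_
  have h1 : ∫ y, |f y * ‖x - y‖⁻¹ - f y * ‖x' - y‖⁻¹| ≤ ∫ y, ‖x - x'‖ ^ γ *
      (|f y| * ‖x - y‖ ^ (-(1 + γ)) + |f y| * ‖x' - y‖ ^ (-(1 + γ))) := by
    refine integral_mono_of_nonneg (ae_of_all _ fun y => abs_nonneg _) ((i1.add i2).const_mul _)
      (ae_of_all _ fun y => ?_)
    simp only
    rw [← mul_sub, abs_mul, ← mul_add, mul_left_comm]
    gcongr
    exact abs_inv_sub_inv_le (norm_nonneg _) (norm_nonneg _) (abs_norm_sub_sub_le x x' y) hγ0 hγ1.le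
  refine h1.trans ?_
  rw [integral_const_mul, integral_add i1 i2, mul_comm]
  gcongr
  linarith

/-- The factor z^{1/2} gains half a power of the distance, so the difference of kernels is linear in
d while the singularity stays at the integrable exponent 3/2. -/
theorem abs_mul_le_of_half_holder {a b d z : ℝ} (ha : 0 ≤ a) (hb : 0 ≤ b) (hd : |a - b| ≤ d)
    (hz0 : 0 ≤ z) (hz : z ≤ max a b) :
    z ^ (1 / 2 : ℝ) * |a⁻¹ - b⁻¹| ≤ d * (a ^ (-(3 / 2) : ℝ) + b ^ (-(3 / 2) : ℝ)) := by
  wlog h : b ≤ a generalizing a b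
  · have := this hb ha (by rwa [abs_sub_comm]) (by rwa [max_comm]) (le_of_not_ge h)
    rwa [abs_sub_comm, add_comm (b ^ _)] at this
  rw [max_eq_left h] at hz
  have hd0 : 0 ≤ d := (abs_nonneg _).trans hd
  rcases ha.eq_or_lt with rfl | ha'
  · have : b = 0 := le_antisymm h hb
    subst this
    simp only [sub_self, abs_zero, mul_zero]
    exact mul_nonneg hd0 (by positivity)
  have h0 : z ^ (1 / 2 : ℝ) ≤ a ^ (1 / 2 : ℝ) := by gcongr
  rcases hb.eq_or_lt with rfl | hb'
  · rw [inv_zero, sub_zero, abs_of_pos (inv_pos.2 ha'), Real.zero_rpow (by norm_num), add_zero]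
    have had : a ≤ d := by simpa [abs_of_pos ha'] using hd
    calc z ^ (1 / 2 : ℝ) * a⁻¹ ≤ a ^ (1 / 2 : ℝ) * a⁻¹ := by gcongr
      _ = a * a ^ (-(3 / 2) : ℝ) := by
        rw [← Real.rpow_neg_one a, ← Real.rpow_add ha']
        nth_rewrite 2 [← Real.rpow_one a]
        rw [← Real.rpow_add ha']; norm_num
      _ ≤ d * a ^ (-(3 / 2) : ℝ) := by gcongr
  · rw [abs_of_nonneg (sub_nonneg.2 h)] at hd
    have h1 : |a⁻¹ - b⁻¹| = (a - b) * (a⁻¹ * b⁻¹) := by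
      rw [abs_sub_comm, abs_of_nonneg (sub_nonneg.2 (inv_anti₀ hb' h))]
      field_simp
    have h3 : a ^ (1 / 2 : ℝ) * (a⁻¹ * b⁻¹) ≤ b ^ (-(3 / 2) : ℝ) := by
      have e1 : a ^ (1 / 2 : ℝ) * a⁻¹ = a ^ (-(1 / 2) : ℝ) := by
        rw [← Real.rpow_neg_one a, ← Real.rpow_add ha']; norm_num
      have e2 : b ^ (-(1 / 2) : ℝ) * b⁻¹ = b ^ (-(3 / 2) : ℝ) := by
        rw [← Real.rpow_neg_one b, ← Real.rpow_add hb']; norm_num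
      rw [← mul_assoc, e1, ← e2]
      refine mul_le_mul_of_nonneg_right ?_ (by positivity)
      exact Real.rpow_le_rpow_of_nonpos hb' h (by norm_num)
    rw [h1]
    calc z ^ (1 / 2 : ℝ) * ((a - b) * (a⁻¹ * b⁻¹)) ≤ a ^ (1 / 2 : ℝ) * (d * (a⁻¹ * b⁻¹)) := by gcongr
      _ = d * (a ^ (1 / 2 : ℝ) * (a⁻¹ * b⁻¹)) := by ring
      _ ≤ _ := by
        gcongr
        exact h3.trans (le_add_of_nonneg_left (by positivity))

theorem isLocDensity_indicator_ball (m : Plane) (r : ℝ) :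
    IsLocDensity ((Metric.ball m r).indicator fun _ => 1) := by
  refine ⟨memLp_indicator_const _ measurableSet_ball _ (Or.inr measure_ball_lt_top.ne), fun R =>
    ⟨1, zero_le_one, ae_of_all _ fun y _ => ?_⟩⟩
  by_cases h : y ∈ Metric.ball m r <;> simp [h]

/-- The reflection y ↦ x + x' − y preserves the ball and exchanges the distances to x and x'. -/
theorem integral_indicator_ball_midpoint (x x' : Plane) (r : ℝ) :
    ∫ y, (Metric.ball ((1 / 2 : ℝ) • (x + x')) r).indicator (fun _ => (1 : ℝ)) y * ‖x - y‖⁻¹ =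
      ∫ y, (Metric.ball ((1 / 2 : ℝ) • (x + x')) r).indicator (fun _ => (1 : ℝ)) y *
        ‖x' - y‖⁻¹ := by
  rw [← integral_sub_left_eq_self _ volume (x + x')]
  congr 1
  funext y
  have h1 : ‖x - (x + x' - y)‖ = ‖x' - y‖ := by
    rw [← norm_neg]; congr 1; abel
  have h2 : x + x' - y ∈ Metric.ball ((1 / 2 : ℝ) • (x + x')) r ↔
      y ∈ Metric.ball ((1 / 2 : ℝ) • (x + x')) r := by
    rw [Metric.mem_ball, Metric.mem_ball, dist_eq_norm, dist_eq_norm, ← norm_neg]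
    have : -(x + x' - y - (1 / 2 : ℝ) • (x + x')) = y - (1 / 2 : ℝ) • (x + x') := by
      module
    rw [this]
  rw [h1]
  by_cases h : y ∈ Metric.ball ((1 / 2 : ℝ) • (x + x')) r
  · rw [Set.indicator_of_mem h, Set.indicator_of_mem (h2.2 h)]
  · rw [Set.indicator_of_notMem h, Set.indicator_of_notMem (mt h2.1 h)]

/-- The Riesz potential of a locally Hölder continuous function is locally Lipschitz. -/
theorem IsLocDensity.abs_rieszPotential_sub_le_norm {f : Plane → ℝ} (hf : IsLocDensity f)
    (hh : ∀ r : ℝ, ∃ L : ℝ, 0 ≤ L ∧ ∀ x y : Plane, ‖x‖ ≤ r → ‖y‖ ≤ r →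
      |f x - f y| ≤ L * ‖x - y‖ ^ (1 / 2 : ℝ)) (r : ℝ) :
    ∃ C : ℝ, 0 ≤ C ∧ ∀ x x' : Plane, ‖x‖ ≤ r → ‖x'‖ ≤ r →
      |rieszPotential f x - rieszPotential f x'| ≤ C * ‖x - x'‖ := by
  obtain ⟨C₁, hC₁0, hC₁⟩ := hf.riesz_bound (a := 1) le_rfl one_lt_two r
  obtain ⟨C₂, hC₂0, hC₂⟩ := (isLocDensity_indicator_ball 0 (r + 1)).riesz_bound (a := 3 / 2)
    (by norm_num) (by norm_num) r
  obtain ⟨L, hL0, hL⟩ := hh (r + 1)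
  obtain ⟨C₃, hC₃0, hC₃⟩ := hf.abs_rieszPotential_le r
  refine ⟨2 * C₁ + 2 * L * C₂ + 2 * C₃, by positivity, fun x x' hx hx' => ?_⟩
  set d := ‖x - x'‖ with hd
  have hd0 : 0 ≤ d := norm_nonneg _
  -- For d ≥ 1 the uniform bound suffices. For d < 1 both points lie within 1/2 of the midpoint, so
  -- outside the unit ball around it the kernels are far from their singularities.
  rcases le_or_gt 1 d with h1d | h1d
  · have h1 := (hC₃ x hx).2
    have h2 := (hC₃ x' hx').2
    have h3 := abs_sub (rieszPotential f x) (rieszPotential f x')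
    have h4 : 2 * C₃ * 1 ≤ 2 * C₃ * d := by gcongr
    nlinarith [mul_nonneg hC₁0 hd0, mul_nonneg (mul_nonneg hL0 hC₂0) hd0]
  set m : Plane := (1 / 2 : ℝ) • (x + x') with hm
  have hmr : ‖m‖ ≤ r := by
    rw [hm, norm_smul]
    have := norm_add_le x x'
    norm_num
    linarith
  -- The indicator χ has equal potentials at x and x', so subtracting f(m)χ changes nothing, while
  -- near the midpoint f is replaced by f − f(m), of size |y − m|^{1/2}.
  set χ : Plane → ℝ := (Metric.ball m 1).indicator fun _ => 1 with hχ
  set χ₀ : Plane → ℝ := (Metric.ball (0 : Plane) (r + 1)).indicator fun _ => 1 with hχ₀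
  have hχi := fun z => (isLocDensity_indicator_ball m 1).integrable z
  rw [← hχ] at hχi
  have hsym := integral_indicator_ball_midpoint x x' 1
  rw [← hm, ← hχ] at hsym
  have e1 : rieszPotential f x - rieszPotential f x' =
      ∫ y, (f y - f m * χ y) * (‖x - y‖⁻¹ - ‖x' - y‖⁻¹) := by
    have e2 : (fun y => (f y - f m * χ y) * (‖x - y‖⁻¹ - ‖x' - y‖⁻¹)) =
        fun y => (f y * ‖x - y‖⁻¹ - f y * ‖x' - y‖⁻¹) -
          f m * (χ y * ‖x - y‖⁻¹ - χ y * ‖x' - y‖⁻¹) := by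
      funext y; ring
    have i4 : Integrable (fun y => f y * ‖x - y‖⁻¹ - f y * ‖x' - y‖⁻¹) volume :=
      (hf.integrable x).sub (hf.integrable x')
    have i5 : Integrable (fun y => f m * (χ y * ‖x - y‖⁻¹ - χ y * ‖x' - y‖⁻¹)) volume :=
      ((hχi x).sub (hχi x')).const_mul _
    rw [e2, integral_sub i4 i5, integral_sub (hf.integrable x) (hf.integrable x'),
      integral_const_mul, integral_sub (hχi x) (hχi x'), hsym]
    simp [rieszPotential]
  obtain ⟨i1, j1⟩ := hC₁ x hx
  obtain ⟨i2, j2⟩ := hC₂ x hx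
  obtain ⟨i3, j3⟩ := hC₂ x' hx'
  rw [e1]
  refine (abs_integral_le_integral_abs).trans ?_
  have h1 : ∫ y, |(f y - f m * χ y) * (‖x - y‖⁻¹ - ‖x' - y‖⁻¹)| ≤
      ∫ y, (2 * d * (|f y| * ‖x - y‖ ^ (-1 : ℝ)) + L * d *
        (|χ₀ y| * ‖x - y‖ ^ (-(3 / 2) : ℝ) + |χ₀ y| * ‖x' - y‖ ^ (-(3 / 2) : ℝ))) := by
    refine integral_mono_of_nonneg (ae_of_all _ fun y => abs_nonneg _)
      ((i1.const_mul _).add ((i2.add i3).const_mul _)) (ae_of_all _ fun y => ?_)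
    simp only
    have hab := abs_norm_sub_sub_le x x' y
    rw [← hd] at hab
    rw [abs_mul]
    have hmx : ‖m - x‖ ≤ 1 / 2 := by
      have : m - x = -(1 / 2 : ℝ) • (x - x') := by rw [hm]; module
      rw [this, norm_smul, ← hd]; norm_num; linarith
    have hmx' : ‖m - x'‖ ≤ 1 / 2 := by
      have : m - x' = (1 / 2 : ℝ) • (x - x') := by rw [hm]; module
      rw [this, norm_smul, ← hd]; norm_num; linarith
    by_cases hy : y ∈ Metric.ball m 1
    · have hχy : χ y = 1 := Set.indicator_of_mem hy _
      have hym : ‖y - m‖ < 1 := by rwa [Metric.mem_ball, dist_eq_norm] at hy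
      have hyr : ‖y‖ < r + 1 := by
        have := norm_add_le (y - m) m
        rw [sub_add_cancel] at this; linarith
      have hχ₀y : χ₀ y = 1 := Set.indicator_of_mem (by simpa using hyr) _
      rw [hχy, hχ₀y, mul_one, abs_one, one_mul, one_mul]
      have hz : ‖y - m‖ ≤ max ‖x - y‖ ‖x' - y‖ := by
        have : y - m = -(1 / 2 : ℝ) • ((x - y) + (x' - y)) := by rw [hm]; module
        rw [this, norm_smul, Real.norm_eq_abs, abs_neg, abs_of_pos (by norm_num : (0 : ℝ) < 1 / 2)]
        have h5 := norm_add_le (x - y) (x' - y)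
        have h6 := le_max_left ‖x - y‖ ‖x' - y‖
        have h7 := le_max_right ‖x - y‖ ‖x' - y‖
        linarith
      have h5 := abs_mul_le_of_half_holder (norm_nonneg _) (norm_nonneg _) hab (norm_nonneg _) hz
      have h6 := hL y m hyr.le (by linarith)
      calc |f y - f m| * |‖x - y‖⁻¹ - ‖x' - y‖⁻¹|
          ≤ L * ‖y - m‖ ^ (1 / 2 : ℝ) * |‖x - y‖⁻¹ - ‖x' - y‖⁻¹| := by gcongr
        _ = L * (‖y - m‖ ^ (1 / 2 : ℝ) * |‖x - y‖⁻¹ - ‖x' - y‖⁻¹|) := by ring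
        _ ≤ L * (d * (‖x - y‖ ^ (-(3 / 2) : ℝ) + ‖x' - y‖ ^ (-(3 / 2) : ℝ))) := by gcongr
        _ = 0 + L * d * (‖x - y‖ ^ (-(3 / 2) : ℝ) + ‖x' - y‖ ^ (-(3 / 2) : ℝ)) := by ring
        _ ≤ _ := by
          gcongr
          positivity
    · have hχy : χ y = 0 := Set.indicator_of_notMem hy _
      have hym : 1 ≤ ‖y - m‖ := by rwa [Metric.mem_ball, dist_eq_norm, not_lt] at hy
      have ha : 1 / 2 ≤ ‖x - y‖ := by
        have := norm_add_le (m - x) (x - y)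
        rw [sub_add_sub_cancel, norm_sub_rev] at this; linarith
      have hb : 1 / 2 ≤ ‖x' - y‖ := by
        have := norm_add_le (m - x') (x' - y)
        rw [sub_add_sub_cancel, norm_sub_rev] at this; linarith
      have ha' : 0 < ‖x - y‖ := by linarith
      have hb' : 0 < ‖x' - y‖ := by linarith
      rw [hχy, mul_zero, sub_zero, Real.rpow_neg_one]
      have h5 : |‖x - y‖⁻¹ - ‖x' - y‖⁻¹| ≤ 2 * d * ‖x - y‖⁻¹ := by
        rw [inv_sub_inv ha'.ne' hb'.ne', abs_div, abs_of_pos (mul_pos ha' hb'), abs_sub_comm,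
          div_le_iff₀ (mul_pos ha' hb')]
        calc |‖x - y‖ - ‖x' - y‖| ≤ d * 1 := by rw [mul_one]; exact hab
          _ ≤ d * (2 * ‖x' - y‖) := by gcongr; linarith
          _ = 2 * d * ‖x - y‖⁻¹ * (‖x - y‖ * ‖x' - y‖) := by field_simp
      calc |f y| * |‖x - y‖⁻¹ - ‖x' - y‖⁻¹| ≤ |f y| * (2 * d * ‖x - y‖⁻¹) := by gcongr
        _ = 2 * d * (|f y| * ‖x - y‖⁻¹) + 0 := by ring
        _ ≤ _ := by
          gcongr
          positivity
  refine h1.trans ?_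
  have i4 : Integrable (fun y => L * d * (|χ₀ y| * ‖x - y‖ ^ (-(3 / 2) : ℝ) +
      |χ₀ y| * ‖x' - y‖ ^ (-(3 / 2) : ℝ))) volume := (i2.add i3).const_mul _
  rw [integral_add (i1.const_mul _) i4, integral_const_mul,
    integral_const_mul, integral_add i2 i3]
  have h2 : 2 * d * (∫ y, |f y| * ‖x - y‖ ^ (-1 : ℝ)) ≤ 2 * d * C₁ := by gcongr
  have h3 : L * d * ((∫ y, |χ₀ y| * ‖x - y‖ ^ (-(3 / 2) : ℝ)) +
      ∫ y, |χ₀ y| * ‖x' - y‖ ^ (-(3 / 2) : ℝ)) ≤ L * d * (C₂ + C₂) := by gcongr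
  nlinarith [mul_nonneg hC₃0 hd0]

/-! ### The integral representation of the solution -/

theorem continuous_poisson_uncurry {s : ℝ} (hs : 0 < s) :
    Continuous fun p : Plane × Plane => poisson s p.1 p.2 := by
  unfold poisson
  exact continuous_const.mul (Continuous.inv₀ (by fun_prop) fun p =>
    (pow_pos (sqrt_reg_pos hs p.1 p.2) 3).ne')

theorem continuous_coulomb_uncurry {s : ℝ} (hs : 0 < s) :
    Continuous fun p : Plane × Plane => coulomb s p.1 p.2 := by
  unfold coulomb
  exact Continuous.inv₀ (by fun_prop) fun p => (sqrt_reg_pos hs p.1 p.2).ne'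

theorem aestronglyMeasurable_integral_mul {g : Plane → ℝ} (hg : AEStronglyMeasurable g volume)
    {k : Plane → Plane → ℝ} (hk : Continuous fun p : Plane × Plane => k p.1 p.2) :
    AEStronglyMeasurable (fun x => ∫ y, g y * k x y) volume :=
  AEStronglyMeasurable.integral_prod_right' (f := fun p : Plane × Plane => g p.2 * k p.1 p.2)
    (hg.comp_snd.mul hk.aestronglyMeasurable)

theorem memLp_of_integrable_of_bound {f : Plane → ℝ} (hf : Integrable f volume) {M : ℝ}
    (hM : ∀ x, |f x| ≤ M) {p : ℝ≥0∞} (hp : 1 ≤ p) (hp' : p ≠ ⊤) : MemLp f p volume := by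
  have h1 : 1 ≤ p.toReal := by
    rwa [← ENNReal.toReal_one, ENNReal.toReal_le_toReal ENNReal.one_ne_top hp']
  rw [← integrable_norm_rpow_iff hf.1 (by positivity) hp']
  refine (hf.norm.const_mul (M ^ (p.toReal - 1))).mono'
    ((hf.1.norm.aemeasurable.pow_const _).aestronglyMeasurable) (ae_of_all _ fun x => ?_)
  rw [Real.norm_of_nonneg (by positivity)]
  rcases (norm_nonneg (f x)).eq_or_lt with h | h
  · rw [← h, Real.zero_rpow (by linarith), mul_zero]
  · have h2 : ‖f x‖ ^ p.toReal = ‖f x‖ ^ (p.toReal - 1) * ‖f x‖ := by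
      rw [← Real.rpow_add_one h.ne', sub_add_cancel]
    rw [h2]
    have := hM x
    rw [← Real.norm_eq_abs] at this
    gcongr

theorem poisson_le {s : ℝ} (hs : 0 < s) (c x : Plane) : poisson s c x ≤ s * s⁻¹ ^ 3 := by
  rw [poisson_eq_coulomb]
  have := coulomb_le hs c x
  have := (coulomb_pos hs c x).le
  gcongr

theorem memLp_poisson {s : ℝ} (hs : 0 < s) (c : Plane) {p : ℝ≥0∞} (hp : 1 ≤ p) (hp' : p ≠ ⊤) :
    MemLp (poisson s c) p volume :=
  memLp_of_integrable_of_bound (integral_poisson hs c).1 (M := s * s⁻¹ ^ 3) (fun x => by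
    rw [abs_of_pos (poisson_pos hs c x)]; exact poisson_le hs c x) hp hp'

theorem one_le_four_thirds : (1 : ℝ≥0∞) ≤ 4 / 3 := by
  rw [ENNReal.le_div_iff_mul_le (by norm_num) (by norm_num)]; norm_num

theorem four_thirds_ne_top : (4 / 3 : ℝ≥0∞) ≠ ⊤ := ENNReal.div_ne_top (by norm_num) (by norm_num)

/-- The formula passes to the completion because P_s lies in L^{4/3} and the approximants converge
in L⁴. -/
theorem hdotInner_coulomb_memHdot {φ : Plane → ℝ} (hφ : MemHdot φ) {s : ℝ} (hs : 0 < s)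
    (c : Plane) : hdotInner (coulomb s c) φ = ∫ y, poisson s c y * φ y := by
  obtain ⟨ψ, hψ, h4, hg, -⟩ := hφ.exists_seq
  have hp := memLp_poisson hs c one_le_four_thirds four_thirds_ne_top
  have hψ4 : ∀ n, MemLp (ψ n) 4 volume := fun n => (hψ n).isLipc.memLp 4
  refine tendsto_nhds_unique (tendsto_hdotInner_of_gagliardo (finiteEnergy_coulomb hs c)
    (fun n => (hψ n).isLipc.finiteEnergy) hφ.finiteEnergy hg) ?_
  simp only [fun n => hdotInner_coulomb (hψ n).isLipc hs c]
  refine tendsto_integral_of_L1' (fun y => poisson s c y * φ y) (hp.1.mul hφ.1.1)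
    (Eventually.of_forall fun n => hp.integrable_mul (hψ4 n)) ?_
  have h1 : Tendsto (fun n => eLpNorm (poisson s c) (4 / 3) volume *
      eLpNorm (ψ n - φ) 4 volume) atTop (𝓝 0) := by
    have := ENNReal.Tendsto.const_mul (a := eLpNorm (poisson s c) (4 / 3) volume) h4
      (Or.inr hp.2.ne)
    rwa [mul_zero] at this
  refine tendsto_of_tendsto_of_tendsto_of_le_of_le tendsto_const_nhds h1 (fun n => zero_le)
    fun n => ?_
  refine le_trans (le_of_eq ?_) (eLpNorm_smul_le_mul_eLpNorm (r := 1) ((hψ4 n).sub hφ.1).1 hp.1)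
  congr 1
  funext y
  simp [mul_sub]

/-- Test the equation with k_s: this is the regularized form of 2π(V − u) = f ∗ |x|⁻¹. -/
theorem IsGround.integral_poisson_mul {V u : Plane → ℝ} (h : IsGround V u) (hV : MemHdot V)
    {s : ℝ} (hs : 0 < s) (c : Plane) :
    ∫ y, (V - u) y * poisson s c y = ∫ y, |u y| * u y * coulomb s c y := by
  have h1 := h.eq_isWeakLimit hV.finiteEnergy (isWeakLimit_coulomb hs c)
  have h2 := hdotInner_coulomb_memHdot (hV.sub h.memHdot) hs c
  rw [hdotInner_comm, hdotInner_sub_left (finiteEnergy_coulomb hs c) hV.finiteEnergy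
    h.finiteEnergy] at h2
  simp only [mul_comm _ (poisson _ _ _)]
  linarith

theorem tendsto_poisson_integral {ψ : Plane → ℝ} (hψ : Integrable ψ volume)
    {y : Plane} (hc : ContinuousAt ψ y) : Tendsto (fun n : ℕ => ∫ c, ψ c * poisson (1 / ((n : ℝ) + 1)) y c) atTop
      (𝓝 (2 * Real.pi * ψ y)) := by
  have hπ := Real.pi_pos
  have h := tendsto_integral_comp_smul_smul_of_integrable' (μ := (volume : Measure Plane))
    (φ := fun x => (2 * Real.pi)⁻¹ * poisson 1 0 x) (g := ψ) (x₀ := y)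
    (fun x => mul_nonneg (by positivity) (poisson_pos one_pos 0 x).le)
    (by rw [integral_const_mul, (integral_poisson one_pos 0).2]; field_simp) ?_ hψ hc
  · have h2 : Tendsto (fun n : ℕ => (n : ℝ) + 1) atTop atTop :=
      tendsto_atTop_add_const_right _ _ tendsto_natCast_atTop_atTop
    have h3 := (h.comp h2).const_mul (2 * Real.pi)
    refine h3.congr fun n => ?_
    simp only [Function.comp]
    rw [← integral_const_mul]
    congr 1
    funext x
    have hn : 0 < (n : ℝ) + 1 := by positivity
    set t := (n : ℝ) + 1
    have h4 : Real.sqrt (‖t • (y - x) - 0‖ ^ 2 + 1 ^ 2) =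
        t * Real.sqrt (‖x - y‖ ^ 2 + (1 / t) ^ 2) := by
      rw [sub_zero, norm_smul, Real.norm_of_nonneg hn.le, norm_sub_rev y x]
      nth_rewrite 2 [← Real.sqrt_sq hn.le]
      rw [← Real.sqrt_mul (by positivity)]
      congr 1
      field_simp
    have h5 := sqrt_reg_pos (one_div_pos.2 hn) y x
    rw [poisson, poisson, h4, smul_eq_mul]
    simp only [finrank_euclideanSpace, Fintype.card_fin]
    field_simp
  · have h1 : Tendsto (fun x : Plane => (2 * Real.pi)⁻¹ * ‖x‖⁻¹) (Bornology.cobounded Plane)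
        (𝓝 0) := by
      have := (tendsto_inv_atTop_zero.comp
        (tendsto_norm_cobounded_atTop (E := Plane))).const_mul (2 * Real.pi)⁻¹
      rwa [mul_zero] at this
    refine tendsto_of_tendsto_of_tendsto_of_le_of_le' tendsto_const_nhds h1
      (Eventually.of_forall fun x => ?_) ?_
    · exact mul_nonneg (by positivity) (mul_nonneg (by positivity) (poisson_pos one_pos 0 x).le)
    · have h0 : ∀ᶠ x : Plane in Bornology.cobounded Plane, 0 < ‖x‖ :=
        (tendsto_norm_cobounded_atTop (E := Plane)).eventually_gt_atTop 0
      filter_upwards [h0] with x hx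
      simp only [finrank_euclideanSpace, Fintype.card_fin]
      rw [mul_left_comm]
      refine mul_le_mul_of_nonneg_left ?_ (by positivity)
      have h2 : ‖x‖ ≤ Real.sqrt (‖x - 0‖ ^ 2 + 1 ^ 2) :=
        Real.le_sqrt_of_sq_le (by rw [sub_zero]; linarith)
      rw [poisson, one_mul, ← div_eq_mul_inv, inv_eq_one_div, div_le_div_iff₀ (by positivity) hx,
        one_mul]
      calc ‖x‖ ^ 2 * ‖x‖ = ‖x‖ ^ 3 := by ring
        _ ≤ _ := by gcongr

/-- Compact support gives |ψ| ≤ B(k_1 − k_2), and the Poisson average of the right side is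
2πB(k_{1+t} − k_{2+t}), which is at most a multiple of P_1 for t < 1. The result is a majorant that
is independent of t. -/
theorem exists_poisson_integral_le {ψ : Plane → ℝ} (hc : Continuous ψ) (hs : HasCompactSupport ψ) :
    ∃ C : ℝ, 0 ≤ C ∧ ∀ (t : ℝ) (_ : 0 < t) (_ : t < 1) (y : Plane),
      Integrable (fun c => |ψ c| * poisson t y c) volume ∧
      ∫ c, |ψ c| * poisson t y c ≤ C * poisson 1 0 y := by
  have hdpos : ∀ c : Plane, 0 < coulomb 1 0 c - coulomb (1 + 1) 0 c := fun c => by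
    rw [coulomb_sub_coulomb one_pos zero_le_one]
    have := sqrt_reg_pos one_pos 0 c
    have := sqrt_reg_pos (two_pos : (0 : ℝ) < 2) 0 c
    positivity
  obtain ⟨B, hB⟩ := Continuous.bounded_above_of_compact_support
    (f := fun c => ψ c / (coulomb 1 0 c - coulomb (1 + 1) 0 c))
    (hc.div ((continuous_coulomb one_pos 0).sub (continuous_coulomb (by norm_num) 0))
      fun c => (hdpos c).ne') (by
        simp only [div_eq_mul_inv]
        exact hs.mul_right)
  have hB0 : 0 ≤ B := (norm_nonneg _).trans (hB 0)
  have hψ : ∀ c, |ψ c| ≤ B * (coulomb 1 0 c - coulomb (1 + 1) 0 c) := fun c => by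
    have := hB c
    rwa [norm_div, Real.norm_eq_abs, Real.norm_of_nonneg (hdpos c).le, div_le_iff₀ (hdpos c)] at this
  refine ⟨B * (2 * Real.pi * 3), by positivity, fun t ht ht1 y => ?_⟩
  obtain ⟨i1, j1⟩ := integral_poisson_mul_coulomb ht ht1 0 y
  obtain ⟨i2, j2⟩ := integral_poisson_mul_coulomb ht (by linarith : t < 1 + 1) 0 y
  have i3 : Integrable (fun c => B * (poisson t y c * coulomb 1 0 c -
      poisson t y c * coulomb (1 + 1) 0 c)) volume := (i1.sub i2).const_mul B
  have hle : ∀ c, |ψ c| * poisson t y c ≤ B * (poisson t y c * coulomb 1 0 c -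
      poisson t y c * coulomb (1 + 1) 0 c) := fun c => by
    have := mul_le_mul_of_nonneg_right (hψ c) (poisson_pos ht y c).le
    linarith
  have h0 : ∀ c, 0 ≤ |ψ c| * poisson t y c := fun c =>
    mul_nonneg (abs_nonneg _) (poisson_pos ht y c).le
  refine ⟨i3.mono' (hc.abs.mul (continuous_poisson ht y)).aestronglyMeasurable
    (ae_of_all _ fun c => by rw [Real.norm_of_nonneg (h0 c)]; exact hle c), ?_⟩
  refine (integral_mono_of_nonneg (ae_of_all _ h0) i3 (ae_of_all _ hle)).trans ?_
  rw [integral_const_mul, integral_sub i1 i2, j1, j2, mul_assoc B]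
  refine mul_le_mul_of_nonneg_left ?_ hB0
  have h1 := coulomb_sub_coulomb_le (s := 1 + t) (t := 1) (by linarith) zero_le_one (by linarith) 0 y
  have h2 := coulomb_sub_coulomb_nonneg (s := 1) (t := t) one_pos ht.le 0 y
  have h3 := (coulomb_pos (by linarith : 0 < 1 + t) 0 y).le
  have e : 1 + t + 1 = 1 + 1 + t := by ring
  rw [e] at h1
  have h4 : 1 * (3 / 2 * (1 + t) * coulomb (1 + t) 0 y ^ 3) ≤ 3 * poisson 1 0 y := by
    rw [poisson_eq_coulomb, one_mul, one_mul]
    have : coulomb (1 + t) 0 y ≤ coulomb 1 0 y := by linarith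
    gcongr
    linarith
  rw [← mul_sub, mul_assoc (2 * Real.pi) 3]
  refine mul_le_mul_of_nonneg_left ?_ (by positivity)
  exact h1.trans h4

theorem IsLocDensity.continuous_rieszPotential {f : Plane → ℝ} (hf : IsLocDensity f) :
    Continuous (rieszPotential f) := by
  refine continuous_iff_continuousAt.2 fun x => ?_
  obtain ⟨C, hC0, hC⟩ := hf.abs_rieszPotential_sub_le (γ := 1 / 2) (by norm_num) (by norm_num)
    (‖x‖ + 1)
  rw [ContinuousAt, tendsto_iff_norm_sub_tendsto_zero]
  have h1 : Tendsto (fun y : Plane => C * ‖y - x‖ ^ (1 / 2 : ℝ)) (𝓝 x) (𝓝 0) := by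
    have h2 : Tendsto (fun y : Plane => ‖y - x‖) (𝓝 x) (𝓝 0) := by
      have : Continuous fun y : Plane => ‖y - x‖ := by fun_prop
      simpa using this.tendsto x
    have h3 := (h2.rpow_const (p := 1 / 2) (Or.inr (by norm_num))).const_mul C
    rwa [Real.zero_rpow (by norm_num), mul_zero] at h3
  refine tendsto_of_tendsto_of_tendsto_of_le_of_le' tendsto_const_nhds h1
    (Eventually.of_forall fun y => norm_nonneg _) ?_
  filter_upwards [Metric.ball_mem_nhds x one_pos] with y hy
  rw [Metric.mem_ball, dist_eq_norm] at hy
  have := norm_add_le (y - x) x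
  rw [sub_add_cancel] at this
  exact hC y x (by linarith) (by linarith)

/-- The integral representation of the solution. -/
theorem IsGround.ae_eq_rieszPotential {V u : Plane → ℝ} (h : IsGround V u) (hV : MemHdot V)
    (hf : IsLocDensity fun x => |u x| * u x) :
    ∀ᵐ x, 2 * Real.pi * (V - u) x = rieszPotential (fun x => |u x| * u x) x := by
  have hφ4 : MemLp (V - u) 4 volume := hV.1.sub h.mem_four
  set φ := V - u with hφ
  set f : Plane → ℝ := fun x => |u x| * u x with hfdef
  -- No continuity of V or u is available here, so the identity is tested against ψ, and the Poisson
  -- average is moved onto ψ.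
  refine ae_eq_of_integral_contDiff_smul_eq
    ((hφ4.locallyIntegrable (by norm_num)).smul (2 * Real.pi))
    hf.continuous_rieszPotential.locallyIntegrable fun ψ hψ1 hψs => ?_
  have hψc : Continuous ψ := hψ1.continuous
  have hψi : Integrable ψ volume := hψc.integrable_of_hasCompactSupport hψs
  obtain ⟨C, hC0, hC⟩ := exists_poisson_integral_le hψc hψs
  -- The shift by one makes t n < 1 for all n, as the uniform majorant requires.
  set t : ℕ → ℝ := fun n => 1 / (((n + 1 : ℕ) : ℝ) + 1) with ht
  have ht0 : ∀ n, 0 < t n := fun n => by simp only [ht]; positivity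
  have ht1 : ∀ n, t n < 1 := fun n => by
    simp only [ht]; rw [div_lt_one (by positivity)]; push_cast; linarith [(Nat.cast_nonneg n : (0 : ℝ) ≤ n)]
  have htl : Tendsto t atTop (𝓝 0) :=
    (tendsto_one_div_add_atTop_nhds_zero_nat (𝕜 := ℝ)).comp (tendsto_add_atTop_nat 1)
  have hpφ : Integrable (fun y => |φ y| * poisson 1 0 y) volume :=
    (memLp_poisson one_pos 0 one_le_four_thirds four_thirds_ne_top).integrable_mul hφ4.norm |>.congr
      (ae_of_all _ fun y => mul_comm _ _)
  have hswap : ∀ n, ∫ c, ψ c * ∫ y, φ y * poisson (t n) c y =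
      ∫ y, φ y * ∫ c, ψ c * poisson (t n) y c := by
    intro n
    have hm : AEStronglyMeasurable (Function.uncurry fun c y : Plane =>
        ψ c * (φ y * poisson (t n) c y)) (volume.prod volume) :=
      (hψc.comp continuous_fst).aestronglyMeasurable.mul (hφ4.1.comp_snd.mul
        (continuous_poisson_uncurry (ht0 n)).aestronglyMeasurable)
    have hint : Integrable (Function.uncurry fun c y : Plane =>
        ψ c * (φ y * poisson (t n) c y)) (volume.prod volume) := by
      rw [integrable_prod_iff' hm]
      refine ⟨ae_of_all _ fun y => ?_, ?_⟩
      · refine (((hC (t n) (ht0 n) (ht1 n) y).1.const_mul (φ y)).mono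
          (show Continuous fun c => ψ c * (φ y * poisson (t n) c y) from
            hψc.mul (continuous_const.mul ((continuous_poisson (ht0 n) y).congr fun c =>
              poisson_comm _ _ _))).aestronglyMeasurable (ae_of_all _ fun c => le_of_eq ?_))
        simp only [Function.uncurry, norm_mul, Real.norm_eq_abs, abs_abs, poisson_comm (t n) c y]
        ring
      · refine (hpφ.const_mul C).mono' hm.norm.prod_swap.integral_prod_right'
          (ae_of_all _ fun y => ?_)
        have e : (fun c : Plane => ‖ψ c * (φ y * poisson (t n) c y)‖) =
            fun c => |φ y| * (|ψ c| * poisson (t n) y c) := by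
          funext c
          rw [norm_mul, norm_mul, Real.norm_of_nonneg (poisson_pos (ht0 n) c y).le,
            poisson_comm, Real.norm_eq_abs, Real.norm_eq_abs]
          ring
        simp only [Function.uncurry, e]
        rw [integral_const_mul, Real.norm_of_nonneg (mul_nonneg (abs_nonneg _)
          (integral_nonneg fun c => mul_nonneg (abs_nonneg _) (poisson_pos (ht0 n) y c).le)),
          mul_left_comm]
        exact mul_le_mul_of_nonneg_left (hC (t n) (ht0 n) (ht1 n) y).2 (abs_nonneg _)
    have h1 := integral_integral_swap hint
    simp only [integral_const_mul] at h1
    rw [h1]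
    congr 1
    funext y
    rw [← integral_const_mul]
    congr 1
    funext c
    rw [poisson_comm]
    ring
  have hlim1 : Tendsto (fun n => ∫ c, ψ c * ∫ y, φ y * poisson (t n) c y) atTop
      (𝓝 (∫ y, φ y * (2 * Real.pi * ψ y))) := by
    simp only [hswap]
    refine tendsto_integral_of_dominated_convergence (fun y => C * (|φ y| * poisson 1 0 y))
      (fun n => hφ4.1.mul (aestronglyMeasurable_integral_mul hψi.1
        (continuous_poisson_uncurry (ht0 n)))) (hpφ.const_mul C)
      (fun n => ae_of_all _ fun y => ?_) (ae_of_all _ fun y => ?_)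
    · rw [norm_mul, Real.norm_eq_abs, mul_left_comm]
      refine mul_le_mul_of_nonneg_left ?_ (abs_nonneg _)
      refine le_trans ?_ (hC (t n) (ht0 n) (ht1 n) y).2
      refine abs_integral_le_integral_abs.trans (le_of_eq ?_)
      congr 1
      funext c
      rw [abs_mul, abs_of_pos (poisson_pos (ht0 n) y c)]
    · exact (((tendsto_poisson_integral hψi hψc.continuousAt).comp (tendsto_add_atTop_nat 1)).const_mul (φ y))
  have hlim2 : Tendsto (fun n => ∫ c, ψ c * ∫ y, φ y * poisson (t n) c y) atTop
      (𝓝 (∫ c, ψ c * rieszPotential f c)) := by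
    simp only [hφ, fun n c => h.integral_poisson_mul hV (ht0 n) c]
    obtain ⟨r, hr⟩ := hψs.isCompact.isBounded.subset_closedBall 0
    obtain ⟨K, hK0, hK⟩ := hf.abs_rieszPotential_le r
    have hle : ∀ n (c y : Plane), y ≠ c → coulomb (t n) c y ≤ ‖c - y‖⁻¹ := fun n c y hy => by
      have h0 : 0 < ‖c - y‖ := norm_pos_iff.2 (sub_ne_zero.2 hy.symm)
      refine inv_anti₀ h0 (Real.le_sqrt_of_sq_le ?_)
      rw [norm_sub_rev]; nlinarith [sq_nonneg (t n)]
    have hne : ∀ c : Plane, ∀ᵐ y : Plane, y ≠ c := fun c => by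
      simp [ae_iff]
    have hint : ∀ c, Integrable (fun y => |f y| * ‖c - y‖⁻¹) volume := fun c => by
      refine (hf.integrable c).norm.congr (ae_of_all _ fun y => ?_)
      simp only
      rw [norm_mul, norm_inv, norm_norm, Real.norm_eq_abs]
    refine tendsto_integral_of_dominated_convergence (fun c => |ψ c| * K)
      (fun n => hψi.1.mul (aestronglyMeasurable_integral_mul hf.memLp.1
        (continuous_coulomb_uncurry (ht0 n)))) (hψi.abs.mul_const K)
      (fun n => ae_of_all _ fun c => ?_) (ae_of_all _ fun c => ?_)
    · rw [norm_mul, Real.norm_eq_abs]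
      by_cases hc : ψ c = 0
      · simp [hc]
      · have hcr : ‖c‖ ≤ r := by simpa using hr (subset_tsupport _ hc)
        refine mul_le_mul_of_nonneg_left ?_ (abs_nonneg _)
        refine abs_integral_le_integral_abs.trans (le_trans ?_ (hK c hcr).1)
        refine integral_mono_of_nonneg (ae_of_all _ fun y => abs_nonneg _) (hint c) ?_
        filter_upwards [hne c] with y hy
        rw [abs_mul, abs_of_pos (coulomb_pos (ht0 n) c y)]
        exact mul_le_mul_of_nonneg_left (hle n c y hy) (abs_nonneg _)
    · refine Tendsto.const_mul _ ?_
      refine tendsto_integral_of_dominated_convergence (fun y => |f y| * ‖c - y‖⁻¹)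
        (fun n => hf.memLp.1.mul (continuous_coulomb (ht0 n) c).aestronglyMeasurable)
        (hint c) (fun n => ?_) ?_
      · filter_upwards [hne c] with y hy
        rw [norm_mul, Real.norm_eq_abs, Real.norm_of_nonneg (coulomb_pos (ht0 n) c y).le]
        exact mul_le_mul_of_nonneg_left (hle n c y hy) (abs_nonneg _)
      · filter_upwards [hne c] with y hy
        have h0 : 0 < ‖c - y‖ := norm_pos_iff.2 (sub_ne_zero.2 hy.symm)
        have hc0 : ContinuousAt (fun s : ℝ => (Real.sqrt (‖c - y‖ ^ 2 + s ^ 2))⁻¹) 0 := by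
          refine ContinuousAt.inv₀ (by fun_prop) ?_
          simp [h0.ne']
        have h1 := (hc0.tendsto.comp htl).const_mul (f y)
        simp only [ne_eq, OfNat.ofNat_ne_zero, not_false_eq_true, zero_pow, add_zero,
          Real.sqrt_sq h0.le] at h1
        refine h1.congr fun n => ?_
        rw [coulomb, norm_sub_rev y c]
        rfl
  have := tendsto_nhds_unique hlim1 hlim2
  simp only [smul_eq_mul]
  rw [← this]
  congr 1
  funext y
  ring

/-! ### Hölder regularity of the ground state -/

theorem LocallyHolder.exists_bound {α : ℝ≥0} {u : Plane → ℝ} (h : LocallyHolder α u) (r : ℝ) :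
    ∃ C : ℝ, 0 ≤ C ∧ ∀ x y : Plane, ‖x‖ ≤ r → ‖y‖ ≤ r → |u x - u y| ≤ C * ‖x - y‖ ^ (α : ℝ) := by
  obtain ⟨K, hK⟩ := h (Metric.closedBall 0 r) (isCompact_closedBall 0 r)
  refine ⟨K, K.2, fun x y hx hy => ?_⟩
  have := hK.dist_le (by simpa using hx) (by simpa using hy)
  rwa [Real.dist_eq, dist_eq_norm] at this

theorem locallyHolder_of_bound {α : ℝ≥0} {u : Plane → ℝ}
    (h : ∀ r : ℝ, ∃ C : ℝ, 0 ≤ C ∧ ∀ x y : Plane, ‖x‖ ≤ r → ‖y‖ ≤ r →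
      |u x - u y| ≤ C * ‖x - y‖ ^ (α : ℝ)) : LocallyHolder α u := by
  intro S hS
  obtain ⟨r, hr⟩ := hS.isBounded.subset_closedBall 0
  obtain ⟨C, hC0, hC⟩ := h r
  refine ⟨C.toNNReal, fun x hx y hy => ?_⟩
  have h1 := hC x y (by simpa using hr hx) (by simpa using hr hy)
  rw [edist_dist, edist_dist, Real.dist_eq, dist_eq_norm, ENNReal.ofReal_rpow_of_nonneg
    (norm_nonneg _) α.coe_nonneg]
  change _ ≤ ENNReal.ofReal C * _
  rw [← ENNReal.ofReal_mul hC0]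
  exact ENNReal.ofReal_le_ofReal h1

theorem LocallyHolder.continuous {α : ℝ≥0} (hα : 0 < α) {u : Plane → ℝ} (h : LocallyHolder α u) :
    Continuous u := by
  refine continuous_iff_continuousAt.2 fun x => ?_
  obtain ⟨K, hK⟩ := h (Metric.closedBall x 1) (isCompact_closedBall x 1)
  exact (hK.continuousOn hα).continuousAt (Metric.closedBall_mem_nhds x one_pos)

theorem isLocDensity_of_le {V u : Plane → ℝ} (hV : Continuous V) (hu3 : MemLp u 3 volume)
    (h0 : ∀ᵐ x, 0 ≤ u x) (hle : ∀ᵐ x, u x ≤ V x) : IsLocDensity fun x => |u x| * u x := by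
  refine ⟨memLp_abs_mul_self hu3, fun r => ?_⟩
  obtain ⟨M, hM⟩ := (isCompact_closedBall (0 : Plane) r).exists_bound_of_continuousOn hV.continuousOn
  refine ⟨M ^ 2, sq_nonneg M, ?_⟩
  filter_upwards [h0, hle] with x h1 h2 hx
  have h3 : |V x| ≤ M := hM x (by simpa using hx)
  have h4 := le_abs_self (V x)
  rw [abs_mul, abs_abs, abs_of_nonneg h1]
  nlinarith

theorem eq_of_ae_eq {u v : Plane → ℝ} (hu : Continuous u) (hv : Continuous v)
    (h : ∀ᵐ x, u x = v x) (x : Plane) : u x = v x := by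
  have : u =ᵐ[volume] v := h
  exact congrFun ((hu.ae_eq_iff_eq volume hv).1 this) x

theorem le_of_ae_le {u v : Plane → ℝ} (hu : Continuous u) (hv : Continuous v)
    (h : ∀ᵐ x, u x ≤ v x) (x : Plane) : u x ≤ v x := by
  have h1 : ∀ᵐ x, max (u x) (v x) = v x := by
    filter_upwards [h] with x hx using max_eq_right hx
  exact max_eq_right_iff.1 (eq_of_ae_eq (hu.max hv) hv h1 x)

theorem half_holder_of_lipschitz {u : Plane → ℝ} {r C : ℝ} (hC0 : 0 ≤ C)
    (hC : ∀ x y : Plane, ‖x‖ ≤ r → ‖y‖ ≤ r → |u x - u y| ≤ C * ‖x - y‖) (x y : Plane)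
    (hx : ‖x‖ ≤ r) (hy : ‖y‖ ≤ r) :
    |u x - u y| ≤ C * (2 * r) ^ (1 / 2 : ℝ) * ‖x - y‖ ^ (1 / 2 : ℝ) := by
  refine (hC x y hx hy).trans ?_
  rw [mul_assoc]
  refine mul_le_mul_of_nonneg_left ?_ hC0
  have h1 : ‖x - y‖ ≤ 2 * r := (norm_sub_le x y).trans (by linarith)
  calc ‖x - y‖ = ‖x - y‖ ^ (1 / 2 : ℝ) * ‖x - y‖ ^ (1 / 2 : ℝ) := by
        rw [← Real.sqrt_eq_rpow, Real.mul_self_sqrt (norm_nonneg _)]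
    _ ≤ _ := by gcongr

/-- The ground state has a representative that is as regular as the potential. -/
theorem exists_holder_isGround {V : Plane → ℝ} {α : ℝ≥0} (hα0 : 0 < α) (hα1 : α ≤ 1)
    (hV : MemHdot V) (hVα : LocallyHolder α V) (hVn : HalfLapNonneg V) :
    ∃ u, IsGround V u ∧ LocallyHolder α u ∧ (∀ x, 0 ≤ u x) ∧ ∀ x, u x ≤ V x := by
  obtain ⟨u₀, hu₀⟩ := exists_isGround hV.finiteEnergy
  have hVc := hVα.continuous hα0
  have h0 := hu₀.nonneg hV hVn
  have h1 := hu₀.le hV h0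
  have hf₀ := isLocDensity_of_le hVc hu₀.mem_three h0 h1
  -- The continuous representative is defined by the representation formula; changing u₀ on a null
  -- set leaves the potential unchanged.
  set u : Plane → ℝ := fun x => V x - (2 * Real.pi)⁻¹ * rieszPotential (fun x => |u₀ x| * u₀ x) x
    with hu
  have hae : u₀ =ᵐ[volume] u := by
    filter_upwards [hu₀.ae_eq_rieszPotential hV hf₀] with x hx
    simp only [hu]
    rw [← hx, Pi.sub_apply, inv_mul_cancel_left₀ (by positivity)]
    ring
  have hg := hu₀.congr hae
  have huc : Continuous u := hVc.sub (continuous_const.mul hf₀.continuous_rieszPotential)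
  have hu0 : ∀ x, 0 ≤ u x := le_of_ae_le continuous_const huc (by
    filter_upwards [hae, h0] with x hx hx'; rwa [← hx])
  have huV : ∀ x, u x ≤ V x := le_of_ae_le huc hVc (by
    filter_upwards [hae, h1] with x hx hx'; rwa [← hx])
  have hRz : rieszPotential (fun x => |u₀ x| * u₀ x) = rieszPotential (fun x => |u x| * u x) := by
    funext x
    apply integral_congr_ae
    filter_upwards [hae] with y hy
    rw [hy]
  rw [hRz] at hu
  have hf := isLocDensity_of_le hVc hg.mem_three (ae_of_all _ hu0) (ae_of_all _ huV)
  have hdiff : ∀ r γ A B : ℝ, (∀ x y : Plane, ‖x‖ ≤ r → ‖y‖ ≤ r →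
      |V x - V y| ≤ A * ‖x - y‖ ^ γ) → (∀ x y : Plane, ‖x‖ ≤ r → ‖y‖ ≤ r →
      |rieszPotential (fun x => |u x| * u x) x - rieszPotential (fun x => |u x| * u x) y| ≤
        B * ‖x - y‖ ^ γ) → ∀ x y : Plane, ‖x‖ ≤ r → ‖y‖ ≤ r →
      |u x - u y| ≤ (A + (2 * Real.pi)⁻¹ * B) * ‖x - y‖ ^ γ := by
    intro r γ A B hA hB x y hx hy
    have e : u x - u y = (V x - V y) - (2 * Real.pi)⁻¹ *
        (rieszPotential (fun x => |u x| * u x) x - rieszPotential (fun x => |u x| * u x) y) := by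
      have e1 : ∀ x, u x = V x - (2 * Real.pi)⁻¹ * rieszPotential (fun x => |u x| * u x) x :=
        fun x => congrFun hu x
      rw [e1 x, e1 y]; ring
    rw [e]
    refine (abs_sub _ _).trans ?_
    rw [abs_mul, abs_of_pos (by positivity : 0 < (2 * Real.pi)⁻¹), add_mul, mul_assoc _ B]
    have h2 : 0 < (2 * Real.pi)⁻¹ := by positivity
    have h3 := hA x y hx hy
    have h4 := hB x y hx hy
    gcongr
  refine ⟨u, hg, locallyHolder_of_bound fun r => ?_, hu0, huV⟩
  have hπ : 0 < (2 * Real.pi)⁻¹ := by positivity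
  obtain ⟨A, hA0, hA⟩ := hVα.exists_bound r
  rcases hα1.lt_or_eq with hlt | rfl
  · obtain ⟨B, hB0, hB⟩ := hf.abs_rieszPotential_sub_le (γ := (α : ℝ)) (by exact_mod_cast hα0)
      (by exact_mod_cast hlt) r
    exact ⟨A + (2 * Real.pi)⁻¹ * B, by positivity, hdiff r _ A B hA hB⟩
  -- At exponent 1 a bootstrap is needed, since a bounded density yields only exponents below 1:
  -- first u is ½-Hölder, hence so is |u|u, and then the potential is Lipschitz.
  · have hhalf : ∀ r : ℝ, ∃ L : ℝ, 0 ≤ L ∧ ∀ x y : Plane, ‖x‖ ≤ r → ‖y‖ ≤ r →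
        |(|u x| * u x) - |u y| * u y| ≤ L * ‖x - y‖ ^ (1 / 2 : ℝ) := by
      intro r
      obtain ⟨A, hA0, hA⟩ := hVα.exists_bound r
      simp only [NNReal.coe_one, Real.rpow_one] at hA
      obtain ⟨B, hB0, hB⟩ := hf.abs_rieszPotential_sub_le (γ := 1 / 2) (by norm_num)
        (by norm_num) r
      have h2 := hdiff r _ _ B (half_holder_of_lipschitz hA0 hA) hB
      obtain ⟨M, hM⟩ := (isCompact_closedBall (0 : Plane) r).exists_bound_of_continuousOn
        huc.continuousOn
      set D := A * (2 * r) ^ (1 / 2 : ℝ) + (2 * Real.pi)⁻¹ * B with hD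
      refine ⟨2 * |M| * |D|, by positivity, fun x y hx hy => ?_⟩
      have h3 := (hM x (by simpa using hx)).trans (le_abs_self M)
      have h4 := (hM y (by simpa using hy)).trans (le_abs_self M)
      rw [Real.norm_of_nonneg (hu0 _)] at h3 h4
      have h5 : |u x - u y| ≤ |D| * ‖x - y‖ ^ (1 / 2 : ℝ) :=
        (h2 x y hx hy).trans (by gcongr; exact le_abs_self D)
      rw [abs_of_nonneg (hu0 x), abs_of_nonneg (hu0 y), mul_self_sub_mul_self, abs_mul,
        abs_of_nonneg (add_nonneg (hu0 x) (hu0 y)), mul_assoc]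
      refine mul_le_mul (by linarith) h5 (abs_nonneg _) (by positivity)
    obtain ⟨B, hB0, hB⟩ := hf.abs_rieszPotential_sub_le_norm hhalf r
    refine ⟨A + (2 * Real.pi)⁻¹ * B, by positivity, hdiff r _ A B hA ?_⟩
    simpa using hB

/-! ### The strong maximum principle -/

/-- A function in L⁴ need not be integrable, so it is split at the unit ball around y. Outside the
ball P_s ≤ 4sP_1, and the far part vanishes with s. -/
theorem tendsto_poisson_integral_memLp {g : Plane → ℝ} (hg : MemLp g 4 volume) (hc : Continuous g)
    (y : Plane) : Tendsto (fun n : ℕ => ∫ c, g c * poisson (1 / ((n : ℝ) + 1)) y c) atTop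
      (𝓝 (2 * Real.pi * g y)) := by
  set B := Metric.closedBall y 1 with hB
  have hBm : MeasurableSet B := Metric.isClosed_closedBall.measurableSet
  set g₁ := B.indicator g with hg₁
  set g₂ := Bᶜ.indicator g with hg₂
  have hsum : ∀ x, g x = g₁ x + g₂ x := fun x => by
    by_cases hx : x ∈ B <;> simp [hg₁, hg₂, hx]
  have hg₁i : Integrable g₁ volume := (integrable_indicator_iff hBm).2
    (hc.continuousOn.integrableOn_compact (isCompact_closedBall y 1))
  have hg₁c : ContinuousAt g₁ y := by
    refine hc.continuousAt.congr ?_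
    filter_upwards [Metric.closedBall_mem_nhds y one_pos] with x hx
    exact (Set.indicator_of_mem hx g).symm
  have hg₁y : g₁ y = g y := Set.indicator_of_mem (Metric.mem_closedBall_self zero_le_one) g
  have hp : ∀ n : ℕ, 0 < 1 / ((n : ℝ) + 1) := fun n => by positivity
  have hpm : ∀ n : ℕ, MemLp (poisson (1 / ((n : ℝ) + 1)) y) (4 / 3) volume := fun n =>
    memLp_poisson (hp n) y one_le_four_thirds four_thirds_ne_top
  have hg₂4 : MemLp g₂ 4 volume := hg.indicator hBm.compl
  have hg₁4 : MemLp g₁ 4 volume := hg.indicator hBm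
  have hpg : Integrable (fun c => |g c| * poisson 1 y c) volume :=
    ((memLp_poisson one_pos y one_le_four_thirds four_thirds_ne_top).integrable_mul hg.norm).congr
      (ae_of_all _ fun c => mul_comm _ _)
  have h1 := tendsto_poisson_integral hg₁i hg₁c
  rw [hg₁y] at h1
  have h2 : Tendsto (fun n : ℕ => ∫ c, g₂ c * poisson (1 / ((n : ℝ) + 1)) y c) atTop (𝓝 0) := by
    have h3 : Tendsto (fun n : ℕ => 1 / ((n : ℝ) + 1) * (4 * ∫ c, |g c| * poisson 1 y c)) atTop
        (𝓝 0) := by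
      simpa using (tendsto_one_div_add_atTop_nhds_zero_nat (𝕜 := ℝ)).mul_const
        (4 * ∫ c, |g c| * poisson 1 y c)
    refine squeeze_zero_norm (fun n => ?_) h3
    refine (norm_integral_le_integral_norm _).trans ?_
    rw [← integral_const_mul, ← integral_const_mul]
    refine integral_mono_of_nonneg (ae_of_all _ fun c => norm_nonneg _)
      ((hpg.const_mul _).const_mul _) (ae_of_all _ fun c => ?_)
    set s := 1 / ((n : ℝ) + 1) with hs
    have hp1 := poisson_pos one_pos y c
    have hps : 0 < poisson s y c := poisson_pos (hp n) y c
    simp only [norm_mul, Real.norm_of_nonneg hps.le]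
    by_cases hx : c ∈ B
    · have : g₂ c = 0 := by simp [hg₂, hx]
      rw [this, norm_zero, zero_mul]
      exact mul_nonneg (hp n).le (mul_nonneg (by norm_num) (mul_nonneg (abs_nonneg _) hp1.le))
    · have hg2c : g₂ c = g c := Set.indicator_of_mem hx g
      rw [hg2c, Real.norm_eq_abs]
      have hr : 1 < ‖c - y‖ := by
        rw [hB, Metric.mem_closedBall, dist_eq_norm, not_le] at hx; exact hx
      have hle : poisson s y c ≤ s * (4 * poisson 1 y c) := by
        unfold poisson
        rw [one_mul]
        refine mul_le_mul_of_nonneg_left ?_ (hp n).le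
        have h5 : ‖c - y‖ ≤ Real.sqrt (‖c - y‖ ^ 2 + s ^ 2) :=
          Real.le_sqrt_of_sq_le (by nlinarith [sq_nonneg s])
        have h6 : Real.sqrt (‖c - y‖ ^ 2 + 1 ^ 2) ≤ 3 / 2 * ‖c - y‖ :=
          Real.sqrt_le_iff.2 ⟨by positivity, by nlinarith⟩
        have h7 := sqrt_reg_pos one_pos y c
        have h8 : Real.sqrt (‖c - y‖ ^ 2 + 1 ^ 2) ^ 3 ≤
            4 * Real.sqrt (‖c - y‖ ^ 2 + s ^ 2) ^ 3 := by
          calc Real.sqrt (‖c - y‖ ^ 2 + 1 ^ 2) ^ 3 ≤ (3 / 2 * ‖c - y‖) ^ 3 := by gcongr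
            _ ≤ 4 * ‖c - y‖ ^ 3 := by
              rw [mul_pow]
              have : 0 ≤ ‖c - y‖ ^ 3 := by positivity
              nlinarith
            _ ≤ _ := by gcongr
        have h9 : 0 < ‖c - y‖ := by linarith
        rw [← div_eq_mul_inv, inv_eq_one_div, div_le_div_iff₀ (by positivity) (by positivity)]
        linarith
      calc |g c| * poisson s y c ≤ |g c| * (s * (4 * poisson 1 y c)) := by gcongr
        _ = _ := by ring
  have h3 := h1.add h2
  rw [add_zero] at h3
  refine h3.congr fun n => ?_
  rw [← integral_add]
  · congr 1
    funext c
    rw [hsum c]; ring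
  · exact ((hpm n).integrable_mul hg₁4).congr (ae_of_all _ fun c => mul_comm _ _)
  · exact ((hpm n).integrable_mul hg₂4).congr (ae_of_all _ fun c => mul_comm _ _)

theorem abs_sub_sub_sub_le (a b a' b' : ℝ) : |(a - b) - (a' - b')| ≤ |a - a'| + |b - b'| := by
  rw [show (a - b) - (a' - b') = (a - a') - (b - b') by ring]
  exact abs_sub _ _

/-- The kernels k_s, and hence their truncations, decrease in s, and V pairs nonnegatively with the
nonnegative differences. -/
theorem HalfLapNonneg.hdotInner_coulomb_le {V : Plane → ℝ} (hVn : HalfLapNonneg V)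
    (hV : FiniteEnergy V) {s t : ℝ} (ht : 0 < t) (hts : t ≤ s) (c : Plane) :
    hdotInner V (coulomb s c) ≤ hdotInner V (coulomb t c) := by
  have hs : 0 < s := ht.trans_le hts
  have h1 := (isWeakLimit_coulomb hs c).tendsto_hdotInner hV
  have h2 := (isWeakLimit_coulomb ht c).tendsto_hdotInner hV
  refine le_of_tendsto_of_tendsto' h1 h2 fun n => ?_
  have hκ : 0 < 1 / ((n : ℝ) + 1) := by positivity
  have l1 := isLipc_coulombTrunc hs hκ c
  have l2 := isLipc_coulombTrunc ht hκ c
  have l3 : IsLipc (coulombTrunc t c (1 / ((n : ℝ) + 1)) - coulombTrunc s c (1 / ((n : ℝ) + 1))) :=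
    l2.comp₂ abs_sub_sub_sub_le (by simp) l1
  have h3 := hVn.lipc hV l3 fun x => sub_nonneg.2 (max_le_max (sub_le_sub_right ?_ _) le_rfl)
  · rw [hdotInner_sub_right hV l2.finiteEnergy l1.finiteEnergy] at h3
    linarith
  · have := coulomb_sub_coulomb_nonneg ht (sub_nonneg.2 hts) c x
    rw [add_sub_cancel] at this
    linarith

theorem IsGround.poisson_add_coulomb_le {V u : Plane → ℝ} (h : IsGround V u) (hV : MemHdot V)
    (hVn : HalfLapNonneg V) {s t : ℝ} (ht : 0 < t) (hts : t ≤ s) (c : Plane) :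
    (∫ y, u y * poisson s c y) + ∫ y, |u y| * u y * coulomb s c y ≤
      (∫ y, u y * poisson t c y) + ∫ y, |u y| * u y * coulomb t c y := by
  have key : ∀ s, 0 < s → (∫ y, u y * poisson s c y) + ∫ y, |u y| * u y * coulomb s c y =
      hdotInner V (coulomb s c) := by
    intro s hs
    have hp := memLp_poisson hs c one_le_four_thirds four_thirds_ne_top
    have hi : ∀ {g : Plane → ℝ}, MemLp g 4 volume →
        Integrable (fun y => g y * poisson s c y) volume := fun hg =>
      (hp.integrable_mul hg).congr (ae_of_all _ fun y => mul_comm _ _)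
    rw [← h.integral_poisson_mul hV hs c, ← integral_add (hi h.mem_four)
      (hi (hV.1.sub h.mem_four)), hdotInner_comm, hdotInner_coulomb_memHdot hV hs c]
    congr 1
    funext y
    simp only [Pi.sub_apply]
    ring
  rw [key s (ht.trans_le hts), key t ht]
  exact hVn.hdotInner_coulomb_le hV.finiteEnergy ht hts c

theorem integral_coulomb_sub {s t : ℝ} (ht : 0 < t) (hts : t ≤ s) (c : Plane) :
    Integrable (fun x => coulomb t c x - coulomb s c x) volume ∧
      ∫ x, (coulomb t c x - coulomb s c x) = 2 * Real.pi * (s - t) := by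
  have hs : 0 < s := ht.trans_le hts
  have hd : ∀ t : ℝ, 0 < t → ∀ r : ℝ, HasDerivAt (fun r => Real.sqrt (r ^ 2 + t ^ 2))
      (r * (Real.sqrt (r ^ 2 + t ^ 2))⁻¹) r := by
    intro t ht r
    have h1 : HasDerivAt (fun r : ℝ => r ^ 2 + t ^ 2) (2 * r) r := by
      simpa using (hasDerivAt_pow 2 r).add_const (t ^ 2)
    have hpos : 0 < r ^ 2 + t ^ 2 := by positivity
    refine (h1.sqrt hpos.ne').congr_deriv ?_
    have := (Real.sqrt_pos.2 hpos).ne'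
    field_simp
  have hle : ∀ r : ℝ, Real.sqrt (r ^ 2 + t ^ 2) ≤ Real.sqrt (r ^ 2 + s ^ 2) := fun r =>
    Real.sqrt_le_sqrt (by nlinarith)
  have hlim : Tendsto (fun r : ℝ => Real.sqrt (r ^ 2 + t ^ 2) - Real.sqrt (r ^ 2 + s ^ 2)) atTop
      (𝓝 0) := by
    have h1 : Tendsto (fun r : ℝ => s ^ 2 * r⁻¹) atTop (𝓝 0) := by
      simpa using tendsto_inv_atTop_zero.const_mul (s ^ 2)
    refine squeeze_zero_norm' ?_ h1
    filter_upwards [eventually_gt_atTop 0] with r hr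
    rw [Real.norm_eq_abs, abs_sub_comm, abs_of_nonneg (sub_nonneg.2 (hle r)), ← div_eq_mul_inv,
      le_div_iff₀ hr]
    have ha := Real.sq_sqrt (show 0 ≤ r ^ 2 + t ^ 2 by positivity)
    have hb := Real.sq_sqrt (show 0 ≤ r ^ 2 + s ^ 2 by positivity)
    have h2 : r ≤ Real.sqrt (r ^ 2 + t ^ 2) := Real.le_sqrt_of_sq_le (by nlinarith)
    have h3 := hle r
    have h4 : (Real.sqrt (r ^ 2 + s ^ 2) - Real.sqrt (r ^ 2 + t ^ 2)) *
        (Real.sqrt (r ^ 2 + s ^ 2) + Real.sqrt (r ^ 2 + t ^ 2)) = s ^ 2 - t ^ 2 := by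
      linear_combination hb - ha
    have h5 : 0 ≤ (Real.sqrt (r ^ 2 + s ^ 2) - Real.sqrt (r ^ 2 + t ^ 2)) *
        (Real.sqrt (r ^ 2 + s ^ 2) + Real.sqrt (r ^ 2 + t ^ 2) - r) :=
      mul_nonneg (sub_nonneg.2 h3) (by linarith)
    nlinarith [sq_nonneg t]
  have h := integral_radial
    (f := fun r => (Real.sqrt (r ^ 2 + t ^ 2))⁻¹ - (Real.sqrt (r ^ 2 + s ^ 2))⁻¹)
    (G := fun r => Real.sqrt (r ^ 2 + t ^ 2) - Real.sqrt (r ^ 2 + s ^ 2)) (l := 0)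
    (fun r _ => ((hd t ht r).sub (hd s hs r)).congr_deriv (by ring))
    (fun r hr => mul_nonneg (le_of_lt hr) (sub_nonneg.2 (inv_anti₀ (Real.sqrt_pos.2 (by positivity))
      (hle r)))) hlim c
  refine ⟨h.1, h.2.trans ?_⟩
  simp only [ne_eq, OfNat.ofNat_ne_zero, not_false_eq_true, zero_pow, zero_add,
    Real.sqrt_sq ht.le, Real.sqrt_sq hs.le]
  ring

/-- Away from the center the difference of kernels is of order s², one power better than its
integral over the plane; this is what decides the comparison in `IsGround.pos`. -/
theorem coulomb_sub_le_of_le_norm {s t δ : ℝ} (ht : 0 < t) (hts : t ≤ s) (hδ : 0 < δ) {c x : Plane}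
    (hx : δ ≤ ‖x - c‖) :
    coulomb t c x - coulomb s c x ≤ s ^ 2 * ((δ⁻¹ ^ 2 + δ⁻¹ ^ 3) * coulomb 1 c x) := by
  have h0 := coulomb_sub_coulomb ht (sub_nonneg.2 hts) c x
  rw [add_sub_cancel] at h0
  rw [h0]
  have hr0 : 0 < ‖x - c‖ := hδ.trans_le hx
  have ha : ‖x - c‖ ≤ Real.sqrt (‖x - c‖ ^ 2 + t ^ 2) := Real.le_sqrt_of_sq_le (by nlinarith)
  have hb : ‖x - c‖ ≤ Real.sqrt (‖x - c‖ ^ 2 + s ^ 2) :=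
    Real.le_sqrt_of_sq_le (by nlinarith [sq_nonneg s])
  have h1 : Real.sqrt (‖x - c‖ ^ 2 + 1 ^ 2) ≤ ‖x - c‖ + 1 :=
    Real.sqrt_le_iff.2 ⟨by positivity, by nlinarith⟩
  have h1pos := sqrt_reg_pos one_pos c x
  unfold coulomb
  set r := ‖x - c‖
  set a := Real.sqrt (r ^ 2 + t ^ 2)
  set b := Real.sqrt (r ^ 2 + s ^ 2)
  have h2 : (s - t) * ((2 * t + (s - t)) / (a * b * (a + b))) ≤ s ^ 2 * (r⁻¹ ^ 3) := by
    have h4 : r * r * (r + r) ≤ a * b * (a + b) := by gcongr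
    have h5 : (s - t) * (2 * t + (s - t)) ≤ s ^ 2 := by nlinarith [sq_nonneg t]
    rw [← mul_div_assoc, inv_pow, ← div_eq_mul_inv]
    refine div_le_div₀ (sq_nonneg s) h5 (by positivity) ?_
    have : 0 < r ^ 3 := by positivity
    nlinarith
  have h3 : r⁻¹ ^ 3 * Real.sqrt (r ^ 2 + 1 ^ 2) ≤ δ⁻¹ ^ 2 + δ⁻¹ ^ 3 := by
    calc r⁻¹ ^ 3 * Real.sqrt (r ^ 2 + 1 ^ 2) ≤ r⁻¹ ^ 3 * (r + 1) := by gcongr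
      _ = r⁻¹ ^ 2 + r⁻¹ ^ 3 := by field_simp
      _ ≤ _ := by gcongr
  refine h2.trans (mul_le_mul_of_nonneg_left ?_ (sq_nonneg s))
  rwa [← div_eq_mul_inv, le_div_iff₀ h1pos]

/-- The strong maximum principle. -/
theorem IsGround.pos {V u : Plane → ℝ} (h : IsGround V u) (hV : MemHdot V)
    (hVn : HalfLapNonneg V) (huc : Continuous u) (hu0 : ∀ x, 0 ≤ u x) (hne : ∃ z, u z ≠ 0)
    (x₀ : Plane) : 0 < u x₀ := by
  refine (hu0 x₀).lt_of_ne' fun hx₀ => ?_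
  have hp4 : ∀ {s : ℝ}, 0 < s → Integrable (fun y => u y * poisson s x₀ y) volume := fun hs =>
    ((memLp_poisson hs x₀ one_le_four_thirds four_thirds_ne_top).integrable_mul h.mem_four).congr
      (ae_of_all _ fun y => mul_comm _ _)
  have hf3 : MemLp (fun y => |u y| * u y) (3 / 2) volume := memLp_abs_mul_self h.mem_three
  have hfi : ∀ {s : ℝ}, 0 < s → Integrable (fun y => |u y| * u y * coulomb s x₀ y) volume :=
    fun hs => hf3.integrable_mul (memLp_coulomb_three hs x₀)
  have hf0 : ∀ y, 0 ≤ |u y| * u y := fun y => mul_nonneg (abs_nonneg _) (hu0 y)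
  set c := ∫ y, u y * poisson 1 x₀ y with hc
  have hcpos : 0 < c := by
    rw [hc, integral_pos_iff_support_of_nonneg
      (fun y => mul_nonneg (hu0 y) (poisson_pos one_pos x₀ y).le) (hp4 one_pos)]
    obtain ⟨z, hz⟩ := hne
    exact (huc.mul (continuous_poisson one_pos x₀)).isOpen_support.measure_pos volume
      ⟨z, mul_ne_zero hz (poisson_pos one_pos x₀ z).ne'⟩
  set K := ∫ y, |u y| * u y * coulomb 1 x₀ y with hK
  have hK0 : 0 ≤ K := integral_nonneg fun y => mul_nonneg (hf0 y) (coulomb_pos one_pos x₀ y).le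
  -- Chosen so that 2πε = c/4; near the zero x₀ the density |u|u stays below ε.
  set ε := c / (8 * Real.pi) with hε
  have hε0 : 0 < ε := by positivity
  obtain ⟨δ, hδ, hδε⟩ : ∃ δ > 0, ∀ y, ‖y - x₀‖ < δ → |u y| * u y ≤ ε := by
    have h1 : Continuous fun y => |u y| * u y := huc.abs.mul huc
    obtain ⟨δ, hδ, hd⟩ := Metric.continuous_iff.1 h1 x₀ ε hε0
    refine ⟨δ, hδ, fun y hy => ?_⟩
    have := hd y (by rwa [dist_eq_norm])
    rw [Real.dist_eq, hx₀, mul_zero, sub_zero] at this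
    exact (le_abs_self _).trans this.le
  set D := δ⁻¹ ^ 2 + δ⁻¹ ^ 3 with hD
  have hD0 : 0 < D := by positivity
  -- For s ≤ 1 one has sP_1 ≤ P_s, so sc is at most the Poisson average of u. By monotonicity this
  -- is at most the average at t < s plus f ∗ (k_t − k_s), and as t → 0 the average tends to 2πu(x₀)
  -- = 0. Near x₀ use f ≤ ε, elsewhere the bound of order s².
  have main : ∀ s, 0 < s → s ≤ 1 → s * c ≤ 2 * Real.pi * ε * s + s ^ 2 * (D * K) := by
    intro s hs hs1
    have hlow : s * c ≤ ∫ y, u y * poisson s x₀ y := by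
      rw [hc, ← integral_const_mul]
      refine integral_mono ((hp4 one_pos).const_mul s) (hp4 hs) fun y => ?_
      simp only
      rw [mul_left_comm]
      refine mul_le_mul_of_nonneg_left ?_ (hu0 y)
      unfold poisson
      have := sqrt_reg_pos hs x₀ y
      rw [one_mul]
      gcongr
    have hup : ∀ t, 0 < t → t < s → s * c ≤
        (∫ y, u y * poisson t x₀ y) + (2 * Real.pi * ε * s + s ^ 2 * (D * K)) := by
      intro t ht hts
      have h1 := h.poisson_add_coulomb_le hV hVn ht hts.le x₀
      obtain ⟨i2, j2⟩ := integral_coulomb_sub ht hts.le x₀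
      have h3 : (∫ y, |u y| * u y * coulomb t x₀ y) - ∫ y, |u y| * u y * coulomb s x₀ y ≤
          ∫ y, (ε * (coulomb t x₀ y - coulomb s x₀ y) +
            s ^ 2 * D * (|u y| * u y * coulomb 1 x₀ y)) := by
        rw [← integral_sub (hfi ht) (hfi hs)]
        refine integral_mono ((hfi ht).sub (hfi hs))
          ((i2.const_mul ε).add ((hfi one_pos).const_mul _)) fun y => ?_
        simp only
        rw [← mul_sub]
        have h4 : 0 ≤ coulomb t x₀ y - coulomb s x₀ y := by
          have := coulomb_sub_coulomb_nonneg ht (sub_nonneg.2 hts.le) x₀ y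
          rwa [add_sub_cancel] at this
        have h5 := mul_nonneg (hf0 y) (coulomb_pos one_pos x₀ y).le
        rcases lt_or_ge ‖y - x₀‖ δ with hy | hy
        · have := mul_le_mul_of_nonneg_right (hδε y hy) h4
          have : 0 ≤ s ^ 2 * D * (|u y| * u y * coulomb 1 x₀ y) := by positivity
          linarith
        · have h6 := mul_le_mul_of_nonneg_left (coulomb_sub_le_of_le_norm ht hts.le hδ hy) (hf0 y)
          have h7 : |u y| * u y * (s ^ 2 * (D * coulomb 1 x₀ y)) =
              s ^ 2 * D * (|u y| * u y * coulomb 1 x₀ y) := by ring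
          have := mul_nonneg hε0.le h4
          linarith
      rw [integral_add (i2.const_mul ε) ((hfi one_pos).const_mul _), integral_const_mul,
        integral_const_mul, j2] at h3
      have h4 : ε * (2 * Real.pi * (s - t)) ≤ 2 * Real.pi * ε * s := by
        have : 0 ≤ 2 * Real.pi * ε * t := by positivity
        linarith
      have h5 : s ^ 2 * D * K = s ^ 2 * (D * K) := by ring
      linarith
    have h1 := (tendsto_poisson_integral_memLp h.mem_four huc x₀).add_const
      (2 * Real.pi * ε * s + s ^ 2 * (D * K))
    rw [hx₀, mul_zero, zero_add] at h1
    refine ge_of_tendsto h1 ?_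
    filter_upwards [(tendsto_one_div_add_atTop_nhds_zero_nat (𝕜 := ℝ)).eventually_lt_const hs]
      with n hn
    exact hup _ (by positivity) hn
  have h2 : 2 * Real.pi * ε = c / 4 := by rw [hε]; field_simp; norm_num
  have hDK : 0 ≤ D * K := mul_nonneg hD0.le hK0
  -- With this s the last term of `main` is at most sc/2, so sc ≤ ¾sc, a contradiction.
  set s := min 1 (c / (2 * (D * K + 1))) with hs
  have hs0 : 0 < s := lt_min one_pos (by positivity)
  have h3 := main s hs0 (min_le_left _ _)
  have h4 : s * (D * K) ≤ c / 2 := by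
    calc s * (D * K) ≤ c / (2 * (D * K + 1)) * (D * K + 1) := by
          gcongr
          · exact min_le_right _ _
          · linarith
      _ = c / 2 := by field_simp
  rw [h2] at h3
  have h5 : s * c ≤ s * (c / 4 + c / 2) := by
    calc s * c ≤ c / 4 * s + s ^ 2 * (D * K) := h3
      _ = s * (c / 4 + s * (D * K)) := by ring
      _ ≤ _ := by gcongr
  have h6 := le_of_mul_le_mul_left h5 hs0
  linarith

/-! ### Comparison with subsolutions and supersolutions -/

theorem hdotInner_comp_le {v : Plane → ℝ} {T : ℝ → ℝ} (hT : Monotone T)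
    (hT1 : ∀ a b, |T a - T b| ≤ |a - b|) (hv : FiniteEnergy v)
    (hTv : FiniteEnergy fun x => T (v x)) :
    hdotInner (fun x => T (v x)) (fun x => T (v x)) ≤ hdotInner v fun x => T (v x) := by
  refine hdotInner_mono hTv hTv hv hTv (ae_of_all _ fun p => ?_)
  simp only [incr]
  have h1 := hT1 (v p.1) (v p.2)
  rcases le_total (v p.2) (v p.1) with h | h
  · have h2 := hT h
    rw [abs_of_nonneg (sub_nonneg.2 h2), abs_of_nonneg (sub_nonneg.2 h)] at h1
    exact mul_le_mul_of_nonneg_right h1 (sub_nonneg.2 h2)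
  · have h2 := hT h
    rw [abs_of_nonpos (sub_nonpos.2 h2), abs_of_nonpos (sub_nonpos.2 h)] at h1
    nlinarith [sub_nonpos.2 h2]

theorem abs_posPart_sub_le (a b a' b' : ℝ) :
    |max (a - b) 0 - max (a' - b') 0| ≤ |a - a'| + |b - b'| := by
  refine (abs_max_sub_max_le_max _ _ _ _).trans ?_
  rw [sub_self, abs_zero, max_eq_left (abs_nonneg _)]
  exact abs_sub_sub_sub_le a b a' b'

/-- Subtract the two relations tested with (W − u)⁺. Monotonicity of t ↦ |t|t gives the nonlinear
terms a sign, and ‖(W − u)⁺‖² ≤ 0 remains. -/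
theorem IsGround.ge_of_subsolution {V u W : Plane → ℝ} {ψ : ℕ → Plane → ℝ} (h : IsGround V u)
    (hV : MemHdot V) (hVn : HalfLapNonneg V) (hW : IsWeakLimit ψ W)
    (hsub : ∀ (χ : Plane → ℝ) (χ' : ℕ → Plane → ℝ), IsWeakLimit χ' χ → (∀ x, 0 ≤ χ x) →
      (∀ x, W x ≤ u x → χ x = 0) → hdotInner W χ + ∫ x, |W x| * W x * χ x ≤ 0) :
    ∀ᵐ x, W x ≤ u x := by
  obtain ⟨φ, hφ, hw, -⟩ := h.exists_isWeakLimit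
  have hχ := hW.comp₂ abs_posPart_sub_le (by simp) hw
  set χ : Plane → ℝ := fun x => max (W x - u x) 0 with hχdef
  have h1 := h.eq_isWeakLimit hV.finiteEnergy hχ
  have h2 : 0 ≤ hdotInner V χ := ge_of_tendsto' (hχ.tendsto_hdotInner hV.finiteEnergy) fun n =>
    hVn.lipc hV.finiteEnergy (hχ.lipc n) fun x => le_max_right _ _
  have hsub' := hsub χ _ hχ (fun x => le_max_right _ _) fun x hx => max_eq_right (sub_nonpos.2 hx)
  have h3 : hdotInner χ χ ≤ hdotInner (W - u) χ := hdotInner_comp_le (T := fun a => max a 0) (fun a b hab => max_le_max hab le_rfl)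
    (fun a b => by simpa using abs_max_sub_max_le_max a 0 b 0)
    (hW.finiteEnergy.sub h.finiteEnergy) hχ.finiteEnergy
  have h4 : hdotInner (W - u) χ = hdotInner W χ - hdotInner u χ :=
    hdotInner_sub_left hχ.finiteEnergy hW.finiteEnergy h.finiteEnergy
  have i1 : Integrable (fun x => |W x| * W x * χ x) volume :=
    (memLp_abs_mul_self (r := 3 / 2) hW.memLp_three).integrable_mul hχ.memLp_three
  have i2 : Integrable (fun x => |u x| * u x * χ x) volume :=
    (memLp_abs_mul_self (r := 3 / 2) h.mem_three).integrable_mul hχ.memLp_three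
  have h5 : ∫ x, |u x| * u x * χ x ≤ ∫ x, |W x| * W x * χ x := by
    refine integral_mono i2 i1 fun x => ?_
    simp only [hχdef]
    rcases le_total (W x - u x) 0 with h0 | h0
    · simp [max_eq_right h0]
    · exact mul_le_mul_of_nonneg_right (abs_mul_self_mono (by linarith)) (le_max_right _ _)
  filter_upwards [ae_eq_zero_of_hdotInner_self hχ.finiteEnergy hχ.memLp_four
    (by linarith)] with x hx
  have : max (W x - u x) 0 = 0 := hx
  linarith [le_max_left (W x - u x) 0]

/-- The cutoff η is itself not compactly supported, but 1 − η is, and the two have the same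
increments up to sign. -/
theorem IsWeakLimit.min_cutoff {ψ : ℕ → Plane → ℝ} {v η : Plane → ℝ} (h : IsWeakLimit ψ v)
    (h0 : ∀ n x, 0 ≤ ψ n x) (hη : IsLipc fun x => 1 - η x) (hη0 : ∀ x, 0 ≤ η x) :
    IsWeakLimit (fun n x => min (ψ n x) (η x)) fun x => min (v x) (η x) := by
  have hηe : ∀ x y, |η x - η y| = |(1 - η x) - (1 - η y)| := fun x y => by
    rw [abs_sub_comm]; congr 1; ring
  have hL : ∀ n, IsLipc fun x => min (ψ n x) (η x) := fun n => by
    obtain ⟨K, hK⟩ := (h.lipc n).lip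
    obtain ⟨K', hK'⟩ := hη.lip
    have hηL : LipschitzWith K' η := LipschitzWith.of_dist_le_mul fun x y => by
      have := hK'.dist_le_mul x y
      rwa [Real.dist_eq, ← hηe, ← Real.dist_eq] at this
    refine ⟨⟨_, hK.min hηL⟩, (h.lipc n).supp.mono fun x hx hx0 => hx ?_⟩
    simp only at hx0 ⊢
    rw [hx0, min_eq_left (hη0 x)]
  obtain ⟨K, hK⟩ := h.bound
  obtain ⟨L, hL3⟩ := h.bound_three
  refine ⟨hL, ⟨K + (gagliardo fun x => 1 - η x).toNNReal, fun n => ?_⟩, ⟨L, fun n => ?_⟩, ?_⟩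
  · push_cast
    rw [ENNReal.coe_toNNReal hη.finiteEnergy.lt_top.ne]
    refine (gagliardo_le_add (h.lipc n).finiteEnergy.meas hη.finiteEnergy.meas
      fun x y => ?_).trans (add_le_add_left (hK n) _)
    rw [← hηe]
    exact abs_min_sub_min_le_add _ _ _ _
  · refine (eLpNorm_mono fun x => ?_).trans (hL3 n)
    rw [Real.norm_of_nonneg (le_min (h0 n x) (hη0 x)), Real.norm_of_nonneg (h0 n x)]
    exact min_le_left _ _
  · filter_upwards [h.lim] with x hx using hx.min tendsto_const_nhds

/-- A cutoff function that vanishes in the ball of radius `R` and equals one outside the ball of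
radius `R + 1`. -/
def cutoff (R : ℝ) (x : Plane) : ℝ := min 1 (max 0 (‖x‖ - R))

theorem isLipc_one_sub_cutoff (R : ℝ) : IsLipc fun x => 1 - cutoff R x := by
  constructor
  · refine ⟨1, LipschitzWith.of_dist_le_mul fun x y => ?_⟩
    rw [Real.dist_eq, dist_eq_norm, NNReal.coe_one, one_mul, sub_sub_sub_cancel_left, abs_sub_comm]
    refine (abs_min_sub_min_le_max _ _ _ _).trans ?_
    rw [sub_self, abs_zero, max_eq_right (abs_nonneg _)]
    refine (abs_max_sub_max_le_max _ _ _ _).trans ?_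
    rw [sub_self, abs_zero, max_eq_right (abs_nonneg _), sub_sub_sub_cancel_right]
    exact abs_norm_sub_norm_le x y
  · refine HasCompactSupport.intro (isCompact_closedBall (0 : Plane) (R + 1)) fun x hx => ?_
    rw [mem_closedBall_zero_iff, not_le] at hx
    rw [cutoff, min_eq_left ((by linarith : 1 ≤ ‖x‖ - R).trans (le_max_right _ _)), sub_self]

theorem cutoff_nonneg (R : ℝ) (x : Plane) : 0 ≤ cutoff R x := le_min zero_le_one (le_max_left _ _)

theorem cutoff_eq_zero {R : ℝ} {x : Plane} (hx : ‖x‖ ≤ R) : cutoff R x = 0 := by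
  rw [cutoff, max_eq_left (by linarith), min_eq_right zero_le_one]

theorem cutoff_eq_one {R : ℝ} {x : Plane} (hx : R + 1 ≤ ‖x‖) : cutoff R x = 1 :=
  min_eq_left ((by linarith : 1 ≤ ‖x‖ - R).trans (le_max_right _ _))

/-- The source bound holds only for |x| > R, so the Lipschitz approximants of the test function must
vanish near the inner ball; the cutoff forces this. Since u ≤ W for |x| ≤ R₁ + 1, the cutoff
survives in the limit only as a saturation at 1, which the monotone map T absorbs. -/
theorem IsGround.le_of_supersolution {V u W g : Plane → ℝ} {ψ : ℕ → Plane → ℝ} {R R₁ : ℝ}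
    (h : IsGround V u) (hV : MemHdot V) (hW : IsWeakLimit ψ W)
    (hVg : HalfLapLE V g {x : Plane | R < ‖x‖})
    (hg : LocallyIntegrableOn g {x : Plane | R < ‖x‖} volume) (hR : R < R₁)
    (hg3 : MemLp ({x : Plane | R₁ ≤ ‖x‖}.indicator g) (3 / 2) volume)
    (hin : ∀ x, ‖x‖ ≤ R₁ + 1 → u x ≤ W x)
    (hsup : ∀ (χ : Plane → ℝ) (χ' : ℕ → Plane → ℝ), IsWeakLimit χ' χ → (∀ x, 0 ≤ χ x) →
      (∀ x, ‖x‖ ≤ R₁ + 1 → χ x = 0) → ∫ x, {x : Plane | R₁ ≤ ‖x‖}.indicator g x * χ x ≤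
        hdotInner W χ + ∫ x, |W x| * W x * χ x) : ∀ᵐ x, u x ≤ W x := by
  obtain ⟨φ, hφ, hw, -⟩ := h.exists_isWeakLimit
  have hχ0 := (hw.comp₂ abs_posPart_sub_le (by simp) hW).min_cutoff
    (fun n x => le_max_right _ _) (isLipc_one_sub_cutoff R₁) (cutoff_nonneg R₁)
  set χ' : ℕ → Plane → ℝ := fun n x => min (max (φ n x - ψ n x) 0) (cutoff R₁ x) with hχ'
  set T : ℝ → ℝ := fun a => min (max a 0) 1 with hT
  set χ : Plane → ℝ := fun x => T (u x - W x) with hχdef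
  have hχ : IsWeakLimit χ' χ := by
    convert hχ0 using 1
    funext x
    rcases le_total ‖x‖ (R₁ + 1) with hx | hx
    · simp only [hχdef, hT, max_eq_right (sub_nonpos.2 (hin x hx)), min_eq_left zero_le_one,
        min_eq_left (cutoff_nonneg R₁ x)]
    · rw [cutoff_eq_one hx]
  have hχnn : ∀ x, 0 ≤ χ x := fun x => le_min (le_max_right _ _) zero_le_one
  have hχz : ∀ x, ‖x‖ ≤ R₁ + 1 → χ x = 0 := fun x hx => by
    simp only [hχdef, hT, max_eq_right (sub_nonpos.2 (hin x hx)), min_eq_left zero_le_one]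
  have hz : ∀ n x, ‖x‖ ≤ R₁ → χ' n x = 0 := fun n x hx => by
    simp only [hχ', cutoff_eq_zero hx]
    exact min_eq_right (le_max_right _ _)
  have hcl : IsClosed {x : Plane | R₁ ≤ ‖x‖} := isClosed_le continuous_const continuous_norm
  have hle : ∀ n, hdotInner V (χ' n) ≤ ∫ x, {x : Plane | R₁ ≤ ‖x‖}.indicator g x * χ' n x := by
    intro n
    refine (hVg.lipc hV.finiteEnergy (isOpen_lt continuous_const continuous_norm) hg
      (hχ.lipc n) (fun x => le_min (le_max_right _ _) (cutoff_nonneg _ _)) ?_).trans (le_of_eq ?_)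
    · have h1 : tsupport (χ' n) ⊆ {x : Plane | R₁ ≤ ‖x‖} := closure_minimal (fun x hx => by
        by_contra hx'
        exact hx (hz n x (le_of_not_ge hx'))) hcl
      exact fun x hx => hR.trans_le (h1 hx)
    · congr 1
      funext x
      by_cases hx : R₁ ≤ ‖x‖
      · rw [Set.indicator_of_mem (by exact hx)]
      · rw [hz n x (le_of_not_ge hx), mul_zero, mul_zero]
  have h1 := h.eq_isWeakLimit hV.finiteEnergy hχ
  have h2 : hdotInner V χ ≤ ∫ x, {x : Plane | R₁ ≤ ‖x‖}.indicator g x * χ x :=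
    le_of_tendsto_of_tendsto' (hχ.tendsto_hdotInner hV.finiteEnergy) (hχ.tendsto_integral hg3) hle
  have hsup' := hsup χ _ hχ hχnn hχz
  have h3 : hdotInner χ χ ≤ hdotInner (u - W) χ := hdotInner_comp_le (T := T)
    (fun a b hab => min_le_min (max_le_max hab le_rfl) le_rfl)
    (fun a b => (abs_min_sub_min_le_max _ _ _ _).trans (by
      simpa using abs_max_sub_max_le_max a 0 b 0))
    (h.finiteEnergy.sub hW.finiteEnergy) hχ.finiteEnergy
  have h4 : hdotInner (u - W) χ = hdotInner u χ - hdotInner W χ :=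
    hdotInner_sub_left hχ.finiteEnergy h.finiteEnergy hW.finiteEnergy
  have i1 : Integrable (fun x => |W x| * W x * χ x) volume :=
    (memLp_abs_mul_self (r := 3 / 2) hW.memLp_three).integrable_mul hχ.memLp_three
  have i2 : Integrable (fun x => |u x| * u x * χ x) volume :=
    (memLp_abs_mul_self (r := 3 / 2) h.mem_three).integrable_mul hχ.memLp_three
  have h5 : ∫ x, |W x| * W x * χ x ≤ ∫ x, |u x| * u x * χ x := by
    refine integral_mono i1 i2 fun x => ?_
    rcases le_total (u x - W x) 0 with h0 | h0
    · simp [hχdef, hT, max_eq_right h0]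
    · exact mul_le_mul_of_nonneg_right (abs_mul_self_mono (by linarith)) (hχnn x)
  filter_upwards [ae_eq_zero_of_hdotInner_self hχ.finiteEnergy hχ.memLp_four (by linarith)]
    with x hx
  have h6 : min (max (u x - W x) 0) 1 = 0 := hx
  by_contra h7
  have h8 : 0 < min (max (u x - W x) 0) 1 :=
    lt_min (lt_max_of_lt_left (by linarith)) one_pos
  exact h8.ne' h6

/-! ### The logarithmic barrier and its half-Laplacian -/

/-- The `k`-th term of the series that defines `barrier`. -/
def barrierTerm (k : ℕ) (x : Plane) : ℝ :=
  1 / ((k : ℝ) + 1) * (coulomb (2 ^ k) 0 x - coulomb (2 ^ (k + 1)) 0 x)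

/-- A positive function that decays like `1 / (|x| log |x|)`. -/
def barrier (x : Plane) : ℝ := ∑' k, barrierTerm k x

/-- The `k`-th term of the series that defines `barrierDensity`. -/
def barrierDensityTerm (k : ℕ) (x : Plane) : ℝ :=
  poisson (2 ^ (k + 1)) 0 x / (((k : ℝ) + 1) * ((k : ℝ) + 2))

/-- The half-Laplacian of `barrier`. -/
def barrierDensity (x : Plane) : ℝ := poisson 1 0 x - ∑' k, barrierDensityTerm k x

theorem coulomb_two_pow_succ_le (k : ℕ) (x : Plane) :
    coulomb (2 ^ (k + 1)) 0 x ≤ coulomb (2 ^ k) 0 x := by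
  have := coulomb_sub_coulomb_nonneg (s := 2 ^ k) (t := 2 ^ k) (by positivity) (by positivity) 0 x
  rw [← two_mul, ← pow_succ'] at this
  linarith

theorem coulomb_two_pow_antitone (x : Plane) : Antitone fun k : ℕ => coulomb (2 ^ k) 0 x :=
  antitone_nat_of_succ_le fun k => coulomb_two_pow_succ_le k x

theorem barrierTerm_nonneg (k : ℕ) (x : Plane) : 0 ≤ barrierTerm k x :=
  mul_nonneg (by positivity) (sub_nonneg.2 (coulomb_two_pow_succ_le k x))

theorem barrierTerm_le (k : ℕ) (x : Plane) :
    barrierTerm k x ≤ coulomb (2 ^ k) 0 x - coulomb (2 ^ (k + 1)) 0 x := by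
  have h1 : 1 / ((k : ℝ) + 1) ≤ 1 := by
    rw [div_le_one (by positivity)]; linarith [k.cast_nonneg (α := ℝ)]
  exact mul_le_of_le_one_left (sub_nonneg.2 (coulomb_two_pow_succ_le k x)) h1

/-- Weights at most 1 leave a telescoping sum. -/
theorem sum_barrierTerm_le_sub (N : ℕ) (x : Plane) :
    ∑ k ∈ Finset.range N, barrierTerm k x ≤ coulomb 1 0 x - coulomb (2 ^ N) 0 x := by
  induction N with
  | zero => simp
  | succ N ih =>
    rw [Finset.sum_range_succ]
    linarith [barrierTerm_le N x]

theorem sum_barrierTerm_le (N : ℕ) (x : Plane) :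
    ∑ k ∈ Finset.range N, barrierTerm k x ≤ coulomb 1 0 x :=
  (sum_barrierTerm_le_sub N x).trans
    (sub_le_self _ (coulomb_pos (s := 2 ^ N) (by positivity) 0 x).le)

theorem summable_barrierTerm (x : Plane) : Summable fun k => barrierTerm k x :=
  summable_of_sum_range_le (fun k => barrierTerm_nonneg k x) fun N => sum_barrierTerm_le N x

theorem tendsto_barrier (x : Plane) :
    Tendsto (fun N => ∑ k ∈ Finset.range N, barrierTerm k x) atTop (𝓝 (barrier x)) :=
  (summable_barrierTerm x).hasSum.tendsto_sum_nat

theorem barrier_le_coulomb (x : Plane) : barrier x ≤ coulomb 1 0 x :=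
  le_of_tendsto' (tendsto_barrier x) fun N => sum_barrierTerm_le N x

theorem barrier_le_one (x : Plane) : barrier x ≤ 1 :=
  (barrier_le_coulomb x).trans (by simpa using coulomb_le one_pos 0 x)

theorem barrierTerm_le_barrier (k : ℕ) (x : Plane) : barrierTerm k x ≤ barrier x :=
  (summable_barrierTerm x).le_tsum k fun j _ => barrierTerm_nonneg j x

theorem coulomb_two_pow_sub (k : ℕ) (x : Plane) :
    coulomb (2 ^ k) 0 x - coulomb (2 ^ (k + 1)) 0 x = 2 ^ k * ((3 * 2 ^ k) /
      (Real.sqrt (‖x‖ ^ 2 + (2 ^ k) ^ 2) * Real.sqrt (‖x‖ ^ 2 + (2 * 2 ^ k) ^ 2) *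
        (Real.sqrt (‖x‖ ^ 2 + (2 ^ k) ^ 2) + Real.sqrt (‖x‖ ^ 2 + (2 * 2 ^ k) ^ 2)))) := by
  have := coulomb_sub_coulomb (s := 2 ^ k) (t := 2 ^ k) (by positivity) (by positivity) 0 x
  rw [← two_mul, ← pow_succ', sub_zero] at this
  rw [this, pow_succ']
  congr 3
  ring

theorem barrier_pos (x : Plane) : 0 < barrier x := by
  refine lt_of_lt_of_le ?_ (barrierTerm_le_barrier 0 x)
  rw [barrierTerm, coulomb_two_pow_sub]
  positivity

theorem continuous_barrierTerm (k : ℕ) : Continuous (barrierTerm k) :=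
  continuous_const.mul ((continuous_coulomb (by positivity) 0).sub
    (continuous_coulomb (by positivity) 0))

theorem continuous_barrier : Continuous barrier := by
  refine continuous_tsum (u := fun k : ℕ => (1 / 2 : ℝ) ^ k) continuous_barrierTerm
    summable_geometric_two fun k x => ?_
  rw [Real.norm_of_nonneg (barrierTerm_nonneg k x)]
  refine (barrierTerm_le k x).trans ((sub_le_self _ (coulomb_pos (by positivity) 0 x).le).trans
    ((coulomb_le (by positivity) 0 x).trans (le_of_eq ?_)))
  rw [one_div, inv_pow]

theorem poisson_le_coulomb_sq {s : ℝ} (hs : 1 ≤ s) (x : Plane) :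
    poisson s 0 x ≤ coulomb 1 0 x ^ 2 := by
  have hs0 : 0 < s := one_pos.trans_le hs
  have h1 : coulomb s 0 x ≤ coulomb 1 0 x := by
    have := coulomb_sub_coulomb_nonneg one_pos (sub_nonneg.2 hs) 0 x
    rw [add_sub_cancel] at this
    linarith
  have h2 := coulomb_le hs0 0 x
  have h3 := coulomb_pos hs0 0 x
  rw [poisson_eq_coulomb]
  calc s * coulomb s 0 x ^ 3 = (s * coulomb s 0 x) * coulomb s 0 x ^ 2 := by ring
    _ ≤ (s * s⁻¹) * coulomb 1 0 x ^ 2 := by gcongr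
    _ = _ := by rw [mul_inv_cancel₀ hs0.ne', one_mul]

theorem one_le_two_pow_real (k : ℕ) : (1 : ℝ) ≤ 2 ^ k := one_le_pow₀ one_le_two

theorem barrierDensityTerm_nonneg (k : ℕ) (x : Plane) : 0 ≤ barrierDensityTerm k x :=
  div_nonneg (poisson_pos (by positivity) 0 x).le (by positivity)

/-- Each Poisson kernel is at most k_1², and the coefficients 1/((k+1)(k+2)) telescope. -/
theorem sum_barrierDensityTerm_le (N : ℕ) (x : Plane) :
    ∑ k ∈ Finset.range N, barrierDensityTerm k x ≤
      coulomb 1 0 x ^ 2 * (1 - 1 / ((N : ℝ) + 1)) := by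
  induction N with
  | zero => simp
  | succ N ih =>
    rw [Finset.sum_range_succ]
    have h1 : barrierDensityTerm N x ≤
        coulomb 1 0 x ^ 2 / (((N : ℝ) + 1) * ((N : ℝ) + 2)) := by
      unfold barrierDensityTerm
      have := poisson_le_coulomb_sq (one_le_two_pow_real (N + 1)) x
      gcongr
    refine (add_le_add ih h1).trans (le_of_eq ?_)
    push_cast
    field_simp
    ring

theorem sum_barrierDensityTerm_le' (N : ℕ) (x : Plane) :
    ∑ k ∈ Finset.range N, barrierDensityTerm k x ≤ coulomb 1 0 x ^ 2 :=
  (sum_barrierDensityTerm_le N x).trans (mul_le_of_le_one_right (by positivity)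
    (sub_le_self _ (by positivity)))

theorem summable_barrierDensityTerm (x : Plane) : Summable fun k => barrierDensityTerm k x :=
  summable_of_sum_range_le (fun k => barrierDensityTerm_nonneg k x)
    fun N => sum_barrierDensityTerm_le' N x

theorem tendsto_barrierDensity (x : Plane) :
    Tendsto (fun N => poisson 1 0 x - ∑ k ∈ Finset.range N, barrierDensityTerm k x) atTop
      (𝓝 (barrierDensity x)) :=
  (summable_barrierDensityTerm x).hasSum.tendsto_sum_nat.const_sub _

theorem barrierDensity_le (k : ℕ) (x : Plane) :
    barrierDensity x ≤ poisson 1 0 x - barrierDensityTerm k x :=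
  sub_le_sub_left ((summable_barrierDensityTerm x).le_tsum k
    fun j _ => barrierDensityTerm_nonneg j x) _

/-- The half-Laplacian of a partial sum of `barrier`. -/
def barrierDensitySum (N : ℕ) (x : Plane) : ℝ :=
  poisson 1 0 x - (∑ k ∈ Finset.range N, barrierDensityTerm k x) -
    1 / ((N : ℝ) + 1) * poisson (2 ^ N) 0 x

theorem abs_barrierDensitySum_le (N : ℕ) (x : Plane) :
    |barrierDensitySum N x| ≤ 3 * coulomb 1 0 x ^ 2 := by
  have h1 := poisson_le_coulomb_sq le_rfl x
  have h2 := sum_barrierDensityTerm_le' N x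
  have h3 := poisson_le_coulomb_sq (one_le_two_pow_real N) x
  have h4 : 0 ≤ ∑ k ∈ Finset.range N, barrierDensityTerm k x :=
    Finset.sum_nonneg fun k _ => barrierDensityTerm_nonneg k x
  have h5 := (poisson_pos one_pos 0 x).le
  have h6 : 0 < poisson (2 ^ N) 0 x := poisson_pos (by positivity) 0 x
  have h7 : 1 / ((N : ℝ) + 1) ≤ 1 := by
    rw [div_le_one (by positivity)]; linarith [N.cast_nonneg (α := ℝ)]
  have h8 : 1 / ((N : ℝ) + 1) * poisson (2 ^ N) 0 x ≤ poisson (2 ^ N) 0 x :=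
    mul_le_of_le_one_left h6.le h7
  have h9 : 0 ≤ 1 / ((N : ℝ) + 1) * poisson (2 ^ N) 0 x := by positivity
  rw [barrierDensitySum, abs_le]
  constructor <;> linarith

theorem tendsto_barrierDensitySum (x : Plane) :
    Tendsto (fun N => barrierDensitySum N x) atTop (𝓝 (barrierDensity x)) := by
  have h1 : Tendsto (fun N : ℕ => 1 / ((N : ℝ) + 1) * poisson (2 ^ N) 0 x) atTop (𝓝 0) := by
    have h2 : Tendsto (fun N : ℕ => 1 / ((N : ℝ) + 1) * coulomb 1 0 x ^ 2) atTop (𝓝 0) := by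
      simpa using (tendsto_one_div_add_atTop_nhds_zero_nat (𝕜 := ℝ)).mul_const (coulomb 1 0 x ^ 2)
    refine squeeze_zero (fun N => ?_) (fun N => ?_) h2
    · have : 0 < poisson (2 ^ N) 0 x := poisson_pos (by positivity) 0 x
      positivity
    · exact mul_le_mul_of_nonneg_left (poisson_le_coulomb_sq (one_le_two_pow_real N) x)
        (by positivity)
  have h3 := (tendsto_barrierDensity x).sub h1
  rwa [sub_zero] at h3

theorem abs_barrierDensity_le (x : Plane) : |barrierDensity x| ≤ 3 * coulomb 1 0 x ^ 2 :=
  le_of_tendsto' (tendsto_barrierDensitySum x).abs fun N => abs_barrierDensitySum_le N x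

theorem measurable_barrierDensitySum (N : ℕ) : Measurable (barrierDensitySum N) := by
  have h : ∀ k : ℕ, Measurable (poisson (2 ^ k) 0) := fun k =>
    (continuous_poisson (by positivity) 0).measurable
  refine ((continuous_poisson one_pos 0).measurable.sub
    (Finset.measurable_fun_sum _ fun k _ => (h (k + 1)).div_const _)).sub ((h N).const_mul _)

theorem memLp_coulomb_sq (C : ℝ) :
    MemLp (fun x => C * coulomb 1 0 x ^ 2) (3 / 2) volume := by
  have h := (memLp_abs_mul_self (r := 3 / 2) (memLp_coulomb_three one_pos 0)).const_mul C
  refine (memLp_congr_ae (ae_of_all _ fun x => ?_)).1 h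
  simp only [abs_of_pos (coulomb_pos one_pos 0 x), sq]

theorem memLp_barrierDensity : MemLp barrierDensity (3 / 2) volume := by
  refine (memLp_coulomb_sq 3).mono (aestronglyMeasurable_of_tendsto_ae atTop
    (fun N => (measurable_barrierDensitySum N).aestronglyMeasurable)
    (ae_of_all _ tendsto_barrierDensitySum)) (ae_of_all _ fun x => ?_)
  rw [Real.norm_eq_abs, Real.norm_of_nonneg (by positivity)]
  exact abs_barrierDensity_le x

theorem memLp_barrierDensitySum (N : ℕ) : MemLp (barrierDensitySum N) (3 / 2) volume := by
  refine (memLp_coulomb_sq 3).mono (measurable_barrierDensitySum N).aestronglyMeasurable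
    (ae_of_all _ fun x => ?_)
  rw [Real.norm_eq_abs, Real.norm_of_nonneg (by positivity)]
  exact abs_barrierDensitySum_le N x

theorem isWeakLimit_barrierTerm (k : ℕ) : ∃ ψ, IsWeakLimit ψ (barrierTerm k) := by
  have h1 := isWeakLimit_coulomb (s := 2 ^ k) (by positivity) 0
  have h2 := isWeakLimit_coulomb (s := 2 ^ (k + 1)) (by positivity) 0
  refine ⟨_, h1.comp₂ (F := fun a b => 1 / ((k : ℝ) + 1) * (a - b)) (fun a b a' b' => ?_)
    (by simp) h2⟩
  have h7 : 1 / ((k : ℝ) + 1) ≤ 1 := by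
    rw [div_le_one (by positivity)]; linarith [k.cast_nonneg (α := ℝ)]
  rw [← mul_sub, abs_mul, abs_of_pos (by positivity)]
  exact (mul_le_of_le_one_left (abs_nonneg _) h7).trans (abs_sub_sub_sub_le a b a' b')

theorem isWeakLimit_sum_barrierTerm (N : ℕ) :
    ∃ ψ, IsWeakLimit ψ fun x => ∑ k ∈ Finset.range N, barrierTerm k x := by
  induction N with
  | zero =>
    refine ⟨_, isWeakLimit_const (f := fun _ => 0) ⟨⟨0, LipschitzWith.const 0⟩, ?_⟩⟩
    exact HasCompactSupport.zero
  | succ N ih =>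
    obtain ⟨ψ, hψ⟩ := ih
    obtain ⟨ψ', hψ'⟩ := isWeakLimit_barrierTerm N
    simp only [Finset.sum_range_succ]
    refine ⟨_, hψ.comp₂ (F := fun a b => a + b) (fun a b a' b' => ?_) (by simp) hψ'⟩
    rw [add_sub_add_comm]
    exact abs_add_le _ _

/-- Abel summation by induction: P_{2^{k+1}} collects 1/(k+1) − 1/(k+2) = 1/((k+1)(k+2)), and the
last summand of `barrierDensitySum` is the boundary term. -/
theorem hdotInner_sum_barrierTerm {g : Plane → ℝ} (hg : IsLipc g) (N : ℕ) :
    hdotInner (fun x => ∑ k ∈ Finset.range N, barrierTerm k x) g =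
      ∫ x, barrierDensitySum N x * g x := by
  induction N with
  | zero =>
    have h1 : ∀ x, barrierDensitySum 0 x = 0 := fun x => by simp [barrierDensitySum]
    simp [h1, hdotInner]
  | succ N ih =>
    have he : ∀ k : ℕ, FiniteEnergy (coulomb (2 ^ k) 0) := fun k =>
      finiteEnergy_coulomb (by positivity) 0
    have h1 : (fun x => ∑ k ∈ Finset.range (N + 1), barrierTerm k x) =
        (fun x => ∑ k ∈ Finset.range N, barrierTerm k x) +
          (1 / ((N : ℝ) + 1)) • (coulomb (2 ^ N) 0 - coulomb (2 ^ (N + 1)) 0) := by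
      funext x
      simp only [Finset.sum_range_succ, Pi.add_apply, Pi.smul_apply, Pi.sub_apply, smul_eq_mul]
      rfl
    obtain ⟨ψ, hψ⟩ := isWeakLimit_sum_barrierTerm N
    have hs : Integrable (fun x => barrierDensitySum N x * g x) volume :=
      (memLp_barrierDensitySum N).integrable_mul (hg.memLp 3)
    have hi : ∀ k : ℕ, Integrable (fun x => poisson (2 ^ k) 0 x * g x) volume := fun k =>
      (memLp_poisson (by positivity) 0 one_le_four_thirds four_thirds_ne_top).integrable_mul
        (hg.memLp 4)
    rw [h1, hdotInner_add_left hg.finiteEnergy hψ.finiteEnergy (((he N).sub (he (N + 1))).smul _),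
      hdotInner_smul_left, hdotInner_sub_left hg.finiteEnergy (he N) (he (N + 1)), ih,
      hdotInner_coulomb hg (by positivity), hdotInner_coulomb hg (by positivity),
      ← integral_sub (hi N) (hi (N + 1)), ← integral_const_mul,
      ← integral_add hs]
    swap
    · exact ((hi N).sub (hi (N + 1))).const_mul _
    congr 1
    funext x
    simp only [barrierDensitySum, Finset.sum_range_succ, barrierDensityTerm]
    push_cast
    field_simp
    ring

/-- The energy of a partial sum is its integral against its own half-Laplacian; the factors are at
most k_1 and 3k_1², whatever N is. -/
theorem exists_gagliardo_sum_barrierTerm_le : ∃ K : ℝ≥0, ∀ N,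
    gagliardo (fun x => ∑ k ∈ Finset.range N, barrierTerm k x) ≤ K := by
  refine ⟨Real.toNNReal (Real.sqrt (∫ x, 3 * coulomb 1 0 x ^ 3)), fun N => ?_⟩
  obtain ⟨ψ, hψ⟩ := isWeakLimit_sum_barrierTerm N
  have he := hψ.finiteEnergy
  have h1 := hψ.hdotInner_eq he (memLp_barrierDensitySum N)
    fun f hf => hdotInner_sum_barrierTerm hf N
  rw [hdotInner_self he] at h1
  have hi : Integrable (fun x => 3 * coulomb 1 0 x ^ 3) volume := by
    refine ((integral_poisson one_pos 0).1.const_mul 3).congr (ae_of_all _ fun x => ?_)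
    simp only [poisson_eq_coulomb, one_mul]
  have h2 : (gagliardo fun x => ∑ k ∈ Finset.range N, barrierTerm k x).toReal ^ 2 ≤
      ∫ x, 3 * coulomb 1 0 x ^ 3 := by
    rw [h1]
    refine integral_mono ((memLp_barrierDensitySum N).integrable_mul hψ.memLp_three) hi
      fun x => ?_
    have h3 := (le_abs_self _).trans (abs_barrierDensitySum_le N x)
    have h4 := sum_barrierTerm_le N x
    have h5 : 0 ≤ ∑ k ∈ Finset.range N, barrierTerm k x :=
      Finset.sum_nonneg fun k _ => barrierTerm_nonneg k x
    calc barrierDensitySum N x * ∑ k ∈ Finset.range N, barrierTerm k x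
        ≤ 3 * coulomb 1 0 x ^ 2 * coulomb 1 0 x := by gcongr
      _ = _ := by ring
  rw [← ENNReal.ofReal_toReal he.lt_top.ne]
  exact ENNReal.ofReal_le_ofReal (Real.le_sqrt_of_sq_le h2)

theorem lipschitzWith_barrierTerm (k : ℕ) : ∃ K : ℝ≥0, LipschitzWith K (barrierTerm k) := by
  have h : ∀ k : ℕ, LipschitzWith 1 (coulomb (2 ^ k) 0) := fun k =>
    LipschitzWith.of_dist_le_mul fun x y => by
      rw [Real.dist_eq, dist_eq_norm]
      refine (abs_coulomb_sub_le (by positivity) 0 x y).trans ?_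
      have h1 : ((2 : ℝ) ^ k)⁻¹ ≤ 1 := inv_le_one_of_one_le₀ (one_le_two_pow_real k)
      have h2 : (0 : ℝ) ≤ ((2 : ℝ) ^ k)⁻¹ := by positivity
      have h3 : ((2 : ℝ) ^ k)⁻¹ * ((2 : ℝ) ^ k)⁻¹ ≤ 1 := by nlinarith
      simpa using mul_le_mul_of_nonneg_right h3 (norm_nonneg (x - y))
  refine ⟨1 + 1, LipschitzWith.of_dist_le_mul fun x y => ?_⟩
  have h1 := ((h k).sub (h (k + 1))).dist_le_mul x y
  refine le_trans ?_ h1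
  have h7 : 1 / ((k : ℝ) + 1) ≤ 1 := by
    rw [div_le_one (by positivity)]; linarith [k.cast_nonneg (α := ℝ)]
  rw [Real.dist_eq, Real.dist_eq, barrierTerm, barrierTerm, ← mul_sub, abs_mul,
    abs_of_pos (by positivity)]
  exact mul_le_of_le_one_left (abs_nonneg _) h7

theorem lipschitzWith_sum_barrierTerm (N : ℕ) :
    ∃ K : ℝ≥0, LipschitzWith K fun x => ∑ k ∈ Finset.range N, barrierTerm k x := by
  induction N with
  | zero => exact ⟨0, LipschitzWith.const 0⟩
  | succ N ih =>
    obtain ⟨K, hK⟩ := ih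
    obtain ⟨K', hK'⟩ := lipschitzWith_barrierTerm N
    exact ⟨K + K', by simpa only [Finset.sum_range_succ] using hK.add hK'⟩

/-- Partial sums are not compactly supported. Subtracting 1/(N+1) and taking positive parts repairs
this, as the result lies below a truncation of k_1, and it does not increase the energy. -/
theorem isWeakLimit_barrier : ∃ ψ, IsWeakLimit ψ barrier := by
  obtain ⟨K, hK⟩ := exists_gagliardo_sum_barrierTerm_le
  have h0 : ∀ N x, 0 ≤ ∑ k ∈ Finset.range N, barrierTerm k x := fun N x =>
    Finset.sum_nonneg fun k _ => barrierTerm_nonneg k x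
  have hκ : ∀ n : ℕ, 0 < 1 / ((n : ℝ) + 1) := fun n => by positivity
  refine ⟨fun N x => max ((∑ k ∈ Finset.range N, barrierTerm k x) - 1 / ((N : ℝ) + 1)) 0,
    fun N => ⟨?_, ?_⟩, ⟨K, fun N => (gagliardo_mono fun x y => ?_).trans (hK N)⟩,
    ⟨(eLpNorm (coulomb 1 0) 3 volume).toNNReal, fun N => ?_⟩, ae_of_all _ fun x => ?_⟩
  · obtain ⟨L, hL⟩ := lipschitzWith_sum_barrierTerm N
    refine ⟨L, LipschitzWith.of_dist_le_mul fun x y => le_trans ?_ (hL.dist_le_mul x y)⟩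
    rw [Real.dist_eq, Real.dist_eq]
    refine (abs_max_sub_max_le_max _ _ _ _).trans ?_
    simp
  · refine (isLipc_coulombTrunc one_pos (hκ N) 0).supp.mono fun x hx hx0 => hx ?_
    refine le_antisymm ?_ (le_max_right _ _)
    exact (max_le_max (sub_le_sub_right (sum_barrierTerm_le N x) _) le_rfl).trans hx0.le
  · refine (abs_max_sub_max_le_max _ _ _ _).trans ?_
    simp
  · rw [ENNReal.coe_toNNReal (memLp_coulomb_three one_pos 0).2.ne]
    refine eLpNorm_mono_real fun x => ?_
    rw [Real.norm_of_nonneg (le_max_right _ _)]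
    exact max_le ((sub_le_self _ (hκ N).le).trans (sum_barrierTerm_le N x))
      (coulomb_pos one_pos 0 x).le
  · have h1 := ((tendsto_barrier x).sub
      (tendsto_one_div_add_atTop_nhds_zero_nat (𝕜 := ℝ))).max (tendsto_const_nhds (x := (0 : ℝ)))
    rwa [sub_zero, max_eq_left (barrier_pos x).le] at h1

theorem hdotInner_barrier {g : Plane → ℝ} (hg : IsLipc g) :
    hdotInner barrier g = ∫ x, barrierDensity x * g x := by
  obtain ⟨K, hK⟩ := exists_gagliardo_sum_barrierTerm_le
  have h1 := tendsto_hdotInner (v := barrier) hg.finiteEnergy (fun N => by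
    obtain ⟨ψ, hψ⟩ := isWeakLimit_sum_barrierTerm N
    exact hψ.finiteEnergy.meas) hK (ae_of_all _ tendsto_barrier)
  simp only [hdotInner_comm g, hdotInner_sum_barrierTerm hg] at h1
  refine tendsto_nhds_unique h1 (tendsto_integral_of_dominated_convergence
    (fun x => 3 * coulomb 1 0 x ^ 2 * ‖g x‖) (fun N => ?_)
    ((memLp_coulomb_sq 3).integrable_mul (hg.memLp 3).norm) (fun N => ae_of_all _ fun x => ?_)
    (ae_of_all _ fun x => (tendsto_barrierDensitySum x).mul_const _))
  · exact (measurable_barrierDensitySum N).aestronglyMeasurable.mul hg.finiteEnergy.meas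
  · rw [norm_mul, Real.norm_eq_abs (barrierDensitySum N x)]
    exact mul_le_mul_of_nonneg_right (abs_barrierDensitySum_le N x) (norm_nonneg _)

/-! ### Two-sided pointwise bounds for the barrier -/

/-- Write log r = 4 log r^{1/4} and use log q ≤ q − 1. -/
theorem sq_log_le {r : ℝ} (hr : 1 ≤ r) : Real.log r ^ 2 ≤ 16 * Real.sqrt r := by
  set q := Real.sqrt (Real.sqrt r) with hq
  have hq0 : 0 < q := Real.sqrt_pos.2 (Real.sqrt_pos.2 (by linarith))
  have hq2 : q ^ 2 = Real.sqrt r := Real.sq_sqrt (Real.sqrt_nonneg r)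
  have hq4 : r = q ^ 4 := by
    rw [show q ^ 4 = (q ^ 2) ^ 2 by ring, hq2, Real.sq_sqrt (by linarith)]
  have h1 : Real.log r = 4 * Real.log q := by
    conv_lhs => rw [hq4]
    rw [Real.log_pow]; norm_num
  have h2 := Real.log_le_sub_one_of_pos hq0
  have h3 := Real.log_nonneg hr
  rw [← hq2, h1]
  rw [h1] at h3
  nlinarith

theorem exists_two_pow_near {r : ℝ} (hr : 2 ≤ r) :
    ∃ m : ℕ, 2 ^ m ≤ r ∧ r < 2 ^ (m + 1) ∧ (m : ℝ) + 1 ≤ 4 * Real.log r := by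
  obtain ⟨m, h1, h2⟩ := exists_nat_pow_near (by linarith : (1 : ℝ) ≤ r) one_lt_two
  refine ⟨m, h1, h2, ?_⟩
  have h3 := Real.log_le_log (by positivity) h1
  rw [Real.log_pow] at h3
  have h4 := Real.log_le_log two_pos hr
  have h5 := Real.log_two_gt_d9
  nlinarith [m.cast_nonneg (α := ℝ)]

/-- The scale 2^j is at most √r, so scales below it contribute little at distance r, while j is
still comparable with log r. -/
theorem exists_four_pow_near {r : ℝ} (hr : 1 ≤ r) :
    ∃ j : ℕ, (2 ^ j) ^ 2 ≤ r ∧ Real.log r ≤ 2 * ((j : ℝ) + 1) := by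
  obtain ⟨j, h1, h2⟩ := exists_nat_pow_near hr (by norm_num : (1 : ℝ) < 4)
  refine ⟨j, ?_, ?_⟩
  · rw [← pow_mul, mul_comm, pow_mul]; norm_num [h1]
  · have h3 := Real.log_le_log (by linarith) h2.le
    rw [Real.log_pow, show (4 : ℝ) = 2 ^ 2 by norm_num, Real.log_pow] at h3
    have h5 := Real.log_two_lt_d9
    push_cast at h3
    nlinarith [j.cast_nonneg (α := ℝ)]

/-- The single term whose scale 2^m is comparable with |x| already has the right size. -/
theorem le_barrier {x : Plane} (hx : 2 ≤ ‖x‖) :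
    1 / 72 / (‖x‖ * Real.log ‖x‖) ≤ barrier x := by
  obtain ⟨m, h1, h2, h3⟩ := exists_two_pow_near hx
  refine le_trans ?_ (barrierTerm_le_barrier m x)
  rw [barrierTerm, coulomb_two_pow_sub]
  rw [pow_succ'] at h2
  set s : ℝ := 2 ^ m
  have hs : 0 < s := by positivity
  set r := ‖x‖
  have hr : 0 < r := by linarith
  have ha : Real.sqrt (r ^ 2 + s ^ 2) ≤ 3 * s := Real.sqrt_le_iff.2 ⟨by positivity, by nlinarith⟩
  have hb : Real.sqrt (r ^ 2 + (2 * s) ^ 2) ≤ 3 * s :=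
    Real.sqrt_le_iff.2 ⟨by positivity, by nlinarith⟩
  have h4 : 1 / (18 * r) ≤ s * ((3 * s) / (Real.sqrt (r ^ 2 + s ^ 2) *
      Real.sqrt (r ^ 2 + (2 * s) ^ 2) * (Real.sqrt (r ^ 2 + s ^ 2) +
        Real.sqrt (r ^ 2 + (2 * s) ^ 2)))) := by
    calc 1 / (18 * r) ≤ 1 / (18 * s) := by gcongr
      _ = s * ((3 * s) / ((3 * s) * (3 * s) * ((3 * s) + (3 * s)))) := by field_simp; norm_num
      _ ≤ _ := by gcongr
  have hl : 0 < Real.log r := Real.log_pos (by linarith)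
  calc 1 / 72 / (r * Real.log r) = 1 / (4 * Real.log r) * (1 / (18 * r)) := by
        field_simp; norm_num
    _ ≤ _ := by gcongr

theorem coulomb_sub_coulomb_two_pow_le {x : Plane} (hx : 0 < ‖x‖) (j : ℕ) :
    coulomb 1 0 x - coulomb (2 ^ j) 0 x ≤ (2 ^ j) ^ 2 / (2 * ‖x‖ ^ 3) := by
  have h := coulomb_sub_coulomb one_pos (sub_nonneg.2 (one_le_two_pow_real j)) 0 x
  rw [add_sub_cancel, sub_zero] at h
  rw [h]
  set s : ℝ := 2 ^ j
  have hs : 1 ≤ s := one_le_two_pow_real j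
  set r := ‖x‖
  have ha : r ≤ Real.sqrt (r ^ 2 + 1 ^ 2) := Real.le_sqrt_of_sq_le (by linarith)
  have hb : r ≤ Real.sqrt (r ^ 2 + s ^ 2) := Real.le_sqrt_of_sq_le (by nlinarith)
  calc (s - 1) * ((2 * 1 + (s - 1)) / (Real.sqrt (r ^ 2 + 1 ^ 2) * Real.sqrt (r ^ 2 + s ^ 2) *
        (Real.sqrt (r ^ 2 + 1 ^ 2) + Real.sqrt (r ^ 2 + s ^ 2))))
      ≤ (s - 1) * ((2 * 1 + (s - 1)) / (r * r * (r + r))) := by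
        have : 0 ≤ s - 1 := by linarith
        gcongr
    _ = (s ^ 2 - 1) / (2 * r ^ 3) := by field_simp; ring
    _ ≤ _ := by gcongr; linarith

/-- Split at j: weights are at most 1 below and at most 1/(j+1) beyond, and both pieces telescope.
-/
theorem sum_barrierTerm_le_of_le {j N : ℕ} (hN : j ≤ N) (x : Plane) :
    ∑ k ∈ Finset.range N, barrierTerm k x ≤ coulomb 1 0 x - coulomb (2 ^ j) 0 x +
      1 / ((j : ℝ) + 1) * (coulomb (2 ^ j) 0 x - coulomb (2 ^ N) 0 x) := by
  induction N, hN using Nat.le_induction with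
  | base => simpa using sum_barrierTerm_le_sub j x
  | succ N hN ih =>
    rw [Finset.sum_range_succ]
    have h1 : barrierTerm N x ≤
        1 / ((j : ℝ) + 1) * (coulomb (2 ^ N) 0 x - coulomb (2 ^ (N + 1)) 0 x) := by
      unfold barrierTerm
      have := sub_nonneg.2 (coulomb_two_pow_succ_le N x)
      gcongr
    refine (add_le_add ih h1).trans (le_of_eq ?_)
    ring

theorem barrier_le {x : Plane} (hx : 2 ≤ ‖x‖) : barrier x ≤ 3 / (‖x‖ * Real.log ‖x‖) := by
  obtain ⟨j, h1, h2⟩ := exists_four_pow_near (by linarith : 1 ≤ ‖x‖)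
  have hr : 0 < ‖x‖ := by linarith
  have hl : 0 < Real.log ‖x‖ := Real.log_pos (by linarith)
  have h3 := coulomb_sub_coulomb_two_pow_le hr j
  have h4 : coulomb (2 ^ j) 0 x ≤ 1 / ‖x‖ := by
    rw [coulomb, sub_zero, one_div]
    exact inv_anti₀ hr (Real.le_sqrt_of_sq_le (by nlinarith [sq_nonneg ((2 : ℝ) ^ j)]))
  have h5 : 1 / ((j : ℝ) + 1) ≤ 2 / Real.log ‖x‖ := by
    rw [div_le_div_iff₀ (by positivity) hl]; linarith
  have h6 : barrier x ≤ (2 ^ j) ^ 2 / (2 * ‖x‖ ^ 3) + 2 / Real.log ‖x‖ * (1 / ‖x‖) := by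
    refine le_of_tendsto (tendsto_barrier x) ?_
    filter_upwards [eventually_ge_atTop j] with N hN
    refine (sum_barrierTerm_le_of_le hN x).trans (add_le_add h3 ?_)
    have h7 : 0 < coulomb (2 ^ N) 0 x := coulomb_pos (by positivity) 0 x
    have h8 : coulomb (2 ^ j) 0 x - coulomb (2 ^ N) 0 x ≤ 1 / ‖x‖ := by linarith
    have h9 : 0 ≤ coulomb (2 ^ j) 0 x - coulomb (2 ^ N) 0 x :=
      sub_nonneg.2 (coulomb_two_pow_antitone x hN)
    gcongr
  refine h6.trans ?_
  have h7 : Real.log ‖x‖ ≤ ‖x‖ := (Real.log_le_sub_one_of_pos hr).trans (by linarith)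
  set r := ‖x‖
  have h8 : (2 ^ j) ^ 2 / (2 * r ^ 3) ≤ 1 / (r * Real.log r) := by
    calc ((2 : ℝ) ^ j) ^ 2 / (2 * r ^ 3) ≤ r / (2 * r ^ 3) := by gcongr
      _ = 1 / (r * (2 * r)) := by field_simp
      _ ≤ _ := by gcongr; linarith
  calc _ ≤ 1 / (r * Real.log r) + 2 / Real.log r * (1 / r) := by linarith
    _ = _ := by field_simp; norm_num

/-- Only the negative term at the scale of |x| is kept. Half of it absorbs P_1 ≤ |x|⁻³, which
requires 672 log²|x| ≤ |x|; as log² r ≤ 16√r, this holds once √|x| ≥ 672·16 = 10752. -/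
theorem barrierDensity_le_neg {x : Plane} (hx : 10752 ^ 2 ≤ ‖x‖) :
    barrierDensity x ≤ -(1 / 672 / (‖x‖ * Real.log ‖x‖) ^ 2) := by
  have h2r : 2 ≤ ‖x‖ := le_trans (by norm_num) hx
  obtain ⟨m, h1, h2, h3⟩ := exists_two_pow_near h2r
  have h0 := barrierDensity_le m x
  have hr : 0 < ‖x‖ := by linarith
  have hl : 0 < Real.log ‖x‖ := Real.log_pos (by linarith)
  have h4 : poisson 1 0 x ≤ 1 / ‖x‖ ^ 3 := by
    rw [poisson, one_mul, sub_zero, ← one_div]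
    have : ‖x‖ ≤ Real.sqrt (‖x‖ ^ 2 + 1 ^ 2) := Real.le_sqrt_of_sq_le (by linarith)
    gcongr
  have h5 : 1 / 14 / ‖x‖ ^ 2 ≤ poisson (2 ^ (m + 1)) 0 x := by
    rw [poisson, sub_zero]
    have hs2 : (2 : ℝ) ^ (m + 1) ≤ 2 * ‖x‖ := by rw [pow_succ']; linarith
    set s : ℝ := 2 ^ (m + 1)
    have hs : 0 < s := by positivity
    have ha : Real.sqrt (‖x‖ ^ 2 + s ^ 2) ≤ 3 / 2 * s :=
      Real.sqrt_le_iff.2 ⟨by positivity, by nlinarith⟩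
    have hb : 0 < Real.sqrt (‖x‖ ^ 2 + s ^ 2) := Real.sqrt_pos.2 (by positivity)
    calc 1 / 14 / ‖x‖ ^ 2 ≤ 8 / 27 / (2 * ‖x‖) ^ 2 := by
          rw [div_le_div_iff₀ (by positivity) (by positivity)]; nlinarith [sq_nonneg ‖x‖]
      _ ≤ 8 / 27 / s ^ 2 := by gcongr
      _ = s * ((3 / 2 * s) ^ 3)⁻¹ := by field_simp; norm_num
      _ ≤ _ := by gcongr
  have h6 : 1 / 336 / (‖x‖ * Real.log ‖x‖) ^ 2 ≤ barrierDensityTerm m x := by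
    have h7 : (m : ℝ) + 2 ≤ 6 * Real.log ‖x‖ := by
      have h4 := Real.log_le_log two_pos h2r
      have h5 := Real.log_two_gt_d9
      linarith
    unfold barrierDensityTerm
    calc 1 / 336 / (‖x‖ * Real.log ‖x‖) ^ 2 =
          1 / 14 / ‖x‖ ^ 2 / ((4 * Real.log ‖x‖) * (6 * Real.log ‖x‖)) := by
            field_simp; norm_num
      _ ≤ _ := div_le_div₀ (poisson_pos (by positivity) 0 x).le h5 (by positivity) (by gcongr)
  have h7 : 1 / ‖x‖ ^ 3 ≤ 1 / 672 / (‖x‖ * Real.log ‖x‖) ^ 2 := by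
    have h8 := sq_log_le (by linarith : 1 ≤ ‖x‖)
    have h9 : 10752 ≤ Real.sqrt ‖x‖ := Real.le_sqrt_of_sq_le hx
    have h10 := Real.sq_sqrt hr.le
    have h11 : 672 * Real.log ‖x‖ ^ 2 ≤ ‖x‖ := by nlinarith
    rw [div_div, div_le_div_iff₀ (by positivity) (by positivity)]
    have : 0 < ‖x‖ ^ 2 := by positivity
    nlinarith
  have h8 : 1 / 336 / (‖x‖ * Real.log ‖x‖) ^ 2 =
      1 / 672 / (‖x‖ * Real.log ‖x‖) ^ 2 + 1 / 672 / (‖x‖ * Real.log ‖x‖) ^ 2 := by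
    ring
  linarith

/-- The s-derivative of sk_s is |x|²(|x|² + s²)^{-3/2}, which decreases in s, so the increment over
[s/2, s] is at least ½|x|²P_s. Sums of P_s over dyadic scales are thereby bounded by a telescoping
sum. -/
theorem poisson_le_sub {s : ℝ} (hs : 0 < s) {x : Plane} (hx : 0 < ‖x‖) :
    poisson s 0 x ≤ 2 / ‖x‖ ^ 2 * (s * coulomb s 0 x - s / 2 * coulomb (s / 2) 0 x) := by
  have ha := sqrt_reg_pos hs 0 x
  have hb := sqrt_reg_pos (half_pos hs) 0 x
  have ha2 := Real.sq_sqrt (show 0 ≤ ‖x - 0‖ ^ 2 + s ^ 2 by positivity)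
  have hb2 := Real.sq_sqrt (show 0 ≤ ‖x - 0‖ ^ 2 + (s / 2) ^ 2 by positivity)
  have hba : Real.sqrt (‖x - 0‖ ^ 2 + (s / 2) ^ 2) ≤ Real.sqrt (‖x - 0‖ ^ 2 + s ^ 2) :=
    Real.sqrt_le_sqrt (by nlinarith)
  unfold poisson coulomb
  rw [sub_zero] at *
  set a := Real.sqrt (‖x‖ ^ 2 + s ^ 2)
  set b := Real.sqrt (‖x‖ ^ 2 + (s / 2) ^ 2)
  set r := ‖x‖
  have h1 : 2 / r ^ 2 * (s * a⁻¹ - s / 2 * b⁻¹) - s * (a ^ 3)⁻¹ =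
      s * ((2 * b - a) * a ^ 2 - r ^ 2 * b) / (r ^ 2 * a ^ 3 * b) := by
    field_simp
  have h2 : (2 * b - a) * (2 * b + a) = 3 * r ^ 2 := by linear_combination 4 * hb2 - ha2
  have h3 : 0 ≤ 2 * b - a := by
    by_contra h
    have : (2 * b - a) * (2 * b + a) < 0 := mul_neg_of_neg_of_pos (by linarith) (by linarith)
    nlinarith
  have h4 : 0 ≤ (2 * b - a) * a ^ 2 - r ^ 2 * b := by
    have h5 : 0 ≤ 3 * a ^ 2 - (2 * b + a) * b := by nlinarith
    have h6 := mul_nonneg h3 h5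
    have h7 : (2 * b - a) * (3 * a ^ 2 - (2 * b + a) * b) =
        3 * ((2 * b - a) * a ^ 2 - r ^ 2 * b) := by linear_combination -b * h2
    linarith
  have h5 : 0 ≤ s * ((2 * b - a) * a ^ 2 - r ^ 2 * b) / (r ^ 2 * a ^ 3 * b) := by positivity
  linarith

theorem sum_barrierDensityTerm_le_pow {x : Plane} (hx : 0 < ‖x‖) (j : ℕ) :
    ∑ k ∈ Finset.range j, barrierDensityTerm k x ≤ 2 * 2 ^ j / ‖x‖ ^ 3 := by
  have h : ∑ k ∈ Finset.range j, barrierDensityTerm k x ≤ 2 * (2 ^ j - 1) / ‖x‖ ^ 3 := by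
    induction j with
    | zero => simp
    | succ j ih =>
      rw [Finset.sum_range_succ]
      have h1 : barrierDensityTerm j x ≤ 2 ^ (j + 1) / ‖x‖ ^ 3 := by
        refine (div_le_self (poisson_pos (by positivity) 0 x).le ?_).trans ?_
        · nlinarith [j.cast_nonneg (α := ℝ)]
        · have h2 : ‖x‖ ≤ Real.sqrt (‖x‖ ^ 2 + (2 ^ (j + 1)) ^ 2) :=
            Real.le_sqrt_of_sq_le (by linarith [sq_nonneg ((2 : ℝ) ^ (j + 1))])
          rw [poisson, sub_zero, ← div_eq_mul_inv]
          gcongr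
      refine (add_le_add ih h1).trans (le_of_eq ?_)
      rw [pow_succ]
      field_simp
      ring
  refine h.trans ?_
  gcongr
  linarith

theorem sum_barrierDensityTerm_le_of_le {j N : ℕ} (hN : j ≤ N) {x : Plane} (hx : 0 < ‖x‖) :
    ∑ k ∈ Finset.range N, barrierDensityTerm k x ≤ 2 * 2 ^ j / ‖x‖ ^ 3 +
      2 / ‖x‖ ^ 2 * (2 ^ N * coulomb (2 ^ N) 0 x - 2 ^ j * coulomb (2 ^ j) 0 x) /
        ((j : ℝ) + 1) ^ 2 := by
  induction N, hN using Nat.le_induction with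
  | base => simpa using sum_barrierDensityTerm_le_pow hx j
  | succ N hN ih =>
    rw [Finset.sum_range_succ]
    have h1 := poisson_le_sub (s := 2 ^ (N + 1)) (by positivity) hx
    rw [show (2 : ℝ) ^ (N + 1) / 2 = 2 ^ N by rw [pow_succ]; ring] at h1
    have h2 : barrierDensityTerm N x ≤ poisson (2 ^ (N + 1)) 0 x / ((j : ℝ) + 1) ^ 2 := by
      unfold barrierDensityTerm
      have h3 : 0 < poisson (2 ^ (N + 1)) 0 x := poisson_pos (by positivity) 0 x
      have h4 : (j : ℝ) ≤ N := by exact_mod_cast hN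
      rw [sq]
      gcongr
      linarith
    have h3 : poisson (2 ^ (N + 1)) 0 x / ((j : ℝ) + 1) ^ 2 ≤ _ / ((j : ℝ) + 1) ^ 2 :=
      div_le_div_of_nonneg_right h1 (by positivity)
    refine (add_le_add ih (h2.trans h3)).trans (le_of_eq ?_)
    ring

/-- Scales below 2^j ≤ √|x| contribute a geometric sum of order |x|^{-5/2}. Larger scales carry
coefficients at most (j+1)⁻², and their sum telescopes to at most 2/|x|² because sk_s ≤ 1. -/
theorem le_barrierDensity {x : Plane} (hx : 2 ≤ ‖x‖) :
    -(40 / (‖x‖ * Real.log ‖x‖) ^ 2) ≤ barrierDensity x := by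
  obtain ⟨j, h1, h2⟩ := exists_four_pow_near (by linarith : 1 ≤ ‖x‖)
  have hr : 0 < ‖x‖ := by linarith
  have hl : 0 < Real.log ‖x‖ := Real.log_pos (by linarith)
  have h3 : (2 : ℝ) ^ j ≤ Real.sqrt ‖x‖ := Real.le_sqrt_of_sq_le h1
  have h4 : ∀ N, j ≤ N → ∑ k ∈ Finset.range N, barrierDensityTerm k x ≤
      40 / (‖x‖ * Real.log ‖x‖) ^ 2 := by
    intro N hN
    have h5 : 0 < coulomb (2 ^ j) 0 x := coulomb_pos (by positivity) 0 x
    have h6 : 2 ^ N * coulomb (2 ^ N) 0 x ≤ 1 := by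
      have h7 : (0 : ℝ) < 2 ^ N := by positivity
      calc 2 ^ N * coulomb (2 ^ N) 0 x ≤ 2 ^ N * (2 ^ N)⁻¹ := by
            gcongr; exact coulomb_le h7 0 x
        _ = 1 := mul_inv_cancel₀ h7.ne'
    have h7 : 2 ^ N * coulomb (2 ^ N) 0 x - 2 ^ j * coulomb (2 ^ j) 0 x ≤ 1 := by
      have : 0 < 2 ^ j * coulomb (2 ^ j) 0 x := by positivity
      linarith
    have h8 := sq_log_le (by linarith : 1 ≤ ‖x‖)
    have h9 := Real.sq_sqrt hr.le
    have h10 : 2 * 2 ^ j / ‖x‖ ^ 3 ≤ 32 / (‖x‖ * Real.log ‖x‖) ^ 2 := by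
      rw [div_le_div_iff₀ (by positivity) (by positivity), mul_pow]
      have h11 : 2 ^ j * Real.log ‖x‖ ^ 2 ≤ 16 * ‖x‖ := by
        calc 2 ^ j * Real.log ‖x‖ ^ 2 ≤ Real.sqrt ‖x‖ * (16 * Real.sqrt ‖x‖) := by gcongr
          _ = 16 * Real.sqrt ‖x‖ ^ 2 := by ring
          _ = _ := by rw [h9]
      have h12 : 0 < ‖x‖ ^ 2 := by positivity
      nlinarith
    have h11 : 2 / ‖x‖ ^ 2 * (2 ^ N * coulomb (2 ^ N) 0 x - 2 ^ j * coulomb (2 ^ j) 0 x) /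
        ((j : ℝ) + 1) ^ 2 ≤ 8 / (‖x‖ * Real.log ‖x‖) ^ 2 := by
      calc _ ≤ 2 / ‖x‖ ^ 2 * 1 / (Real.log ‖x‖ / 2) ^ 2 := by gcongr; linarith
        _ = _ := by field_simp; norm_num
    refine (sum_barrierDensityTerm_le_of_le hN hr).trans ((add_le_add h10 h11).trans
      (le_of_eq ?_))
    ring
  have h5 : ∑' k, barrierDensityTerm k x ≤ 40 / (‖x‖ * Real.log ‖x‖) ^ 2 := by
    refine le_of_tendsto (summable_barrierDensityTerm x).hasSum.tendsto_sum_nat ?_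
    filter_upwards [eventually_ge_atTop j] with N hN using h4 N hN
  have h6 := (poisson_pos one_pos 0 x).le
  rw [barrierDensity]
  linarith

/-! ### Decay of the solution -/

theorem IsWeakLimit.const_smul {ψ : ℕ → Plane → ℝ} {v : Plane → ℝ} (h : IsWeakLimit ψ v) (c : ℝ) :
    IsWeakLimit (fun n => c • ψ n) (c • v) := by
  have hg : ∀ n, hdotInner (c • ψ n) (c • ψ n) = c ^ 2 * (gagliardo (ψ n)).toReal ^ 2 := fun n => by
    rw [hdotInner_smul_left, hdotInner_smul_right, hdotInner_self (h.lipc n).finiteEnergy]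
    ring
  obtain ⟨K, hK⟩ := h.bound
  obtain ⟨L, hL⟩ := h.bound_three
  refine ⟨fun n => ⟨?_, (h.lipc n).supp.smul_left (f := fun _ => c)⟩,
    ⟨Real.toNNReal |c| * K, fun n => ?_⟩, ⟨‖c‖₊ * L, fun n => ?_⟩, ?_⟩
  · obtain ⟨M, hM⟩ := (h.lipc n).lip
    refine ⟨‖c‖₊ * M, LipschitzWith.of_dist_le_mul fun x y => ?_⟩
    have := hM.dist_le_mul x y
    simp only [Pi.smul_apply, dist_smul₀, NNReal.coe_mul, coe_nnnorm]
    rw [mul_assoc]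
    gcongr
  · have he := ((h.lipc n).finiteEnergy.smul c)
    have h1 := hg n
    rw [hdotInner_self he, ← mul_pow, sq_eq_sq_iff_abs_eq_abs, abs_mul, abs_of_nonneg (by positivity),
      abs_of_nonneg (a := (gagliardo (ψ n)).toReal) (by positivity)] at h1
    have h2 := (h.lipc n).finiteEnergy.lt_top.ne
    rw [← ENNReal.ofReal_toReal he.lt_top.ne, h1, ENNReal.ofReal_mul (abs_nonneg c),
      ENNReal.ofReal_toReal h2]
    push_cast
    exact mul_le_mul_right (hK n) _
  · rw [eLpNorm_const_smul]
    push_cast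
    exact mul_le_mul_right (hL n) _
  · filter_upwards [h.lim] with x hx using hx.const_smul c

theorem hdotInner_smul_barrier_add {χ : Plane → ℝ} {χ' : ℕ → Plane → ℝ} (hχ : IsWeakLimit χ' χ)
    {c : ℝ} (hc : 0 ≤ c) :
    Integrable (fun x => (c * barrierDensity x + (c * barrier x) ^ 2) * χ x) volume ∧
      hdotInner (c • barrier) χ + ∫ x, |(c • barrier) x| * (c • barrier) x * χ x =
        ∫ x, (c * barrierDensity x + (c * barrier x) ^ 2) * χ x := by
  obtain ⟨ψ, hψ⟩ := isWeakLimit_barrier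
  have i1 : Integrable (fun x => c * barrierDensity x * χ x) volume :=
    (memLp_barrierDensity.const_mul c).integrable_mul hχ.memLp_three
  have i2 : Integrable (fun x => |(c • barrier) x| * (c • barrier) x * χ x) volume :=
    (memLp_abs_mul_self (r := 3 / 2) (hψ.const_smul c).memLp_three).integrable_mul hχ.memLp_three
  have e : (fun x => (c * barrierDensity x + (c * barrier x) ^ 2) * χ x) = fun x =>
      c * barrierDensity x * χ x + |(c • barrier) x| * (c • barrier) x * χ x := by
    funext x
    simp only [Pi.smul_apply, smul_eq_mul]
    rw [abs_of_nonneg (mul_nonneg hc (barrier_pos x).le)]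
    ring
  rw [e]
  refine ⟨i1.add i2, ?_⟩
  rw [integral_add i1 i2, hdotInner_smul_left, hχ.hdotInner_eq hψ.finiteEnergy memLp_barrierDensity
    fun f hf => hdotInner_barrier hf, ← integral_const_mul]
  simp only [mul_assoc]

theorem IsGround.exists_le_of_norm_ge {V u : Plane → ℝ} (h : IsGround V u) (hV : MemHdot V)
    (hVn : HalfLapNonneg V) (huc : Continuous u) (hu0 : ∀ x, 0 < u x) :
    ∃ c R : ℝ, 0 < c ∧ 1 < R ∧ ∀ x, R ≤ ‖x‖ → c / (‖x‖ * Real.log ‖x‖) ≤ u x := by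
  obtain ⟨z, -, hz⟩ := (isCompact_closedBall (0 : Plane) (10752 ^ 2)).exists_isMinOn
    ⟨0, Metric.mem_closedBall_self (by norm_num)⟩ huc.continuousOn
  -- The first entry puts c times the barrier below u on the ball, where the barrier is at most 1.
  -- The second, 1/(9·672), makes the negative half-Laplacian beat the square outside.
  set c := min (u z) (1 / 6048) with hc
  have hc0 : 0 < c := lt_min (hu0 z) (by norm_num)
  obtain ⟨ψ, hψ⟩ := isWeakLimit_barrier
  have hin : ∀ x : Plane, ‖x‖ ≤ 10752 ^ 2 → c * barrier x ≤ u x := fun x hx =>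
    ((mul_le_of_le_one_right hc0.le (barrier_le_one x)).trans (min_le_left _ _)).trans
      (hz (mem_closedBall_zero_iff.2 hx))
  have hle := h.ge_of_subsolution hV hVn (hψ.const_smul c) fun χ χ' hχ hχ0 hχz => by
    rw [(hdotInner_smul_barrier_add hχ hc0.le).2]
    refine integral_nonpos fun x => ?_
    rcases le_total ‖x‖ (10752 ^ 2) with hx | hx
    · simp only [hχz x (hin x hx), mul_zero, Pi.zero_apply, le_refl]
    · refine mul_nonpos_of_nonpos_of_nonneg ?_ (hχ0 x)
      have hx2 : 2 ≤ ‖x‖ := le_trans (by norm_num) hx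
      have h1 := barrierDensity_le_neg hx
      have h2 := barrier_le hx2
      have h3 : (c * barrier x) ^ 2 ≤ (c * (3 / (‖x‖ * Real.log ‖x‖))) ^ 2 := by
        have := (barrier_pos x).le
        gcongr
      have h4 : (c * (3 / (‖x‖ * Real.log ‖x‖))) ^ 2 =
          c * (9 * c / (‖x‖ * Real.log ‖x‖) ^ 2) := by ring
      have h5 : 9 * c / (‖x‖ * Real.log ‖x‖) ^ 2 ≤ 1 / 672 / (‖x‖ * Real.log ‖x‖) ^ 2 := by
        have := min_le_right (u z) (1 / 6048)
        gcongr
        linarith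
      rw [h4] at h3
      have h6 := mul_le_mul_of_nonneg_left (h1.trans (neg_le_neg h5)) hc0.le
      linarith
  refine ⟨c / 72, 2, by positivity, one_lt_two, fun x hx => ?_⟩
  have h1 := le_of_ae_le (continuous_barrier.const_smul c) huc hle x
  refine le_trans (le_trans (le_of_eq ?_) (mul_le_mul_of_nonneg_left (le_barrier hx) hc0.le)) h1
  ring

theorem IsGround.exists_ge_of_norm_ge {V u : Plane → ℝ} {R C : ℝ} (h : IsGround V u)
    (hV : MemHdot V) (huc : Continuous u) (hR : 1 < R) (hC : 0 < C)
    (hVg : HalfLapLE V (fun x => C / (‖x‖ ^ 2 * Real.log ‖x‖ ^ 2)) {x : Plane | R < ‖x‖}) :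
    ∃ c R' : ℝ, 0 < c ∧ 1 < R' ∧ ∀ x, R' ≤ ‖x‖ → u x ≤ c / (‖x‖ * Real.log ‖x‖) := by
  -- Beyond R₁ > max(R, 2) the source bound and the barrier estimates both apply, and log|x| ≥ 1/2.
  set R₁ := R + 2 with hR₁
  have hR₁2 : 2 < R₁ := by linarith
  set g : Plane → ℝ := fun x => C / (‖x‖ ^ 2 * Real.log ‖x‖ ^ 2) with hg
  obtain ⟨M, hM⟩ := (isCompact_closedBall (0 : Plane) (R₁ + 1)).exists_bound_of_continuousOn
    huc.continuousOn
  obtain ⟨z, -, hz⟩ := (isCompact_closedBall (0 : Plane) (R₁ + 1)).exists_isMinOn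
    ⟨0, Metric.mem_closedBall_self (by linarith)⟩ continuous_barrier.continuousOn
  have hz0 := barrier_pos z
  -- The first entry gives u ≤ c·barrier on the inner ball. The second, with 5184 = 72², gives
  -- c²/72² − 40c ≥ C, so the square dominates both the negative half-Laplacian and the source.
  set c := max (|M| / barrier z) (5184 * (40 + C)) with hc
  have hc1 : 5184 * (40 + C) ≤ c := le_max_right _ _
  have hc0 : 0 < c := lt_of_lt_of_le (by positivity) hc1
  obtain ⟨ψ, hψ⟩ := isWeakLimit_barrier
  have hgc : ContinuousOn g {x : Plane | R < ‖x‖} := by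
    refine continuousOn_const.div ((continuous_norm.pow 2).continuousOn.mul
      ((continuous_norm.continuousOn.log fun x hx => ?_).pow 2)) fun x hx => ?_
    · have : R < ‖x‖ := hx
      linarith
    · have h1 : R < ‖x‖ := hx
      have h2 : 0 < Real.log ‖x‖ := Real.log_pos (by linarith)
      have h3 : 0 < ‖x‖ := by linarith
      positivity
  have hm : MeasurableSet {x : Plane | R₁ ≤ ‖x‖} := measurableSet_le measurable_const measurable_norm
  have hgm : Measurable g := by fun_prop
  have hlog : ∀ x : Plane, R₁ ≤ ‖x‖ → 1 / 2 ≤ Real.log ‖x‖ := fun x hx => by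
    have h1 := Real.log_le_log two_pos (hR₁2.le.trans hx)
    have h2 := Real.log_two_gt_d9
    linarith
  have hle := h.le_of_supersolution (R₁ := R₁) hV (hψ.const_smul c) hVg
    (hgc.locallyIntegrableOn (measurableSet_lt measurable_const measurable_norm)) (by linarith)
    -- Beyond R₁ the source is at most 8C k_1², since log|x| ≥ 1/2 and |x| ≥ 1; hence it lies in
    -- L^{3/2}.
    ((memLp_coulomb_sq (8 * C)).mono (hgm.indicator hm).aestronglyMeasurable
      (ae_of_all _ fun x => ?_)) (fun x hx => ?_) fun χ χ' hχ hχ0 hχz => ?_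
  · refine ⟨c * 3, 2, by positivity, one_lt_two, fun x hx => ?_⟩
    have h1 := le_of_ae_le huc (continuous_barrier.const_smul c) hle x
    refine h1.trans ((mul_le_mul_of_nonneg_left (barrier_le hx) hc0.le).trans (le_of_eq ?_))
    ring
  · have h0 : 0 ≤ 8 * C * coulomb 1 0 x ^ 2 := by positivity
    rw [Real.norm_of_nonneg h0]
    by_cases hx : x ∈ {x : Plane | R₁ ≤ ‖x‖}
    · have hx' : R₁ ≤ ‖x‖ := hx
      have hl := hlog x hx
      have hr : 0 < ‖x‖ := by linarith
      rw [Set.indicator_of_mem hx, Real.norm_of_nonneg (by positivity), coulomb, inv_pow,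
        Real.sq_sqrt (by positivity), sub_zero, hg]
      simp only
      rw [← div_eq_mul_inv, div_le_div_iff₀ (by positivity) (by positivity)]
      have h1 : 1 / 4 ≤ Real.log ‖x‖ ^ 2 := by nlinarith
      have h2 : C * ‖x‖ ^ 2 * (1 / 4) ≤ C * ‖x‖ ^ 2 * Real.log ‖x‖ ^ 2 := by gcongr
      have h3 : C * 1 ≤ C * ‖x‖ ^ 2 := by gcongr; nlinarith
      linarith
    · rw [Set.indicator_of_notMem hx, norm_zero]
      exact h0
  · have hx' := mem_closedBall_zero_iff.2 hx
    have h1 := (le_abs_self _).trans ((hM x hx').trans (le_abs_self M))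
    have h2 : barrier z ≤ barrier x := hz hx'
    calc u x ≤ |M| := h1
      _ = |M| / barrier z * barrier z := by field_simp
      _ ≤ c * barrier x := by gcongr; exact le_max_left _ _
  · obtain ⟨hi, he⟩ := hdotInner_smul_barrier_add hχ hc0.le
    rw [he]
    refine integral_mono_of_nonneg (ae_of_all _ fun x => mul_nonneg
      (Set.indicator_nonneg (fun x _ => by positivity) x) (hχ0 x)) hi (ae_of_all _ fun x => ?_)
    simp only
    rcases le_total ‖x‖ (R₁ + 1) with hx | hx
    · rw [hχz x hx, mul_zero, mul_zero]
    · refine mul_le_mul_of_nonneg_right ?_ (hχ0 x)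
      have hx1 : R₁ ≤ ‖x‖ := by linarith
      have hx2 : 2 ≤ ‖x‖ := by linarith
      have hl := hlog x hx1
      rw [Set.indicator_of_mem (by exact hx1), hg]
      simp only
      have h1 := le_barrierDensity hx2
      have h2 := le_barrier hx2
      have h3 : (c * (1 / 72 / (‖x‖ * Real.log ‖x‖))) ^ 2 ≤ (c * barrier x) ^ 2 := by gcongr
      have h4 := mul_le_mul_of_nonneg_left h1 hc0.le
      have h5 : C / (‖x‖ ^ 2 * Real.log ‖x‖ ^ 2) ≤
          (c ^ 2 / 5184 - 40 * c) / (‖x‖ * Real.log ‖x‖) ^ 2 := by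
        rw [mul_pow]
        gcongr
        nlinarith
      have h6 : (c ^ 2 / 5184 - 40 * c) / (‖x‖ * Real.log ‖x‖) ^ 2 =
          (c * (1 / 72 / (‖x‖ * Real.log ‖x‖))) ^ 2 +
            c * -(40 / (‖x‖ * Real.log ‖x‖) ^ 2) := by ring
      linarith

/-! ### Square integrability, nontriviality and conclusion -/

/-- In polar coordinates the integrand is 1/(r log² r), the derivative of −1/log r. -/
theorem integrable_inv_sq_norm_mul_log {R : ℝ} (hR : 1 < R) :
    Integrable ({x : Plane | R < ‖x‖}.indicator fun x => ((‖x‖ * Real.log ‖x‖) ^ 2)⁻¹) volume := by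
  have h1 : IntegrableOn (fun r : ℝ => r * ((r * Real.log r) ^ 2)⁻¹) (Set.Ioi R) volume := by
    refine integrableOn_Ioi_deriv_of_nonneg' (g := fun r => -(Real.log r)⁻¹) (l := 0)
      (fun r hr => ?_) (fun r hr => ?_) ?_
    · have hr1 : 1 < r := hR.trans_le hr
      have hl := Real.log_pos hr1
      refine ((Real.hasDerivAt_log (by linarith)).inv hl.ne').neg.congr_deriv ?_
      have : r ≠ 0 := by linarith
      field_simp
    · have : 0 < r := by linarith [show R < r from hr]
      positivity
    · simpa using Real.tendsto_log_atTop.inv_tendsto_atTop.neg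
  have h2 : Integrable (fun x : Plane =>
      (Set.Ioi R).indicator (fun r : ℝ => ((r * Real.log r) ^ 2)⁻¹) ‖x‖) volume := by
    rw [integrable_fun_norm_addHaar]
    refine ((integrable_indicator_iff measurableSet_Ioi).2 h1).integrableOn.congr
      (ae_of_all _ fun r => ?_)
    by_cases hr : r ∈ Set.Ioi R <;> simp [hr, finrank_euclideanSpace]
  exact h2

theorem memLp_two_of_le {u : Plane → ℝ} (huc : Continuous u) (hu0 : ∀ x, 0 ≤ u x) {c R : ℝ}
    (hR : 1 < R) (h : ∀ x, R ≤ ‖x‖ → u x ≤ c / (‖x‖ * Real.log ‖x‖)) : MemLp u 2 volume := by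
  rw [memLp_two_iff_integrable_sq huc.aestronglyMeasurable]
  set B := Metric.closedBall (0 : Plane) R
  have h1 : Integrable (B.indicator fun x => u x ^ 2) volume :=
    (integrable_indicator_iff Metric.isClosed_closedBall.measurableSet).2
      ((huc.pow 2).continuousOn.integrableOn_compact (isCompact_closedBall 0 R))
  refine (h1.add ((integrable_inv_sq_norm_mul_log hR).const_mul (c ^ 2))).mono'
    (huc.pow 2).aestronglyMeasurable (ae_of_all _ fun x => ?_)
  rw [Real.norm_of_nonneg (sq_nonneg _), Pi.add_apply]
  rcases le_or_gt ‖x‖ R with hx | hx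
  · rw [Set.indicator_of_mem (by exact mem_closedBall_zero_iff.2 hx), Set.indicator_of_notMem
      (by simpa using hx), mul_zero, add_zero]
  · rw [Set.indicator_of_notMem (by simpa [B] using hx), zero_add,
      Set.indicator_of_mem (by exact hx), ← div_eq_mul_inv, ← div_pow]
    exact pow_le_pow_left₀ (hu0 x) (h x hx.le) 2

/-- If u vanished, the equation would make V orthogonal to all test functions, hence to itself. -/
theorem IsGround.exists_ne_zero {V u : Plane → ℝ} (h : IsGround V u) (hV : MemHdot V)
    (hVc : Continuous V) (hV0 : V ≠ 0) : ∃ z, u z ≠ 0 := by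
  by_contra! hu
  refine hV0 (funext fun x => eq_of_ae_eq hVc continuous_zero
    (ae_eq_zero_of_hdotInner_self hV.finiteEnergy hV.1 (le_of_eq ?_)) x)
  obtain ⟨φ, hφ, -, hg, -⟩ := hV.exists_seq
  refine tendsto_nhds_unique (tendsto_hdotInner_of_gagliardo hV.finiteEnergy
    (fun n => (hφ n).isLipc.finiteEnergy) hV.finiteEnergy hg) ?_
  refine tendsto_const_nhds.congr fun n => ?_
  rw [← h.eq _ (hφ n), show u = 0 from funext hu]
  simp [hdotInner]

theorem signedRoot_abs_mul_self {u : Plane → ℝ} (hu : ∀ x, 0 < u x) :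
    signedRoot (fun x => |u x| * u x) = u := by
  funext x
  have h := hu x
  simp only [signedRoot]
  rw [abs_of_pos h, Real.sign_of_pos (mul_pos h h), one_mul, abs_of_pos (mul_pos h h),
    Real.sqrt_mul_self h.le]

end Graphene

end

theorem mainTheorem3
    (V : Graphene.Plane → ℝ) (α : ℝ≥0) (hα0 : 0 < α) (hα1 : α ≤ 1)
    (hV : Graphene.MemHdot V) (hVα : Graphene.LocallyHolder α V)
    (hV0 : V ≠ 0) (hVnonneg : Graphene.HalfLapNonneg V)
    (R C : ℝ) (hR : 1 < R) (hC : 0 < C)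
    (hVdecay : Graphene.HalfLapLE V (fun x => C / (‖x‖ ^ 2 * Real.log ‖x‖ ^ 2))
      {x : Graphene.Plane | R < ‖x‖}) :
    ∃ ρ u : Graphene.Plane → ℝ,
      Graphene.IsTFMinimizer V ρ ∧
      (∀ σ : Graphene.Plane → ℝ, Graphene.IsTFMinimizer V σ → σ =ᵐ[volume] ρ) ∧
      u = Graphene.signedRoot ρ ∧
      Graphene.IsWeakSolution V u ∧
      (∀ w : Graphene.Plane → ℝ, Graphene.IsWeakSolution V w → w =ᵐ[volume] u) ∧
      Graphene.MemH u ∧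
      Graphene.LocallyHolder α u ∧
      (∀ x, 0 < u x ∧ u x ≤ V x) ∧
      (∃ c₁ c₂ R' : ℝ, 0 < c₁ ∧ 0 < c₂ ∧ 1 < R' ∧ ∀ x : Graphene.Plane, R' ≤ ‖x‖ →
        c₁ / (‖x‖ * Real.log ‖x‖) ≤ u x ∧ u x ≤ c₂ / (‖x‖ * Real.log ‖x‖)) ∧
      MemLp u 2 volume := by
  obtain ⟨u, h, huα, hu0, huV⟩ := Graphene.exists_holder_isGround hα0 hα1 hV hVα hVnonneg
  have huc := huα.continuous hα0
  have hpos := h.pos hV hVnonneg huc hu0 (h.exists_ne_zero hV (hVα.continuous hα0) hV0)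
  obtain ⟨c₁, R₁, hc₁, hR₁, hlow⟩ := h.exists_le_of_norm_ge hV hVnonneg huc hpos
  obtain ⟨c₂, R₂, hc₂, hR₂, hup⟩ := h.exists_ge_of_norm_ge hV huc hR hC hVdecay
  have hu2 := Graphene.memLp_two_of_le huc hu0 hR₂ hup
  -- Strict positivity makes the signed root of |u|u equal to u at every point, not merely almost
  -- everywhere.
  exact ⟨fun x => |u x| * u x, u, h.isTFMinimizer hV, fun σ hσ => h.tfMinimizer_unique hV hσ,
    (Graphene.signedRoot_abs_mul_self hpos).symm, h.isWeakSolution hV.finiteEnergy,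
    fun w hw => h.weakSolution_unique hV hw, ⟨hu2, h.finiteEnergy.lt_top⟩, huα,
    fun x => ⟨hpos x, huV x⟩, ⟨c₁, c₂, max R₁ R₂, hc₁, hc₂, lt_max_of_lt_left hR₁, fun x hx =>
      ⟨hlow x ((le_max_left _ _).trans hx), hup x ((le_max_right _ _).trans hx)⟩⟩, hu2⟩
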